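/- **Notation.** For $d\ge 1$ let $S=\mathrm{diag}(\lambda_1,\dots,\lambda_d)$ with $\lambda_1\ge\dots\ge\lambda_d>0$, $M=\mathrm{diag}(m_1,\dots,m_d)$ positive definite, $T\in\mathbb R^{d\times d}$ positive semidefinite, $\|v\|_T^2=v^\top Tv$, $W=\{w\in\mathbb R^d:\|w\|_M^2\le 1\}$. For a matrix $A$, $A_{k:\infty}$ is $A$ with all rows and columns of index $\le k$ replaced by $0$, $A'=M^{-1/2}AM^{-1/2}$, $A'_{k:\infty}=M^{-1/2}A_{k:\infty}M^{-1/2}$, $\|A\|$ is the spectral norm and $\sigma_1(A)\ge\sigma_2(A)\ge\cdots$ are the singular values ($\sigma_i(A)=0$ for $i>d$). **Power-law assumption.** Let $a,s,r,\nu\in\mathbb R$ with $0\le\nu\le1$, let $c_1>0$ and $c_2$ be constants, and let $0\le D<d$. For $1\le i\le d$, $$c_1 i^{-a}\le\lambda_i\le c_2 i^{-a},\qquad c_1\lambda_i^{1-s}\le m_i\le c_2\lambda_i^{1-s},\qquad c_1 i^{-(1+r)a}\le T_{ii}\le c_2 i^{-(1+r)a},$$ and $\|T'_{k:\infty}\|\le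 c_2k^{-(r+s)a+\nu}$ for $1\le k<d$, $\|T'_{k:\infty}\|\ge c_1k^{-(r+s)a+\nu}$ for $1\le k\le D$. **Problem class.** $\mathcal P_{\psi,\sigma}(S,M,T)$ consists of the triples $(P,Q,w^*)$ where $P,Q$ are square-integrable laws of $(x,y)\in\mathbb R^d\times\mathbb R$ with $E_P[xx^\top]=S$, $E_Q[xx^\top]=T$, $w^*\in W$ minimizes both $w\mapsto\frac12E_P(y-\langle w,x\rangle)^2$ and $w\mapsto\frac12E_Q(y-\langle w,x\rangle)^2$, $E_P[xx^\top Axx^\top]\preceq\psi\,\mathrm{tr}(SA)\,S$ for every positive semidefinite $A$, and $E_P[\epsilon^2xx^\top]\preceq\sigma^2S$ for $\epsilon=y-\langle w^*,x\rangle$. For $w\in W$, $P_w$ is the Gaussian law given by $x\sim N(0,S)$, $y=\langle w,x\rangle+\epsilon$, with $\epsilon\sim N(0,\sigma^2)$ independent of $x$. **ASGD.** With parameters $(\alpha,\beta,\delta,\gamma)$ and i.i.d. samples $(x_t,y_t)_{t=1}^n$ from $P$, put $w_0=v_0=0$ and, for $t=1,\dots,n$, $$u_{t-1}=\alpha w_{t-1}+(1-\alpha)v_{t-1},\quad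 g_t=(x_t^\top u_{t-1}-y_t)x_t,\quad w_t=u_{t-1}-\delta_tg_t,\quad v_t=\beta u_{t-1}+(1-\beta)v_{t-1}-\gamma_tg_t,$$ where $\delta_t=\delta/4^{\ell-1}$, $\gamma_t=\gamma/4^{\ell-1}$ in stage $\ell=1,\dots,\lfloor\log_2n\rfloor$; the stages are consecutive, of length $\lfloor n/\lfloor\log_2n\rfloor\rfloor$, and the last one also takes the remaining iterations. The output is $w_n^{\mathrm{SGD}}=w_n$. **Theorem.** 1. (*Upper bound.*) Let $\psi\ge1$, $a>1$, $s>\frac{(a-1)^2}{a(2a-1)}+\frac{\nu}{a}$ and $r>\max\{\frac1a-2,\,-s+\frac{\nu}{a}\}$. There are $C>0$, $N$ and parameters $\alpha_n,\beta_n\in(0,1)$, $0<\delta_n\le\gamma_n$ ($n\ge N$), depending only on $(a,s,r,\nu,c_1,c_2,\psi)$ (and $n$), such that for all $d,D,S,M,T$ satisfying the power-law assumption, all $\sigma\ge0$, all $(P,Q,w^*)\in\mathcal P_{\psi,\sigma}(S,M,T)$ and all $n\ge N$, ASGD with these parameters satisfies $$E_{P^{\otimes n}}\|w_n^{\mathrm{SGD}}-w^*\|_T^2\le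 C(1+\sigma^2)\cdot\begin{cases}\ln n/n,& r>1/a,\\ (\ln n)^3/n,& r=1/a,\\ (1/n)^{\frac{(r+s)a-\nu}{sa-\nu+1}}(\ln n)^{L},& r<1/a,\end{cases}$$ $$L=\max\Big\{\frac{3(1+r)a-3}{a},\ \frac{(r+s)a-\nu}{sa-\nu+1}\Big\}.$$ 2. (*Minimax lower bounds.*) Under the power-law assumption, for every $\sigma\ge0$ and $w\in W$ there is $Q$ with $(P_w,Q,w)\in\mathcal P_{3,\sigma}(S,M,T)$. Write $$R_n=\inf_{\hat w}\sup_{w\in W}E_{P_w}\|\hat w-w\|_T^2,$$ the infimum being over all randomized estimators $\hat w((x_i,y_i)_{i\le n},\xi)$ with $\xi$ independent of the data. Let $a>0$. In each case below there is $c>0$, depending only on $(a,s,r,\nu,c_1,c_2)$ and on the further constants named, such that for all $d,D,S,M,T$ satisfying the power-law assumption, all $n\ge1$ and all $\sigma>0$: * if $r>1/a$ and $\sigma^2\le n$, then $R_n\ge c\,\sigma^2/n$; * if $r=1/a$, $p>0$ is a constant, $\sigma^2\le n$ and $n/\sigma^2\le d^{\,p}$, then $R_n\ge c\,(\sigma^2/n)\ln(n/\sigma^2)$;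 * if $r<1/a$, $sa-\nu+1\ne0$ and $\kappa_1,\kappa_2,\kappa_3>0$ are constants, and if there is an integer $1\le k^*\le D$ with $\kappa_1(\sigma^2/n)^{-1/(sa-\nu+1)}\le k^*\le\kappa_2(\sigma^2/n)^{-1/(sa-\nu+1)}$ such that $\Delta k=\big\lfloor\frac{n}{\pi^2\sigma^2}\|S'_{k^*:\infty}\|\big\rfloor\ge1$ and $$\frac1{\Delta k}\sum_{i=1}^{\Delta k}\sigma_i\big(T'_{k^*:\infty}\big)\ge\kappa_3\big\|T'_{k^*:\infty}\big\|,$$ then $R_n\ge c\,(\sigma^2/n)^{\frac{(r+s)a-\nu}{sa-\nu+1}}$. Thus upper and lower bounds match in $n$ up to logarithmic factors. -/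

import Mathlib

open MeasureTheory ProbabilityTheory
open scoped ENNReal Matrix

namespace CovShift

/-- Covariate-response pairs `(x, y)` with `x ∈ ℝ^d` and `y ∈ ℝ`. -/
abbrev Obs (d : ℕ) : Type := (Fin d → ℝ) × ℝ

/-! ### Matrices -/

/-- Spectral norm of a square matrix: its operator norm on Euclidean space. -/
noncomputable def specNorm {d : ℕ} (A : Matrix (Fin d) (Fin d) ℝ) : ℝ :=
  ‖Matrix.toEuclideanCLM (n := Fin d) (𝕜 := ℝ) A‖

/-- `A_{k:∞}`: all rows and columns with (one-based) index at most `k` are replaced by zero.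
The zero-based index `i : Fin d` stands for the one-based index `i + 1`. -/
def tail {d : ℕ} (k : ℕ) (A : Matrix (Fin d) (Fin d) ℝ) : Matrix (Fin d) (Fin d) ℝ :=
  Matrix.of fun i j => if k ≤ (i : ℕ) ∧ k ≤ (j : ℕ) then A i j else 0

/-- `M^{-1/2} A M^{-1/2}` for `M = diag m`. -/
noncomputable def whiten {d : ℕ} (m : Fin d → ℝ) (A : Matrix (Fin d) (Fin d) ℝ) :
    Matrix (Fin d) (Fin d) ℝ :=
  Matrix.diagonal (fun i => (√(m i))⁻¹) * A * Matrix.diagonal (fun i => (√(m i))⁻¹)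

/-- The sum of the `N` largest singular values of `A`, counted with multiplicity (the singular
values beyond the dimension are zero). -/
noncomputable def topSingularSum {d : ℕ} (N : ℕ) (A : Matrix (Fin d) (Fin d) ℝ) : ℝ :=
  ∑ i ∈ Finset.range N, (Matrix.toEuclideanLin A).singularValues i

/-- The squared seminorm `‖v‖_T² = vᵀ T v`. -/
def sqNorm {d : ℕ} (T : Matrix (Fin d) (Fin d) ℝ) (v : Fin d → ℝ) : ℝ := v ⬝ᵥ (T *ᵥ v)

/-- The ellipsoid `W = {w : ‖w‖_M² ≤ 1}` for `M = diag m`. -/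
def ellipsoid {d : ℕ} (m : Fin d → ℝ) : Set (Fin d → ℝ) :=
  {w | sqNorm (Matrix.diagonal m) w ≤ 1}

/-! ### The power-law assumption -/

/-- `S = diag lam`, `M = diag m` and `T` follow power laws with exponents `a, s, r, ν`, up to the
constants `c₁, c₂`.  The norms of the tails of `T` have the stated upper bound on the whole range
`1 ≤ k < d` and the matching lower bound on the range `1 ≤ k ≤ D`. -/
structure PowerLaw (a s r ν c₁ c₂ : ℝ) {d : ℕ} (D : ℕ) (lam m : Fin d → ℝ)
    (T : Matrix (Fin d) (Fin d) ℝ) : Prop where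
  range_lt : D < d
  antitone : Antitone lam
  lam_lower : ∀ i : Fin d, c₁ * ((i : ℕ) + 1 : ℝ) ^ (-a) ≤ lam i
  lam_upper : ∀ i : Fin d, lam i ≤ c₂ * ((i : ℕ) + 1 : ℝ) ^ (-a)
  m_lower : ∀ i : Fin d, c₁ * lam i ^ (1 - s) ≤ m i
  m_upper : ∀ i : Fin d, m i ≤ c₂ * lam i ^ (1 - s)
  posSemidef : T.PosSemidef
  diag_lower : ∀ i : Fin d, c₁ * ((i : ℕ) + 1 : ℝ) ^ (-((1 + r) * a)) ≤ T i i
  diag_upper : ∀ i : Fin d, T i i ≤ c₂ * ((i : ℕ) + 1 : ℝ) ^ (-((1 + r) * a))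
  tail_lower : ∀ k : ℕ, 1 ≤ k → k ≤ D →
    c₁ * (k : ℝ) ^ (-((r + s) * a) + ν) ≤ specNorm (whiten m (tail k T))
  tail_upper : ∀ k : ℕ, 1 ≤ k → k < d →
    specNorm (whiten m (tail k T)) ≤ c₂ * (k : ℝ) ^ (-((r + s) * a) + ν)

/-! ### Linear regression under covariate shift -/

/-- The risk `½ E (y - ⟨v, x⟩)²` of the regressor `v` under the law `P` of `(x, y)`. -/
noncomputable def popRisk {d : ℕ} (P : Measure (Obs d)) (v : Fin d → ℝ) : ℝ :=
  (1 / 2) * ∫ z, (z.2 - v ⬝ᵥ z.1) ^ 2 ∂P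

/-- `P` is a square-integrable law of `(x, y)` with `E x xᵀ = S`. -/
structure HasSecondMoment {d : ℕ} (P : Measure (Obs d)) (S : Matrix (Fin d) (Fin d) ℝ) :
    Prop where
  prob : IsProbabilityMeasure P
  memLp_x : ∀ i, MemLp (fun z : Obs d => z.1 i) 2 P
  memLp_y : MemLp (fun z : Obs d => z.2) 2 P
  second_moment : ∀ i j, ∫ z, z.1 i * z.1 j ∂P = S i j

/-- A covariate-shift problem: source law `P` with covariance `S = diag lam`, target law `Q` with
covariance `T`, and a common risk minimizer `w` in the ellipsoid of `M = diag m`.  The source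
satisfies the fourth-moment condition `E[x xᵀ A x xᵀ] ≼ ψ tr(S A) S` for all positive
semidefinite `A`, and the noise condition `E[ε² x xᵀ] ≼ σ² S` with `ε = y - ⟨w, x⟩`; both matrix
inequalities are tested on vectors `u`. -/
structure IsProblem (ψ σ : ℝ) {d : ℕ} (lam m : Fin d → ℝ) (T : Matrix (Fin d) (Fin d) ℝ)
    (P Q : Measure (Obs d)) (w : Fin d → ℝ) : Prop where
  source : HasSecondMoment P (Matrix.diagonal lam)
  target : HasSecondMoment Q T
  source_min : ∀ v, popRisk P w ≤ popRisk P v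
  target_min : ∀ v, popRisk Q w ≤ popRisk Q v
  mem_ellipsoid : w ∈ ellipsoid m
  fourth_moment : ∀ A : Matrix (Fin d) (Fin d) ℝ, A.PosSemidef → ∀ u : Fin d → ℝ,
    ∫⁻ z, ENNReal.ofReal ((u ⬝ᵥ z.1) ^ 2 * sqNorm A z.1) ∂P ≤
      ENNReal.ofReal (ψ * (Matrix.diagonal lam * A).trace * sqNorm (Matrix.diagonal lam) u)
  noise : ∀ u : Fin d → ℝ,
    ∫⁻ z, ENNReal.ofReal ((z.2 - w ⬝ᵥ z.1) ^ 2 * (u ⬝ᵥ z.1) ^ 2) ∂P ≤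
      ENNReal.ofReal (σ ^ 2 * sqNorm (Matrix.diagonal lam) u)

/-- The Gaussian model `P_w`: `x ∼ N(0, diag lam)`, `y = ⟨w, x⟩ + ε`, with `ε ∼ N(0, σ²)`
independent of `x`. -/
noncomputable def gaussianModel (σ : ℝ) {d : ℕ} (lam w : Fin d → ℝ) : Measure (Obs d) :=
  ((Measure.pi fun i => gaussianReal 0 (lam i).toNNReal).prod
    (gaussianReal 0 (σ ^ 2).toNNReal)).map fun q => (q.1, w ⬝ᵥ q.1 + q.2)

/-! ### Accelerated stochastic gradient descent -/

/-- One ASGD iteration on the pair `(w, v)` with the observation `z = (x, y)`. -/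
def asgdStep {d : ℕ} (α β δ γ : ℝ) (z : Obs d) (p : (Fin d → ℝ) × (Fin d → ℝ)) :
    (Fin d → ℝ) × (Fin d → ℝ) :=
  let u := α • p.1 + (1 - α) • p.2
  let g := (z.1 ⬝ᵥ u - z.2) • z.1
  (u - δ • g, β • u + (1 - β) • p.2 - γ • g)

/-- The zero-based stage of the zero-based iteration `t < n`: there are `⌊log₂ n⌋` stages of
`⌊n / ⌊log₂ n⌋⌋` iterations each, and the last stage also takes the remaining iterations. -/
def stage (n t : ℕ) : ℕ := min (t / (n / Nat.log 2 n)) (Nat.log 2 n - 1)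

/-- The output `w_n` of ASGD started at `w₀ = v₀ = 0`, passing once through the `n` observations
in order, with both step sizes divided by `4` after each stage. -/
noncomputable def asgd {d n : ℕ} (α β δ γ : ℝ) (data : Fin n → Obs d) : Fin d → ℝ :=
  (Fin.foldl n (fun p t => asgdStep α β (δ / 4 ^ stage n t) (γ / 4 ^ stage n t) (data t) p)
    ((0 : Fin d → ℝ), (0 : Fin d → ℝ))).1

/-- `E ‖ŵ - w‖_T²` for a nonrandomized estimator `est` fed with `n` i.i.d. observations from
`P`. -/
noncomputable def expRisk {d n : ℕ} (T : Matrix (Fin d) (Fin d) ℝ) (P : Measure (Obs d))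
    (est : (Fin n → Obs d) → Fin d → ℝ) (w : Fin d → ℝ) : ℝ≥0∞ :=
  ∫⁻ data, ENNReal.ofReal (sqNorm T (est data - w)) ∂(Measure.pi fun _ : Fin n => P)

/-- The rate attained by ASGD. -/
noncomputable def asgdRate (a s r ν : ℝ) (n : ℕ) : ℝ :=
  if 1 / a < r then Real.log n / n
  else if r = 1 / a then Real.log n ^ 3 / n
  else (1 / n : ℝ) ^ (((r + s) * a - ν) / (s * a - ν + 1)) *
    Real.log n ^ max ((3 * (1 + r) * a - 3) / a) (((r + s) * a - ν) / (s * a - ν + 1))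

/-! ### Minimax risk -/

/-- A randomized estimator: a measurable function of the `n` observations and of an independent
random seed. -/
structure RandomizedEstimator (d n : ℕ) where
  Seed : Type
  [measurableSpace : MeasurableSpace Seed]
  law : Measure Seed
  prob : IsProbabilityMeasure law
  toFun : (Fin n → Obs d) × Seed → Fin d → ℝ
  measurable_toFun : Measurable toFun

/-- The expected risk of a randomized estimator, averaged over its seed. -/
noncomputable def RandomizedEstimator.risk {d n : ℕ} (e : RandomizedEstimator d n)
    (T : Matrix (Fin d) (Fin d) ℝ) (P : Measure (Obs d)) (w : Fin d → ℝ) : ℝ≥0∞ :=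
  letI := e.measurableSpace
  ∫⁻ ξ, expRisk T P (fun data => e.toFun (data, ξ)) w ∂e.law

/-- `inf_ŵ sup_{w ∈ W} E_{P_w} ‖ŵ - w‖_T²` over all randomized estimators based on `n`
observations, where `P_w` is the Gaussian model. -/
noncomputable def minimaxRisk (n : ℕ) (σ : ℝ) {d : ℕ} (lam m : Fin d → ℝ)
    (T : Matrix (Fin d) (Fin d) ℝ) : ℝ≥0∞ :=
  ⨅ e : RandomizedEstimator d n, ⨆ w ∈ ellipsoid m, e.risk T (gaussianModel σ lam w) w

end CovShift

/-! Lower bounds. Consider the regressors `w_θ = ∑ θ_j b_j`, with `θ` a vector of signs, and let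
`p_θ` be the likelihood ratio of the sample against the model with zero regressor. Completing the
square in `‖h - w_θ‖_T²` bounds the `θ`-sum of `p_θ ‖h - w_θ‖_T²` from below by an expression
without the guess `h`, because the signs weighted by `√(p_θ p_θ')`, where `θ'` is `θ` with one sign
reversed, cancel in pairs (`sum_weighted_sqNorm_ge`). What remains after integration are Hellinger
affinities. For Gaussian models they depend only on the distance of the regressors in the `S`-norm.
Hence, if the `b_j` are `S`-orthogonal, the mixed terms cancel even when `T` is not diagonal in the
`b_j`; and if `n ‖b_j‖_S² ≤ σ²`, the relevant affinities are at least 1/2. This gives the bound `¼ ∑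
‖b_j‖_T²` (`minimaxRisk_ge`). The three regimes are three choices of directions: the first
coordinate; a box over about `(n/σ²)^q` leading coordinates, whose contributions form a harmonic
sum; and the leading eigenvectors of the whitened tail of `T`, rotated within their span until they
are `S`-orthogonal, which preserves the trace (`minimaxRisk_ge_tail`).

Upper bound. Write the parameters through an averaging rate `b`, a ratio `κ`, an effective long step
`Γ` and the short step `δ = κ b Γ`. Since `S` is diagonal, the mean dynamics splits into planar
linear recursions, one per eigenvalue, coupled only through the gradient noise (`modeOf_asgdStep`).
The second moment of any linear functional of the state is at most its squared mean plus the
responses to all earlier noise terms (`lintegral_moment_le`). The noise level depends on the mean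
squared `S`-norm of the iterate, so the estimate closes as a discrete Volterra equation. Two
Lyapunov functions show that the response of a mode with eigenvalue `x`, squared, weighted by `x²`
and summed over a stage, is `O(min (Γ x) (1/κ + δ x))` (`Schedule.kernel_le`). Summed over the modes
this is a negative power of the stage length `N`, so even the sum over logarithmically many stages
is a contraction, and the noise accumulated in a stage is `O((1 + σ²) N)` (`exists_noise_level`).

In the output, the bias of a mode is damped by `exp(-N Γ x / 8)`, and its variance is `O(N Γ² / (1 +
(N Γ x)²))`, because the contributions of the geometrically shrinking stages telescope
(`expRisk_asgd_le`). Thus the modes of index up to `K`, where `K^a = N Γ`, are resolved. With `q =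
(r+s)a - ν`, a splitting into dyadic blocks bounds the bias in the `T`-norm by `K^(-q)`, and for `r
< 1/a` the variance is of order `K^(1-ra)/N`. The two balance at `K = N^(1/(sa-ν+1))`, that is `Γ =
N^θ` with `θ = a/(sa-ν+1) - 1`. Exponents for `b` and `κ` that make the kernel small while `N b`
still grows as a power of `N` exist as soon as `θ < (a-1)/a` (`exists_exponents`), which is what the
hypothesis on `s` says. -/

namespace CovShift

/-! ### Product measures -/

/-- Integration against a finite power of a probability measure, one factor at a time. -/
theorem lintegral_pi_succ {α : Type*} [MeasurableSpace α] (μ : Measure α) [IsProbabilityMeasure μ]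
    {n : ℕ} {F : (Fin (n + 1) → α) → ℝ≥0∞} (hF : Measurable F) :
    ∫⁻ x, F x ∂(Measure.pi fun _ : Fin (n + 1) => μ) =
      ∫⁻ x, ∫⁻ z, F (Fin.snoc x z) ∂μ ∂(Measure.pi fun _ : Fin n => μ) := by
  have h := measurePreserving_piFinSuccAbove (fun _ : Fin (n + 1) => μ) (Fin.last n)
  have h2 := h.symm.lintegral_comp hF
  rw [← h2]
  have hm : Measurable fun q : α × (Fin n → α) =>
      F ((MeasurableEquiv.piFinSuccAbove (fun _ => α) (Fin.last n)).symm q) :=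
    hF.comp (MeasurableEquiv.measurable _)
  rw [lintegral_prod_symm' _ hm]
  simp [MeasurableEquiv.piFinSuccAbove, Fin.insertNthEquiv, Fin.insertNth_last']

theorem measurable_snoc {α : Type*} [MeasurableSpace α] {n : ℕ} :
    Measurable fun q : (Fin n → α) × α => (Fin.snoc q.1 q.2 : Fin (n + 1) → α) := by
  refine measurable_pi_lambda _ fun i => ?_
  refine Fin.lastCases ?_ (fun j => ?_) i
  · simpa using measurable_snd
  · have : Measurable fun c : (Fin n → α) × α => c.1 j := by fun_prop
    simpa using this

/-- The likelihood of an i.i.d. sample factorizes; peeling off the last observation reduces the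
claim to a single factor. It moves the risks under all the models to one reference law. -/
theorem lintegral_pi_withDensity {α : Type*} [MeasurableSpace α] (μ : Measure α)
    [IsProbabilityMeasure μ] {f : α → ℝ≥0∞} (hf : Measurable f)
    [IsProbabilityMeasure (μ.withDensity f)] {n : ℕ} {F : (Fin n → α) → ℝ≥0∞}
    (hF : Measurable F) :
    ∫⁻ x, F x ∂(Measure.pi fun _ : Fin n => μ.withDensity f) =
      ∫⁻ x, (∏ i, f (x i)) * F x ∂(Measure.pi fun _ : Fin n => μ) := by
  induction n with
  | zero => rw [Measure.pi_of_empty _ default, Measure.pi_of_empty _ default]; simp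
  | succ n ih =>
    have hs : Measurable fun q : (Fin n → α) × α => F (Fin.snoc q.1 q.2) :=
      hF.comp measurable_snoc
    rw [lintegral_pi_succ _ hF, lintegral_pi_succ _ (by fun_prop), ih hs.lintegral_prod_right']
    refine lintegral_congr fun x => ?_
    have h1 : Measurable fun z => F (Fin.snoc x z) := hs.comp measurable_prodMk_left
    rw [lintegral_withDensity_eq_lintegral_mul _ hf h1, ← lintegral_const_mul _ (hf.mul h1)]
    refine lintegral_congr fun z => ?_
    simp [Fin.prod_univ_castSucc, mul_assoc]

/-! ### Gaussian laws -/

/-- By independence the characteristic function is a product of Gaussian ones, whose exponents add.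
-/
theorem map_dotProduct_gaussian {d : ℕ} {lam : Fin d → ℝ} (hlam : ∀ i, 0 ≤ lam i)
    (w : Fin d → ℝ) :
    (Measure.pi fun i => gaussianReal 0 (lam i).toNNReal).map (fun x => w ⬝ᵥ x) =
      gaussianReal 0 (∑ i, lam i * w i ^ 2).toNNReal := by
  have hm : Measurable fun x : Fin d → ℝ => w ⬝ᵥ x := by unfold dotProduct; fun_prop
  have : IsProbabilityMeasure ((Measure.pi fun i => gaussianReal 0 (lam i).toNNReal).map
      (fun x => w ⬝ᵥ x)) := Measure.isProbabilityMeasure_map hm.aemeasurable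
  refine Measure.ext_of_charFun ?_
  ext t
  rw [charFun_apply_real, integral_map hm.aemeasurable (by fun_prop)]
  have : ∀ x : Fin d → ℝ, Complex.exp (t * ((w ⬝ᵥ x : ℝ) : ℂ) * Complex.I) =
      ∏ i, Complex.exp (((t * w i : ℝ) : ℂ) * (x i) * Complex.I) := by
    intro x
    rw [← Complex.exp_sum]
    congr 1
    simp only [dotProduct, Complex.ofReal_sum, Complex.ofReal_mul, Finset.mul_sum, Finset.sum_mul]
    refine Finset.sum_congr rfl fun i _ => by ring
  simp_rw [this]
  rw [integral_fintype_prod_eq_prod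
    (f := fun i (y : ℝ) => Complex.exp (((t * w i : ℝ) : ℂ) * y * Complex.I))]
  simp_rw [← charFun_apply_real, charFun_gaussianReal, ← Complex.exp_sum]
  congr 1
  have h0 : 0 ≤ ∑ i, lam i * w i ^ 2 :=
    Finset.sum_nonneg fun i _ => mul_nonneg (hlam i) (sq_nonneg _)
  simp only [Real.coe_toNNReal _ h0, Real.coe_toNNReal _ (hlam _)]
  push_cast
  simp only [mul_zero, zero_mul, zero_sub, Finset.sum_neg_distrib, Finset.sum_mul,
    Finset.sum_div]
  congr 1
  refine Finset.sum_congr rfl fun i _ => by ring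

theorem gaussianReal_eq_withDensity (m : ℝ) {v : NNReal} (hv : v ≠ 0) :
    gaussianReal m v = (gaussianReal 0 v).withDensity
      fun y => ENNReal.ofReal (Real.exp (m * y / v - m ^ 2 / (2 * v))) := by
  rw [gaussianReal_of_var_ne_zero _ hv, gaussianReal_of_var_ne_zero _ hv,
    ← withDensity_mul _ (measurable_gaussianPDF _ _) (by fun_prop)]
  congr 1
  ext y
  have hv' : (v : ℝ) ≠ 0 := by exact_mod_cast hv
  simp only [gaussianPDF, Pi.mul_apply]
  rw [← ENNReal.ofReal_mul (gaussianPDFReal_nonneg _ _ _), gaussianPDFReal, gaussianPDFReal,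
    mul_assoc _ (Real.exp _) (Real.exp _), ← Real.exp_add]
  congr 3
  field_simp
  ring

instance isProbabilityMeasure_gaussianModel (σ : ℝ) {d : ℕ} (lam w : Fin d → ℝ) :
    IsProbabilityMeasure (gaussianModel σ lam w) := by
  unfold gaussianModel
  exact Measure.isProbabilityMeasure_map (by unfold dotProduct; fun_prop)

theorem lintegral_gaussianModel (σ : ℝ) {d : ℕ} (lam w : Fin d → ℝ) {F : Obs d → ℝ≥0∞}
    (hF : Measurable F) :
    ∫⁻ z, F z ∂(gaussianModel σ lam w) =
      ∫⁻ x, ∫⁻ e, F (x, w ⬝ᵥ x + e) ∂(gaussianReal 0 (σ ^ 2).toNNReal)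
        ∂(Measure.pi fun i => gaussianReal 0 (lam i).toNNReal) := by
  have hm : Measurable fun q : (Fin d → ℝ) × ℝ => ((q.1, w ⬝ᵥ q.1 + q.2) : Obs d) := by
    unfold dotProduct; fun_prop
  rw [gaussianModel, lintegral_map hF hm,
    lintegral_prod (fun q : (Fin d → ℝ) × ℝ => F (q.1, w ⬝ᵥ q.1 + q.2))
      (hF.comp hm).aemeasurable]

/-- The geometric mean of the likelihood ratios of two Gaussian models with respect to the model
with zero regressor. -/
noncomputable def overlap (σ : ℝ) {d : ℕ} (w w' : Fin d → ℝ) (z : Obs d) : ℝ :=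
  Real.exp ((w ⬝ᵥ z.1 + w' ⬝ᵥ z.1) / 2 * z.2 / σ ^ 2 -
    ((w ⬝ᵥ z.1) ^ 2 + (w' ⬝ᵥ z.1) ^ 2) / (4 * σ ^ 2))

theorem measurable_overlap (σ : ℝ) {d : ℕ} (w w' : Fin d → ℝ) :
    Measurable (overlap σ w w') := by
  unfold overlap dotProduct; fun_prop

theorem overlap_pos (σ : ℝ) {d : ℕ} (w w' : Fin d → ℝ) (z : Obs d) : 0 < overlap σ w w' z :=
  Real.exp_pos _

/-- Since `overlap σ w w` is a likelihood ratio, this turns the root of a product of two sample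
likelihoods into a product over the observations. -/
theorem overlap_sq (σ : ℝ) {d : ℕ} (w w' : Fin d → ℝ) (z : Obs d) :
    overlap σ w w' z ^ 2 = overlap σ w w z * overlap σ w' w' z := by
  unfold overlap
  rw [← Real.exp_add, ← Real.exp_nat_mul]
  congr 1
  push_cast
  ring

/-- Given `x`, the response is the noise shifted by `w ⬝ᵥ x`, so the ratio is that of two Gaussians
of equal variance; the law of `x` is common to all models. -/
theorem gaussianModel_eq_withDensity {σ : ℝ} (hσ : 0 < σ) {d : ℕ} (lam w : Fin d → ℝ) :
    gaussianModel σ lam w = (gaussianModel σ lam 0).withDensity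
      fun z => ENNReal.ofReal (overlap σ w w z) := by
  refine Measure.ext_of_lintegral _ fun F hF => ?_
  have hL : Measurable fun z : Obs d => ENNReal.ofReal (overlap σ w w z) :=
    (measurable_overlap σ w w).ennreal_ofReal
  have hv : (σ ^ 2).toNNReal ≠ 0 := by
    rw [Ne, Real.toNNReal_eq_zero, not_le]; positivity
  rw [lintegral_withDensity_eq_lintegral_mul _ hL hF, lintegral_gaussianModel _ _ _ hF,
    lintegral_gaussianModel _ _ _ (hL.mul hF)]
  refine lintegral_congr fun x => ?_
  have hFx : Measurable fun y => F (x, y) := hF.comp measurable_prodMk_left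
  have hmap := gaussianReal_map_const_add (μ := 0) (v := (σ ^ 2).toNNReal) (w ⬝ᵥ x)
  rw [← lintegral_map (f := fun y => F (x, y)) hFx (by fun_prop), hmap, zero_add,
    gaussianReal_eq_withDensity _ hv,
    lintegral_withDensity_eq_lintegral_mul _ (by fun_prop) hFx]
  refine lintegral_congr fun y => ?_
  simp only [Pi.mul_apply, zero_dotProduct, zero_add]
  congr 2
  unfold overlap
  rw [Real.coe_toNNReal _ (sq_nonneg σ)]
  congr 1
  field_simp
  ring

/-- The Hellinger affinity of two Gaussian models, as a function of the squared distance of the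
regressors in the covariance seminorm. -/
noncomputable def affinity (σ v : ℝ) : ℝ :=
  ∫ t, Real.exp (-(t ^ 2 / (8 * σ ^ 2))) ∂(gaussianReal 0 v.toNNReal)

/-- Given `x`, the Gaussian moment generating function integrates out the response and leaves
`exp(-((w - w') ⬝ᵥ x)² / (8σ²))`. As `(w - w') ⬝ᵥ x` is centred Gaussian, only its variance matters.
-/
theorem overlap_integral {σ : ℝ} (hσ : 0 < σ) {d : ℕ} {lam : Fin d → ℝ} (hlam : ∀ i, 0 ≤ lam i)
    (w w' : Fin d → ℝ) :
    Integrable (overlap σ w w') (gaussianModel σ lam 0) ∧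
      ∫ z, overlap σ w w' z ∂(gaussianModel σ lam 0) =
        affinity σ (∑ i, lam i * (w i - w' i) ^ 2) := by
  have hm := measurable_overlap σ w w'
  have hint : ∀ c : ℝ, ∫⁻ y, ENNReal.ofReal (Real.exp (c * y))
      ∂(gaussianReal 0 (σ ^ 2).toNNReal) = ENNReal.ofReal (Real.exp (σ ^ 2 * c ^ 2 / 2)) := by
    intro c
    rw [← ofReal_integral_eq_lintegral_ofReal (integrable_exp_mul_gaussianReal c)
      (ae_of_all _ fun _ => (Real.exp_pos _).le)]
    have := congrFun (mgf_fun_id_gaussianReal (μ := 0) (v := (σ ^ 2).toNNReal)) c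
    simp only [mgf] at this
    rw [this, Real.coe_toNNReal _ (sq_nonneg σ)]
    congr 2; ring
  have hexp : Integrable (fun t => Real.exp (-(t ^ 2 / (8 * σ ^ 2))))
      (gaussianReal 0 (∑ i, lam i * (w i - w' i) ^ 2).toNNReal) := by
    refine Integrable.of_bound (by fun_prop) 1 (ae_of_all _ fun t => ?_)
    rw [Real.norm_of_nonneg (Real.exp_pos _).le, Real.exp_le_one_iff]
    have : 0 ≤ t ^ 2 / (8 * σ ^ 2) := by positivity
    linarith
  have hL : ∫⁻ z, ENNReal.ofReal (overlap σ w w' z) ∂(gaussianModel σ lam 0) =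
      ENNReal.ofReal (affinity σ (∑ i, lam i * (w i - w' i) ^ 2)) := by
    rw [lintegral_gaussianModel _ _ _ hm.ennreal_ofReal, affinity,
      ofReal_integral_eq_lintegral_ofReal hexp (ae_of_all _ fun _ => (Real.exp_pos _).le)]
    have h1 := map_dotProduct_gaussian hlam (w - w')
    simp only [Pi.sub_apply] at h1
    rw [← h1, lintegral_map (by fun_prop) (by unfold dotProduct; fun_prop)]
    refine lintegral_congr fun x => ?_
    set m := w ⬝ᵥ x
    set m' := w' ⬝ᵥ x
    have h2 : ∀ e : ℝ, ENNReal.ofReal (overlap σ w w' (x, 0 ⬝ᵥ x + e)) =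
        ENNReal.ofReal (Real.exp (-((m ^ 2 + m' ^ 2) / (4 * σ ^ 2)))) *
          ENNReal.ofReal (Real.exp ((m + m') / (2 * σ ^ 2) * e)) := by
      intro e
      rw [← ENNReal.ofReal_mul (Real.exp_pos _).le, ← Real.exp_add, overlap, zero_dotProduct,
        zero_add]
      congr 2
      field_simp
      ring
    simp_rw [h2]
    rw [lintegral_const_mul _ (by fun_prop), hint, ← ENNReal.ofReal_mul (Real.exp_pos _).le,
      ← Real.exp_add, sub_dotProduct]
    congr 2
    field_simp
    ring
  have hi : Integrable (overlap σ w w') (gaussianModel σ lam 0) := by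
    refine ⟨hm.aestronglyMeasurable, ?_⟩
    rw [hasFiniteIntegral_iff_ofReal (ae_of_all _ fun z => (overlap_pos σ w w' z).le), hL]
    exact ENNReal.ofReal_lt_top
  refine ⟨hi, ?_⟩
  rw [integral_eq_lintegral_of_nonneg_ae (ae_of_all _ fun z => (overlap_pos σ w w' z).le)
    hm.aestronglyMeasurable, hL, ENNReal.toReal_ofReal]
  exact integral_nonneg fun _ => (Real.exp_pos _).le

/-- The inequality `1 - x ≤ exp(-x)` under the integral. -/
theorem le_affinity {σ v : ℝ} (hσ : 0 < σ) (hv : 0 ≤ v) : 1 - v / (8 * σ ^ 2) ≤ affinity σ v := by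
  have h2 : Integrable (fun t : ℝ => t ^ 2) (gaussianReal 0 v.toNNReal) :=
    (memLp_id_gaussianReal (μ := 0) (v := v.toNNReal) 2).integrable_sq
  have hexp : Integrable (fun t => Real.exp (-(t ^ 2 / (8 * σ ^ 2))))
      (gaussianReal 0 v.toNNReal) := by
    refine Integrable.of_bound (by fun_prop) 1 (ae_of_all _ fun t => ?_)
    rw [Real.norm_of_nonneg (Real.exp_pos _).le, Real.exp_le_one_iff]
    have : 0 ≤ t ^ 2 / (8 * σ ^ 2) := by positivity
    linarith
  have hsq : ∫ t, t ^ 2 ∂(gaussianReal 0 v.toNNReal) = v := by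
    have := variance_fun_id_gaussianReal (μ := 0) (v := v.toNNReal)
    rw [variance_eq_integral (by fun_prop)] at this
    simpa [Real.coe_toNNReal _ hv] using this
  have : ∫ t, (1 - t ^ 2 / (8 * σ ^ 2)) ∂(gaussianReal 0 v.toNNReal) = 1 - v / (8 * σ ^ 2) := by
    rw [integral_sub (integrable_const _) (h2.div_const _), integral_div, hsq]
    simp
  rw [← this, affinity]
  refine integral_mono ((integrable_const _).sub (h2.div_const _)) hexp fun t => ?_
  have := Real.add_one_le_exp (-(t ^ 2 / (8 * σ ^ 2)))
  simp only
  linarith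

/-! ### A quadratic form and its polarization -/

theorem sqNorm_nonneg {d : ℕ} {T : Matrix (Fin d) (Fin d) ℝ} (hT : T.PosSemidef)
    (v : Fin d → ℝ) : 0 ≤ sqNorm T v := by
  simpa [sqNorm] using hT.dotProduct_mulVec_nonneg v

theorem measurable_sqNorm {d : ℕ} (T : Matrix (Fin d) (Fin d) ℝ) : Measurable (sqNorm T) := by
  unfold sqNorm Matrix.mulVec dotProduct; fun_prop

theorem dotProduct_mulVec_comm_of_posSemidef {d : ℕ} {T : Matrix (Fin d) (Fin d) ℝ}
    (hT : T.PosSemidef) (u v : Fin d → ℝ) : u ⬝ᵥ (T *ᵥ v) = v ⬝ᵥ (T *ᵥ u) := by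
  have h : Tᵀ = T := by simpa [Matrix.IsHermitian] using hT.1
  rw [Matrix.dotProduct_mulVec, ← Matrix.mulVec_transpose, h, dotProduct_comm]

theorem sqNorm_sub_smul {d : ℕ} {T : Matrix (Fin d) (Fin d) ℝ} (hT : T.PosSemidef)
    (u v : Fin d → ℝ) (c : ℝ) :
    sqNorm T (u - c • v) = sqNorm T u - 2 * c * (u ⬝ᵥ (T *ᵥ v)) + c ^ 2 * sqNorm T v := by
  have := dotProduct_mulVec_comm_of_posSemidef hT v u
  simp only [sqNorm, Matrix.mulVec_sub, Matrix.mulVec_smul, dotProduct_sub, sub_dotProduct,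
    smul_dotProduct, dotProduct_smul, smul_eq_mul, this]
  ring

theorem sqNorm_sum {d : ℕ} {J : Type*} [Fintype J] (T : Matrix (Fin d) (Fin d) ℝ)
    (c : J → ℝ) (b : J → Fin d → ℝ) :
    sqNorm T (∑ j, c j • b j) = ∑ j, ∑ l, c j * c l * (b j ⬝ᵥ (T *ᵥ b l)) := by
  simp only [sqNorm, Matrix.mulVec_sum, Matrix.mulVec_smul, sum_dotProduct, dotProduct_sum,
    smul_dotProduct, dotProduct_smul, smul_eq_mul, Finset.mul_sum]
  rw [Finset.sum_comm]
  refine Finset.sum_congr rfl fun j _ => Finset.sum_congr rfl fun l _ => by ring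

/-! ### Sign vectors -/

set_option linter.unusedSectionVars false

section Signs

variable {J : Type*} [Fintype J] [DecidableEq J]

/-- The `j`-th sign as a real number. -/
def sgn (θ : J → ℤˣ) (j : J) : ℝ := ((θ j : ℤ) : ℝ)

/-- Reverse the `j`-th sign. -/
def flip (j : J) (θ : J → ℤˣ) : J → ℤˣ := Function.update θ j (-θ j)

theorem flip_flip (j : J) (θ : J → ℤˣ) : flip j (flip j θ) = θ := by
  simp [flip]

theorem sgn_sq (θ : J → ℤˣ) (j : J) : sgn θ j * sgn θ j = 1 := by
  unfold sgn
  rcases Int.units_eq_one_or (θ j) with h | h <;> simp [h]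

theorem sgn_flip (j : J) (θ : J → ℤˣ) (l : J) :
    sgn (flip j θ) l = if l = j then -sgn θ l else sgn θ l := by
  unfold sgn flip
  split_ifs with h
  · subst h; simp
  · simp [h]

/-- Reversing one sign is an involution that negates each summand. This removes first the guess and
later the mixed terms from the lower bound. -/
theorem sum_sgn_mul_eq_zero (j : J) {F : (J → ℤˣ) → ℝ} (hF : ∀ θ, F (flip j θ) = F θ) :
    ∑ θ, sgn θ j * F θ = 0 := by
  have hinv : Function.Involutive (flip j) := flip_flip j
  have h : ∑ θ, sgn θ j * F θ = ∑ θ, sgn (flip j θ) j * F (flip j θ) :=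
    (Equiv.sum_comp hinv.toPerm fun θ => sgn θ j * F θ).symm
  simp only [sgn_flip, hF, if_true, neg_mul, Finset.sum_neg_distrib] at h
  linarith

/-- The regressor with signs `θ` along the directions `b`. -/
def signedSum {d : ℕ} (b : J → Fin d → ℝ) (θ : J → ℤˣ) : Fin d → ℝ := ∑ j, sgn θ j • b j

theorem signedSum_flip {d : ℕ} (b : J → Fin d → ℝ) (j : J) (θ : J → ℤˣ) :
    signedSum b (flip j θ) = signedSum b θ - (2 * sgn θ j) • b j := by
  unfold signedSum
  rw [eq_sub_iff_add_eq, ← Finset.sum_erase_add _ _ (Finset.mem_univ j),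
    ← Finset.sum_erase_add (a := j) _ (fun l => sgn θ l • b l) (Finset.mem_univ j), add_assoc]
  congr 1
  · refine Finset.sum_congr rfl fun l hl => ?_
    rw [sgn_flip, if_neg (Finset.ne_of_mem_erase hl)]
  · rw [sgn_flip, if_pos rfl, ← add_smul]; congr 1; ring

/-- The pointwise inequality behind the lower bound: averaged over the signs, the weighted loss of
any guess `h` dominates an expression that does not involve `h`. -/
theorem sum_weighted_sqNorm_ge {d : ℕ} {T : Matrix (Fin d) (Fin d) ℝ} (hT : T.PosSemidef)
    (b : J → Fin d → ℝ) (h : Fin d → ℝ) {p : (J → ℤˣ) → ℝ} (hp : ∀ θ, 0 < p θ) :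
    ∑ θ, ∑ j, ∑ l, sgn θ j * sgn θ l * (b j ⬝ᵥ (T *ᵥ b l)) *
        (√(p θ * p (flip j θ)) - 1 / 4 * √(p (flip j θ) * p (flip l θ))) ≤
      ∑ θ, p θ * sqNorm T (h - signedSum b θ) := by
  -- The reversal exchanges the two factors under the root, so the weight is invariant and the terms
  -- containing `h` cancel.
  have hz : ∑ θ, ∑ j, sgn θ j * √(p θ * p (flip j θ)) * (h ⬝ᵥ (T *ᵥ b j)) = 0 := by
    rw [Finset.sum_comm]
    refine Finset.sum_eq_zero fun j _ => ?_
    rw [← Finset.sum_mul, sum_sgn_mul_eq_zero, zero_mul]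
    intro θ
    rw [flip_flip, mul_comm]
  rw [← add_zero (Finset.sum _ _), ← neg_zero, ← hz, ← sub_eq_add_neg, ← Finset.sum_sub_distrib]
  refine Finset.sum_le_sum fun θ _ => ?_
  set r : J → ℝ := fun j => sgn θ j * (√(p θ * p (flip j θ)) / p θ) with hr
  -- With a shift `ρ ∑ r j • b j` the gain per direction will be `2ρA - ρ²`, where `A` is an
  -- affinity. The choice `ρ = 1/2` is optimal at `A = 1/2`, the only lower bound for `A` available
  -- later.
  have key := sqNorm_nonneg hT (h - signedSum b θ - (-(1 / 2 : ℝ)) • ∑ j, r j • b j)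
  rw [sqNorm_sub_smul hT, sqNorm_sum] at key
  have hpp := (hp θ).ne'
  have e1 : p θ * ((h - signedSum b θ) ⬝ᵥ (T *ᵥ ∑ j, r j • b j)) =
      ∑ j, sgn θ j * √(p θ * p (flip j θ)) * (h ⬝ᵥ (T *ᵥ b j)) -
      ∑ j, ∑ l, sgn θ j * sgn θ l * (b j ⬝ᵥ (T *ᵥ b l)) * √(p θ * p (flip j θ)) := by
    have e3 : ∀ j, p θ * r j = sgn θ j * √(p θ * p (flip j θ)) := by
      intro j; simp only [hr]; field_simp
    rw [sub_dotProduct, mul_sub]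
    congr 1
    · simp only [Matrix.mulVec_sum, Matrix.mulVec_smul, dotProduct_sum, dotProduct_smul,
        smul_eq_mul, Finset.mul_sum]
      refine Finset.sum_congr rfl fun j _ => by rw [← e3]; ring
    · simp only [signedSum, Matrix.mulVec_sum, Matrix.mulVec_smul, dotProduct_sum,
        dotProduct_smul, smul_eq_mul, Finset.mul_sum, sum_dotProduct, smul_dotProduct]
      refine Finset.sum_congr rfl fun j _ => Finset.sum_congr rfl fun l _ => ?_
      rw [dotProduct_mulVec_comm_of_posSemidef hT (b l)]
      linear_combination (sgn θ l * (b j ⬝ᵥ (T *ᵥ b l))) * e3 j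
  have e2 : p θ * ∑ j, ∑ l, r j * r l * (b j ⬝ᵥ (T *ᵥ b l)) =
      ∑ j, ∑ l, sgn θ j * sgn θ l * (b j ⬝ᵥ (T *ᵥ b l)) * √(p (flip j θ) * p (flip l θ)) := by
    simp only [Finset.mul_sum]
    refine Finset.sum_congr rfl fun j _ => Finset.sum_congr rfl fun l _ => ?_
    have : √(p θ * p (flip j θ)) * √(p θ * p (flip l θ)) =
        p θ * √(p (flip j θ) * p (flip l θ)) := by
      rw [← Real.sqrt_mul (mul_pos (hp _) (hp _)).le,
        show p θ * p (flip j θ) * (p θ * p (flip l θ)) =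
          p θ ^ 2 * (p (flip j θ) * p (flip l θ)) by ring,
        Real.sqrt_mul (sq_nonneg _), Real.sqrt_sq (hp θ).le]
    simp only [hr]
    field_simp
    linear_combination (sgn θ j * sgn θ l * (b j ⬝ᵥ (T *ᵥ b l))) * this
  have key2 := mul_nonneg (hp θ).le key
  have e4 : ∑ j, ∑ l, sgn θ j * sgn θ l * (b j ⬝ᵥ (T *ᵥ b l)) *
        (√(p θ * p (flip j θ)) - 1 / 4 * √(p (flip j θ) * p (flip l θ))) =
      ∑ j, ∑ l, sgn θ j * sgn θ l * (b j ⬝ᵥ (T *ᵥ b l)) * √(p θ * p (flip j θ)) -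
      1 / 4 * ∑ j, ∑ l, sgn θ j * sgn θ l * (b j ⬝ᵥ (T *ᵥ b l)) *
        √(p (flip j θ) * p (flip l θ)) := by
    simp only [Finset.mul_sum, ← Finset.sum_sub_distrib]
    refine Finset.sum_congr rfl fun j _ => Finset.sum_congr rfl fun l _ => by ring
  rw [e4, ← e2]
  linear_combination key2 + e1

end Signs

/-! ### The minimax lower bound -/

theorem affinity_zero (σ : ℝ) : affinity σ 0 = 1 := by
  simp [affinity]

theorem ofReal_integral_le_lintegral {α : Type*} [MeasurableSpace α] {μ : Measure α} {g : α → ℝ}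
    (hg : Integrable g μ) : ENNReal.ofReal (∫ x, g x ∂μ) ≤ ∫⁻ x, ENNReal.ofReal (g x) ∂μ := by
  rw [integral_eq_lintegral_pos_part_sub_lintegral_neg_part hg]
  exact (ENNReal.ofReal_le_ofReal (sub_le_self _ ENNReal.toReal_nonneg)).trans
    ENNReal.ofReal_toReal_le

theorem measurable_lintegral_pi {α Seed : Type*} [MeasurableSpace α] [MeasurableSpace Seed]
    (P : Measure α) [IsProbabilityMeasure P] {n : ℕ} {F : (Fin n → α) × Seed → ℝ≥0∞}
    (hF : Measurable F) :
    Measurable fun ξ => ∫⁻ x, F (x, ξ) ∂(Measure.pi fun _ : Fin n => P) :=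
  hF.lintegral_prod_left'

theorem measurable_expRisk {d n : ℕ} {Seed : Type*} [MeasurableSpace Seed]
    (T : Matrix (Fin d) (Fin d) ℝ) (P : Measure (Obs d)) [IsProbabilityMeasure P]
    {f : (Fin n → Obs d) × Seed → Fin d → ℝ} (hf : Measurable f) (w : Fin d → ℝ) :
    Measurable fun ξ => expRisk T P (fun data => f (data, ξ)) w := by
  have hF : Measurable fun q : (Fin n → Obs d) × Seed =>
      ENNReal.ofReal (sqNorm T (f q - w)) :=
    ((measurable_sqNorm T).comp (hf.sub_const _)).ennreal_ofReal
  exact measurable_lintegral_pi P hF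

section Minimax

variable {J : Type*} [Fintype J] [DecidableEq J]

/-- The pointwise inequality is integrated under the model with zero regressor. Reversing sign `j`
moves the regressor by `2 b j`, and by orthogonality the squared distance between two different
single reversals is `4 (v j + v l)`; so no affinity depends on `θ`, and the terms with `j ≠ l`
cancel in the sum over `θ` whatever the entries of `T` are. -/
theorem sum_expRisk_ge {d n : ℕ} {σ : ℝ} (hσ : 0 < σ) {lam : Fin d → ℝ} (hlam : ∀ i, 0 ≤ lam i)
    {T : Matrix (Fin d) (Fin d) ℝ} (hT : T.PosSemidef) {b : J → Fin d → ℝ}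
    (horth : ∀ j l, j ≠ l → ∑ i, lam i * (b j i * b l i) = 0)
    (hinfo : ∀ j, n * ∑ i, lam i * b j i ^ 2 ≤ σ ^ 2)
    {est : (Fin n → Obs d) → Fin d → ℝ} (hest : Measurable est) :
    ENNReal.ofReal (Fintype.card (J → ℤˣ) * (1 / 4 * ∑ j, sqNorm T (b j))) ≤
      ∑ θ : J → ℤˣ, expRisk T (gaussianModel σ lam (signedSum b θ)) est (signedSum b θ) := by
  set μ : Measure (Fin n → Obs d) := Measure.pi fun _ => gaussianModel σ lam 0
  set p : (J → ℤˣ) → (Fin n → Obs d) → ℝ := fun θ x =>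
    ∏ k, overlap σ (signedSum b θ) (signedSum b θ) (x k) with hp_def
  have hp : ∀ θ x, 0 < p θ x := fun θ x => Finset.prod_pos fun k _ => overlap_pos _ _ _ _
  have hpm : ∀ θ, Measurable (p θ) := fun θ => Finset.measurable_prod _ fun k _ =>
    (measurable_overlap σ _ _).comp (measurable_pi_apply k)
  have hs : ∀ θ θ' x, √(p θ x * p θ' x) =
      ∏ k, overlap σ (signedSum b θ) (signedSum b θ') (x k) := by
    intro θ θ' x
    rw [hp_def]
    simp only
    rw [← Finset.prod_mul_distrib]
    simp_rw [← overlap_sq]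
    rw [Finset.prod_pow, Real.sqrt_sq (Finset.prod_nonneg fun k _ => (overlap_pos _ _ _ _).le)]
  have hi : ∀ θ θ', Integrable (fun x => √(p θ x * p θ' x)) μ := by
    intro θ θ'
    simp_rw [hs]
    exact Integrable.fintype_prod
      (f := fun _ : Fin n => overlap σ (signedSum b θ) (signedSum b θ'))
      fun k => (overlap_integral hσ hlam _ _).1
  have hI : ∀ θ θ', ∫ x, √(p θ x * p θ' x) ∂μ =
      affinity σ (∑ i, lam i * (signedSum b θ i - signedSum b θ' i) ^ 2) ^ n := by
    intro θ θ'
    simp_rw [hs]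
    rw [integral_fintype_prod_eq_pow, (overlap_integral hσ hlam _ _).2, Fintype.card_fin]
  have hrisk : ∀ θ, expRisk T (gaussianModel σ lam (signedSum b θ)) est (signedSum b θ) =
      ∫⁻ x, ENNReal.ofReal (p θ x * sqNorm T (est x - signedSum b θ)) ∂μ := by
    intro θ
    have hprob : IsProbabilityMeasure ((gaussianModel σ lam 0).withDensity
        fun z => ENNReal.ofReal (overlap σ (signedSum b θ) (signedSum b θ) z)) := by
      rw [← gaussianModel_eq_withDensity hσ]; infer_instance
    unfold expRisk
    have hF : Measurable fun x => ENNReal.ofReal (sqNorm T (est x - signedSum b θ)) :=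
      ((measurable_sqNorm T).comp (hest.sub_const _)).ennreal_ofReal
    simp_rw [gaussianModel_eq_withDensity hσ lam (signedSum b θ)]
    rw [lintegral_pi_withDensity _ (measurable_overlap σ _ _).ennreal_ofReal hF]
    refine lintegral_congr fun x => ?_
    rw [ENNReal.ofReal_mul (hp θ x).le, hp_def,
      ENNReal.ofReal_prod_of_nonneg fun k _ => (overlap_pos _ _ _ _).le]
  simp_rw [hrisk]
  have hlm : ∀ θ, Measurable fun x =>
      ENNReal.ofReal (p θ x * sqNorm T (est x - signedSum b θ)) := fun θ =>
    ((hpm θ).mul ((measurable_sqNorm T).comp (hest.sub_const _))).ennreal_ofReal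
  rw [← lintegral_finsetSum _ fun θ _ => hlm θ]
  have hle : ∀ x, ENNReal.ofReal (∑ θ, ∑ j, ∑ l, sgn θ j * sgn θ l * (b j ⬝ᵥ (T *ᵥ b l)) *
        (√(p θ x * p (flip j θ) x) - 1 / 4 * √(p (flip j θ) x * p (flip l θ) x))) ≤
      ∑ θ, ENNReal.ofReal (p θ x * sqNorm T (est x - signedSum b θ)) := by
    intro x
    rw [← ENNReal.ofReal_sum_of_nonneg fun θ _ => mul_nonneg (hp θ x).le (sqNorm_nonneg hT _)]
    exact ENNReal.ofReal_le_ofReal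
      (sum_weighted_sqNorm_ge hT b (est x) (p := fun θ => p θ x) fun θ => hp θ x)
  refine le_trans ?_ (lintegral_mono hle)
  have hterm : ∀ θ j l, Integrable (fun x => sgn θ j * sgn θ l * (b j ⬝ᵥ (T *ᵥ b l)) *
      (√(p θ x * p (flip j θ) x) - 1 / 4 * √(p (flip j θ) x * p (flip l θ) x))) μ :=
    fun θ j l => ((hi _ _).sub ((hi _ _).const_mul _)).const_mul _
  have hG : Integrable (fun x => ∑ θ, ∑ j, ∑ l, sgn θ j * sgn θ l * (b j ⬝ᵥ (T *ᵥ b l)) *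
        (√(p θ x * p (flip j θ) x) - 1 / 4 * √(p (flip j θ) x * p (flip l θ) x))) μ :=
    integrable_finsetSum _ fun θ _ => integrable_finsetSum _ fun j _ =>
      integrable_finsetSum _ fun l _ => hterm θ j l
  refine le_trans (ENNReal.ofReal_le_ofReal ?_) (ofReal_integral_le_lintegral hG)
  rw [integral_finsetSum _ fun θ _ => integrable_finsetSum _ fun j _ =>
      integrable_finsetSum _ fun l _ => hterm θ j l]
  set v : J → ℝ := fun j => ∑ i, lam i * b j i ^ 2 with hv
  have hv0 : ∀ j, 0 ≤ v j := fun j =>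
    Finset.sum_nonneg fun i _ => mul_nonneg (hlam i) (sq_nonneg _)
  have hA : ∀ θ j, ∫ x, √(p θ x * p (flip j θ) x) ∂μ = affinity σ (4 * v j) ^ n := by
    intro θ j
    rw [hI]
    congr 2
    rw [hv, Finset.mul_sum]
    refine Finset.sum_congr rfl fun i _ => ?_
    rw [signedSum_flip]
    simp only [Pi.sub_apply, Pi.smul_apply, smul_eq_mul]
    linear_combination (4 * lam i * b j i ^ 2) * sgn_sq θ j
  have hB : ∀ θ j l, j ≠ l → ∫ x, √(p (flip j θ) x * p (flip l θ) x) ∂μ =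
      affinity σ (4 * (v j + v l)) ^ n := by
    intro θ j l hjl
    rw [hI]
    congr 2
    have e : ∑ i, lam i * (signedSum b (flip j θ) i - signedSum b (flip l θ) i) ^ 2 =
        ∑ i, (4 * (lam i * b j i ^ 2) + 4 * (lam i * b l i ^ 2) -
          8 * sgn θ j * sgn θ l * (lam i * (b j i * b l i))) := by
      refine Finset.sum_congr rfl fun i _ => ?_
      rw [signedSum_flip, signedSum_flip]
      simp only [Pi.sub_apply, Pi.smul_apply, smul_eq_mul]
      linear_combination (4 * lam i * b j i ^ 2) * sgn_sq θ j +
        (4 * lam i * b l i ^ 2) * sgn_sq θ l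
    rw [e, Finset.sum_sub_distrib, Finset.sum_add_distrib, ← Finset.mul_sum, ← Finset.mul_sum,
      ← Finset.mul_sum, horth j l hjl]
    simp only [hv]; ring
  have hB' : ∀ θ j, ∫ x, √(p (flip j θ) x * p (flip j θ) x) ∂μ = 1 := by
    intro θ j
    rw [hI]
    simp [affinity_zero]
  have hsum : ∑ θ, ∫ x, ∑ j, ∑ l, sgn θ j * sgn θ l * (b j ⬝ᵥ (T *ᵥ b l)) *
        (√(p θ x * p (flip j θ) x) - 1 / 4 * √(p (flip j θ) x * p (flip l θ) x)) ∂μ =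
      ∑ θ : J → ℤˣ, ∑ j, sqNorm T (b j) * (affinity σ (4 * v j) ^ n - 1 / 4) := by
    have h1 : ∀ θ, ∫ x, ∑ j, ∑ l, sgn θ j * sgn θ l * (b j ⬝ᵥ (T *ᵥ b l)) *
        (√(p θ x * p (flip j θ) x) - 1 / 4 * √(p (flip j θ) x * p (flip l θ) x)) ∂μ =
        ∑ j, ∑ l, sgn θ j * (sgn θ l * ((b j ⬝ᵥ (T *ᵥ b l)) * if j = l then
          affinity σ (4 * v j) ^ n - 1 / 4 else
          affinity σ (4 * v j) ^ n - 1 / 4 * affinity σ (4 * (v j + v l)) ^ n)) := by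
      intro θ
      rw [integral_finsetSum _ fun j _ => integrable_finsetSum _ fun l _ => hterm θ j l]
      refine Finset.sum_congr rfl fun j _ => ?_
      rw [integral_finsetSum _ fun l _ => hterm θ j l]
      refine Finset.sum_congr rfl fun l _ => ?_
      rw [integral_const_mul, integral_sub (hi _ _) ((hi _ _).const_mul _), integral_const_mul,
        hA]
      split_ifs with hjl
      · subst hjl; rw [hB']; ring
      · rw [hB θ j l hjl]; ring
    simp_rw [h1]
    rw [Finset.sum_comm]
    conv_rhs => rw [Finset.sum_comm]
    refine Finset.sum_congr rfl fun j _ => ?_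
    rw [Finset.sum_comm]
    rw [Finset.sum_eq_single j]
    · refine Finset.sum_congr rfl fun θ _ => ?_
      rw [← mul_assoc, sgn_sq, if_pos rfl, sqNorm, one_mul]
    · intro l _ hlj
      refine sum_sgn_mul_eq_zero j fun θ => ?_
      rw [sgn_flip, if_neg hlj]
    · simp
  rw [hsum, Finset.sum_const, Finset.card_univ, nsmul_eq_mul, Finset.mul_sum]
  refine mul_le_mul_of_nonneg_left (Finset.sum_le_sum fun j _ => ?_) (Nat.cast_nonneg _)
  rw [mul_comm]
  refine mul_le_mul_of_nonneg_left ?_ (sqNorm_nonneg hT _)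
  -- The information constraint limits the total loss of affinity over the sample to 1/2;
  -- Bernoulli's inequality then keeps the `n`-th power above 1/2.
  have h3 : 4 * v j / (8 * σ ^ 2) * n ≤ 1 / 2 := by
    rw [div_mul_eq_mul_div, div_le_iff₀ (by positivity)]
    have := hinfo j
    nlinarith
  have h4 : 1 - 4 * v j / (8 * σ ^ 2) ≤ affinity σ (4 * v j) :=
    le_affinity hσ (by have := hv0 j; positivity)
  have h5 : (1 / 2 : ℝ) ≤ affinity σ (4 * v j) ^ n := by
    rcases Nat.eq_zero_or_pos n with hn | hn
    · subst hn; norm_num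
    · have hn1 : (1 : ℝ) ≤ n := by exact_mod_cast hn
      have hq : 0 ≤ 4 * v j / (8 * σ ^ 2) := by have := hv0 j; positivity
      have hq1 : 4 * v j / (8 * σ ^ 2) ≤ 1 / 2 := by nlinarith
      have hb := one_add_mul_le_pow (a := -(4 * v j / (8 * σ ^ 2))) (by linarith) n
      have := pow_le_pow_left₀ (by linarith) h4 n
      have e : 1 + -(4 * v j / (8 * σ ^ 2)) = 1 - 4 * v j / (8 * σ ^ 2) := by ring
      rw [e] at hb
      nlinarith
  linarith

/-- Minimax lower bound over sign vectors: along directions `b` that are orthogonal with respect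
to the source covariance and carry at most unit information each. -/
theorem minimaxRisk_ge {d n : ℕ} {σ : ℝ} (hσ : 0 < σ) {lam m : Fin d → ℝ} (hlam : ∀ i, 0 ≤ lam i)
    {T : Matrix (Fin d) (Fin d) ℝ} (hT : T.PosSemidef) {b : J → Fin d → ℝ}
    (horth : ∀ j l, j ≠ l → ∑ i, lam i * (b j i * b l i) = 0)
    (hinfo : ∀ j, n * ∑ i, lam i * b j i ^ 2 ≤ σ ^ 2)
    (hmem : ∀ θ : J → ℤˣ, signedSum b θ ∈ ellipsoid m) :
    ENNReal.ofReal (1 / 4 * ∑ j, sqNorm T (b j)) ≤ minimaxRisk n σ lam m T := by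
  unfold minimaxRisk
  refine le_iInf fun e => ?_
  set R := ⨆ w ∈ ellipsoid m, e.risk T (gaussianModel σ lam w) w with hR
  let _ := e.measurableSpace
  have hprob := e.prob
  have h1 : ∀ θ : J → ℤˣ, e.risk T (gaussianModel σ lam (signedSum b θ)) (signedSum b θ) ≤ R :=
    fun θ => le_iSup₂ (f := fun w (_ : w ∈ ellipsoid m) => e.risk T (gaussianModel σ lam w) w)
      (signedSum b θ) (hmem θ)
  have h2 : ENNReal.ofReal (Fintype.card (J → ℤˣ) * (1 / 4 * ∑ j, sqNorm T (b j))) ≤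
      ∑ θ : J → ℤˣ, e.risk T (gaussianModel σ lam (signedSum b θ)) (signedSum b θ) := by
    have hmeas : ∀ θ : J → ℤˣ, Measurable fun ξ => expRisk T (gaussianModel σ lam (signedSum b θ))
        (fun data => e.toFun (data, ξ)) (signedSum b θ) :=
      fun θ => measurable_expRisk T _ e.measurable_toFun _
    unfold RandomizedEstimator.risk
    rw [← lintegral_finsetSum _ fun θ _ => hmeas θ]
    calc _ = ∫⁻ _, ENNReal.ofReal (Fintype.card (J → ℤˣ) * (1 / 4 * ∑ j, sqNorm T (b j)))
          ∂e.law := by simp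
      _ ≤ _ := lintegral_mono fun ξ => sum_expRisk_ge hσ hlam hT horth hinfo
          (e.measurable_toFun.comp measurable_prodMk_right)
  have h3 := h2.trans (Finset.sum_le_sum fun θ _ => h1 θ)
  rw [Finset.sum_const, Finset.card_univ, nsmul_eq_mul, ENNReal.ofReal_mul (Nat.cast_nonneg _),
    ENNReal.ofReal_natCast] at h3
  refine (ENNReal.mul_le_mul_iff_right ?_ (ENNReal.natCast_ne_top _)).1 h3
  exact_mod_cast Fintype.card_ne_zero

end Minimax

/-! ### Consequences of the power laws -/

theorem sqNorm_diagonal {d : ℕ} (m v : Fin d → ℝ) :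
    sqNorm (Matrix.diagonal m) v = ∑ i, m i * v i ^ 2 := by
  simp only [sqNorm, Matrix.mulVec_diagonal, dotProduct]
  exact Finset.sum_congr rfl fun i _ => by ring

theorem sqNorm_single {d : ℕ} (T : Matrix (Fin d) (Fin d) ℝ) (i : Fin d) (t : ℝ) :
    sqNorm T (Pi.single i t) = T i i * t ^ 2 := by
  simp [sqNorm, Matrix.mulVec_single]
  ring

section PowerLaw

variable {a s r ν c₁ c₂ : ℝ} {d D : ℕ} {lam m : Fin d → ℝ} {T : Matrix (Fin d) (Fin d) ℝ}

theorem PowerLaw.dim_pos (h : PowerLaw a s r ν c₁ c₂ D lam m T) : 0 < d :=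
  lt_of_le_of_lt (Nat.zero_le _) h.range_lt

theorem PowerLaw.lam_pos (h : PowerLaw a s r ν c₁ c₂ D lam m T) (hc₁ : 0 < c₁) (i : Fin d) :
    0 < lam i :=
  lt_of_lt_of_le (by positivity) (h.lam_lower i)

theorem PowerLaw.m_pos (h : PowerLaw a s r ν c₁ c₂ D lam m T) (hc₁ : 0 < c₁) (i : Fin d) :
    0 < m i :=
  lt_of_lt_of_le (mul_pos hc₁ (Real.rpow_pos_of_pos (h.lam_pos hc₁ i) _)) (h.m_lower i)

theorem PowerLaw.const_le (h : PowerLaw a s r ν c₁ c₂ D lam m T) : c₁ ≤ c₂ := by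
  have h1 := h.lam_lower ⟨0, h.dim_pos⟩
  have h2 := h.lam_upper ⟨0, h.dim_pos⟩
  simp at h1 h2
  linarith

/-- Real powers of the eigenvalues, in terms of the index. -/
theorem PowerLaw.lam_rpow_le (h : PowerLaw a s r ν c₁ c₂ D lam m T) (hc₁ : 0 < c₁) (t : ℝ)
    (i : Fin d) : lam i ^ t ≤ max (c₁ ^ t) (c₂ ^ t) * ((i : ℕ) + 1 : ℝ) ^ (-(a * t)) := by
  have hi : (0 : ℝ) < (i : ℕ) + 1 := by positivity
  have hc₂ : 0 < c₂ := hc₁.trans_le h.const_le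
  have e : (((i : ℕ) + 1 : ℝ) ^ (-a)) ^ t = ((i : ℕ) + 1 : ℝ) ^ (-(a * t)) := by
    rw [← Real.rpow_mul hi.le]; congr 1; ring
  have hp : 0 ≤ ((i : ℕ) + 1 : ℝ) ^ (-(a * t)) := by positivity
  rcases le_total 0 t with ht | ht
  · calc lam i ^ t ≤ (c₂ * ((i : ℕ) + 1 : ℝ) ^ (-a)) ^ t :=
          Real.rpow_le_rpow (h.lam_pos hc₁ i).le (h.lam_upper i) ht
      _ = c₂ ^ t * ((i : ℕ) + 1 : ℝ) ^ (-(a * t)) := by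
          rw [Real.mul_rpow hc₂.le (by positivity), e]
      _ ≤ _ := mul_le_mul_of_nonneg_right (le_max_right _ _) hp
  · calc lam i ^ t ≤ (c₁ * ((i : ℕ) + 1 : ℝ) ^ (-a)) ^ t :=
          Real.rpow_le_rpow_of_nonpos (by positivity) (h.lam_lower i) ht
      _ = c₁ ^ t * ((i : ℕ) + 1 : ℝ) ^ (-(a * t)) := by
          rw [Real.mul_rpow hc₁.le (by positivity), e]
      _ ≤ _ := mul_le_mul_of_nonneg_right (le_max_left _ _) hp

end PowerLaw

/-! ### The lower bounds for `r ≥ 1 / a` -/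

/-- Minimax lower bound over a box with axes along the eigenvectors of the covariance. -/
theorem minimaxRisk_ge_diag {d n : ℕ} {σ : ℝ} (hσ : 0 < σ) {lam m : Fin d → ℝ}
    (hlam : ∀ i, 0 ≤ lam i) {T : Matrix (Fin d) (Fin d) ℝ} (hT : T.PosSemidef)
    {t : Fin d → ℝ} (ht : ∀ i, 0 ≤ t i) (hinfo : ∀ i, n * (lam i * t i) ≤ σ ^ 2)
    (hmem : ∑ i, m i * t i ≤ 1) :
    ENNReal.ofReal (1 / 4 * ∑ i, T i i * t i) ≤ minimaxRisk n σ lam m T := by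
  have key := minimaxRisk_ge (n := n) (m := m) (b := fun i : Fin d => Pi.single i (√(t i)))
    hσ hlam hT ?_ ?_ ?_
  · simpa only [sqNorm_single, Real.sq_sqrt (ht _)] using key
  · intro j l hjl
    refine Finset.sum_eq_zero fun i _ => ?_
    by_cases h : i = j
    · subst h; simp [Pi.single_eq_of_ne hjl]
    · simp [Pi.single_eq_of_ne h]
  · intro j
    rw [Finset.sum_eq_single j]
    · rw [Pi.single_eq_same, Real.sq_sqrt (ht j)]; exact hinfo j
    · intro i _ hij; simp [Pi.single_eq_of_ne hij]
    · simp
  · intro θ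
    have : ∀ i, signedSum (fun i : Fin d => (Pi.single i (√(t i)) : Fin d → ℝ)) θ i =
        sgn θ i * √(t i) := by
      intro i
      rw [signedSum, Finset.sum_apply, Finset.sum_eq_single i]
      · simp
      · intro j _ hji; simp [Pi.single_eq_of_ne hji.symm]
      · simp
    rw [ellipsoid, Set.mem_ofPred_eq, sqNorm_diagonal]
    refine le_of_eq_of_le (Finset.sum_congr rfl fun i _ => ?_) hmem
    rw [this, mul_pow, Real.sq_sqrt (ht i), pow_two (sgn θ i), sgn_sq, one_mul]

/-- A single direction suffices, the first coordinate, where all the power laws reduce to constants.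
The factor `κ` ensures both the information constraint and membership in the ellipsoid. -/
theorem minimaxRisk_ge_parametric {a s r ν c₁ c₂ : ℝ} (hc₁ : 0 < c₁) :
    ∃ c : ℝ, 0 < c ∧ ∀ (d D : ℕ) (lam m : Fin d → ℝ) (T : Matrix (Fin d) (Fin d) ℝ),
      PowerLaw a s r ν c₁ c₂ D lam m T → ∀ (n : ℕ) (σ : ℝ), 0 < σ → σ ^ 2 ≤ n →
        ENNReal.ofReal (c * (σ ^ 2 / n)) ≤ minimaxRisk n σ lam m T := by
  by_cases hc : c₁ ≤ c₂
  swap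
  · exact ⟨1, one_pos, fun d D lam m T h => absurd h.const_le hc⟩
  have hc₂ : 0 < c₂ := hc₁.trans_le hc
  set M := c₂ * max (c₁ ^ (1 - s)) (c₂ ^ (1 - s)) with hM
  have hMpos : 0 < M := mul_pos hc₂ (lt_max_of_lt_left (Real.rpow_pos_of_pos hc₁ _))
  refine ⟨1 / 4 * (c₁ * min (1 / c₂) (1 / M)), by positivity, ?_⟩
  intro d D lam m T h n σ hσ hn
  have hσ2 : 0 < σ ^ 2 := by positivity
  have hn0 : (0 : ℝ) < n := hσ2.trans_le hn
  set κ := min (1 / c₂) (1 / M) with hκ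
  have hκ0 : 0 < κ := by positivity
  have hκ1 : κ * c₂ ≤ 1 := by rw [← le_div_iff₀ hc₂]; exact min_le_left _ _
  have hκ2 : κ * M ≤ 1 := by rw [← le_div_iff₀ hMpos]; exact min_le_right _ _
  have hd := h.dim_pos
  set i₀ : Fin d := ⟨0, hd⟩ with hi₀
  have hl : lam i₀ ≤ c₂ := by simpa using h.lam_upper i₀
  have hm : m i₀ ≤ M := by
    refine (h.m_upper i₀).trans (mul_le_mul_of_nonneg_left ?_ hc₂.le)
    simpa using h.lam_rpow_le hc₁ (1 - s) i₀
  have ht : c₁ ≤ T i₀ i₀ := by simpa using h.diag_lower i₀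
  set τ := κ * (σ ^ 2 / n) with hτ
  have hτ0 : 0 < τ := by positivity
  have hnτ : n * τ = κ * σ ^ 2 := by rw [hτ]; field_simp
  have hτκ : τ ≤ κ := by
    rw [hτ]; exact mul_le_of_le_one_right hκ0.le ((div_le_one hn0).2 hn)
  refine le_trans (ENNReal.ofReal_le_ofReal ?_) (minimaxRisk_ge_diag hσ
    (fun i => (h.lam_pos hc₁ i).le) h.posSemidef (t := Pi.single i₀ τ) ?_ ?_ ?_)
  · rw [Finset.sum_eq_single i₀ (fun i _ hi => by simp [Pi.single_eq_of_ne hi]) (by simp),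
      Pi.single_eq_same]
    have := mul_le_mul_of_nonneg_right ht hτ0.le
    calc _ = 1 / 4 * (c₁ * τ) := by rw [hτ]; ring
      _ ≤ _ := by linarith
  · intro i
    by_cases hi : i = i₀
    · subst hi; simpa using hτ0.le
    · simp [Pi.single_eq_of_ne hi]
  · intro i
    by_cases hi : i = i₀
    · rw [hi, Pi.single_eq_same]
      calc n * (lam i₀ * τ) = lam i₀ * (κ * σ ^ 2) := by rw [← hnτ]; ring
        _ ≤ c₂ * (κ * σ ^ 2) := mul_le_mul_of_nonneg_right hl (by positivity)
        _ = κ * c₂ * σ ^ 2 := by ring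
        _ ≤ 1 * σ ^ 2 := mul_le_mul_of_nonneg_right hκ1 hσ2.le
        _ = σ ^ 2 := one_mul _
    · simp [Pi.single_eq_of_ne hi, hσ2.le]
  · rw [Finset.sum_eq_single i₀ (fun i _ hi => by simp [Pi.single_eq_of_ne hi]) (by simp),
      Pi.single_eq_same]
    calc m i₀ * τ ≤ M * κ := mul_le_mul hm hτκ hτ0.le hMpos.le
      _ ≤ 1 := by linarith

theorem sum_fin_ite_lt {d K : ℕ} (hK : K ≤ d) (f : ℕ → ℝ) :
    ∑ i : Fin d, (if (i : ℕ) < K then f i else 0) = ∑ i ∈ Finset.range K, f i := by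
  rw [Fin.sum_univ_eq_sum_range (fun i => if i < K then f i else 0), ← Finset.sum_filter]
  congr 1
  ext i
  simp only [Finset.mem_filter, Finset.mem_range]
  omega

/-- At `r = 1/a` the ratio `T i i / lam i` is at least of order `1 / i`, so squared side lengths
proportional to `1 / lam i`, the largest order the information constraint allows, contribute a
harmonic sum. Any small power of `n / σ²` will do as the number of coordinates, since only its
logarithm counts. -/
theorem minimaxRisk_ge_log {a s r ν c₁ c₂ : ℝ} (hc₁ : 0 < c₁) (ha : 0 < a) (hr : r = 1 / a)
    {p : ℝ} (hp : 0 < p) :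
    ∃ c : ℝ, 0 < c ∧ ∀ (d D : ℕ) (lam m : Fin d → ℝ) (T : Matrix (Fin d) (Fin d) ℝ),
      PowerLaw a s r ν c₁ c₂ D lam m T → ∀ (n : ℕ) (σ : ℝ), 0 < σ → σ ^ 2 ≤ n →
        n / σ ^ 2 ≤ (d : ℝ) ^ p →
        ENNReal.ofReal (c * (σ ^ 2 / n * Real.log (n / σ ^ 2))) ≤ minimaxRisk n σ lam m T := by
  by_cases hc : c₁ ≤ c₂
  swap
  · exact ⟨1, one_pos, fun d D lam m T h => absurd h.const_le hc⟩
  have hc₂ : 0 < c₂ := hc₁.trans_le hc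
  set B := max (c₁ ^ (-s)) (c₂ ^ (-s)) with hB
  have hB0 : 0 < B := lt_max_of_lt_left (Real.rpow_pos_of_pos hc₁ _)
  set κ := min 1 (1 / (c₂ * B)) with hκ
  have hκ0 : 0 < κ := by positivity
  have hκ1 : κ ≤ 1 := min_le_left _ _
  have hκ2 : κ * (c₂ * B) ≤ 1 := by
    rw [← le_div_iff₀ (by positivity)]; exact min_le_right _ _
  -- The first bound keeps the box inside the ellipsoid, through `K^(1 + |a s|) ≤ x`; the second
  -- gives `K ≤ d`.
  set q := min (1 / (1 + |a * s|)) (1 / p) with hq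
  have hq0 : 0 < q := by positivity
  have hq1 : q * (1 + |a * s|) ≤ 1 := by
    rw [← le_div_iff₀ (by positivity)]; exact min_le_left _ _
  have hq2 : q * p ≤ 1 := by rw [← le_div_iff₀ hp]; exact min_le_right _ _
  refine ⟨1 / 4 * (κ * (c₁ / c₂) * q), by positivity, ?_⟩
  intro d D lam m T h n σ hσ hn hnd
  have hσ2 : 0 < σ ^ 2 := by positivity
  have hn0 : (0 : ℝ) < n := hσ2.trans_le hn
  set x := n / σ ^ 2 with hx
  have hx1 : 1 ≤ x := (one_le_div hσ2).2 hn
  have hx0 : 0 < x := by linarith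
  have hxi : σ ^ 2 / n = 1 / x := by rw [hx, one_div_div]
  have hd : (1 : ℝ) ≤ d := by exact_mod_cast h.dim_pos
  set K := ⌊x ^ q⌋₊ with hK
  have hy1 : 1 ≤ x ^ q := Real.one_le_rpow hx1 hq0.le
  have hKy : (K : ℝ) ≤ x ^ q := Nat.floor_le (by positivity)
  have hK1 : 1 ≤ K := Nat.le_floor (by simpa using hy1)
  have hK1' : (1 : ℝ) ≤ K := by exact_mod_cast hK1
  have hKd : K ≤ d := by
    have : (K : ℝ) ≤ d := by
      calc (K : ℝ) ≤ x ^ q := hKy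
        _ ≤ ((d : ℝ) ^ p) ^ q := Real.rpow_le_rpow hx0.le hnd hq0.le
        _ = (d : ℝ) ^ (q * p) := by rw [← Real.rpow_mul (by positivity), mul_comm]
        _ ≤ (d : ℝ) ^ (1 : ℝ) := Real.rpow_le_rpow_of_exponent_le hd hq2
        _ = d := Real.rpow_one _
    exact_mod_cast this
  have hKs : (K : ℝ) * (K : ℝ) ^ |a * s| ≤ x := by
    calc (K : ℝ) * (K : ℝ) ^ |a * s| = (K : ℝ) ^ (1 + |a * s|) := by
          rw [Real.rpow_add (by linarith), Real.rpow_one]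
      _ ≤ (x ^ q) ^ (1 + |a * s|) := Real.rpow_le_rpow (by linarith) hKy (by positivity)
      _ = x ^ (q * (1 + |a * s|)) := by rw [← Real.rpow_mul hx0.le]
      _ ≤ x ^ (1 : ℝ) := Real.rpow_le_rpow_of_exponent_le hx1 hq1
      _ = x := Real.rpow_one _
  set t : Fin d → ℝ := fun i => if (i : ℕ) < K then κ * (1 / x) / lam i else 0 with ht
  have hlp := h.lam_pos hc₁
  refine le_trans (ENNReal.ofReal_le_ofReal ?_) (minimaxRisk_ge_diag hσ
    (fun i => (hlp i).le) h.posSemidef (t := t) ?_ ?_ ?_)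
  · have h1 : ∀ i : Fin d, (if (i : ℕ) < K then κ * (c₁ / c₂) * (1 / x) * ((i : ℕ) + 1 : ℝ)⁻¹ else 0) ≤
        T i i * t i := by
      intro i
      simp only [ht]
      split_ifs with hi
      swap
      · simp
      have hi0 : (0 : ℝ) < (i : ℕ) + 1 := by positivity
      have e : ((i : ℕ) + 1 : ℝ) ^ (-((1 + r) * a)) =
          ((i : ℕ) + 1 : ℝ)⁻¹ * ((i : ℕ) + 1 : ℝ) ^ (-a) := by
        rw [← Real.rpow_neg_one, ← Real.rpow_add hi0]
        congr 1
        rw [hr]; field_simp; ring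
      have h2 := h.diag_lower i
      rw [e] at h2
      have h3 := h.lam_upper i
      have h4 : κ * (1 / x) / (c₂ * ((i : ℕ) + 1 : ℝ) ^ (-a)) ≤ κ * (1 / x) / lam i :=
        div_le_div_of_nonneg_left (by positivity) (hlp i) h3
      calc _ = (c₁ * (((i : ℕ) + 1 : ℝ)⁻¹ * ((i : ℕ) + 1 : ℝ) ^ (-a))) *
            (κ * (1 / x) / (c₂ * ((i : ℕ) + 1 : ℝ) ^ (-a))) := by
            have : ((i : ℕ) + 1 : ℝ) ^ (-a) ≠ 0 := by positivity
            field_simp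
        _ ≤ _ := mul_le_mul h2 h4 (by positivity) (le_trans (by positivity) h2)
    have h5 := Finset.sum_le_sum fun i (_ : i ∈ Finset.univ) => h1 i
    rw [sum_fin_ite_lt hKd fun i => κ * (c₁ / c₂) * (1 / x) * ((i : ℕ) + 1 : ℝ)⁻¹,
      ← Finset.mul_sum] at h5
    have h6 : q * Real.log x ≤ ∑ i ∈ Finset.range K, ((i : ℕ) + 1 : ℝ)⁻¹ := by
      have h7 := log_add_one_le_harmonic K
      have h8 : ((harmonic K : ℚ) : ℝ) = ∑ i ∈ Finset.range K, ((i : ℕ) + 1 : ℝ)⁻¹ := by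
        simp [harmonic]
      rw [h8] at h7
      refine le_trans ?_ h7
      rw [← Real.log_rpow hx0]
      exact Real.log_le_log (by positivity) (by push_cast; exact (Nat.lt_floor_add_one _).le)
    rw [hxi]
    have h9 := mul_le_mul_of_nonneg_left h6
      (show 0 ≤ κ * (c₁ / c₂) * (1 / x) by positivity)
    linarith
  · intro i
    simp only [ht]
    have := hlp i
    split_ifs <;> positivity
  · intro i
    simp only [ht]
    have := hlp i
    split_ifs
    · calc n * (lam i * (κ * (1 / x) / lam i)) = κ * (n * (1 / x)) := by field_simp
        _ = κ * σ ^ 2 := by rw [hx]; field_simp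
        _ ≤ 1 * σ ^ 2 := mul_le_mul_of_nonneg_right hκ1 hσ2.le
        _ = σ ^ 2 := one_mul _
    · simp [hσ2.le]
  · have h1 : ∀ i : Fin d, m i * t i ≤
        (if (i : ℕ) < K then c₂ * B * κ * (1 / x) * (K : ℝ) ^ |a * s| else 0) := by
      intro i
      simp only [ht]
      split_ifs with hi
      swap
      · simp
      have hi0 : (1 : ℝ) ≤ (i : ℕ) + 1 := by
        have : (0 : ℝ) ≤ (i : ℕ) := by positivity
        linarith
      have hiK : ((i : ℕ) + 1 : ℝ) ≤ K := by exact_mod_cast hi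
      have h2 : lam i ^ (1 - s) / lam i = lam i ^ (-s) := by
        rw [Real.rpow_sub (hlp i), Real.rpow_one, Real.rpow_neg (hlp i).le]
        have := hlp i
        field_simp
      have h3 : lam i ^ (-s) ≤ B * (K : ℝ) ^ |a * s| := by
        refine (h.lam_rpow_le hc₁ (-s) i).trans (mul_le_mul_of_nonneg_left ?_ hB0.le)
        calc ((i : ℕ) + 1 : ℝ) ^ (-(a * -s)) ≤ ((i : ℕ) + 1 : ℝ) ^ |a * s| :=
              Real.rpow_le_rpow_of_exponent_le hi0 (by rw [mul_neg, neg_neg]; exact le_abs_self _)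
          _ ≤ _ := Real.rpow_le_rpow (by linarith) hiK (abs_nonneg _)
      calc m i * (κ * (1 / x) / lam i) ≤ c₂ * lam i ^ (1 - s) * (κ * (1 / x) / lam i) :=
            mul_le_mul_of_nonneg_right (h.m_upper i) (by have := hlp i; positivity)
        _ = c₂ * κ * (1 / x) * (lam i ^ (1 - s) / lam i) := by ring
        _ ≤ c₂ * κ * (1 / x) * (B * (K : ℝ) ^ |a * s|) := by
            rw [h2]; exact mul_le_mul_of_nonneg_left h3 (by positivity)
        _ = _ := by ring
    refine (Finset.sum_le_sum fun i _ => h1 i).trans ?_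
    rw [sum_fin_ite_lt hKd fun _ => c₂ * B * κ * (1 / x) * (K : ℝ) ^ |a * s|, Finset.sum_const,
      Finset.card_range, nsmul_eq_mul]
    calc (K : ℝ) * (c₂ * B * κ * (1 / x) * (K : ℝ) ^ |a * s|) =
          (κ * (c₂ * B)) * ((K : ℝ) * (K : ℝ) ^ |a * s| * (1 / x)) := by ring
      _ ≤ 1 * (x * (1 / x)) := by gcongr
      _ = 1 := by field_simp

/-! ### The lower bound for `r < 1 / a` -/

theorem dotProduct_mulVec_le_specNorm {d : ℕ} (A : Matrix (Fin d) (Fin d) ℝ) (v : Fin d → ℝ) :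
    v ⬝ᵥ (A *ᵥ v) ≤ specNorm A * (v ⬝ᵥ v) := by
  set x : EuclideanSpace ℝ (Fin d) := WithLp.toLp 2 v
  have h1 : v ⬝ᵥ (A *ᵥ v) = inner ℝ x (Matrix.toEuclideanCLM (n := Fin d) (𝕜 := ℝ) A x) := by
    simp [x, EuclideanSpace.inner_eq_star_dotProduct, dotProduct_comm]
  have h2 : v ⬝ᵥ v = ‖x‖ ^ 2 := by
    rw [EuclideanSpace.real_norm_sq_eq]
    simp [x, dotProduct, pow_two]
  rw [h1, h2, specNorm]
  calc _ ≤ ‖x‖ * ‖Matrix.toEuclideanCLM (n := Fin d) (𝕜 := ℝ) A x‖ := real_inner_le_norm _ _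
    _ ≤ ‖x‖ * (‖Matrix.toEuclideanCLM (n := Fin d) (𝕜 := ℝ) A‖ * ‖x‖) :=
        mul_le_mul_of_nonneg_left (ContinuousLinearMap.le_opNorm _ _) (norm_nonneg _)
    _ = _ := by ring

theorem whiten_apply {d : ℕ} (m : Fin d → ℝ) (A : Matrix (Fin d) (Fin d) ℝ) (i j : Fin d) :
    whiten m A i j = (√(m i))⁻¹ * A i j * (√(m j))⁻¹ := by
  simp [whiten, Matrix.diagonal_mul, Matrix.mul_diagonal]

theorem sqNorm_whiten {d : ℕ} (m : Fin d → ℝ) (A : Matrix (Fin d) (Fin d) ℝ) (v : Fin d → ℝ) :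
    v ⬝ᵥ (whiten m A *ᵥ v) = sqNorm A fun i => (√(m i))⁻¹ * v i := by
  simp only [sqNorm, Matrix.mulVec, dotProduct, whiten_apply, Finset.mul_sum]
  refine Finset.sum_congr rfl fun i _ => Finset.sum_congr rfl fun j _ => by ring

theorem sqNorm_tail {d k : ℕ} (A : Matrix (Fin d) (Fin d) ℝ) {v : Fin d → ℝ}
    (hv : ∀ i : Fin d, (i : ℕ) < k → v i = 0) : sqNorm (tail k A) v = sqNorm A v := by
  simp only [sqNorm, Matrix.mulVec, dotProduct, Finset.mul_sum, tail, Matrix.of_apply]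
  refine Finset.sum_congr rfl fun i _ => Finset.sum_congr rfl fun j _ => ?_
  by_cases hi : k ≤ (i : ℕ)
  · by_cases hj : k ≤ (j : ℕ)
    · simp [hi, hj]
    · simp [hv j (not_le.1 hj)]
  · simp [hv i (not_le.1 hi)]

theorem posSemidef_tail {d : ℕ} (k : ℕ) {A : Matrix (Fin d) (Fin d) ℝ} (hA : A.PosSemidef) :
    (tail k A).PosSemidef := by
  have : tail k A = (Matrix.diagonal fun i : Fin d => if k ≤ (i : ℕ) then (1 : ℝ) else 0)ᴴ * A *
      Matrix.diagonal fun i : Fin d => if k ≤ (i : ℕ) then (1 : ℝ) else 0 := by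
    ext i j
    rw [Matrix.mul_diagonal, Matrix.diagonal_conjTranspose, Matrix.diagonal_mul]
    by_cases hi : k ≤ (i : ℕ) <;> by_cases hj : k ≤ (j : ℕ) <;> simp [tail, hi, hj]
  rw [this]
  exact hA.conjTranspose_mul_mul_same _

theorem posSemidef_whiten {d : ℕ} (m : Fin d → ℝ) {A : Matrix (Fin d) (Fin d) ℝ}
    (hA : A.PosSemidef) : (whiten m A).PosSemidef := by
  have := hA.conjTranspose_mul_mul_same (Matrix.diagonal fun i => (√(m i))⁻¹)
  rwa [Matrix.diagonal_conjTranspose] at this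

/-- A positive semidefinite matrix has an orthonormal family of eigenvectors for its positive
singular values. -/
theorem exists_singular_vectors {d : ℕ} {A : Matrix (Fin d) (Fin d) ℝ} (hA : A.PosSemidef) :
    ∃ u : Fin d → Fin d → ℝ, (∀ i l, u i ⬝ᵥ u l = if i = l then 1 else 0) ∧
      ∀ i, A *ᵥ u i = ((Matrix.toEuclideanLin A).singularValues i) • u i := by
  set f := Matrix.toEuclideanLin A with hf
  have hn : Module.finrank ℝ (EuclideanSpace ℝ (Fin d)) = d := finrank_euclideanSpace_fin
  have hsymm : LinearMap.adjoint f = f := by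
    have := Matrix.toEuclideanLin_conjTranspose_eq_adjoint A
    rw [hA.1] at this
    exact this.symm
  obtain ⟨e, he⟩ : ∃ e : OrthonormalBasis (Fin d) ℝ (EuclideanSpace ℝ (Fin d)),
      ∀ i, LinearMap.adjoint f (f (e i)) = (f.singularValues i ^ 2) • e i := by
    refine ⟨f.isSymmetric_adjoint_comp_self.eigenvectorBasis hn, fun i => ?_⟩
    have := f.isSymmetric_adjoint_comp_self.apply_eigenvectorBasis hn i
    rw [← f.sq_singularValues_fin hn i] at this
    exact this
  rw [hsymm] at he
  refine ⟨fun i => WithLp.ofLp (e i), fun i l => ?_, fun i => ?_⟩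
  · have := orthonormal_iff_ite.1 e.orthonormal i l
    rw [EuclideanSpace.inner_eq_star_dotProduct, star_trivial, dotProduct_comm] at this
    exact this
  · set s := f.singularValues i with hs
    have hs0 : 0 ≤ s := f.singularValues_nonneg i
    have h1 : f (f (e i)) = (s ^ 2) • e i := he i
    -- The basis diagonalizes only `f²`. From `(f + s)(f - s) e = 0`, the vector `y` satisfies `f y
    -- = -s y`, which positivity forbids for `s > 0` unless `y = 0`. For `s = 0`, symmetry gives `f
    -- e = 0` from `f (f e) = 0`.
    set y := f (e i) - s • e i with hy
    have h2 : f y = (-s) • y := by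
      rw [hy, map_sub, map_smul, h1]
      module
    have h3 : 0 ≤ inner ℝ y (f y) := by
      have := hA.dotProduct_mulVec_nonneg (WithLp.ofLp y)
      rw [EuclideanSpace.inner_eq_star_dotProduct, dotProduct_comm]
      exact this
    have hy0 : y = 0 := by
      rcases hs0.eq_or_lt with h0 | h0
      · have h4 : f (f (e i)) = 0 := by rw [h1, ← h0]; simp
        have h5 : inner ℝ (f (e i)) (f (e i)) = 0 := by
          nth_rewrite 2 [← hsymm]
          rw [LinearMap.adjoint_inner_right, h4, inner_zero_left]
        rw [hy, ← h0, inner_self_eq_zero.1 h5]; simp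
      · rw [h2, inner_smul_right, real_inner_self_eq_norm_sq] at h3
        have : ‖y‖ ^ 2 = 0 := by nlinarith [sq_nonneg ‖y‖]
        simpa using this
    have h6 : f (e i) = s • e i := sub_eq_zero.1 hy0
    exact congrArg WithLp.ofLp h6

/-- Within the span of an orthonormal family, a diagonal quadratic form has an orthonormal frame
of principal axes. -/
theorem exists_principal_axes {d : ℕ} {I : Type*} [Fintype I] [DecidableEq I]
    {u : I → Fin d → ℝ} (hu : ∀ i l, u i ⬝ᵥ u l = if i = l then 1 else 0) (g : Fin d → ℝ) :
    ∃ U : Matrix I I ℝ, Uᵀ * U = 1 ∧ U * Uᵀ = 1 ∧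
      (∀ j l, (∑ i, U i j • u i) ⬝ᵥ (∑ i, U i l • u i) = if j = l then 1 else 0) ∧
      ∀ j l, j ≠ l → ∑ x, g x * ((∑ i, U i j • u i) x * (∑ i, U i l • u i) x) = 0 := by
  set G : Matrix I I ℝ := Matrix.of fun i l => ∑ x, g x * (u i x * u l x) with hG
  have hGh : G.IsHermitian := by
    ext i l
    simp only [hG, Matrix.conjTranspose_apply, Matrix.of_apply, star_trivial]
    exact Finset.sum_congr rfl fun x _ => by ring
  set U : Matrix I I ℝ := (hGh.eigenvectorUnitary : Matrix I I ℝ) with hU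
  have h1 : Uᵀ * U = 1 := by
    have := Unitary.coe_star_mul_self hGh.eigenvectorUnitary
    simpa [Matrix.star_eq_conjTranspose] using this
  have h2 : U * Uᵀ = 1 := by
    have := Unitary.coe_mul_star_self hGh.eigenvectorUnitary
    simpa [Matrix.star_eq_conjTranspose] using this
  obtain ⟨ev, h4⟩ : ∃ ev : I → ℝ, G = U * Matrix.diagonal ev * Uᵀ := by
    refine ⟨hGh.eigenvalues, ?_⟩
    have := hGh.spectral_theorem
    simpa [Unitary.conjStarAlgAut_apply, Matrix.star_eq_conjTranspose, Function.comp_def]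
      using this
  have h3 : Uᵀ * G * U = Matrix.diagonal ev := by
    rw [h4]
    calc Uᵀ * (U * Matrix.diagonal ev * Uᵀ) * U =
          (Uᵀ * U) * Matrix.diagonal ev * (Uᵀ * U) := by
          simp only [Matrix.mul_assoc]
      _ = _ := by rw [h1]; simp
  refine ⟨U, h1, h2, fun j l => ?_, fun j l hjl => ?_⟩
  · have := congrFun (congrFun h1 j) l
    rw [Matrix.one_apply] at this
    rw [← this]
    simp [sum_dotProduct, dotProduct_sum, hu, Matrix.mul_apply, mul_comm]
  · have := congrFun (congrFun h3 j) l
    rw [Matrix.diagonal_apply_ne _ hjl] at this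
    rw [← this]
    simp only [Matrix.mul_apply, Matrix.transpose_apply, hG, Matrix.of_apply, Finset.sum_apply,
      Pi.smul_apply, smul_eq_mul, Finset.sum_mul, Finset.mul_sum]
    rw [Finset.sum_comm]
    refine Finset.sum_congr rfl fun i _ => ?_
    rw [Finset.sum_comm]
    refine Finset.sum_congr rfl fun i' _ => Finset.sum_congr rfl fun x _ => by ring

/-- Minimax lower bound in the directions of the leading eigenvectors of the tail of the whitened
target covariance. -/
theorem minimaxRisk_ge_tail {d n : ℕ} {σ : ℝ} (hσ : 0 < σ) {lam m : Fin d → ℝ}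
    (hlam : ∀ i, 0 ≤ lam i) (hm : ∀ i, 0 < m i) {T : Matrix (Fin d) (Fin d) ℝ}
    (hT : T.PosSemidef) (k Δ : ℕ) {τ : ℝ} (hτ : 0 ≤ τ) (hΔ : Δ * τ ≤ 1)
    (hinfo : n * (τ * specNorm (whiten m (tail k (Matrix.diagonal lam)))) ≤ σ ^ 2) :
    ENNReal.ofReal (1 / 4 * (τ * topSingularSum Δ (whiten m (tail k T)))) ≤
      minimaxRisk n σ lam m T := by
  set A := whiten m (tail k T) with hA
  have hApsd : A.PosSemidef := posSemidef_whiten m (posSemidef_tail k hT)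
  obtain ⟨u, hu, hAu⟩ := exists_singular_vectors hApsd
  set sv : Fin d → ℝ := fun i => (Matrix.toEuclideanLin A).singularValues i with hsv
  have hsv0 : ∀ i, 0 ≤ sv i := fun i => LinearMap.singularValues_nonneg _ _
  -- Eigenvectors with a nonzero eigenvalue are supported in the tail, while those in the kernel
  -- need not be; dropping the latter does not change the sum of singular values.
  let I := {i : Fin d // (i : ℕ) < Δ ∧ 0 < sv i}
  have huI : ∀ i l : I, u i ⬝ᵥ u l = if i = l then 1 else 0 := by
    intro i l; rw [hu]; exact if_congr Subtype.ext_iff.symm rfl rfl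
  set g : Fin d → ℝ := fun x => lam x / m x with hg
  -- The rotation achieves orthogonality for the source covariance, and leaves the trace of `A` on
  -- the span unchanged.
  obtain ⟨U, hU1, hU2, hon, hdiag⟩ := exists_principal_axes (u := fun i : I => u i) huI g
  set v : I → Fin d → ℝ := fun j => ∑ i, U i j • u i with hv
  have hsupp : ∀ i : I, ∀ x : Fin d, (x : ℕ) < k → u i x = 0 := by
    intro i x hx
    have h1 := congrFun (hAu i) x
    have h2 : (A *ᵥ u i) x = 0 := by
      simp only [Matrix.mulVec, dotProduct]
      refine Finset.sum_eq_zero fun y _ => ?_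
      simp [hA, whiten_apply, tail, not_le.2 hx]
    rw [h2] at h1
    exact (mul_eq_zero.1 h1.symm).resolve_left i.2.2.ne'
  have hvsupp : ∀ j : I, ∀ x : Fin d, (x : ℕ) < k → v j x = 0 := by
    intro j x hx
    simp only [hv, Finset.sum_apply, Pi.smul_apply, smul_eq_mul]
    exact Finset.sum_eq_zero fun i _ => by rw [hsupp i x hx, mul_zero]
  have hAv : ∀ j, v j ⬝ᵥ (A *ᵥ v j) = ∑ i : I, sv i * U i j ^ 2 := by
    intro j
    simp only [hv, Matrix.mulVec_sum, Matrix.mulVec_smul, hAu, sum_dotProduct, dotProduct_sum,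
      smul_dotProduct, dotProduct_smul, huI, smul_eq_mul, mul_ite, mul_one, mul_zero,
      Finset.mem_univ, if_true, Finset.sum_ite_eq', hsv]
    exact Finset.sum_congr rfl fun i _ => by ring
  have hsumA : ∑ j, v j ⬝ᵥ (A *ᵥ v j) = topSingularSum Δ A := by
    simp_rw [hAv]
    rw [Finset.sum_comm]
    have h1 : ∀ i : I, ∑ j, sv i * U i j ^ 2 = sv i := by
      intro i
      have := congrFun (congrFun hU2 i) i
      simp only [Matrix.mul_apply, Matrix.transpose_apply, Matrix.one_apply_eq] at this
      rw [← Finset.mul_sum]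
      simp_rw [pow_two]
      rw [this, mul_one]
    simp_rw [h1]
    have h2 : ∑ i : I, sv i = ∑ i : Fin d, if (i : ℕ) < Δ then sv i else 0 := by
      rw [← Finset.sum_subtype (Finset.univ.filter fun i : Fin d => (i : ℕ) < Δ ∧ 0 < sv i)
        (by simp) sv, Finset.sum_filter]
      refine Finset.sum_congr rfl fun i _ => ?_
      by_cases hi : (i : ℕ) < Δ
      · rcases (hsv0 i).eq_or_lt with h0 | h0
        · simp [← h0]
        · simp [hi, h0]
      · simp [hi]
    rw [h2, hsv]
    simp only
    rw [Fin.sum_univ_eq_sum_range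
      fun i => if i < Δ then (Matrix.toEuclideanLin A).singularValues i else 0,
      ← Finset.sum_filter, topSingularSum]
    refine Finset.sum_subset (fun i hi => ?_) fun i hi hi' => ?_
    · simp only [Finset.mem_filter] at hi
      simpa using hi.2
    · refine LinearMap.singularValues_of_finrank_le _ ?_
      rw [finrank_euclideanSpace_fin]
      simp only [Finset.mem_filter, Finset.mem_range, not_and] at hi hi'
      by_contra hd
      exact hi' (not_le.1 hd) hi
  -- Undoing the whitening: every signed sum has squared `M`-norm `τ` times the number of
  -- directions, hence at most `τ Δ`.
  set b : I → Fin d → ℝ := fun j x => (√(m x))⁻¹ * (√τ * v j x) with hb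
  have hmm : ∀ x, (√(m x))⁻¹ * (√(m x))⁻¹ = (m x)⁻¹ := fun x => by
    rw [← mul_inv, Real.mul_self_sqrt (hm x).le]
  have hττ : √τ * √τ = τ := Real.mul_self_sqrt hτ
  have hsq : ∀ j, sqNorm T (b j) = τ * (v j ⬝ᵥ (A *ᵥ v j)) := by
    intro j
    have h1 : sqNorm T (b j) = sqNorm (tail k T) (b j) :=
      (sqNorm_tail T fun i hi => by simp [hb, hvsupp j i hi]).symm
    rw [h1, hb, ← sqNorm_whiten m (tail k T) fun x => √τ * v j x]
    have : (fun x => √τ * v j x) = √τ • v j := rfl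
    rw [this, Matrix.mulVec_smul, smul_dotProduct, dotProduct_smul, smul_smul, hττ, smul_eq_mul]
  refine le_trans (ENNReal.ofReal_le_ofReal (le_of_eq ?_))
    (minimaxRisk_ge (b := b) hσ hlam hT ?_ ?_ ?_)
  · simp_rw [hsq]
    rw [← Finset.mul_sum, hsumA]
  · intro j l hjl
    have : ∀ x, lam x * (b j x * b l x) = τ * (g x * (v j x * v l x)) := by
      intro x
      simp only [hb, hg]
      calc _ = lam x * ((√(m x))⁻¹ * (√(m x))⁻¹) * (√τ * √τ) * (v j x * v l x) := by ring
        _ = _ := by rw [hmm, hττ]; ring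
    simp_rw [this]
    rw [← Finset.mul_sum, hdiag j l hjl, mul_zero]
  · intro j
    have h1 : ∑ x, lam x * b j x ^ 2 =
        τ * (v j ⬝ᵥ (whiten m (tail k (Matrix.diagonal lam)) *ᵥ v j)) := by
      rw [sqNorm_whiten, sqNorm_tail _ fun i hi => by simp [hvsupp j i hi], sqNorm_diagonal,
        Finset.mul_sum]
      refine Finset.sum_congr rfl fun x _ => ?_
      simp only [hb]
      linear_combination (lam x * ((√(m x))⁻¹ * v j x) ^ 2) * hττ
    have h2 := dotProduct_mulVec_le_specNorm (whiten m (tail k (Matrix.diagonal lam))) (v j)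
    have h3 := hon j j
    simp only [if_true] at h3
    rw [h3, mul_one] at h2
    rw [h1]
    refine le_trans ?_ hinfo
    gcongr
  · intro θ
    have h1 : ∀ x, m x * signedSum b θ x ^ 2 = τ * (∑ j, sgn θ j • v j) x ^ 2 := by
      intro x
      have : signedSum b θ x = (√(m x))⁻¹ * √τ * (∑ j, sgn θ j • v j) x := by
        simp only [signedSum, hb, Finset.sum_apply, Pi.smul_apply, smul_eq_mul, Finset.mul_sum]
        exact Finset.sum_congr rfl fun j _ => by ring
      rw [this]
      have := (hm x).ne'
      calc _ = m x * ((√(m x))⁻¹ * (√(m x))⁻¹) * (√τ * √τ) * (∑ j, sgn θ j • v j) x ^ 2 := by ring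
        _ = _ := by rw [hmm, hττ, mul_inv_cancel₀ this, one_mul]
    rw [ellipsoid, Set.mem_ofPred_eq, sqNorm_diagonal]
    simp_rw [h1]
    rw [← Finset.mul_sum]
    have h2 : ∑ x, (∑ j, sgn θ j • v j) x ^ 2 = Fintype.card I := by
      have : ∑ x, (∑ j, sgn θ j • v j) x ^ 2 = (∑ j, sgn θ j • v j) ⬝ᵥ (∑ j, sgn θ j • v j) := by
        simp only [dotProduct, pow_two]
      rw [this]
      simp only [sum_dotProduct, dotProduct_sum, smul_dotProduct, dotProduct_smul, smul_eq_mul]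
      simp only [hv, hon, mul_ite, mul_one, mul_zero, Finset.mem_univ, if_true,
        Finset.sum_ite_eq', sgn_sq]
      simp
    have h3 : (Fintype.card I : ℝ) ≤ Δ := by
      have : Fintype.card I ≤ Fintype.card (Fin Δ) :=
        Fintype.card_le_of_injective (fun i : I => (⟨i.1, i.2.1⟩ : Fin Δ)) fun i l h =>
          Subtype.ext (Fin.ext (Fin.mk.inj_iff.1 h))
      simpa using this
    rw [h2, mul_comm]
    exact (mul_le_mul_of_nonneg_right h3 hτ).trans hΔ

/-- The hypothesis on the singular values makes their average over the first `Δ` comparable with the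
spectral norm of the tail, which is at least `c₁ k^(-q)`. Bounds on `k` from both sides convert this
into the rate, whatever the sign of `q`. -/
theorem minimaxRisk_ge_rpow {a s r ν c₁ c₂ : ℝ} (hc₁ : 0 < c₁) {κ₁ κ₂ κ₃ : ℝ}
    (hκ₁ : 0 < κ₁) (hκ₂ : 0 < κ₂) (hκ₃ : 0 < κ₃) :
    ∃ c : ℝ, 0 < c ∧ ∀ (d D : ℕ) (lam m : Fin d → ℝ) (T : Matrix (Fin d) (Fin d) ℝ),
      PowerLaw a s r ν c₁ c₂ D lam m T → ∀ (n : ℕ) (σ : ℝ) (k Δ : ℕ), 1 ≤ n → 0 < σ → 1 ≤ k →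
        k ≤ D → κ₁ * (σ ^ 2 / n) ^ (-(1 / (s * a - ν + 1))) ≤ k →
        k ≤ κ₂ * (σ ^ 2 / n) ^ (-(1 / (s * a - ν + 1))) →
        Δ = ⌊n / (Real.pi ^ 2 * σ ^ 2) *
          specNorm (whiten m (tail k (Matrix.diagonal lam)))⌋₊ →
        1 ≤ Δ →
        κ₃ * specNorm (whiten m (tail k T)) ≤ 1 / Δ * topSingularSum Δ (whiten m (tail k T)) →
        ENNReal.ofReal (c * (σ ^ 2 / n) ^ (((r + s) * a - ν) / (s * a - ν + 1))) ≤
          minimaxRisk n σ lam m T := by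
  set q := (r + s) * a - ν with hq
  refine ⟨1 / 80 * (κ₃ * (c₁ * min (κ₁ ^ (-q)) (κ₂ ^ (-q)))), by positivity, ?_⟩
  intro d D lam m T h n σ k Δ hn hσ hk hkD hk₁ hk₂ hΔ hΔ1 hsum
  have hσ2 : 0 < σ ^ 2 := by positivity
  have hn0 : (0 : ℝ) < n := by exact_mod_cast hn
  have hΔ0 : (1 : ℝ) ≤ Δ := by exact_mod_cast hΔ1
  have hk0 : (0 : ℝ) < k := by exact_mod_cast hk
  set X := (σ ^ 2 / n) ^ (-(1 / (s * a - ν + 1))) with hX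
  have hX0 : 0 < X := by positivity
  have hXq : (σ ^ 2 / n) ^ (q / (s * a - ν + 1)) = X ^ (-q) := by
    rw [hX, ← Real.rpow_mul (by positivity)]
    congr 1; ring
  have hkq : min (κ₁ ^ (-q)) (κ₂ ^ (-q)) * X ^ (-q) ≤ (k : ℝ) ^ (-q) := by
    have hXp : 0 ≤ X ^ (-q) := by positivity
    rcases le_total 0 (-q) with h0 | h0
    · refine (mul_le_mul_of_nonneg_right (min_le_left _ _) hXp).trans ?_
      rw [← Real.mul_rpow hκ₁.le hX0.le]
      exact Real.rpow_le_rpow (by positivity) hk₁ h0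
    · refine (mul_le_mul_of_nonneg_right (min_le_right _ _) hXp).trans ?_
      rw [← Real.mul_rpow hκ₂.le hX0.le]
      exact Real.rpow_le_rpow_of_nonpos hk0 hk₂ h0
  have htail := h.tail_lower k hk hkD
  rw [show -((r + s) * a) + ν = -q by rw [hq]; ring] at htail
  set NS := specNorm (whiten m (tail k (Matrix.diagonal lam))) with hNS
  have hpi : Real.pi ^ 2 ≤ 10 := by
    have := Real.pi_lt_d2
    nlinarith [Real.pi_pos]
  have hfl : n / (Real.pi ^ 2 * σ ^ 2) * NS ≤ 2 * Δ := by
    have := Nat.lt_floor_add_one (n / (Real.pi ^ 2 * σ ^ 2) * NS)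
    rw [← hΔ] at this
    linarith
  -- As `Δ ≥ 1`, the number whose floor is `Δ` is at most `2 Δ`; together with `π² ≤ 10` this
  -- explains the 20.
  have hinfo : n * (1 / (20 * Δ) * NS) ≤ σ ^ 2 := by
    rw [div_mul_eq_mul_div, div_le_iff₀ (by positivity)] at hfl
    have h1 : n * NS ≤ 20 * Δ * σ ^ 2 := by
      refine hfl.trans ?_
      have := mul_le_mul_of_nonneg_right hpi (show 0 ≤ 2 * (Δ : ℝ) * σ ^ 2 by positivity)
      linarith
    calc n * (1 / (20 * Δ) * NS) = n * NS / (20 * Δ) := by ring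
      _ ≤ σ ^ 2 := by rw [div_le_iff₀ (by positivity)]; linarith
  refine le_trans (ENNReal.ofReal_le_ofReal ?_) (minimaxRisk_ge_tail hσ
    (fun i => (h.lam_pos hc₁ i).le) (h.m_pos hc₁) h.posSemidef k Δ (τ := 1 / (20 * Δ))
    (by positivity) ?_ hinfo)
  · rw [hXq]
    have h1 : κ₃ * (c₁ * (min (κ₁ ^ (-q)) (κ₂ ^ (-q)) * X ^ (-q))) ≤
        1 / Δ * topSingularSum Δ (whiten m (tail k T)) :=
      le_trans (mul_le_mul_of_nonneg_left
        ((mul_le_mul_of_nonneg_left hkq hc₁.le).trans htail) hκ₃.le) hsum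
    calc _ = 1 / 80 * (κ₃ * (c₁ * (min (κ₁ ^ (-q)) (κ₂ ^ (-q)) * X ^ (-q)))) := by ring
      _ ≤ 1 / 80 * (1 / Δ * topSingularSum Δ (whiten m (tail k T))) := by gcongr
      _ = _ := by field_simp; ring
  · rw [mul_one_div, div_le_one (by positivity)]; linarith

/-! ### The Gaussian models belong to the problem class -/

theorem measurable_dotProduct {d : ℕ} (w : Fin d → ℝ) : Measurable fun x : Fin d → ℝ => w ⬝ᵥ x := by
  unfold dotProduct; fun_prop

/-- The fourth derivative at zero of the moment generating function `exp(v t² / 2)`; each derivative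
is a polynomial times this exponential. -/
theorem integral_pow_four_gaussianReal (v : NNReal) :
    ∫ t, t ^ 4 ∂(gaussianReal 0 v) = 3 * (v : ℝ) ^ 2 := by
  have h0 : (0 : ℝ) ∈ interior (integrableExpSet id (gaussianReal 0 v)) := by
    rw [integrableExpSet_id_gaussianReal]; simp
  have h1 := iteratedDeriv_mgf_zero h0 4
  have hm : mgf id (gaussianReal 0 v) = fun t : ℝ => Real.exp (v * t ^ 2 / 2) := by
    rw [mgf_id_gaussianReal]; ext t; congr 1; ring
  have hd : ∀ (p p' : ℝ → ℝ), (∀ t, HasDerivAt p (p' t) t) →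
      deriv (fun t : ℝ => p t * Real.exp (v * t ^ 2 / 2)) =
        fun t => (p' t + p t * (v * t)) * Real.exp (v * t ^ 2 / 2) := by
    intro p p' hp
    ext t
    have he : HasDerivAt (fun t : ℝ => Real.exp (v * t ^ 2 / 2))
        (Real.exp (v * t ^ 2 / 2) * (v * t)) t := by
      have : HasDerivAt (fun t : ℝ => v * t ^ 2 / 2) (v * t) t := by
        have := (((hasDerivAt_id' t).fun_pow 2).const_mul (v : ℝ)).div_const 2
        exact this.congr_deriv (by norm_num; ring)
      exact this.exp
    rw [((hp t).fun_mul he).deriv]; ring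
  rw [hm] at h1
  have e0 : (fun t : ℝ => Real.exp (v * t ^ 2 / 2)) =
      fun t => (1 : ℝ) * Real.exp (v * t ^ 2 / 2) := by simp
  have d0 : ∀ t : ℝ, HasDerivAt (fun _ : ℝ => (1 : ℝ)) 0 t := fun t => hasDerivAt_const t 1
  have d1 : ∀ t : ℝ, HasDerivAt (fun t : ℝ => (0 : ℝ) + 1 * (v * t)) v t := fun t => by
    simpa using (hasDerivAt_id t).const_mul (v : ℝ)
  have d2 : ∀ t : ℝ, HasDerivAt (fun t : ℝ => (v : ℝ) + (0 + 1 * (v * t)) * (v * t))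
      (2 * v ^ 2 * t) t := fun t => by
    have := ((d1 t).fun_mul ((hasDerivAt_id' t).const_mul (v : ℝ))).const_add (v : ℝ)
    exact this.congr_deriv (by ring)
  have d3 : ∀ t : ℝ, HasDerivAt (fun t : ℝ => 2 * (v : ℝ) ^ 2 * t +
      ((v : ℝ) + (0 + 1 * (v * t)) * (v * t)) * (v * t))
      (2 * v ^ 2 + (2 * v ^ 2 * t * (v * t) + (v + v ^ 2 * t ^ 2) * v)) t := fun t => by
    have := ((hasDerivAt_id' t).const_mul (2 * (v : ℝ) ^ 2)).fun_add
      ((d2 t).fun_mul ((hasDerivAt_id' t).const_mul (v : ℝ)))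
    exact this.congr_deriv (by ring)
  rw [iteratedDeriv_succ', iteratedDeriv_succ', iteratedDeriv_succ', iteratedDeriv_succ',
    iteratedDeriv_zero, e0, hd _ _ d0, hd _ _ d1, hd _ _ d2, hd _ _ d3] at h1
  simp only [id, Pi.pow_apply] at h1
  rw [← h1]
  norm_num
  ring

theorem integrable_pow_gaussianReal (v : NNReal) (k : ℕ) :
    Integrable (fun t : ℝ => t ^ k) (gaussianReal 0 v) := by
  rcases Nat.eq_zero_or_pos k with h | h
  · subst h; simp
  · have := (memLp_id_gaussianReal (μ := 0) (v := v) k).integrable_norm_pow h.ne'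
    exact (integrable_norm_iff (by fun_prop)).1 (by simpa using this)

theorem integral_sq_gaussianReal (v : NNReal) :
    ∫ t, t ^ 2 ∂(gaussianReal 0 v) = v := by
  have := variance_fun_id_gaussianReal (μ := 0) (v := v)
  rw [variance_eq_integral (by fun_prop)] at this
  simpa using this

theorem lintegral_add_sq_gaussianReal (v : NNReal) (b : ℝ) :
    ∫⁻ t, ENNReal.ofReal ((b + t) ^ 2) ∂(gaussianReal 0 v) = ENNReal.ofReal (b ^ 2 + v) := by
  have h1 : Integrable (fun t : ℝ => t) (gaussianReal 0 v) := by
    simpa using integrable_pow_gaussianReal v 1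
  have h2 := integrable_pow_gaussianReal v 2
  have e : (fun t : ℝ => (b + t) ^ 2) = fun t => b ^ 2 + 2 * b * t + t ^ 2 := by ext t; ring
  have hi : Integrable (fun t : ℝ => (b + t) ^ 2) (gaussianReal 0 v) := by
    rw [e]; exact ((integrable_const _).add (h1.const_mul _)).add h2
  have h3 : Integrable (fun t : ℝ => b ^ 2 + 2 * b * t) (gaussianReal 0 v) :=
    (integrable_const _).add (h1.const_mul _)
  rw [← ofReal_integral_eq_lintegral_ofReal hi (ae_of_all _ fun t => sq_nonneg _), e,
    integral_add h3 h2, integral_add (integrable_const _) (h1.const_mul _), integral_const_mul,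
    integral_id_gaussianReal, integral_sq_gaussianReal]
  simp

/-- A positive semidefinite form is a sum of squares of linear functionals. -/
theorem exists_sq_decomposition {d : ℕ} {T : Matrix (Fin d) (Fin d) ℝ} (hT : T.PosSemidef) :
    ∃ (k : ℕ) (v : Fin k → Fin d → ℝ), (∀ x, sqNorm T x = ∑ l, (v l ⬝ᵥ x) ^ 2) ∧
      ∀ i, T i i = ∑ l, v l i ^ 2 := by
  obtain ⟨k, v, hv⟩ := Matrix.posSemidef_iff_eq_sum_vecMulVec.1 hT
  refine ⟨k, v, fun x => ?_, fun i => ?_⟩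
  · rw [hv, sqNorm, Matrix.sum_mulVec, dotProduct_sum]
    refine Finset.sum_congr rfl fun l _ => ?_
    rw [Matrix.vecMulVec_mulVec, star_trivial, dotProduct_comm x]
    simp [dotProduct_comm, pow_two]
  · rw [hv, Matrix.sum_apply]
    simp [Matrix.vecMulVec_apply, pow_two]

/-- Any positive semidefinite matrix is the covariance of a noiseless linear model. -/
theorem exists_target_law {d : ℕ} {T : Matrix (Fin d) (Fin d) ℝ} (hT : T.PosSemidef)
    (w : Fin d → ℝ) : ∃ Q : Measure (Obs d), HasSecondMoment Q T ∧
      ∀ v, popRisk Q w ≤ popRisk Q v := by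
  obtain ⟨k, v, hv⟩ := Matrix.posSemidef_iff_eq_sum_vecMulVec.1 hT
  -- The uniform law on these atoms has covariance `T`: the root compensates the mass `1 / (k + 1)`,
  -- and the atom at zero keeps the support nonempty when `k = 0`.
  set g : Option (Fin k) → Fin d → ℝ := fun j => √(k + 1) • j.elim 0 v with hg
  set f : Option (Fin k) → Obs d := fun j => (g j, w ⬝ᵥ g j) with hf
  let _ : MeasurableSpace (Option (Fin k)) := ⊤
  have hfm : Measurable f := measurable_from_top
  set μ := (PMF.uniformOfFintype (Option (Fin k))).toMeasure with hμ
  have hμp : IsProbabilityMeasure μ := inferInstance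
  refine ⟨μ.map f, ⟨Measure.isProbabilityMeasure_map hfm.aemeasurable, fun i => ?_, ?_,
    fun i j => ?_⟩, fun u => ?_⟩
  · rw [memLp_map_measure_iff (by fun_prop) hfm.aemeasurable]
    exact MemLp.of_discrete
  · rw [memLp_map_measure_iff (by fun_prop) hfm.aemeasurable]
    exact MemLp.of_discrete
  · rw [integral_map hfm.aemeasurable (by fun_prop), hμ, PMF.integral_eq_sum]
    have hk : √((k : ℝ) + 1) * √(k + 1) = k + 1 := Real.mul_self_sqrt (by positivity)
    simp only [PMF.uniformOfFintype_apply, Fintype.card_option, Fintype.card_fin, hf, hg,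
      Fintype.sum_option, Option.elim, Pi.zero_apply, mul_zero, zero_add,
      Pi.smul_apply, smul_eq_mul]
    rw [hv]
    simp only [Matrix.sum_apply, Matrix.vecMulVec_apply, star_trivial]
    refine Finset.sum_congr rfl fun l _ => ?_
    have h1 : (((k + 1 : ℕ) : ℝ≥0∞)⁻¹).toReal = ((k : ℝ) + 1)⁻¹ := by
      rw [ENNReal.toReal_inv, ENNReal.toReal_natCast]; push_cast; rfl
    rw [h1]
    have h2 : ((k : ℝ) + 1) ≠ 0 := by positivity
    calc ((k : ℝ) + 1)⁻¹ * (√(k + 1) * v l i * (√(k + 1) * v l j)) =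
          ((k : ℝ) + 1)⁻¹ * (√(k + 1) * √(k + 1)) * (v l i * v l j) := by ring
      _ = _ := by rw [hk, inv_mul_cancel₀ h2, one_mul]
  · have hw : popRisk (μ.map f) w = 0 := by
      rw [popRisk, integral_map hfm.aemeasurable (by unfold dotProduct; fun_prop)]
      simp [hf]
    rw [hw, popRisk]
    exact mul_nonneg (by norm_num) (integral_nonneg fun z => sq_nonneg _)

section Gaussian

variable {d : ℕ} {lam : Fin d → ℝ}

theorem lintegral_dotProduct_gaussian (hlam : ∀ i, 0 ≤ lam i) (u : Fin d → ℝ) {F : ℝ → ℝ≥0∞}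
    (hF : Measurable F) :
    ∫⁻ x, F (u ⬝ᵥ x) ∂(Measure.pi fun i => gaussianReal 0 (lam i).toNNReal) =
      ∫⁻ t, F t ∂(gaussianReal 0 (∑ i, lam i * u i ^ 2).toNNReal) := by
  rw [← map_dotProduct_gaussian hlam u, lintegral_map hF (measurable_dotProduct u)]

theorem sqNorm_diagonal_nonneg (hlam : ∀ i, 0 ≤ lam i) (u : Fin d → ℝ) :
    0 ≤ ∑ i, lam i * u i ^ 2 :=
  Finset.sum_nonneg fun i _ => mul_nonneg (hlam i) (sq_nonneg _)

theorem measurePreserving_fst_gaussianModel (σ : ℝ) (w : Fin d → ℝ) :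
    MeasurePreserving Prod.fst (gaussianModel σ lam w)
      (Measure.pi fun i => gaussianReal 0 (lam i).toNNReal) := by
  refine ⟨measurable_fst, ?_⟩
  rw [gaussianModel, Measure.map_map measurable_fst (by unfold dotProduct; fun_prop)]
  exact Measure.fst_prod

theorem memLp_dotProduct_gaussian (hlam : ∀ i, 0 ≤ lam i) (u : Fin d → ℝ) :
    MemLp (fun x => u ⬝ᵥ x) 2 (Measure.pi fun i => gaussianReal 0 (lam i).toNNReal) := by
  have : MemLp id 2 ((Measure.pi fun i => gaussianReal 0 (lam i).toNNReal).map
      fun x => u ⬝ᵥ x) := by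
    rw [map_dotProduct_gaussian hlam]; exact memLp_id_gaussianReal 2
  exact (memLp_map_measure_iff (by fun_prop) (measurable_dotProduct u).aemeasurable).1 this

theorem integral_dotProduct_sq_gaussian (hlam : ∀ i, 0 ≤ lam i) (u : Fin d → ℝ) :
    ∫ x, (u ⬝ᵥ x) ^ 2 ∂(Measure.pi fun i => gaussianReal 0 (lam i).toNNReal) =
      ∑ i, lam i * u i ^ 2 := by
  rw [← integral_map (φ := fun x => u ⬝ᵥ x) (f := fun t : ℝ => t ^ 2)
    (measurable_dotProduct u).aemeasurable (by fun_prop), map_dotProduct_gaussian hlam,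
    integral_sq_gaussianReal, Real.coe_toNNReal _ (sqNorm_diagonal_nonneg hlam u)]

theorem hasSecondMoment_gaussianModel (hlam : ∀ i, 0 ≤ lam i) (σ : ℝ) (w : Fin d → ℝ) :
    HasSecondMoment (gaussianModel σ lam w) (Matrix.diagonal lam) := by
  have hmp := measurePreserving_fst_gaussianModel (lam := lam) σ w
  have hx : ∀ i, MemLp (fun x : Fin d → ℝ => x i) 2
      (Measure.pi fun i => gaussianReal 0 (lam i).toNNReal) := fun i => by
    simpa using memLp_dotProduct_gaussian hlam (Pi.single i 1)
  refine ⟨inferInstance, fun i => (hx i).comp_measurePreserving hmp, ?_, fun i j => ?_⟩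
  · rw [gaussianModel, memLp_map_measure_iff (by fun_prop) (by unfold dotProduct; fun_prop)]
    have h1 := (memLp_dotProduct_gaussian hlam w).comp_fst
      (gaussianReal 0 (σ ^ 2).toNNReal)
    have h2 := (memLp_id_gaussianReal (μ := 0) (v := (σ ^ 2).toNNReal) 2).comp_snd
      (Measure.pi fun i => gaussianReal 0 (lam i).toNNReal)
    exact h1.add h2
  · have h0 : ∫ z, z.1 i * z.1 j ∂(gaussianModel σ lam w) =
        ∫ x, x i * x j ∂(Measure.pi fun i => gaussianReal 0 (lam i).toNNReal) := by
      rw [← hmp.map_eq, integral_map measurable_fst.aemeasurable (by fun_prop)]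
    have e : ∀ x : Fin d → ℝ, x i * x j = 1 / 2 * (((Pi.single i 1 + Pi.single j 1) ⬝ᵥ x) ^ 2 -
        (((Pi.single i 1 : Fin d → ℝ) ⬝ᵥ x) ^ 2 + ((Pi.single j 1 : Fin d → ℝ) ⬝ᵥ x) ^ 2)) := by
      intro x
      simp only [add_dotProduct, single_dotProduct]
      ring
    have hi : ∀ u : Fin d → ℝ, Integrable (fun x => (u ⬝ᵥ x) ^ 2)
        (Measure.pi fun i => gaussianReal 0 (lam i).toNNReal) := fun u =>
      (memLp_dotProduct_gaussian hlam u).integrable_sq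
    have hi2 : Integrable (fun x : Fin d → ℝ => ((Pi.single i 1 : Fin d → ℝ) ⬝ᵥ x) ^ 2 +
        ((Pi.single j 1 : Fin d → ℝ) ⬝ᵥ x) ^ 2)
        (Measure.pi fun i => gaussianReal 0 (lam i).toNNReal) := (hi _).add (hi _)
    rw [h0]
    simp_rw [e]
    rw [integral_const_mul, integral_sub (hi _) hi2, integral_add (hi _) (hi _),
      integral_dotProduct_sq_gaussian hlam, integral_dotProduct_sq_gaussian hlam,
      integral_dotProduct_sq_gaussian hlam, ← Finset.sum_add_distrib, ← Finset.sum_sub_distrib,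
      Finset.mul_sum, Finset.sum_eq_single i]
    · by_cases hij : i = j
      · subst hij; simp; ring
      · simp [Matrix.diagonal_apply_ne _ hij, Pi.single_eq_of_ne hij]
    · intro k _ hk
      simp [Pi.single_eq_of_ne hk]
    · simp

theorem lintegral_residual_sq_gaussianModel (hlam : ∀ i, 0 ≤ lam i) (σ : ℝ) (w v : Fin d → ℝ) :
    ∫⁻ z, ENNReal.ofReal ((z.2 - v ⬝ᵥ z.1) ^ 2) ∂(gaussianModel σ lam w) =
      ENNReal.ofReal (∑ i, lam i * (w i - v i) ^ 2 + σ ^ 2) := by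
  rw [lintegral_gaussianModel _ _ _ (by unfold dotProduct; fun_prop)]
  have h1 : ∀ x : Fin d → ℝ, ∫⁻ e, ENNReal.ofReal ((w ⬝ᵥ x + e - v ⬝ᵥ x) ^ 2)
      ∂(gaussianReal 0 (σ ^ 2).toNNReal) =
      ENNReal.ofReal (((w - v) ⬝ᵥ x) ^ 2) + ENNReal.ofReal (σ ^ 2) := by
    intro x
    rw [← ENNReal.ofReal_add (sq_nonneg _) (sq_nonneg _)]
    have := lintegral_add_sq_gaussianReal (σ ^ 2).toNNReal ((w - v) ⬝ᵥ x)
    rw [Real.coe_toNNReal _ (sq_nonneg σ)] at this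
    rw [← this]
    refine lintegral_congr fun e => ?_
    rw [sub_dotProduct]
    congr 2
    ring
  simp_rw [h1]
  rw [lintegral_add_right _ measurable_const, lintegral_const, measure_univ, mul_one,
    lintegral_dotProduct_gaussian hlam (w - v) (F := fun t => ENNReal.ofReal (t ^ 2))
      (by fun_prop)]
  have := lintegral_add_sq_gaussianReal (∑ i, lam i * (w - v) i ^ 2).toNNReal 0
  simp only [zero_add, ne_eq, OfNat.ofNat_ne_zero, not_false_eq_true, zero_pow] at this
  rw [this, Real.coe_toNNReal _ (sqNorm_diagonal_nonneg hlam _),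
    ENNReal.ofReal_add (sqNorm_diagonal_nonneg hlam (fun i => w i - v i)) (sq_nonneg _)]
  rfl

/-- Cauchy–Schwarz reduces the mixed moment to two fourth moments. This is where the value 3 of `ψ`
comes from. -/
theorem lintegral_sq_mul_sq_gaussian_le (hlam : ∀ i, 0 ≤ lam i) (u v : Fin d → ℝ) :
    ∫⁻ x, ENNReal.ofReal ((u ⬝ᵥ x) ^ 2) * ENNReal.ofReal ((v ⬝ᵥ x) ^ 2)
        ∂(Measure.pi fun i => gaussianReal 0 (lam i).toNNReal) ≤
      ENNReal.ofReal (3 * (∑ i, lam i * u i ^ 2) * ∑ i, lam i * v i ^ 2) := by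
  have hm : ∀ u : Fin d → ℝ, AEMeasurable (fun x : Fin d → ℝ => ENNReal.ofReal ((u ⬝ᵥ x) ^ 2))
      (Measure.pi fun i => gaussianReal 0 (lam i).toNNReal) := fun u =>
    ((measurable_dotProduct u).pow_const 2).ennreal_ofReal.aemeasurable
  have h4 : ∀ u : Fin d → ℝ, (∫⁻ x, ENNReal.ofReal ((u ⬝ᵥ x) ^ 2) ^ (2 : ℝ)
      ∂(Measure.pi fun i => gaussianReal 0 (lam i).toNNReal)) ^ (1 / 2 : ℝ) =
      ENNReal.ofReal (√3 * ∑ i, lam i * u i ^ 2) := by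
    intro u
    have hp := sqNorm_diagonal_nonneg hlam u
    rw [lintegral_dotProduct_gaussian hlam u (F := fun t => ENNReal.ofReal (t ^ 2) ^ (2 : ℝ))
      (by fun_prop)]
    have e : ∀ t : ℝ, ENNReal.ofReal (t ^ 2) ^ (2 : ℝ) = ENNReal.ofReal (t ^ 4) := fun t => by
      rw [ENNReal.ofReal_rpow_of_nonneg (sq_nonneg t) (by norm_num)]
      congr 1
      rw [Real.rpow_two]; ring
    simp_rw [e]
    rw [← ofReal_integral_eq_lintegral_ofReal (integrable_pow_gaussianReal _ 4)
      (ae_of_all _ fun t => by positivity), integral_pow_four_gaussianReal,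
      Real.coe_toNNReal _ hp, ENNReal.ofReal_rpow_of_nonneg (by positivity) (by norm_num),
      ← Real.sqrt_eq_rpow, Real.sqrt_mul (by norm_num), Real.sqrt_sq hp]
  refine (ENNReal.lintegral_mul_le_Lp_mul_Lq _ Real.HolderConjugate.two_two (hm u) (hm v)).trans ?_
  rw [h4, h4, ← ENNReal.ofReal_mul (mul_nonneg (Real.sqrt_nonneg 3) (sqNorm_diagonal_nonneg hlam u))]
  refine ENNReal.ofReal_le_ofReal (le_of_eq ?_)
  have := Real.mul_self_sqrt (show (0 : ℝ) ≤ 3 by norm_num)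
  calc _ = √3 * √3 * (∑ i, lam i * u i ^ 2) * ∑ i, lam i * v i ^ 2 := by ring
    _ = _ := by rw [this]

end Gaussian

/-- The source risk of `v` is half of `‖w - v‖_S² + σ²`, so `w` minimizes it. For the fourth
moments, `A` is split into squares of linear functionals, each handled by
`lintegral_sq_mul_sq_gaussian_le`. -/
theorem isProblem_gaussianModel {a s r ν c₁ c₂ : ℝ} (hc₁ : 0 < c₁) {d D : ℕ} {lam m : Fin d → ℝ}
    {T : Matrix (Fin d) (Fin d) ℝ} (h : PowerLaw a s r ν c₁ c₂ D lam m T) (σ : ℝ)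
    {w : Fin d → ℝ} (hw : w ∈ ellipsoid m) :
    ∃ Q : Measure (Obs d), IsProblem 3 σ lam m T (gaussianModel σ lam w) Q w := by
  have hlam : ∀ i, 0 ≤ lam i := fun i => (h.lam_pos hc₁ i).le
  obtain ⟨Q, hQ, hmin⟩ := exists_target_law h.posSemidef w
  have hrisk : ∀ v, popRisk (gaussianModel σ lam w) v =
      1 / 2 * (∑ i, lam i * (w i - v i) ^ 2 + σ ^ 2) := fun v => by
    rw [popRisk, integral_eq_lintegral_of_nonneg_ae (ae_of_all _ fun z => sq_nonneg _)
      (by unfold dotProduct; fun_prop), lintegral_residual_sq_gaussianModel hlam,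
      ENNReal.toReal_ofReal
        (add_nonneg (sqNorm_diagonal_nonneg hlam (fun i => w i - v i)) (sq_nonneg _))]
  refine ⟨Q, hasSecondMoment_gaussianModel hlam σ w, hQ, fun v => ?_, hmin, hw,
    fun A hA u => ?_, fun u => ?_⟩
  · rw [hrisk, hrisk]
    have := sqNorm_diagonal_nonneg hlam (fun i => w i - v i)
    simp only [sub_self, ne_eq, OfNat.ofNat_ne_zero, not_false_eq_true, zero_pow, mul_zero,
      Finset.sum_const_zero]
    linarith
  · obtain ⟨k, v, hA', hv⟩ := exists_sq_decomposition hA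
    have htr : (Matrix.diagonal lam * A).trace = ∑ l, ∑ i, lam i * v l i ^ 2 := by
      rw [Finset.sum_comm]
      refine Finset.sum_congr rfl fun i _ => ?_
      rw [Matrix.diag_apply, Matrix.diagonal_mul, hv, Finset.mul_sum]
    have hmp := measurePreserving_fst_gaussianModel (lam := lam) σ w
    have hm : ∀ u : Fin d → ℝ, Measurable (fun x : Fin d → ℝ => ENNReal.ofReal ((u ⬝ᵥ x) ^ 2)) :=
      fun u => ((measurable_dotProduct u).pow_const 2).ennreal_ofReal
    have e : ∀ z : Obs d, ENNReal.ofReal ((u ⬝ᵥ z.1) ^ 2 * sqNorm A z.1) =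
        ∑ l, ENNReal.ofReal ((u ⬝ᵥ z.1) ^ 2) * ENNReal.ofReal ((v l ⬝ᵥ z.1) ^ 2) := fun z => by
      rw [hA', ENNReal.ofReal_mul (sq_nonneg _),
        ENNReal.ofReal_sum_of_nonneg fun l _ => sq_nonneg _, Finset.mul_sum]
    simp_rw [e]
    rw [hmp.lintegral_comp (f := fun x => ∑ l, ENNReal.ofReal ((u ⬝ᵥ x) ^ 2) *
      ENNReal.ofReal ((v l ⬝ᵥ x) ^ 2)) (Finset.measurable_sum _ fun l _ => (hm u).mul (hm (v l))),
      lintegral_finsetSum (f := fun l x => ENNReal.ofReal ((u ⬝ᵥ x) ^ 2) *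
      ENNReal.ofReal ((v l ⬝ᵥ x) ^ 2)) _ fun l _ => (hm u).mul (hm (v l))]
    refine (Finset.sum_le_sum fun l _ => lintegral_sq_mul_sq_gaussian_le hlam u (v l)).trans ?_
    rw [← ENNReal.ofReal_sum_of_nonneg fun l _ => mul_nonneg (mul_nonneg (by norm_num)
      (sqNorm_diagonal_nonneg hlam u)) (sqNorm_diagonal_nonneg hlam (v l)), htr,
      sqNorm_diagonal, ← Finset.mul_sum]
    exact ENNReal.ofReal_le_ofReal (le_of_eq (by ring))
  · rw [lintegral_gaussianModel _ _ _ (by unfold dotProduct; fun_prop)]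
    have h1 : ∀ x : Fin d → ℝ, ∫⁻ e, ENNReal.ofReal ((w ⬝ᵥ x + e - w ⬝ᵥ x) ^ 2 * (u ⬝ᵥ x) ^ 2)
        ∂(gaussianReal 0 (σ ^ 2).toNNReal) =
        ENNReal.ofReal (σ ^ 2) * ENNReal.ofReal ((u ⬝ᵥ x) ^ 2) := fun x => by
      have h2 := lintegral_add_sq_gaussianReal (σ ^ 2).toNNReal 0
      simp only [zero_add, ne_eq, OfNat.ofNat_ne_zero, not_false_eq_true, zero_pow] at h2
      rw [Real.coe_toNNReal _ (sq_nonneg σ)] at h2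
      simp_rw [add_sub_cancel_left, ENNReal.ofReal_mul (sq_nonneg _)]
      rw [lintegral_mul_const _ (by fun_prop), h2]
    simp_rw [h1]
    rw [lintegral_const_mul _ ((measurable_dotProduct u).pow_const 2).ennreal_ofReal,
      lintegral_dotProduct_gaussian hlam u (F := fun t => ENNReal.ofReal (t ^ 2)) (by fun_prop),
      ENNReal.ofReal_mul (sq_nonneg _), sqNorm_diagonal]
    have := lintegral_add_sq_gaussianReal (∑ i, lam i * u i ^ 2).toNNReal 0
    simp only [zero_add, ne_eq, OfNat.ofNat_ne_zero, not_false_eq_true, zero_pow] at this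
    rw [this, Real.coe_toNNReal _ (sqNorm_diagonal_nonneg hlam u)]

/-! ### Lyapunov functions for a single mode -/

/-- One step of the mean dynamics in an eigendirection: `u` is the centred iterate, `R` the rescaled
momentum, `D` and `G` the rescaled short and long step sizes. -/
def modeStep (b D G : ℝ) (p : ℝ × ℝ) : ℝ × ℝ :=
  ((1 - D) * p.1 + b * (p.2 - (G - D) * p.1), (1 - b) * (p.2 - (G - D) * p.1))

/-- The cross coefficient that removes the mixed term from the dissipation. -/
noncomputable def crossCoeff (b D J : ℝ) : ℝ := 2 * b * D * J / (b + D - b * D)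

/-- The Lyapunov function that controls the modes with a small step size. -/
noncomputable def lyap (b D G : ℝ) (p : ℝ × ℝ) : ℝ :=
  b * p.2 ^ 2 + b * (p.1 + p.2) ^ 2 + (2 * G - D) * p.1 ^ 2 -
    crossCoeff b D (2 * G - D) * p.2 * p.1

/-- The Lyapunov function that controls the modes with a large step size. -/
noncomputable def energy (b D G : ℝ) (p : ℝ × ℝ) : ℝ :=
  b * p.2 ^ 2 + (G - D) * p.1 ^ 2 - crossCoeff b D (G - D) * p.2 * p.1

/-- The range of step sizes in which the Lyapunov functions are used. -/
structure StepBounds (b κ D G : ℝ) : Prop where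
  b_pos : 0 < b
  b_le : b ≤ 1 / 16
  kappa : 64 ≤ κ
  G_pos : 0 < G
  D_eq : D = κ * (b * G)
  D_le : D ≤ 1 / 4
  two_D_le : 2 * D ≤ G

theorem StepBounds.D_pos {b κ D G : ℝ} (h : StepBounds b κ D G) : 0 < D := by
  rw [h.D_eq]
  have := h.kappa
  exact mul_pos (by linarith) (mul_pos h.b_pos h.G_pos)

theorem StepBounds.bG_le {b κ D G : ℝ} (h : StepBounds b κ D G) : b * G ≤ D / 64 := by
  have h1 := mul_le_mul_of_nonneg_right h.kappa (mul_pos h.b_pos h.G_pos).le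
  rw [← h.D_eq] at h1
  linarith

theorem StepBounds.quarter {b κ D G : ℝ} (h : StepBounds b κ D G) :
    StepBounds b κ (D / 4) (G / 4) :=
  ⟨h.b_pos, h.b_le, h.kappa, by have := h.G_pos; positivity, by rw [h.D_eq]; ring,
    by linarith [h.D_le, h.D_pos], by linarith [h.two_D_le]⟩

theorem crossCoeff_nonneg {b D J : ℝ} (hb : 0 < b) (hb1 : b ≤ 1) (hD : 0 < D) (hJ : 0 ≤ J) :
    0 ≤ crossCoeff b D J := by
  have : 0 < b + D - b * D := by nlinarith [mul_nonneg hD.le (sub_nonneg.2 hb1)]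
  unfold crossCoeff; positivity

theorem crossCoeff_le {b D J : ℝ} (hb : 0 < b) (hD : 0 < D) (hD1 : D ≤ 1)
    (hJ : 0 ≤ J) : crossCoeff b D J ≤ 2 * b * J := by
  have h0 : 0 < b + D - b * D := by nlinarith
  rw [crossCoeff, div_le_iff₀ h0]
  have : 0 ≤ b * J := by positivity
  nlinarith [mul_nonneg this (mul_nonneg hb.le (sub_nonneg.2 hD1))]

theorem crossCoeff_mul {b D J : ℝ} (hb : 0 < b) (hb1 : b ≤ 1) (hD : 0 < D) :
    crossCoeff b D J * (b + D - b * D) = 2 * b * D * J := by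
  have h0 : 0 < b + D - b * D := by nlinarith
  rw [crossCoeff, div_mul_cancel₀ _ h0.ne']

/-- The cross terms are dominated by the diagonal ones. -/
theorem abs_cross_le {b κ D G J : ℝ} (h : StepBounds b κ D G) (hJ : 0 ≤ J) (hJG : J ≤ 2 * G)
    (R u : ℝ) : |crossCoeff b D J * R * u| ≤ b / 2 * R ^ 2 + J / 4 * u ^ 2 := by
  have hb := h.b_pos
  have hD := h.D_pos
  have hc0 := crossCoeff_nonneg (J := J) hb (by linarith [h.b_le]) hD hJ
  have hc := crossCoeff_le (J := J) hb hD (by linarith [h.D_le]) hJ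
  have h1 : |crossCoeff b D J * R * u| ≤ 2 * b * J * (|R| * |u|) := by
    rw [abs_mul, abs_mul, abs_of_nonneg hc0, mul_assoc]
    exact mul_le_mul_of_nonneg_right hc (by positivity)
  have h2 : 2 * b * J * (|R| * |u|) ≤ b / 2 * |R| ^ 2 + 2 * (b * J) * J * |u| ^ 2 := by
    nlinarith [mul_nonneg hb.le (sq_nonneg (|R| - 2 * J * |u|))]
  have h3 : b * J ≤ 1 / 8 := by
    have := h.bG_le
    have := mul_le_mul_of_nonneg_left hJG hb.le
    nlinarith [h.D_le]
  rw [sq_abs, sq_abs] at h2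
  nlinarith [mul_nonneg (mul_nonneg hJ (sq_nonneg u)) (sub_nonneg.2 h3)]

theorem lyap_ge {b κ D G : ℝ} (h : StepBounds b κ D G) (p : ℝ × ℝ) :
    b / 2 * p.2 ^ 2 + b * (p.1 + p.2) ^ 2 + 3 / 4 * (2 * G - D) * p.1 ^ 2 ≤ lyap b D G p := by
  have := abs_le.1 (abs_cross_le (J := 2 * G - D) h (by linarith [h.two_D_le, h.D_pos])
    (by linarith [h.D_pos]) p.2 p.1)
  rw [lyap]
  linarith

theorem lyap_le {b κ D G : ℝ} (h : StepBounds b κ D G) (p : ℝ × ℝ) :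
    lyap b D G p ≤ 2 * b * p.2 ^ 2 + b * (p.1 + p.2) ^ 2 + 3 * G * p.1 ^ 2 := by
  have := abs_le.1 (abs_cross_le (J := 2 * G - D) h (by linarith [h.two_D_le, h.D_pos])
    (by linarith [h.D_pos]) p.2 p.1)
  rw [lyap]
  have h1 : 0 ≤ D * p.1 ^ 2 := mul_nonneg h.D_pos.le (sq_nonneg _)
  have h2 : 0 ≤ G * p.1 ^ 2 := mul_nonneg h.G_pos.le (sq_nonneg _)
  have h3 : 0 ≤ b * p.2 ^ 2 := mul_nonneg h.b_pos.le (sq_nonneg _)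
  linarith

theorem lyap_nonneg {b κ D G : ℝ} (h : StepBounds b κ D G) (p : ℝ × ℝ) : 0 ≤ lyap b D G p := by
  refine le_trans ?_ (lyap_ge h p)
  have := h.b_pos
  have : 0 ≤ 2 * G - D := by linarith [h.two_D_le, h.D_pos]
  positivity

/-- Both coordinates are controlled by the Lyapunov function, uniformly in the step size. -/
theorem sq_add_sq_le_lyap {b κ D G : ℝ} (h : StepBounds b κ D G) (p : ℝ × ℝ) :
    b * (p.1 ^ 2 + p.2 ^ 2) ≤ 6 * lyap b D G p := by
  have h1 := lyap_ge h p
  have h2 : 0 ≤ (2 * G - D) * p.1 ^ 2 :=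
    mul_nonneg (by linarith [h.two_D_le, h.D_pos]) (sq_nonneg _)
  nlinarith [mul_nonneg h.b_pos.le (sq_nonneg (p.1 + 2 * p.2)), h.b_pos, sq_nonneg (p.1 + p.2)]

/-- In the variables `u` and `ρ = R - (G - D) u`, the decrease is a quadratic form whose mixed term
vanishes by the choice of `crossCoeff`. Its two coefficients keep the required size because `b G ≤ D
/ 64` makes the corrections small. -/
theorem lyap_sub {b κ D G : ℝ} (h : StepBounds b κ D G) (p : ℝ × ℝ) :
    b ^ 2 * (p.2 - (G - D) * p.1) ^ 2 + b * G * p.1 ^ 2 ≤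
      lyap b D G p - lyap b D G (modeStep b D G p) := by
  obtain ⟨u, R⟩ := p
  have hb := h.b_pos
  have hD := h.D_pos
  have hG := h.G_pos
  have hJ : 0 ≤ 2 * G - D := by linarith [h.two_D_le]
  set c := crossCoeff b D (2 * G - D) with hc
  have hcm := crossCoeff_mul (J := 2 * G - D) hb (by linarith [h.b_le]) hD
  have hcl := crossCoeff_le (J := 2 * G - D) hb hD (by linarith [h.D_le]) hJ
  rw [← hc] at hcm hcl
  set ρ := R - (G - D) * u with hρ
  have hR : R = ρ + (G - D) * u := by rw [hρ]; ring
  have key : lyap b D G (u, R) - lyap b D G (modeStep b D G (u, R)) =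
      (b ^ 2 * (2 - b) - b ^ 2 * (2 * G - D) + b * (1 - b) * c) * ρ ^ 2 +
      ((G - D) * (b * (G - D) + 2 * D - D ^ 2) + b * G * (2 + (G - D) - D) + G * D * (2 - D) -
        c * (G - D)) * u ^ 2 := by
    simp only [lyap, modeStep, ← hc]
    rw [← hρ, hR]
    linear_combination (-(ρ * u)) * hcm
  rw [key]
  have hA : b ^ 2 ≤ b ^ 2 * (2 - b) - b ^ 2 * (2 * G - D) + b * (1 - b) * c := by
    have h0 : 0 < b + D - b * D := by nlinarith [h.b_le]
    have hbJ : b * (2 * G - D) * (b - (1 - b) * D) ≤ 1 / 16 * (b * (b + D - b * D)) := by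
      have h5 : b * (2 * G - D) ≤ D / 32 := by
        have := h.bG_le
        nlinarith
      have h6 : 0 ≤ b * (2 * G - D) := by positivity
      rcases le_total (b - (1 - b) * D) 0 with h7 | h7
      · have := mul_nonpos_of_nonneg_of_nonpos h6 h7
        have : 0 ≤ b * (b + D - b * D) := by positivity
        linarith
      · have h8 := mul_le_mul_of_nonneg_right h5 h7
        have h9 : D / 32 * (b - (1 - b) * D) ≤ D / 32 * b :=
          mul_le_mul_of_nonneg_left (by nlinarith [h.b_le]) (by positivity)
        nlinarith [h.b_le, mul_pos hb hD, mul_pos hb hb, mul_pos (mul_pos hb hb) hD]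
    have h10 : (-(b ^ 2 * (2 * G - D)) + b * (1 - b) * c) * (b + D - b * D) =
        -(b * (b * (2 * G - D) * (b - (1 - b) * D))) := by
      linear_combination b * (1 - b) * hcm
    have h11 : -(1 / 16 * b ^ 2) ≤ -(b ^ 2 * (2 * G - D)) + b * (1 - b) * c := by
      refine le_of_mul_le_mul_right ?_ h0
      rw [h10]
      nlinarith [mul_le_mul_of_nonneg_left hbJ hb.le]
    nlinarith [h.b_le, sq_nonneg b]
  have hB : b * G ≤ (G - D) * (b * (G - D) + 2 * D - D ^ 2) + b * G * (2 + (G - D) - D) +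
      G * D * (2 - D) - c * (G - D) := by
    have h1 : c * (G - D) ≤ 2 * b * (2 * G - D) * (G - D) :=
      mul_le_mul_of_nonneg_right hcl (by linarith [h.two_D_le])
    have h2 := h.bG_le
    have hH : 0 ≤ G - D := by linarith [h.two_D_le]
    have h3 : 2 * b * (2 * G - D) * (G - D) ≤ D / 16 * G := by
      have e1 : b * G * G ≤ D / 64 * G := mul_le_mul_of_nonneg_right h2 hG.le
      have e2 : b * ((2 * G - D) * (G - D)) ≤ b * (2 * G * G) :=
        mul_le_mul_of_nonneg_left (mul_le_mul (by linarith) (by linarith) hH (by linarith)) hb.le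
      linarith
    have h4 : 0 ≤ b * G * (1 + G - 2 * D) :=
      mul_nonneg (mul_pos hb hG).le (by linarith [h.D_le])
    have h5 : G * D * D ≤ G * D * (1 / 4) := mul_le_mul_of_nonneg_left h.D_le (by positivity)
    have h6 : 0 ≤ (G - D) * (b * (G - D) + (2 * D - D ^ 2)) :=
      mul_nonneg hH (add_nonneg (mul_nonneg hb.le hH) (by nlinarith [h.D_le]))
    have h7 : 0 ≤ G * D := by positivity
    linarith
  have e1 := mul_le_mul_of_nonneg_right hA (sq_nonneg ρ)
  have e2 := mul_le_mul_of_nonneg_right hB (sq_nonneg u)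
  linarith

/-- In terms of `ρ` and `u` the Lyapunov function is `O(b ρ² + (b + G) u²)`, and `min b G * (b + G)
≤ 2 b G`. So each step contracts it at the rate `min b G`. -/
theorem lyap_le_dissipation {b κ D G : ℝ} (h : StepBounds b κ D G) (p : ℝ × ℝ) :
    min b G / 8 * lyap b D G p ≤ b ^ 2 * (p.2 - (G - D) * p.1) ^ 2 + b * G * p.1 ^ 2 := by
  obtain ⟨u, R⟩ := p
  set ρ := R - (G - D) * u with hρ
  have hR : R = ρ + (G - D) * u := by rw [hρ]; ring
  have hb := h.b_pos
  have hD := h.D_pos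
  have hG := h.G_pos
  have hb1 := h.b_le
  have hH : 0 ≤ G - D := by linarith [h.two_D_le]
  have hV : lyap b D G (u, R) ≤ 2 * b * R ^ 2 + b * (u + R) ^ 2 + 3 * G * u ^ 2 := lyap_le h _
  have h1 : R ^ 2 ≤ 5 / 4 * ρ ^ 2 + 5 * (G ^ 2 * u ^ 2) := by
    have e : ((G - D) * u) ^ 2 ≤ G ^ 2 * u ^ 2 := by
      rw [mul_pow]
      exact mul_le_mul_of_nonneg_right (pow_le_pow_left₀ hH (by linarith) 2) (sq_nonneg _)
    rw [hR]
    nlinarith [sq_nonneg (ρ - 4 * ((G - D) * u))]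
  have h2 : (u + R) ^ 2 ≤ 2 * ρ ^ 2 + 4 * u ^ 2 + 4 * (G ^ 2 * u ^ 2) := by
    have e : ((G - D) * u) ^ 2 ≤ G ^ 2 * u ^ 2 := by
      rw [mul_pow]
      exact mul_le_mul_of_nonneg_right (pow_le_pow_left₀ hH (by linarith) 2) (sq_nonneg _)
    rw [hR]
    nlinarith [sq_nonneg (ρ - (1 + (G - D)) * u), sq_nonneg (u - (G - D) * u)]
  have hbG : b * G ≤ 1 / 256 := by linarith [h.bG_le, h.D_le]
  have h3 : lyap b D G (u, R) ≤ 5 * (b * ρ ^ 2) + (4 * b + 4 * G) * u ^ 2 := by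
    have e1 := mul_le_mul_of_nonneg_left h1 hb.le
    have e2 := mul_le_mul_of_nonneg_left h2 hb.le
    have e3 : b * (G ^ 2 * u ^ 2) ≤ 1 / 256 * (G * u ^ 2) := by
      have := mul_le_mul_of_nonneg_right hbG (mul_nonneg hG.le (sq_nonneg u))
      linarith [this]
    nlinarith [mul_nonneg hG.le (sq_nonneg u), mul_nonneg hb.le (sq_nonneg ρ)]
  have h4 : 0 ≤ min b G := le_min hb.le hG.le
  have h5 := mul_le_mul_of_nonneg_left h3 (div_nonneg h4 (by norm_num : (0 : ℝ) ≤ 8))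
  have h6 : min b G * (b * ρ ^ 2) ≤ b * (b * ρ ^ 2) :=
    mul_le_mul_of_nonneg_right (min_le_left _ _) (by positivity)
  have h7 : min b G * (b + G) ≤ 2 * (b * G) := by
    rcases le_total b G with e | e
    · rw [min_eq_left e]; nlinarith
    · rw [min_eq_right e]; nlinarith
  have h8 := mul_le_mul_of_nonneg_right h7 (sq_nonneg u)
  nlinarith [mul_nonneg (mul_nonneg hb.le hb.le) (sq_nonneg ρ)]

theorem lyap_modeStep_le {b κ D G : ℝ} (h : StepBounds b κ D G) (p : ℝ × ℝ) :
    lyap b D G (modeStep b D G p) ≤ (1 - min b G / 8) * lyap b D G p := by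
  linarith [lyap_sub h p, lyap_le_dissipation h p]

theorem energy_bounds {b κ D G : ℝ} (h : StepBounds b κ D G) (p : ℝ × ℝ) :
    1 / 2 * (b * p.2 ^ 2 + (G - D) * p.1 ^ 2) ≤ energy b D G p ∧
      energy b D G p ≤ 2 * (b * p.2 ^ 2 + (G - D) * p.1 ^ 2) := by
  have hH : 0 ≤ G - D := by linarith [h.two_D_le, h.D_pos]
  have := abs_le.1 (abs_cross_le (J := G - D) h hH (by linarith [h.D_pos, h.G_pos]) p.2 p.1)
  have h1 : 0 ≤ b * p.2 ^ 2 := mul_nonneg h.b_pos.le (sq_nonneg _)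
  have h2 : 0 ≤ (G - D) * p.1 ^ 2 := mul_nonneg hH (sq_nonneg _)
  rw [energy]
  constructor <;> linarith

/-- The mixed term is removed as in `lyap_sub`. Here the dissipation in `u` exceeds the one of
`lyap` by a factor of order `κ G`, which pays when the step is large; the coefficient of `ρ²` need
only be nonnegative. -/
theorem energy_sub {b κ D G : ℝ} (h : StepBounds b κ D G) (p : ℝ × ℝ) :
    (G - D) * D * p.1 ^ 2 ≤ energy b D G p - energy b D G (modeStep b D G p) := by
  obtain ⟨u, R⟩ := p
  have hb := h.b_pos
  have hD := h.D_pos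
  have hG := h.G_pos
  have hJ : 0 ≤ G - D := by linarith [h.two_D_le]
  set c := crossCoeff b D (G - D) with hc
  have hcm := crossCoeff_mul (J := G - D) hb (by linarith [h.b_le]) hD
  have hcl := crossCoeff_le (J := G - D) hb hD (by linarith [h.D_le]) hJ
  rw [← hc] at hcm hcl
  set ρ := R - (G - D) * u with hρ
  have hR : R = ρ + (G - D) * u := by rw [hρ]; ring
  have key : energy b D G (u, R) - energy b D G (modeStep b D G (u, R)) =
      (b ^ 2 * (2 - b) - b ^ 2 * (G - D) + b * (1 - b) * c) * ρ ^ 2 +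
      ((G - D) * (b * (G - D) + 2 * D - D ^ 2) - c * (G - D)) * u ^ 2 := by
    simp only [energy, modeStep, ← hc]
    rw [← hρ, hR]
    linear_combination (-(ρ * u)) * hcm
  rw [key]
  have hA : 0 ≤ b ^ 2 * (2 - b) - b ^ 2 * (G - D) + b * (1 - b) * c := by
    have h0 : 0 < b + D - b * D := by nlinarith [h.b_le]
    have h5 : b * (G - D) ≤ D / 64 := by nlinarith [h.bG_le]
    have h6 : 0 ≤ b * (G - D) := by positivity
    have h10 : (b ^ 2 * (2 - b) - b ^ 2 * (G - D) + b * (1 - b) * c) * (b + D - b * D) =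
        b * (b * (2 - b) * (b + D - b * D) - b * (G - D) * (b - (1 - b) * D)) := by
      linear_combination b * (1 - b) * hcm
    refine le_of_mul_le_mul_right ?_ h0
    rw [h10, zero_mul]
    refine mul_nonneg hb.le ?_
    have h8 : b * (G - D) * (b - (1 - b) * D) ≤ D / 64 * b := by
      have h9 : b * (G - D) * (b - (1 - b) * D) ≤ b * (G - D) * b :=
        mul_le_mul_of_nonneg_left (by nlinarith [h.b_le]) h6
      exact h9.trans (mul_le_mul_of_nonneg_right h5 hb.le)
    have h11 : b * D / 2 ≤ b * (2 - b) * (b + D - b * D) := by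
      have : b * (D / 2) ≤ b * ((2 - b) * (b + D - b * D)) :=
        mul_le_mul_of_nonneg_left (by nlinarith [h.b_le]) hb.le
      linarith
    nlinarith [mul_pos hb hD]
  have hB : (G - D) * D ≤ (G - D) * (b * (G - D) + 2 * D - D ^ 2) - c * (G - D) := by
    have h1 : c ≤ D / 32 := by nlinarith [h.bG_le]
    have h2 : 0 ≤ b * (G - D) := by positivity
    have h3 : D ^ 2 ≤ D / 4 := by nlinarith [h.D_le]
    have : (G - D) * D ≤ (G - D) * (b * (G - D) + 2 * D - D ^ 2 - c) :=
      mul_le_mul_of_nonneg_left (by linarith) hJ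
    linarith
  have e1 := mul_nonneg hA (sq_nonneg ρ)
  have e2 := mul_le_mul_of_nonneg_right hB (sq_nonneg u)
  linarith

theorem energy_nonneg {b κ D G : ℝ} (h : StepBounds b κ D G) (p : ℝ × ℝ) :
    0 ≤ energy b D G p := by
  refine le_trans ?_ (energy_bounds h p).1
  have := h.b_pos
  have : 0 ≤ G - D := by linarith [h.two_D_le, h.D_pos]
  positivity

/-- The weight of the momentum does not shrink with the steps, so comparison with the diagonal form
costs a factor 4. The division by `4 ^ st t` in `energyAt` absorbs it. -/
theorem energy_quarter_le {b κ D G : ℝ} (h : StepBounds b κ D G) (p : ℝ × ℝ) :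
    energy b (D / 4) (G / 4) p ≤ 4 * energy b D G p := by
  have h1 := (energy_bounds h.quarter p).2
  have h2 := (energy_bounds h p).1
  have : 0 ≤ (G - D) * p.1 ^ 2 :=
    mul_nonneg (by linarith [h.two_D_le, h.D_pos]) (sq_nonneg _)
  linarith

/-- The Lyapunov function, with a weight that makes it decrease when the step sizes do. -/
noncomputable def wlyap (b D G : ℝ) (p : ℝ × ℝ) : ℝ := (1 + 16 * (b * G)) * lyap b D G p

/-- Quartering the steps changes the cross term, so `lyap` alone may grow. The simultaneous loss of
`3/4 (2G - D) u²` limits the growth to a factor `1 + 6 b G`, and the fall of the weight from `1 + 16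
b G` to `1 + 4 b G` pays for it. -/
theorem wlyap_quarter_le {b κ D G : ℝ} (h : StepBounds b κ D G) (p : ℝ × ℝ) :
    wlyap b (D / 4) (G / 4) p ≤ wlyap b D G p := by
  obtain ⟨u, R⟩ := p
  have hb := h.b_pos
  have hD := h.D_pos
  have hG := h.G_pos
  have hb1 := h.b_le
  have hJ : 0 < 2 * G - D := by linarith [h.two_D_le]
  set J := 2 * G - D with hJd
  have hbG : b * G ≤ 1 / 256 := by linarith [h.bG_le, h.D_le]
  have hbG0 : 0 < b * G := mul_pos hb hG
  have hc0 := crossCoeff_nonneg (J := J) hb (by linarith) hD hJ.le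
  have hc1 := crossCoeff_le (J := J) hb hD (by linarith [h.D_le]) hJ.le
  have hd0 := crossCoeff_nonneg (J := J / 4) hb (by linarith) (D := D / 4) (by linarith)
    (by linarith)
  have hd1 := crossCoeff_le (J := J / 4) hb (D := D / 4) (by linarith)
    (by linarith [h.D_le]) (by linarith)
  have hV := lyap_ge h (u, R)
  have hle : lyap b (D / 4) (G / 4) (u, R) ≤ (1 + 6 * (b * G)) * lyap b D G (u, R) := by
    have e0 : lyap b (D / 4) (G / 4) (u, R) - lyap b D G (u, R) =
        (crossCoeff b D J - crossCoeff b (D / 4) (J / 4)) * (R * u) - 3 / 4 * J * u ^ 2 := by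
      have : 2 * (G / 4) - D / 4 = J / 4 := by rw [hJd]; ring
      simp only [lyap, this, ← hJd]
      rw [hJd]; ring
    have e1 : |crossCoeff b D J - crossCoeff b (D / 4) (J / 4)| ≤ 2 * b * J := by
      rw [abs_le]; constructor <;> nlinarith [mul_pos hb hJ]
    have e2 : (crossCoeff b D J - crossCoeff b (D / 4) (J / 4)) * (R * u) ≤
        2 * b * J * (|R| * |u|) := by
      rw [← abs_mul R u]
      exact (le_abs_self _).trans (by rw [abs_mul]; gcongr)
    have e3 : 2 * b * J * (|R| * |u|) ≤ 3 / 4 * J * u ^ 2 + 4 / 3 * b ^ 2 * J * R ^ 2 := by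
      have := mul_nonneg hJ.le (sq_nonneg (3 / 2 * |u| - 2 * b * |R|))
      rw [← sq_abs u, ← sq_abs R]
      nlinarith
    have e4 : 4 / 3 * b ^ 2 * J * R ^ 2 ≤ 3 * (b * G) * (b * R ^ 2) := by
      have : 0 ≤ b * (b * R ^ 2) := by positivity
      nlinarith [mul_nonneg this hD.le, mul_nonneg this hG.le]
    have e5 : b * R ^ 2 ≤ 2 * lyap b D G (u, R) := by
      have : 0 ≤ b * (u + R) ^ 2 + 3 / 4 * J * u ^ 2 := by positivity
      linarith
    have e6 := mul_le_mul_of_nonneg_left e5 (by linarith : 0 ≤ 3 * (b * G))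
    linarith
  have hV0 := lyap_nonneg h (u, R)
  rw [wlyap, wlyap]
  calc (1 + 16 * (b * (G / 4))) * lyap b (D / 4) (G / 4) (u, R) ≤
        (1 + 16 * (b * (G / 4))) * ((1 + 6 * (b * G)) * lyap b D G (u, R)) :=
      mul_le_mul_of_nonneg_left hle (by positivity)
    _ = ((1 + 16 * (b * (G / 4))) * (1 + 6 * (b * G))) * lyap b D G (u, R) := by ring
    _ ≤ _ := mul_le_mul_of_nonneg_right (by nlinarith) hV0

theorem lyap_le_wlyap {b κ D G : ℝ} (h : StepBounds b κ D G) (p : ℝ × ℝ) :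
    lyap b D G p ≤ wlyap b D G p := by
  have := mul_nonneg (mul_pos h.b_pos h.G_pos).le (lyap_nonneg h p)
  rw [wlyap]; linarith

theorem wlyap_le {b κ D G : ℝ} (h : StepBounds b κ D G) (p : ℝ × ℝ) :
    wlyap b D G p ≤ 2 * lyap b D G p := by
  have h1 : b * G ≤ 1 / 256 := by linarith [h.bG_le, h.D_le]
  have := mul_le_mul_of_nonneg_right h1 (lyap_nonneg h p)
  rw [wlyap]; linarith [lyap_nonneg h p]

theorem wlyap_nonneg {b κ D G : ℝ} (h : StepBounds b κ D G) (p : ℝ × ℝ) : 0 ≤ wlyap b D G p :=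
  (lyap_nonneg h p).trans (lyap_le_wlyap h p)

theorem wlyap_sub {b κ D G : ℝ} (h : StepBounds b κ D G) (p : ℝ × ℝ) :
    b * G * p.1 ^ 2 ≤ wlyap b D G p - wlyap b D G (modeStep b D G p) := by
  have h1 := lyap_sub h p
  have h0 := mul_pos h.b_pos h.G_pos
  have h2 : 0 ≤ b * G * p.1 ^ 2 := mul_nonneg h0.le (sq_nonneg _)
  have h3 : 0 ≤ b ^ 2 * (p.2 - (G - D) * p.1) ^ 2 := by positivity
  have := mul_nonneg h0.le (by linarith : 0 ≤ lyap b D G p - lyap b D G (modeStep b D G p))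
  rw [wlyap, wlyap]; linarith

theorem wlyap_modeStep_le {b κ D G : ℝ} (h : StepBounds b κ D G) (p : ℝ × ℝ) :
    wlyap b D G (modeStep b D G p) ≤ (1 - min b G / 8) * wlyap b D G p := by
  have := mul_le_mul_of_nonneg_left (lyap_modeStep_le h p)
    (by have := mul_pos h.b_pos h.G_pos; positivity : 0 ≤ 1 + 16 * (b * G))
  rw [wlyap, wlyap]; linarith

/-! ### Trajectories of a single mode over the stages -/

theorem StepBounds.at_stage {b κ D G : ℝ} (h : StepBounds b κ D G) (k : ℕ) :
    StepBounds b κ (D / 4 ^ k) (G / 4 ^ k) := by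
  induction k with
  | zero => simpa using h
  | succ k ih =>
    have := ih.quarter
    rwa [div_div, div_div, ← pow_succ] at this

/-- `p` follows the mean dynamics from time `s` on, with step sizes divided by `4 ^ st t`. -/
def IsTraj (b D G : ℝ) (st : ℕ → ℕ) (s : ℕ) (p : ℕ → ℝ × ℝ) : Prop :=
  ∀ t, s ≤ t → p (t + 1) = modeStep b (D / 4 ^ st t) (G / 4 ^ st t) (p t)

/-- The stage index grows by at most one at a time. -/
def SlowStage (st : ℕ → ℕ) : Prop := ∀ t, st (t + 1) = st t ∨ st (t + 1) = st t + 1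

/-- The weighted Lyapunov function at the step sizes of time `t`. -/
noncomputable def wlyapAt (b D G : ℝ) (st : ℕ → ℕ) (t : ℕ) (p : ℝ × ℝ) : ℝ :=
  wlyap b (D / 4 ^ st t) (G / 4 ^ st t) p

/-- The weighted energy at the step sizes of time `t`. -/
noncomputable def energyAt (b D G : ℝ) (st : ℕ → ℕ) (t : ℕ) (p : ℝ × ℝ) : ℝ :=
  energy b (D / 4 ^ st t) (G / 4 ^ st t) p / 4 ^ st t

section Traj

variable {b κ D G : ℝ} {st : ℕ → ℕ} {s : ℕ} {p : ℕ → ℝ × ℝ}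

theorem wlyapAt_succ_le (h : StepBounds b κ D G) (hst : SlowStage st) (t : ℕ) (q : ℝ × ℝ) :
    wlyapAt b D G st (t + 1) q ≤ wlyapAt b D G st t q := by
  unfold wlyapAt
  rcases hst t with e | e
  · rw [e]
  · rw [e, pow_succ, ← div_div, ← div_div]
    exact wlyap_quarter_le (h.at_stage _) q

theorem energyAt_succ_le (h : StepBounds b κ D G) (hst : SlowStage st) (t : ℕ) (q : ℝ × ℝ) :
    energyAt b D G st (t + 1) q ≤ energyAt b D G st t q := by
  unfold energyAt
  rcases hst t with e | e
  · rw [e]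
  · have := energy_quarter_le (h.at_stage (st t)) q
    rw [div_div, div_div, ← pow_succ] at this
    rw [e]
    refine (div_le_div_of_nonneg_right this (by positivity)).trans (le_of_eq ?_)
    rw [pow_succ]
    field_simp

theorem wlyapAt_nonneg (h : StepBounds b κ D G) (t : ℕ) (q : ℝ × ℝ) :
    0 ≤ wlyapAt b D G st t q := wlyap_nonneg (h.at_stage _) q

theorem energyAt_nonneg (h : StepBounds b κ D G) (t : ℕ) (q : ℝ × ℝ) :
    0 ≤ energyAt b D G st t q :=
  div_nonneg (energy_nonneg (h.at_stage _) q) (by positivity)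

theorem wlyapAt_step_sub (h : StepBounds b κ D G) (hst : SlowStage st)
    (hp : IsTraj b D G st s p) {t : ℕ} (ht : s ≤ t) :
    b * (G / 4 ^ st t) * (p t).1 ^ 2 ≤
      wlyapAt b D G st t (p t) - wlyapAt b D G st (t + 1) (p (t + 1)) := by
  have h1 := wlyapAt_succ_le h hst t (p (t + 1))
  have h2 := wlyap_sub (h.at_stage (st t)) (p t)
  rw [← hp t ht] at h2
  have h3 : wlyapAt b D G st t (p (t + 1)) = wlyap b (D / 4 ^ st t) (G / 4 ^ st t) (p (t + 1)) :=
    rfl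
  have h4 : wlyapAt b D G st t (p t) = wlyap b (D / 4 ^ st t) (G / 4 ^ st t) (p t) := rfl
  linarith

theorem wlyapAt_step_le (h : StepBounds b κ D G) (hst : SlowStage st)
    (hp : IsTraj b D G st s p) {t : ℕ} (ht : s ≤ t) :
    wlyapAt b D G st (t + 1) (p (t + 1)) ≤
      (1 - min b (G / 4 ^ st t) / 8) * wlyapAt b D G st t (p t) := by
  refine (wlyapAt_succ_le h hst t _).trans ?_
  rw [hp t ht]
  exact wlyap_modeStep_le (h.at_stage _) _

theorem energyAt_step_sub (h : StepBounds b κ D G) (hst : SlowStage st)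
    (hp : IsTraj b D G st s p) {t : ℕ} (ht : s ≤ t) :
    (G - D) * D / 4 ^ (3 * st t) * (p t).1 ^ 2 ≤
      energyAt b D G st t (p t) - energyAt b D G st (t + 1) (p (t + 1)) := by
  have h1 := energyAt_succ_le h hst t (p (t + 1))
  have h2 := energy_sub (h.at_stage (st t)) (p t)
  rw [← hp t ht] at h2
  have h5 : (0 : ℝ) < 4 ^ st t := by positivity
  have h3 : energyAt b D G st t (p t) - energyAt b D G st t (p (t + 1)) =
      (energy b (D / 4 ^ st t) (G / 4 ^ st t) (p t) -
        energy b (D / 4 ^ st t) (G / 4 ^ st t) (p (t + 1))) / 4 ^ st t := by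
    unfold energyAt; ring
  have h6 : (G - D) * D / 4 ^ (3 * st t) * (p t).1 ^ 2 =
      ((G / 4 ^ st t - D / 4 ^ st t) * (D / 4 ^ st t) * (p t).1 ^ 2) / 4 ^ st t := by
    rw [mul_comm 3, pow_mul]; field_simp
  have h7 := div_le_div_of_nonneg_right h2 h5.le
  rw [← h6, ← h3] at h7
  linarith

theorem wlyapAt_antitone (h : StepBounds b κ D G) (hst : SlowStage st)
    (hp : IsTraj b D G st s p) {t t' : ℕ} (ht : s ≤ t) (htt : t ≤ t') :
    wlyapAt b D G st t' (p t') ≤ wlyapAt b D G st t (p t) := by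
  induction t', htt using Nat.le_induction with
  | base => exact le_rfl
  | succ k hk ih =>
    refine le_trans ?_ ih
    have h1 := wlyapAt_step_sub h hst hp (ht.trans hk)
    have h2 : 0 ≤ b * (G / 4 ^ st k) * (p k).1 ^ 2 := by
      have := h.b_pos; have := h.G_pos; positivity
    linarith

/-- Geometric decay over a time interval on which the stage stays below `ℓ`. -/
theorem wlyapAt_decay (h : StepBounds b κ D G) (hst : SlowStage st)
    (hp : IsTraj b D G st s p) {t ℓ : ℕ} (ht : s ≤ t) (k : ℕ)
    (hk : ∀ i < k, st (t + i) ≤ ℓ) :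
    wlyapAt b D G st (t + k) (p (t + k)) ≤
      Real.exp (-(k * min b (G / 4 ^ ℓ) / 8)) * wlyapAt b D G st t (p t) := by
  induction k with
  | zero => simp
  | succ k ih =>
    have ih' := ih fun i hi => hk i (by omega)
    have h1 := wlyapAt_step_le h hst hp (ht.trans (Nat.le_add_right t k))
    have h2 : min b (G / 4 ^ ℓ) ≤ min b (G / 4 ^ st (t + k)) := by
      refine min_le_min le_rfl (div_le_div_of_nonneg_left h.G_pos.le (by positivity) ?_)
      exact pow_le_pow_right₀ (by norm_num) (hk k (by omega))
    have h3 : 1 - min b (G / 4 ^ st (t + k)) / 8 ≤ Real.exp (-(min b (G / 4 ^ ℓ) / 8)) := by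
      have := Real.add_one_le_exp (-(min b (G / 4 ^ ℓ) / 8))
      linarith
    rw [← Nat.add_assoc]
    refine h1.trans ((mul_le_mul_of_nonneg_right h3 (wlyapAt_nonneg h _ _)).trans
      ((mul_le_mul_of_nonneg_left ih' (Real.exp_nonneg _)).trans (le_of_eq ?_)))
    rw [← mul_assoc, ← Real.exp_add]
    congr 2
    push_cast
    ring

/-- The decreases telescope over all times after `s`, and those outside `A` are nonnegative. Having
no factor for the length of the stage is the point. -/
theorem sum_sq_le_wlyapAt (h : StepBounds b κ D G) (hst : SlowStage st)
    (hp : IsTraj b D G st s p) (A : Finset ℕ) (ℓ : ℕ) (hA : ∀ t ∈ A, s ≤ t ∧ st t = ℓ) :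
    b * (G / 4 ^ ℓ) * ∑ t ∈ A, (p t).1 ^ 2 ≤ wlyapAt b D G st s (p s) := by
  obtain ⟨T, hT⟩ : ∃ T, ∀ t ∈ A, t < T :=
    ⟨A.sup id + 1, fun t ht => Nat.lt_succ_of_le (Finset.le_sup (f := id) ht)⟩
  have hnn : ∀ t, 0 ≤ b * (G / 4 ^ st t) * (p t).1 ^ 2 := fun t => by
    have := h.b_pos; have := h.G_pos; positivity
  have h1 : b * (G / 4 ^ ℓ) * ∑ t ∈ A, (p t).1 ^ 2 = ∑ t ∈ A, b * (G / 4 ^ st t) * (p t).1 ^ 2 := by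
    rw [Finset.mul_sum]
    exact Finset.sum_congr rfl fun t ht => by rw [(hA t ht).2]
  rw [h1]
  calc ∑ t ∈ A, b * (G / 4 ^ st t) * (p t).1 ^ 2 ≤
        ∑ t ∈ Finset.Ico s (s + T), b * (G / 4 ^ st t) * (p t).1 ^ 2 :=
      Finset.sum_le_sum_of_subset_of_nonneg
        (fun t ht => Finset.mem_Ico.2 ⟨(hA t ht).1, (hT t ht).trans_le (Nat.le_add_left _ _)⟩)
        fun t _ _ => hnn t
    _ ≤ ∑ t ∈ Finset.Ico s (s + T),
        (wlyapAt b D G st t (p t) - wlyapAt b D G st (t + 1) (p (t + 1))) :=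
      Finset.sum_le_sum fun t ht => wlyapAt_step_sub h hst hp (Finset.mem_Ico.1 ht).1
    _ = wlyapAt b D G st s (p s) - wlyapAt b D G st (s + T) (p (s + T)) := by
      rw [Finset.sum_Ico_eq_sum_range, Nat.add_sub_cancel_left]
      exact Finset.sum_range_sub' (fun i => wlyapAt b D G st (s + i) (p (s + i))) T
    _ ≤ _ := sub_le_self _ (wlyapAt_nonneg h _ _)

/-- Telescoping again. Of the three powers of `4 ^ ℓ`, two come from the product of two step sizes
and one from the weight in `energyAt`. -/
theorem sum_sq_le_energyAt (h : StepBounds b κ D G) (hst : SlowStage st)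
    (hp : IsTraj b D G st s p) (A : Finset ℕ) (ℓ : ℕ) (hA : ∀ t ∈ A, s ≤ t ∧ st t = ℓ) :
    (G - D) * D / 4 ^ (3 * ℓ) * ∑ t ∈ A, (p t).1 ^ 2 ≤ energyAt b D G st s (p s) := by
  obtain ⟨T, hT⟩ : ∃ T, ∀ t ∈ A, t < T :=
    ⟨A.sup id + 1, fun t ht => Nat.lt_succ_of_le (Finset.le_sup (f := id) ht)⟩
  have hnn : ∀ t, 0 ≤ (G - D) * D / 4 ^ (3 * st t) * (p t).1 ^ 2 := fun t => by
    have := h.D_pos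
    have : 0 ≤ G - D := by linarith [h.two_D_le]
    positivity
  have h1 : (G - D) * D / 4 ^ (3 * ℓ) * ∑ t ∈ A, (p t).1 ^ 2 =
      ∑ t ∈ A, (G - D) * D / 4 ^ (3 * st t) * (p t).1 ^ 2 := by
    rw [Finset.mul_sum]
    exact Finset.sum_congr rfl fun t ht => by rw [(hA t ht).2]
  rw [h1]
  calc ∑ t ∈ A, (G - D) * D / 4 ^ (3 * st t) * (p t).1 ^ 2 ≤
        ∑ t ∈ Finset.Ico s (s + T), (G - D) * D / 4 ^ (3 * st t) * (p t).1 ^ 2 :=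
      Finset.sum_le_sum_of_subset_of_nonneg
        (fun t ht => Finset.mem_Ico.2 ⟨(hA t ht).1, (hT t ht).trans_le (Nat.le_add_left _ _)⟩)
        fun t _ _ => hnn t
    _ ≤ ∑ t ∈ Finset.Ico s (s + T),
        (energyAt b D G st t (p t) - energyAt b D G st (t + 1) (p (t + 1))) :=
      Finset.sum_le_sum fun t ht => energyAt_step_sub h hst hp (Finset.mem_Ico.1 ht).1
    _ = energyAt b D G st s (p s) - energyAt b D G st (s + T) (p (s + T)) := by
      rw [Finset.sum_Ico_eq_sum_range, Nat.add_sub_cancel_left]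
      exact Finset.sum_range_sub' (fun i => energyAt b D G st (s + i) (p (s + i))) T
    _ ≤ _ := sub_le_self _ (energyAt_nonneg h _ _)

theorem sq_add_sq_le_wlyapAt (h : StepBounds b κ D G) (t : ℕ) (q : ℝ × ℝ) :
    b * (q.1 ^ 2 + q.2 ^ 2) ≤ 6 * wlyapAt b D G st t q := by
  have h1 := sq_add_sq_le_lyap (h.at_stage (st t)) q
  have h2 := lyap_le_wlyap (h.at_stage (st t)) q
  rw [wlyapAt]; linarith

end Traj

/-! ### Stages and admissible step sizes -/

/-- The stage of an iteration when there are `L` stages of length `N`. -/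
def stageOf (N L t : ℕ) : ℕ := min (t / N) (L - 1)

theorem slowStage_stageOf {N : ℕ} (hN : 0 < N) (L : ℕ) : SlowStage (stageOf N L) := by
  intro t
  have h1 : t / N ≤ (t + 1) / N := Nat.div_le_div_right (Nat.le_succ t)
  have h2 : (t + 1) / N ≤ t / N + 1 := by
    rw [← Nat.add_div_right t hN]
    exact Nat.div_le_div_right (by omega)
  unfold stageOf
  omega

/-- The factor 2 is for the last stage, which also takes the remaining iterations. -/
theorem card_stageOf_le {N L n : ℕ} (hN : 0 < N) (hL : 1 ≤ L) (hn : n ≤ (L + 1) * N) (ℓ : ℕ) :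
    ((Finset.range n).filter fun t => stageOf N L t = ℓ).card ≤ 2 * N := by
  have hsub : ((Finset.range n).filter fun t => stageOf N L t = ℓ) ⊆
      Finset.Ico (ℓ * N) (ℓ * N + 2 * N) := by
    intro t ht
    rw [Finset.mem_filter, Finset.mem_range, stageOf] at ht
    obtain ⟨h1, h2⟩ := ht
    have h3 := Nat.div_mul_le_self t N
    have h4 := Nat.lt_div_mul_add hN (a := t)
    rw [Finset.mem_Ico]
    refine ⟨le_trans (Nat.mul_le_mul_right N ?_) h3, ?_⟩
    · rw [← h2]; exact min_le_left _ _
    · rcases Nat.lt_or_ge (t / N) (L - 1) with h5 | h5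
      · rw [min_eq_left h5.le] at h2
        subst h2; omega
      · rw [min_eq_right h5] at h2
        obtain ⟨k, rfl⟩ : ∃ k, L = k + 1 := ⟨L - 1, by omega⟩
        simp only [Nat.add_sub_cancel] at h2
        subst h2
        have : (k + 1 + 1) * N = k * N + 2 * N := by ring
        omega
  simpa using Finset.card_le_card hsub

/-- Admissible step sizes and stage lengths; `B` bounds the eigenvalues of the covariance. -/
structure Schedule (b κ δ Γ B : ℝ) (N L n : ℕ) : Prop where
  b_pos : 0 < b
  b_le : b ≤ 1 / 16
  kappa : 64 ≤ κ
  b_kappa : b * κ ≤ 1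
  delta_eq : δ = κ * b * Γ
  two_delta : 2 * δ ≤ Γ
  delta_B : δ * B ≤ 1 / 4
  B_le : B ≤ N
  L_ge : 2 ≤ L
  le_n : L * N ≤ n
  n_le : n ≤ (L + 1) * N
  L_le : L ≤ N
  Gamma_le : Γ ≤ N
  le_Gamma : 1 ≤ Γ * N
  bN : 1 ≤ b * N
  -- The first condition makes the steps of the last stage so small that noise arriving there needs
  -- no further decay. The second lets one stage of contraction at rate `b` absorb any polynomial
  -- prefactor that occurs.
  last : N ^ 2 * B ≤ 4 ^ (L - 1)
  tiny : (N : ℝ) ^ 20 * Real.exp (-(N * b / 8)) ≤ 1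

section Schedule

variable {b κ δ Γ B : ℝ} {N L n : ℕ}

theorem Schedule.N_pos (h : Schedule b κ δ Γ B N L n) : 0 < N := by
  rcases Nat.eq_zero_or_pos N with e | e
  · have := h.bN; rw [e] at this; norm_num at this
  · exact e

theorem Schedule.Gamma_pos (h : Schedule b κ δ Γ B N L n) : 0 < Γ := by
  have h0 : (0 : ℝ) < N := Nat.cast_pos.2 h.N_pos
  exact pos_of_mul_pos_left (by linarith [h.le_Gamma]) h0.le

theorem Schedule.delta_pos (h : Schedule b κ δ Γ B N L n) : 0 < δ := by
  rw [h.delta_eq]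
  have := h.kappa; have := h.b_pos; have := h.Gamma_pos
  positivity

theorem Schedule.stepBounds (h : Schedule b κ δ Γ B N L n) {x : ℝ} (hx : 0 < x) (hxB : x ≤ B) :
    StepBounds b κ (δ * x) (Γ * x) where
  b_pos := h.b_pos
  b_le := h.b_le
  kappa := h.kappa
  G_pos := mul_pos h.Gamma_pos hx
  D_eq := by rw [h.delta_eq]; ring
  D_le := (mul_le_mul_of_nonneg_left hxB h.delta_pos.le).trans h.delta_B
  two_D_le := by
    have := mul_le_mul_of_nonneg_right h.two_delta hx.le
    linarith

/-! ### The response of a mode to a single noise term -/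

/-- The effect of one noise term on a mode, at stage `ℓ`. -/
noncomputable def kick (b δ Γ : ℝ) (ℓ : ℕ) : ℝ × ℝ :=
  ((δ + b * (Γ - δ)) / 4 ^ ℓ, (1 - b) * (Γ - δ) / 4 ^ ℓ)

theorem Schedule.kick_bounds (h : Schedule b κ δ Γ B N L n) (ℓ : ℕ) :
    (kick b δ Γ ℓ).1 ^ 2 ≤ 4 * δ ^ 2 * (1 / 4 ^ ℓ) ^ 2 ∧
      (kick b δ Γ ℓ).2 ^ 2 ≤ Γ ^ 2 * (1 / 4 ^ ℓ) ^ 2 ∧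
      (kick b δ Γ ℓ).1 + (kick b δ Γ ℓ).2 = Γ * (1 / 4 ^ ℓ) := by
  have hb := h.b_pos
  have hb1 := h.b_le
  have hδ := h.delta_pos
  have hΓ := h.Gamma_pos
  have h2 := h.two_delta
  have e1 : b * Γ ≤ δ := by
    have := mul_le_mul_of_nonneg_right h.kappa (mul_pos hb hΓ).le
    rw [h.delta_eq]; nlinarith [mul_pos hb hΓ]
  refine ⟨?_, ?_, by simp only [kick]; ring⟩
  · have : (kick b δ Γ ℓ).1 ^ 2 = (δ + b * (Γ - δ)) ^ 2 * (1 / 4 ^ ℓ) ^ 2 := by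
      simp only [kick]; ring
    rw [this]
    refine mul_le_mul_of_nonneg_right ?_ (sq_nonneg _)
    have : 0 ≤ b * (Γ - δ) := mul_nonneg hb.le (by linarith)
    nlinarith [mul_pos hb hδ]
  · have : (kick b δ Γ ℓ).2 ^ 2 = ((1 - b) * (Γ - δ)) ^ 2 * (1 / 4 ^ ℓ) ^ 2 := by
      simp only [kick]; ring
    rw [this]
    refine mul_le_mul_of_nonneg_right ?_ (sq_nonneg _)
    have e2 : 0 ≤ (1 - b) * (Γ - δ) := mul_nonneg (by linarith) (by linarith)
    have e3 : (1 - b) * (Γ - δ) ≤ Γ := by nlinarith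
    exact pow_le_pow_left₀ e2 e3 2

/-- A noise term enters the momentum at size `Γ` but the iterate only at size `δ`. The momentum thus
contributes `b Γ²`, and the iterate contributes `Γ x δ²`, rewritten by `δ = κ b Γ`. -/
theorem Schedule.wlyapAt_kick_le (h : Schedule b κ δ Γ B N L n) {x : ℝ} (hx : 0 < x)
    (hxB : x ≤ B) (st : ℕ → ℕ) (s : ℕ) :
    wlyapAt b (δ * x) (Γ * x) st s (kick b δ Γ (st s)) ≤
      6 * b * (1 / 4 ^ st s) ^ 2 * Γ ^ 2 * (1 + 4 * κ * δ * x * (1 / 4 ^ st s)) := by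
  have hs := (h.stepBounds hx hxB).at_stage (st s)
  obtain ⟨h1, h2, h3⟩ := h.kick_bounds (st s)
  have h4 := (wlyap_le hs (kick b δ Γ (st s))).trans
    (mul_le_mul_of_nonneg_left (lyap_le hs (kick b δ Γ (st s))) zero_le_two)
  rw [h3] at h4
  have hG := hs.G_pos
  have hb := h.b_pos
  set q : ℝ := 1 / 4 ^ st s with hq
  have e1 : Γ * x / 4 ^ st s = Γ * x * q := by rw [hq]; ring
  rw [e1] at h4 hG
  have h5 := mul_le_mul_of_nonneg_left h1 hG.le
  have h6 := mul_le_mul_of_nonneg_left h2 hb.le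
  have e2 : 6 * b * q ^ 2 * Γ ^ 2 * (1 + 4 * κ * δ * x * q) =
      6 * b * q ^ 2 * Γ ^ 2 + 24 * (Γ * x * q) * δ * (κ * b * Γ) * q ^ 2 := by ring
  rw [e2, ← h.delta_eq]
  unfold wlyapAt
  rw [e1]
  linarith

theorem Schedule.energyAt_kick_le (h : Schedule b κ δ Γ B N L n) {x : ℝ} (hx : 0 < x)
    (hxB : x ≤ B) (st : ℕ → ℕ) (s : ℕ) :
    energyAt b (δ * x) (Γ * x) st s (kick b δ Γ (st s)) ≤
      2 * (1 / 4 ^ st s) ^ 3 * (b * Γ ^ 2 + 4 * δ ^ 2 * ((Γ - δ) * x) * (1 / 4 ^ st s)) := by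
  have hs := (h.stepBounds hx hxB).at_stage (st s)
  obtain ⟨h1, h2, -⟩ := h.kick_bounds (st s)
  have h4 := (energy_bounds hs (kick b δ Γ (st s))).2
  have hH : 0 ≤ Γ * x / 4 ^ st s - δ * x / 4 ^ st s := by linarith [hs.two_D_le, hs.D_pos]
  have hb := h.b_pos
  set q : ℝ := 1 / 4 ^ st s with hq
  have e1 : Γ * x / 4 ^ st s - δ * x / 4 ^ st s = (Γ - δ) * x * q := by rw [hq]; ring
  rw [e1] at h4 hH
  have h5 := mul_le_mul_of_nonneg_left h1 hH
  have h6 := mul_le_mul_of_nonneg_left h2 hb.le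
  have hq0 : 0 ≤ q := by positivity
  have e3 : energyAt b (δ * x) (Γ * x) st s (kick b δ Γ (st s)) =
      energy b (δ * x / 4 ^ st s) (Γ * x / 4 ^ st s) (kick b δ Γ (st s)) * q := by
    rw [energyAt, hq]; ring
  rw [e3]
  calc _ ≤ (2 * (b * (Γ ^ 2 * q ^ 2) + (Γ - δ) * x * q * (4 * δ ^ 2 * q ^ 2))) * q :=
        mul_le_mul_of_nonneg_right (by linarith) hq0
    _ = _ := by ring

/-- The response of a mode at time `t > s` to a unit noise term at time `s`. -/
def IsResponse (b δ Γ x : ℝ) (st : ℕ → ℕ) (s : ℕ) (p : ℕ → ℝ × ℝ) : Prop :=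
  IsTraj b (δ * x) (Γ * x) st (s + 1) p ∧ p (s + 1) = kick b δ Γ (st s)

/-- Initial value over dissipation, for both Lyapunov functions. The weighted one yields `Γ x (1 + κ
δ x)`, the energy yields `1/κ + δ x`. Where `κ δ x > 1` the first bound is poor, but then `1/κ ≤ δ
x` and the second is itself `O(Γ x)`. The restriction on `ℓ` keeps the step sizes within a factor 4
of those at the time of the noise. -/
theorem Schedule.kernel_near (h : Schedule b κ δ Γ B N L n) {x : ℝ} (hx : 0 < x) (hxB : x ≤ B)
    {st : ℕ → ℕ} (hst : SlowStage st) {s : ℕ} {p : ℕ → ℝ × ℝ} (hp : IsResponse b δ Γ x st s p)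
    (A : Finset ℕ) {ℓ : ℕ} (hℓ : ℓ ≤ st s + 1) (hA : ∀ t ∈ A, s + 1 ≤ t ∧ st t = ℓ) :
    x ^ 2 * ∑ t ∈ A, (p t).1 ^ 2 ≤ 50000 * min (Γ * x) (1 / κ + δ * x) := by
  have hs := h.stepBounds hx hxB
  have hb := h.b_pos
  have hδ := h.delta_pos
  have hΓ := h.Gamma_pos
  have hκ : 0 < κ := by linarith [h.kappa]
  have h2 := h.two_delta
  set q : ℝ := 1 / 4 ^ st s with hq
  have hq0 : 0 < q := by positivity
  have hq1 : q ≤ 1 := by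
    rw [hq, div_le_one (by positivity)]; exact one_le_pow₀ (by norm_num)
  set S := ∑ t ∈ A, (p t).1 ^ 2 with hS
  have hS0 : 0 ≤ S := Finset.sum_nonneg fun t _ => sq_nonneg _
  have hqℓ : q / 4 ≤ 1 / 4 ^ ℓ := by
    rw [hq, div_div, ← pow_succ]
    exact one_div_le_one_div_of_le (by positivity) (pow_le_pow_right₀ (by norm_num) hℓ)
  have hW : b * (Γ * x * (q / 4)) * S ≤ 6 * b * q ^ 2 * Γ ^ 2 * (1 + 4 * κ * δ * x * q) := by
    have e1 := sum_sq_le_wlyapAt hs hst hp.1 A ℓ hA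
    rw [hp.2] at e1
    have e2 := (wlyapAt_succ_le hs hst s _).trans (h.wlyapAt_kick_le hx hxB st s)
    refine le_trans (mul_le_mul_of_nonneg_right ?_ hS0) (e1.trans e2)
    refine mul_le_mul_of_nonneg_left ?_ hb.le
    calc Γ * x * (q / 4) ≤ Γ * x * (1 / 4 ^ ℓ) :=
          mul_le_mul_of_nonneg_left hqℓ (by positivity)
      _ = _ := by ring
  have hE : (Γ * x - δ * x) * (δ * x) * (q / 4) ^ 3 * S ≤
      2 * q ^ 3 * (b * Γ ^ 2 + 4 * δ ^ 2 * ((Γ - δ) * x) * q) := by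
    have e1 := sum_sq_le_energyAt hs hst hp.1 A ℓ hA
    rw [hp.2] at e1
    have e2 := (energyAt_succ_le hs hst s _).trans (h.energyAt_kick_le hx hxB st s)
    refine le_trans (mul_le_mul_of_nonneg_right ?_ hS0) (e1.trans e2)
    have e3 : 0 ≤ (Γ * x - δ * x) * (δ * x) :=
      mul_nonneg (by linarith [hs.two_D_le, hs.D_pos]) hs.D_pos.le
    calc _ ≤ (Γ * x - δ * x) * (δ * x) * (1 / 4 ^ ℓ) ^ 3 :=
          mul_le_mul_of_nonneg_left (pow_le_pow_left₀ (by positivity) hqℓ 3) e3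
      _ = _ := by rw [mul_comm 3 ℓ, pow_mul]; ring
  have hW' : x ^ 2 * S ≤ 24 * (Γ * x) * (1 + 4 * κ * δ * x) := by
    have e1 : b * Γ * q * (x * S) ≤ b * Γ * q * (24 * Γ * q * (1 + 4 * κ * δ * x * q)) := by
      nlinarith
    have e2 := le_of_mul_le_mul_left e1 (by positivity)
    have e3 : 24 * Γ * q * (1 + 4 * κ * δ * x * q) ≤ 24 * Γ * 1 * (1 + 4 * κ * δ * x * 1) := by
      gcongr
    nlinarith [mul_le_mul_of_nonneg_left (e2.trans e3) hx.le]
  have hE' : x ^ 2 * S ≤ 256 * (1 / κ) + 512 * (δ * x) := by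
    have hH : 0 < (Γ - δ) * x := mul_pos (by linarith) hx
    have e1 : (Γ - δ) * δ * (x ^ 2 * S) ≤ 128 * (b * Γ ^ 2 + 4 * δ ^ 2 * ((Γ - δ) * x) * q) := by
      have : q ^ 3 * ((Γ - δ) * δ * (x ^ 2 * S)) ≤
          q ^ 3 * (128 * (b * Γ ^ 2 + 4 * δ ^ 2 * ((Γ - δ) * x) * q)) := by nlinarith
      exact le_of_mul_le_mul_left this (by positivity)
    have e2 : 4 * δ ^ 2 * ((Γ - δ) * x) * q ≤ 4 * δ ^ 2 * ((Γ - δ) * x) * 1 :=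
      mul_le_mul_of_nonneg_left hq1 (by positivity)
    have e3 : b * Γ ^ 2 ≤ (Γ - δ) * δ * (2 * (1 / κ)) := by
      have : b * Γ = δ * (1 / κ) := by rw [h.delta_eq]; field_simp
      have e5 : 0 ≤ δ * (1 / κ) := by positivity
      calc b * Γ ^ 2 = (b * Γ) * Γ := by ring
        _ = δ * (1 / κ) * Γ := by rw [this]
        _ ≤ δ * (1 / κ) * (2 * (Γ - δ)) := mul_le_mul_of_nonneg_left (by linarith) e5
        _ = _ := by ring
    have e4 : (Γ - δ) * δ * (x ^ 2 * S) ≤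
        (Γ - δ) * δ * (256 * (1 / κ) + 512 * (δ * x)) := by nlinarith
    exact le_of_mul_le_mul_left e4 (mul_pos (by linarith) hδ)
  have hGx : 0 < Γ * x := mul_pos hΓ hx
  have hDx : 0 < δ * x := mul_pos hδ hx
  have hik : 0 < 1 / κ := by positivity
  rw [mul_min_of_nonneg _ _ (by norm_num)]
  refine le_min ?_ (by linarith)
  rcases le_total (κ * δ * x) 1 with h7 | h7
  · have : 24 * (Γ * x) * (1 + 4 * κ * δ * x) ≤ 24 * (Γ * x) * 5 :=
      mul_le_mul_of_nonneg_left (by linarith) (by positivity)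
    linarith
  · have : 1 / κ ≤ δ * x := by
      rw [div_le_iff₀ hκ]; linarith
    have : 2 * (δ * x) ≤ Γ * x := hs.two_D_le
    linarith

end Schedule

section Schedule

variable {b κ δ Γ B : ℝ} {N L n : ℕ}

theorem Schedule.one_le_N (h : Schedule b κ δ Γ B N L n) : (1 : ℝ) ≤ N :=
  Nat.one_le_cast.2 h.N_pos

theorem Schedule.pow_mul_exp_le (h : Schedule b κ δ Γ B N L n) {k : ℕ} (hk : k ≤ 20) :
    (N : ℝ) ^ k * Real.exp (-(N * b / 8)) ≤ 1 :=
  (mul_le_mul_of_nonneg_right (pow_le_pow_right₀ h.one_le_N hk) (Real.exp_nonneg _)).trans h.tiny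

theorem Schedule.kappa_le (h : Schedule b κ δ Γ B N L n) : κ ≤ N := by
  have h1 := mul_le_mul_of_nonneg_right h.b_kappa (Nat.cast_nonneg N : (0 : ℝ) ≤ N)
  have h2 := mul_le_mul_of_nonneg_right h.bN (by linarith [h.kappa] : 0 ≤ κ)
  linarith

theorem Schedule.one_le_delta (h : Schedule b κ δ Γ B N L n) : 1 ≤ δ * N ^ 2 := by
  have h1 : 1 * 1 ≤ (b * N) * (Γ * N) :=
    mul_le_mul h.bN h.le_Gamma zero_le_one (by linarith [h.bN])
  have h2 := mul_le_mul_of_nonneg_right h.kappa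
    (by linarith : 0 ≤ (b * N) * (Γ * N))
  rw [h.delta_eq]
  linarith

/-- Decay is collected only in the first `N` iterations of the stage after the noise term; before
and after, monotonicity suffices. The rate is the smaller of `b` and the current step, whence the
two alternatives, the second of which is smaller than any power of `N` needed. -/
theorem Schedule.resp_sq_le (h : Schedule b κ δ Γ B N L n) {x : ℝ} (hx : 0 < x) (hxB : x ≤ B)
    {s : ℕ} {p : ℕ → ℝ × ℝ} (hp : IsResponse b δ Γ x (stageOf N L) s p)
    (hs : stageOf N L s + 1 ≤ L - 1) {t : ℕ} (ht : (stageOf N L s + 2) * N ≤ t) :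
    (Γ * x * (1 / 4 ^ stageOf N L s) ≤ 4 * b ∧ (p t).1 ^ 2 + (p t).2 ^ 2 ≤
      180 * Γ ^ 2 * (1 / 4 ^ stageOf N L s) ^ 2 *
        Real.exp (-(N * Γ * x * (1 / 4 ^ stageOf N L s) / 32))) ∨
    ((p t).1 ^ 2 + (p t).2 ^ 2 ≤ 72 * Γ ^ 2 * κ * Real.exp (-(N * b / 8))) := by
  have hN := h.N_pos
  have hsb := h.stepBounds hx hxB
  have hst := slowStage_stageOf hN L
  have hb := h.b_pos
  have hΓ := h.Gamma_pos
  have hδ := h.delta_pos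
  have hκ : 0 < κ := by linarith [h.kappa]
  set ℓ := stageOf N L s with hℓ
  have hsN : s / N = ℓ := by rw [hℓ, stageOf] at hs ⊢; omega
  have hs1 : s + 1 ≤ (ℓ + 1) * N := by
    have := Nat.lt_div_mul_add hN (a := s)
    rw [hsN] at this
    rw [add_mul, one_mul]; exact this
  set q : ℝ := 1 / 4 ^ ℓ with hq
  have hq0 : 0 < q := by positivity
  have hq1 : q ≤ 1 := by
    rw [hq, div_le_one (by positivity)]; exact one_le_pow₀ (by norm_num)
  have hW0 : wlyapAt b (δ * x) (Γ * x) (stageOf N L) (s + 1) (p (s + 1)) ≤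
      6 * b * q ^ 2 * Γ ^ 2 * (1 + 4 * κ * δ * x * q) := by
    rw [hp.2]
    exact (wlyapAt_succ_le hsb hst s _).trans (h.wlyapAt_kick_le hx hxB _ s)
  have hW1 := (wlyapAt_antitone hsb hst hp.1 le_rfl hs1).trans hW0
  have hdec := wlyapAt_decay hsb hst hp.1 hs1 (ℓ := ℓ + 1) N fun i hi => by
    have : ((ℓ + 1) * N + i) / N = ℓ + 1 := by
      rw [Nat.mul_comm, Nat.mul_add_div hN, Nat.div_eq_of_lt hi, Nat.add_zero]
    rw [stageOf, this]; exact min_le_left _ _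
  have ht' : (ℓ + 1) * N + N ≤ t := by linarith
  have hW2 := ((wlyapAt_antitone hsb hst hp.1 (hs1.trans (Nat.le_add_right _ _)) ht').trans
    hdec).trans (mul_le_mul_of_nonneg_left hW1 (Real.exp_nonneg _))
  have hfin := (sq_add_sq_le_wlyapAt hsb t (p t)).trans (mul_le_mul_of_nonneg_left hW2 (by norm_num))
  have e4 : Γ * x / 4 ^ (ℓ + 1) = Γ * x * q / 4 := by rw [hq, pow_succ]; field_simp
  rw [e4] at hfin
  have hNr : (0 : ℝ) < N := Nat.cast_pos.2 hN
  rcases le_total (Γ * x * q / 4) b with hc | hc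
  · left
    refine ⟨by linarith, ?_⟩
    rw [min_eq_right hc] at hfin
    have e5 : 4 * κ * δ * x * q ≤ 4 := by
      have e6 : κ * δ * (Γ * x * q) ≤ κ * δ * (4 * b) :=
        mul_le_mul_of_nonneg_left (by linarith) (by positivity)
      have e7 : κ * δ * (4 * b) * Γ ≤ Γ ^ 2 := by
        have : κ * δ * (4 * b) * Γ = 4 * δ * (κ * b * Γ) := by ring
        rw [this, ← h.delta_eq]
        nlinarith [h.two_delta]
      have e8 : (κ * δ * x * q) * Γ ^ 2 ≤ 1 * Γ ^ 2 := by nlinarith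
      have := le_of_mul_le_mul_right e8 (by positivity)
      linarith
    have e9 : b * ((p t).1 ^ 2 + (p t).2 ^ 2) ≤ b * (180 * Γ ^ 2 * q ^ 2 *
        Real.exp (-(N * Γ * x * q / 32))) := by
      refine hfin.trans ?_
      have e10 : -(N * (Γ * x * q / 4) / 8) = -(N * Γ * x * q / 32) := by ring
      rw [e10]
      have : 6 * b * q ^ 2 * Γ ^ 2 * (1 + 4 * κ * δ * x * q) ≤ 6 * b * q ^ 2 * Γ ^ 2 * 5 :=
        mul_le_mul_of_nonneg_left (by linarith) (by positivity)
      have := mul_le_mul_of_nonneg_left this (Real.exp_nonneg (-(N * Γ * x * q / 32)))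
      linarith
    exact le_of_mul_le_mul_left e9 hb
  · right
    rw [min_eq_left hc] at hfin
    have e5 : 6 * b * q ^ 2 * Γ ^ 2 * (1 + 4 * κ * δ * x * q) ≤ 12 * b * Γ ^ 2 * κ := by
      have e6 : 4 * κ * δ * x * q ≤ κ * 1 := by
        have : δ * x * q ≤ 1 / 4 * 1 :=
          mul_le_mul hsb.D_le hq1 hq0.le (by norm_num)
        nlinarith
      have e7 : q ^ 2 * (1 + 4 * κ * δ * x * q) ≤ 1 * (2 * κ) :=
        mul_le_mul (pow_le_one₀ hq0.le hq1) (by linarith [h.kappa]) (by positivity) zero_le_one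
      have := mul_le_mul_of_nonneg_left e7 (by positivity : 0 ≤ 6 * b * Γ ^ 2)
      linarith
    have e9 : b * ((p t).1 ^ 2 + (p t).2 ^ 2) ≤ b * (72 * Γ ^ 2 * κ *
        Real.exp (-(N * b / 8))) := by
      refine hfin.trans ?_
      have := mul_le_mul_of_nonneg_left e5 (Real.exp_nonneg (-(N * b / 8)))
      linarith
    exact le_of_mul_le_mul_left e9 hb

theorem mul_exp_neg_le (y : ℝ) : y * Real.exp (-(y / 32)) ≤ 32 := by
  have h1 := Real.add_one_le_exp (y / 32)
  have h2 : Real.exp (y / 32) * Real.exp (-(y / 32)) = 1 := by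
    rw [← Real.exp_add]; simp
  nlinarith [Real.exp_pos (-(y / 32))]

/-- Beyond the stages covered by `kernel_near`, the pointwise bound is multiplied by the length of
the stage. The exponential absorbs the factor `N Γ x q`, leaving `O(Γ x q)`, which is also `O(1/κ)`
since `Γ x q ≤ 4 b` and `b κ ≤ 1`. The other alternative is absorbed by `δ x`, because `δ ≥ N⁻²`. -/
theorem Schedule.kernel_le (h : Schedule b κ δ Γ B N L n) {x : ℝ} (hx : 0 < x) (hxB : x ≤ B)
    {s : ℕ} {p : ℕ → ℝ × ℝ} (hp : IsResponse b δ Γ x (stageOf N L) s p)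
    (A : Finset ℕ) {ℓ : ℕ} (hA : ∀ t ∈ A, s + 1 ≤ t ∧ stageOf N L t = ℓ) (hcard : A.card ≤ 2 * N) :
    x ^ 2 * ∑ t ∈ A, (p t).1 ^ 2 ≤ 50000 * min (Γ * x) (1 / κ + δ * x) := by
  rcases Nat.lt_or_ge (stageOf N L s + 1) ℓ with hlt | hge
  swap
  · exact h.kernel_near hx hxB (slowStage_stageOf h.N_pos L) hp A hge hA
  have hb := h.b_pos
  have hΓ := h.Gamma_pos
  have hδ := h.delta_pos
  have hκ : 0 < κ := by linarith [h.kappa]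
  have hN1 := h.one_le_N
  have hDx : 2 * (δ * x) ≤ Γ * x := (h.stepBounds hx hxB).two_D_le
  have hDx0 : 0 < δ * x := mul_pos hδ hx
  have hGx0 : 0 < Γ * x := mul_pos hΓ hx
  have hik : 0 < 1 / κ := by positivity
  rcases A.eq_empty_or_nonempty with he | ⟨t₀, ht₀⟩
  · subst he
    rw [Finset.sum_empty, mul_zero]
    exact mul_nonneg (by norm_num) (le_min hGx0.le (by linarith))
  have hs : stageOf N L s + 1 ≤ L - 1 := by
    have := (hA t₀ ht₀).2
    rw [stageOf] at this
    omega
  have ht : ∀ t ∈ A, (stageOf N L s + 2) * N ≤ t := fun t ht => by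
    have h1 : ℓ ≤ t / N := by rw [← (hA t ht).2]; exact min_le_left _ _
    exact (Nat.mul_le_mul_right N (by omega)).trans ((Nat.mul_le_mul_right N h1).trans
      (Nat.div_mul_le_self t N))
  set q : ℝ := 1 / 4 ^ stageOf N L s with hq
  have hq0 : 0 < q := by positivity
  have hq1 : q ≤ 1 := by
    rw [hq, div_le_one (by positivity)]; exact one_le_pow₀ (by norm_num)
  have hsum : ∀ v : ℝ, 0 ≤ v → (∀ t ∈ A, (p t).1 ^ 2 + (p t).2 ^ 2 ≤ v) →
      ∑ t ∈ A, (p t).1 ^ 2 ≤ 2 * N * v := fun v hv0 hv => by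
    calc ∑ t ∈ A, (p t).1 ^ 2 ≤ A.card • v :=
          Finset.sum_le_card_nsmul _ _ _ fun t ht => by linarith [hv t ht, sq_nonneg (p t).2]
      _ = A.card * v := nsmul_eq_mul _ _
      _ ≤ 2 * N * v := mul_le_mul_of_nonneg_right (by exact_mod_cast hcard) hv0
  rw [mul_min_of_nonneg _ _ (by norm_num)]
  have hτ : (0 : ℝ) ≤ Real.exp (-(N * b / 8)) := Real.exp_nonneg _
  have hbig : ∀ v : ℝ, v ≤ 72 * Γ ^ 2 * κ * Real.exp (-(N * b / 8)) →
      x ^ 2 * (2 * N * v) ≤ 144 * (δ * x) := fun v hv => by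
    have e1 : x * (N * (Γ ^ 2 * κ)) ≤ N * (N * (N ^ 2 * N)) :=
      mul_le_mul (hxB.trans h.B_le) (mul_le_mul_of_nonneg_left
        (mul_le_mul (pow_le_pow_left₀ hΓ.le h.Gamma_le 2) h.kappa_le hκ.le (by positivity))
        (by positivity)) (by positivity) (by positivity)
    have e2 : N * (N * (N ^ 2 * N)) * Real.exp (-(N * b / 8)) ≤ δ := by
      have e3 := mul_le_mul_of_nonneg_right h.one_le_delta
        (by positivity : 0 ≤ (N : ℝ) ^ 5 * Real.exp (-(N * b / 8)))
      have e4 := mul_le_mul_of_nonneg_left (h.pow_mul_exp_le (k := 7) (by norm_num)) hδ.le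
      nlinarith
    have e5 := (mul_le_mul_of_nonneg_right e1 hτ).trans e2
    calc x ^ 2 * (2 * N * v) ≤
          x ^ 2 * (2 * N * (72 * Γ ^ 2 * κ * Real.exp (-(N * b / 8)))) := by gcongr
      _ = 144 * (x * (N * (Γ ^ 2 * κ)) * Real.exp (-(N * b / 8))) * x := by ring
      _ ≤ 144 * δ * x := by gcongr
      _ = _ := by ring
  by_cases hc : Γ * x * q ≤ 4 * b
  · set v₁ : ℝ := 180 * Γ ^ 2 * q ^ 2 * Real.exp (-(N * Γ * x * q / 32)) with hv₁
    set v₂ : ℝ := 72 * Γ ^ 2 * κ * Real.exp (-(N * b / 8)) with hv₂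
    have hv₁0 : 0 ≤ v₁ := by positivity
    have hv₂0 : 0 ≤ v₂ := by positivity
    have h1 := hsum (v₁ + v₂) (by positivity) fun t htA => by
      rcases h.resp_sq_le hx hxB hp hs (ht t htA) with ⟨-, h1⟩ | h1
      · rw [← hq, ← hv₁] at h1; linarith
      · rw [← hv₂] at h1; linarith
    have h2 := mul_le_mul_of_nonneg_left h1 (sq_nonneg x)
    have h3 := hbig v₂ le_rfl
    have h4 : x ^ 2 * (2 * N * v₁) ≤ 11520 * (Γ * x * q) := by
      have e1 := mul_exp_neg_le (N * Γ * x * q)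
      calc x ^ 2 * (2 * N * v₁) =
            360 * (Γ * x * q) * (N * Γ * x * q * Real.exp (-(N * Γ * x * q / 32))) := by
            rw [hv₁]; ring
        _ ≤ 360 * (Γ * x * q) * 32 := mul_le_mul_of_nonneg_left e1 (by positivity)
        _ = _ := by ring
    have h5 : x ^ 2 * (2 * N * (v₁ + v₂)) = x ^ 2 * (2 * N * v₁) + x ^ 2 * (2 * N * v₂) := by ring
    have h6 : Γ * x * q ≤ Γ * x := mul_le_of_le_one_right hGx0.le hq1
    have h7 : b ≤ 1 / κ := by rw [le_div_iff₀ hκ]; exact h.b_kappa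
    refine le_min ?_ ?_ <;> linarith
  · set v₂ : ℝ := 72 * Γ ^ 2 * κ * Real.exp (-(N * b / 8)) with hv₂
    have hv₂0 : 0 ≤ v₂ := by positivity
    have h1 := hsum v₂ hv₂0 fun t htA => by
      rcases h.resp_sq_le hx hxB hp hs (ht t htA) with ⟨h1, -⟩ | h1
      · exact absurd h1 hc
      · exact h1
    have h2 := mul_le_mul_of_nonneg_left h1 (sq_nonneg x)
    have h3 := hbig v₂ le_rfl
    refine le_min ?_ ?_ <;> linarith

/-! ### The mean trajectory -/

theorem Schedule.wlyapAt_start_le (h : Schedule b κ δ Γ B N L n) {x : ℝ} (hx : 0 < x)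
    (hxB : x ≤ B) {w : ℝ} {p : ℕ → ℝ × ℝ} (hp0 : p 0 = (w, 0)) :
    wlyapAt b (δ * x) (Γ * x) (stageOf N L) 0 (p 0) ≤ 2 * (b + 3 * (Γ * x)) * w ^ 2 := by
  have hs := h.stepBounds hx hxB
  have h0 : stageOf N L 0 = 0 := by simp [stageOf]
  rw [wlyapAt, h0, pow_zero, div_one, div_one, hp0]
  refine (wlyap_le hs _).trans ?_
  have := lyap_le hs (w, 0)
  simp only [add_zero] at this
  linarith

/-- The first stage does all the damping; afterwards the weighted Lyapunov function merely does not
increase. The factor `N ^ 3` pays for the initial ratio `Γ x / b` when it exceeds 1. -/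
theorem Schedule.bias_sq_le (h : Schedule b κ δ Γ B N L n) {x : ℝ} (hx : 0 < x) (hxB : x ≤ B)
    {w : ℝ} {p : ℕ → ℝ × ℝ} (hp : IsTraj b (δ * x) (Γ * x) (stageOf N L) 0 p)
    (hp0 : p 0 = (w, 0)) {t : ℕ} (ht : N ≤ t) :
    (p t).1 ^ 2 + (p t).2 ^ 2 ≤
      48 * w ^ 2 * (Real.exp (-(N * Γ * x / 8)) + N ^ 3 * Real.exp (-(N * b / 8))) := by
  have hsb := h.stepBounds hx hxB
  have hN := h.N_pos
  have hst := slowStage_stageOf hN L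
  have hb := h.b_pos
  have hG := hsb.G_pos
  have hdec := wlyapAt_decay hsb hst hp le_rfl (ℓ := 0) N fun i hi => by
    rw [stageOf, Nat.zero_add, Nat.div_eq_of_lt hi]; exact Nat.zero_le _
  rw [Nat.zero_add, pow_zero, div_one] at hdec
  have hW := ((wlyapAt_antitone hsb hst hp (Nat.zero_le N) ht).trans hdec).trans
    (mul_le_mul_of_nonneg_left (h.wlyapAt_start_le hx hxB hp0) (Real.exp_nonneg _))
  have hfin := (sq_add_sq_le_wlyapAt hsb t (p t)).trans (mul_le_mul_of_nonneg_left hW (by norm_num))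
  have hw := sq_nonneg w
  refine le_of_mul_le_mul_left (hfin.trans ?_) hb
  have hE1 := Real.exp_pos (-(N * Γ * x / 8))
  have hE2 := Real.exp_pos (-(N * b / 8))
  rcases le_total (Γ * x) b with hc | hc
  · rw [min_eq_right hc, ← mul_assoc]
    have e1 : 6 * (Real.exp (-(N * Γ * x / 8)) * (2 * (b + 3 * (Γ * x)) * w ^ 2)) ≤
        6 * (Real.exp (-(N * Γ * x / 8)) * (2 * (b + 3 * b) * w ^ 2)) := by gcongr
    have e2 : 0 ≤ b * (48 * w ^ 2 * (N ^ 3 * Real.exp (-(N * b / 8)))) := by positivity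
    rw [← mul_assoc (N : ℝ)]
    linarith
  · rw [min_eq_left hc]
    have e0 : Γ * x ≤ b * N ^ 3 := by
      have e1 : Γ * x ≤ N * N := mul_le_mul h.Gamma_le (hxB.trans h.B_le) hx.le (by positivity)
      nlinarith [mul_le_mul_of_nonneg_right h.bN (by positivity : (0 : ℝ) ≤ N * N)]
    have e1 : 6 * (Real.exp (-(N * b / 8)) * (2 * (b + 3 * (Γ * x)) * w ^ 2)) ≤
        6 * (Real.exp (-(N * b / 8)) * (2 * (b * N ^ 3 + 3 * (b * N ^ 3)) * w ^ 2)) := by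
      have : b ≤ b * N ^ 3 := hc.trans e0
      gcongr
    have e2 : 0 ≤ b * (48 * w ^ 2 * Real.exp (-(N * Γ * x / 8))) := by positivity
    linarith

/-- For `Γ x ≤ b` the iterate is bounded throughout. For `Γ x > b` it may be large at first, but in
the first stage the dissipation bounds the sum by `O(w² / b) = O(N w²)`, and after that stage it is
bounded again. -/
theorem Schedule.bias_stage_sum_le (h : Schedule b κ δ Γ B N L n) {x : ℝ} (hx : 0 < x)
    (hxB : x ≤ B) {w : ℝ} {p : ℕ → ℝ × ℝ} (hp : IsTraj b (δ * x) (Γ * x) (stageOf N L) 0 p)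
    (hp0 : p 0 = (w, 0)) (A : Finset ℕ) {ℓ : ℕ} (hA : ∀ t ∈ A, stageOf N L t = ℓ)
    (hcard : A.card ≤ 2 * N) : ∑ t ∈ A, (p t).1 ^ 2 ≤ 200 * N * w ^ 2 := by
  have hsb := h.stepBounds hx hxB
  have hN := h.N_pos
  have hst := slowStage_stageOf hN L
  have hb := h.b_pos
  have hG := hsb.G_pos
  have hw := sq_nonneg w
  have hstart := h.wlyapAt_start_le hx hxB hp0
  have hN0 : (0 : ℝ) < N := Nat.cast_pos.2 hN
  have hsum : ∀ v : ℝ, 0 ≤ v → (∀ t ∈ A, (p t).1 ^ 2 + (p t).2 ^ 2 ≤ v) →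
      ∑ t ∈ A, (p t).1 ^ 2 ≤ 2 * N * v := fun v hv0 hv => by
    calc ∑ t ∈ A, (p t).1 ^ 2 ≤ A.card • v :=
          Finset.sum_le_card_nsmul _ _ _ fun t ht => by linarith [hv t ht, sq_nonneg (p t).2]
      _ = A.card * v := nsmul_eq_mul _ _
      _ ≤ 2 * N * v := mul_le_mul_of_nonneg_right (by exact_mod_cast hcard) hv0
  rcases le_total (Γ * x) b with hc | hc
  · have := hsum (48 * w ^ 2) (by positivity) fun t _ => by
      have h1 := (sq_add_sq_le_wlyapAt hsb t (p t)).trans (mul_le_mul_of_nonneg_left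
        ((wlyapAt_antitone hsb hst hp le_rfl (Nat.zero_le t)).trans hstart) (by norm_num))
      have h2 : 6 * (2 * (b + 3 * (Γ * x)) * w ^ 2) ≤ 6 * (2 * (b + 3 * b) * w ^ 2) := by gcongr
      refine le_of_mul_le_mul_left (h1.trans ?_) hb
      linarith
    have h3 : 0 ≤ N * w ^ 2 := by positivity
    linarith
  · rcases Nat.eq_zero_or_pos ℓ with h0 | h0
    · subst h0
      have h1 := sum_sq_le_wlyapAt hsb hst hp A 0 fun t ht => ⟨Nat.zero_le t, hA t ht⟩
      rw [pow_zero, div_one] at h1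
      have h2 : 2 * (b + 3 * (Γ * x)) * w ^ 2 ≤ b * (Γ * x) * (8 * N * w ^ 2) := by
        have h3 : 2 * (b + 3 * (Γ * x)) * w ^ 2 ≤ 2 * (Γ * x + 3 * (Γ * x)) * w ^ 2 := by gcongr
        have h4 := mul_le_mul_of_nonneg_right h.bN (by positivity : 0 ≤ 8 * (Γ * x) * w ^ 2)
        linarith
      have h5 := le_of_mul_le_mul_left ((h1.trans hstart).trans h2) (by positivity)
      have h3 : 0 ≤ N * w ^ 2 := by positivity
      linarith
    · have := hsum (96 * w ^ 2) (by positivity) fun t ht => by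
        have htN : N ≤ t := by
          have h1 := hA t ht
          rw [stageOf] at h1
          have h2 : 1 ≤ t / N := by omega
          have := (Nat.le_div_iff_mul_le hN).1 h2
          omega
        refine (h.bias_sq_le hx hxB hp hp0 htN).trans ?_
        have h1 : Real.exp (-(N * Γ * x / 8)) ≤ 1 := by
          rw [Real.exp_le_one_iff, mul_assoc]
          have : 0 ≤ N * (Γ * x) := by positivity
          linarith
        have h2 := h.pow_mul_exp_le (k := 3) (by norm_num)
        have h3 : 48 * w ^ 2 * (Real.exp (-(N * Γ * x / 8)) + N ^ 3 * Real.exp (-(N * b / 8))) ≤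
            48 * w ^ 2 * (1 + 1) := by gcongr
        linarith
      have h3 : 0 ≤ N * w ^ 2 := by positivity
      linarith

end Schedule

/-! ### Summation of the noise over all stages -/

/-- The difference on the right is of order `y² / ((1 + y²)(16 + y²))`, and the exponential decays
faster than `y⁻⁴`. Telescoping along `y, y/4, y/16, …` then avoids any factor for the number of
stages. -/
theorem sq_mul_exp_le_telescope {y : ℝ} (hy : 0 ≤ y) :
    y ^ 2 * Real.exp (-(y / 32)) ≤
      10 ^ 8 * (y ^ 2 / (1 + y ^ 2) - (y / 4) ^ 2 / (1 + (y / 4) ^ 2)) := by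
  have h1 : y ^ 2 / (1 + y ^ 2) - (y / 4) ^ 2 / (1 + (y / 4) ^ 2) =
      15 * y ^ 2 / ((1 + y ^ 2) * (16 + y ^ 2)) := by
    have : (1 + (y / 4) ^ 2) ≠ 0 := by positivity
    have : (1 + y ^ 2) ≠ 0 := by positivity
    have : (16 + y ^ 2) ≠ 0 := by positivity
    field_simp
    ring
  rw [h1, ← mul_div_assoc, le_div_iff₀ (by positivity)]
  have h2 : (1 + y ^ 2) * (16 + y ^ 2) ≤ 10 ^ 8 * 15 * Real.exp (y / 32) := by
    have e1 := Real.pow_div_factorial_le_exp (y / 32) (by positivity) 4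
    have e2 := Real.one_le_exp (by positivity : 0 ≤ y / 32)
    have e3 : (y / 32) ^ 4 / (Nat.factorial 4 : ℕ) = y ^ 4 / (24 * 32 ^ 4) := by
      rw [div_pow, div_div]; norm_num [Nat.factorial]
    rw [e3, div_le_iff₀ (by norm_num)] at e1
    nlinarith [sq_nonneg (y ^ 2 - 1)]
  have h3 : Real.exp (y / 32) * Real.exp (-(y / 32)) = 1 := by
    rw [← Real.exp_add]; simp
  have h4 := mul_le_mul_of_nonneg_right h2 (Real.exp_nonneg (-(y / 32)))
  have h5 := mul_le_mul_of_nonneg_left h4 (sq_nonneg y)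
  have h6 : y ^ 2 * (10 ^ 8 * 15 * Real.exp (y / 32) * Real.exp (-(y / 32))) =
      10 ^ 8 * 15 * y ^ 2 * (Real.exp (y / 32) * Real.exp (-(y / 32))) := by ring
  rw [h6, h3] at h5
  linarith

theorem sum_stage_response_le {y : ℝ} (hy : 0 < y) (L : ℕ) :
    ∑ ℓ ∈ Finset.range L, (1 / 4 ^ ℓ : ℝ) ^ 2 * Real.exp (-(y * (1 / 4 ^ ℓ) / 32)) ≤
      10 ^ 8 / (1 + y ^ 2) := by
  have h0 : ∀ ℓ : ℕ, y ^ 2 * ((1 / 4 ^ ℓ : ℝ) ^ 2 * Real.exp (-(y * (1 / 4 ^ ℓ) / 32))) ≤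
      10 ^ 8 * ((y / 4 ^ ℓ) ^ 2 / (1 + (y / 4 ^ ℓ) ^ 2) -
        (y / 4 ^ (ℓ + 1)) ^ 2 / (1 + (y / 4 ^ (ℓ + 1)) ^ 2)) := fun ℓ => by
    have := sq_mul_exp_le_telescope (y := y / 4 ^ ℓ) (by positivity)
    have e : y / 4 ^ ℓ / 4 = y / 4 ^ (ℓ + 1) := by rw [div_div, ← pow_succ]
    rw [e] at this
    refine le_trans (le_of_eq ?_) this
    rw [mul_one_div]
    ring
  refine le_of_mul_le_mul_left ?_ (pow_pos hy 2)
  rw [Finset.mul_sum]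
  refine (Finset.sum_le_sum fun ℓ _ => h0 ℓ).trans ?_
  rw [← Finset.mul_sum,
    Finset.sum_range_sub' (fun ℓ => (y / 4 ^ ℓ) ^ 2 / (1 + (y / 4 ^ ℓ) ^ 2)) L, pow_zero, div_one]
  have : 0 ≤ (y / 4 ^ L) ^ 2 / (1 + (y / 4 ^ L) ^ 2) := by positivity
  have e : y ^ 2 * (10 ^ 8 / (1 + y ^ 2)) = 10 ^ 8 * (y ^ 2 / (1 + y ^ 2)) := by ring
  rw [e]
  linarith

section Schedule

variable {b κ δ Γ B : ℝ} {N L n : ℕ}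

/-- Noise from an earlier stage has decayed by `resp_sq_le`. Noise from the last stage has no later
stage to decay in, but there `N Γ x q ≤ 1`, so the exponential is at least 1/2 and monotonicity is
enough. -/
theorem Schedule.final_resp_sq_le (h : Schedule b κ δ Γ B N L n) {x : ℝ} (hx : 0 < x)
    (hxB : x ≤ B) {s : ℕ} (hsn : s < n) {p : ℕ → ℝ × ℝ}
    (hp : IsResponse b δ Γ x (stageOf N L) s p) :
    (p n).1 ^ 2 + (p n).2 ^ 2 ≤ 180 * Γ ^ 2 * ((1 / 4 ^ stageOf N L s) ^ 2 *
      Real.exp (-(N * Γ * x * (1 / 4 ^ stageOf N L s) / 32))) +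
      72 * Γ ^ 2 * κ * Real.exp (-(N * b / 8)) := by
  have hΓ := h.Gamma_pos
  have hκ : 0 < κ := by linarith [h.kappa]
  have hb := h.b_pos
  have hδ := h.delta_pos
  have hN := h.N_pos
  have hN0 : (0 : ℝ) < N := Nat.cast_pos.2 hN
  have hr : 0 ≤ 72 * Γ ^ 2 * κ * Real.exp (-(N * b / 8)) := by positivity
  by_cases hs : stageOf N L s + 1 ≤ L - 1
  · have ht : (stageOf N L s + 2) * N ≤ n :=
      (Nat.mul_le_mul_right N (by omega)).trans h.le_n
    rcases h.resp_sq_le hx hxB hp hs ht with ⟨-, h1⟩ | h1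
    · linarith
    · have : 0 ≤ 180 * Γ ^ 2 * ((1 / 4 ^ stageOf N L s) ^ 2 *
        Real.exp (-(N * Γ * x * (1 / 4 ^ stageOf N L s) / 32))) := by positivity
      linarith
  · have hst := slowStage_stageOf hN L
    have hsb := h.stepBounds hx hxB
    have hs' : stageOf N L s = L - 1 := by
      have : stageOf N L s ≤ L - 1 := min_le_right _ _
      omega
    set q : ℝ := 1 / 4 ^ stageOf N L s with hq
    have hq0 : 0 < q := by positivity
    have hW0 : wlyapAt b (δ * x) (Γ * x) (stageOf N L) (s + 1) (p (s + 1)) ≤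
        6 * b * q ^ 2 * Γ ^ 2 * (1 + 4 * κ * δ * x * q) := by
      rw [hp.2]
      exact (wlyapAt_succ_le hsb hst s _).trans (h.wlyapAt_kick_le hx hxB _ s)
    have hW1 := (wlyapAt_antitone hsb hst hp.1 le_rfl hsn).trans hW0
    have hfin := (sq_add_sq_le_wlyapAt hsb n (p n)).trans
      (mul_le_mul_of_nonneg_left hW1 (by norm_num))
    have e0 : N * Γ * x * q ≤ 1 := by
      have e1 : N * Γ * x ≤ N ^ 2 * B := by
        have : N * Γ * x ≤ N * N * B :=
          mul_le_mul (mul_le_mul_of_nonneg_left h.Gamma_le hN0.le) hxB hx.le (by positivity)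
        linarith
      have e2 := mul_le_mul_of_nonneg_right (e1.trans h.last) hq0.le
      have e3 : (4 : ℝ) ^ (L - 1) * q = 1 := by rw [hq, hs']; field_simp
      linarith
    have e1 : 4 * κ * δ * x * q ≤ 1 := by
      have e2 : κ * δ * (N * Γ * x * q) ≤ κ * δ * (b * N) :=
        mul_le_mul_of_nonneg_left (e0.trans h.bN) (by positivity)
      have e3 : N * Γ * (4 * κ * δ * x * q) ≤ N * (4 * δ) * (κ * b) := by linarith
      have e4 : Γ * (N * Γ * (4 * κ * δ * x * q)) ≤ N * (4 * δ) * (κ * b * Γ) := by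
        have := mul_le_mul_of_nonneg_left e3 hΓ.le
        linarith
      rw [← h.delta_eq] at e4
      have e5 : 4 * δ * δ ≤ Γ ^ 2 := by nlinarith [h.two_delta]
      have e6 : N * Γ ^ 2 * (4 * κ * δ * x * q) ≤ N * Γ ^ 2 * 1 := by
        have := mul_le_mul_of_nonneg_left e5 hN0.le
        linarith
      exact le_of_mul_le_mul_left e6 (by positivity)
    have e2 : (p n).1 ^ 2 + (p n).2 ^ 2 ≤ 72 * Γ ^ 2 * q ^ 2 := by
      refine le_of_mul_le_mul_left (hfin.trans ?_) hb
      have : 6 * b * q ^ 2 * Γ ^ 2 * (1 + 4 * κ * δ * x * q) ≤ 6 * b * q ^ 2 * Γ ^ 2 * 2 :=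
        mul_le_mul_of_nonneg_left (by linarith) (by positivity)
      linarith
    have e3 : 1 / 2 ≤ Real.exp (-(N * Γ * x * q / 32)) := by
      have := Real.add_one_le_exp (-(N * Γ * x * q / 32))
      linarith
    have e4 := mul_le_mul_of_nonneg_left e3 (by positivity : 0 ≤ Γ ^ 2 * q ^ 2)
    have e5 : 0 ≤ Γ ^ 2 * q ^ 2 := by positivity
    linarith

/-- The accumulated noise in the final iterate, when the noise level of every stage adds up to at
most `C`. -/
theorem Schedule.final_variance_le (h : Schedule b κ δ Γ B N L n) {x : ℝ} (hx : 0 < x)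
    (hxB : x ≤ B) {p : ℕ → ℕ → ℝ × ℝ}
    (hp : ∀ s < n, IsResponse b δ Γ x (stageOf N L) s (p s)) {c : ℕ → ℝ} {C : ℝ}
    (hc : ∀ s, 0 ≤ c s)
    (hC : ∀ ℓ < L, ∑ s ∈ (Finset.range n).filter fun s => stageOf N L s = ℓ, c s ≤ C) :
    ∑ s ∈ Finset.range n, c s * ((p s n).1 ^ 2 + (p s n).2 ^ 2) ≤
      10 ^ 11 * C * (Γ ^ 2 / (1 + (N * Γ * x) ^ 2)) := by
  have hΓ := h.Gamma_pos
  have hκ : 0 < κ := by linarith [h.kappa]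
  have hN0 : (0 : ℝ) < N := Nat.cast_pos.2 h.N_pos
  have hL := h.L_ge
  set V : ℕ → ℝ := fun ℓ => 180 * Γ ^ 2 * ((1 / 4 ^ ℓ) ^ 2 *
      Real.exp (-(N * Γ * x * (1 / 4 ^ ℓ) / 32))) +
      72 * Γ ^ 2 * κ * Real.exp (-(N * b / 8)) with hV
  have hV0 : ∀ ℓ, 0 ≤ V ℓ := fun ℓ => by positivity
  have hmap : ∀ s ∈ Finset.range n, stageOf N L s ∈ Finset.range L := fun s _ => by
    rw [Finset.mem_range, stageOf]; omega
  have hC0 : 0 ≤ C := (Finset.sum_nonneg fun s _ => hc s).trans (hC 0 (by omega))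
  have h1 : ∑ s ∈ Finset.range n, c s * ((p s n).1 ^ 2 + (p s n).2 ^ 2) ≤
      ∑ ℓ ∈ Finset.range L, C * V ℓ := by
    rw [← Finset.sum_fiberwise_of_maps_to hmap]
    refine Finset.sum_le_sum fun ℓ hℓ => ?_
    calc _ ≤ ∑ s ∈ (Finset.range n).filter fun s => stageOf N L s = ℓ, c s * V ℓ := by
          refine Finset.sum_le_sum fun s hs => mul_le_mul_of_nonneg_left ?_ (hc s)
          rw [Finset.mem_filter, Finset.mem_range] at hs
          have := h.final_resp_sq_le hx hxB hs.1 (hp s hs.1)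
          rwa [hs.2] at this
      _ = (∑ s ∈ (Finset.range n).filter fun s => stageOf N L s = ℓ, c s) * V ℓ := by
          rw [Finset.sum_mul]
      _ ≤ C * V ℓ := mul_le_mul_of_nonneg_right (hC ℓ (Finset.mem_range.1 hℓ)) (hV0 ℓ)
  refine h1.trans ?_
  set y := N * Γ * x with hy
  have hy0 : 0 < y := by positivity
  have h2 : ∑ ℓ ∈ Finset.range L, C * V ℓ = C * (180 * Γ ^ 2 *
      ∑ ℓ ∈ Finset.range L, (1 / 4 ^ ℓ : ℝ) ^ 2 * Real.exp (-(y * (1 / 4 ^ ℓ) / 32)) +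
      L * (72 * Γ ^ 2 * κ * Real.exp (-(N * b / 8)))) := by
    rw [← Finset.mul_sum, hV, Finset.sum_add_distrib, ← Finset.mul_sum, Finset.sum_const,
      Finset.card_range, nsmul_eq_mul]
  rw [h2]
  have h3 := mul_le_mul_of_nonneg_left (sum_stage_response_le hy0 L)
    (by positivity : 0 ≤ 180 * Γ ^ 2)
  have h4 : (L : ℝ) * (72 * Γ ^ 2 * κ * Real.exp (-(N * b / 8))) ≤
      144 * Γ ^ 2 / (1 + y ^ 2) := by
    rw [le_div_iff₀ (by positivity)]
    have e1 : y ≤ N ^ 3 := by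
      have : N * Γ * x ≤ N * N * N :=
        mul_le_mul (mul_le_mul_of_nonneg_left h.Gamma_le hN0.le) (hxB.trans h.B_le) hx.le
          (by positivity)
      linarith
    have e2 : 1 + y ^ 2 ≤ 2 * N ^ 6 := by
      have e3 : y ^ 2 ≤ (N ^ 3) ^ 2 := pow_le_pow_left₀ hy0.le e1 2
      have e4 : (1 : ℝ) ≤ N ^ 6 := one_le_pow₀ h.one_le_N
      have e5 : ((N : ℝ) ^ 3) ^ 2 = N ^ 6 := by ring
      linarith
    have e3 : (L : ℝ) * κ * (1 + y ^ 2) ≤ N * N * (2 * N ^ 6) :=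
      mul_le_mul (mul_le_mul (Nat.cast_le.2 h.L_le) h.kappa_le hκ.le hN0.le) e2 (by positivity)
        (by positivity)
    have e4 := mul_le_mul_of_nonneg_right e3 (Real.exp_nonneg (-(N * b / 8)))
    have e5 := h.pow_mul_exp_le (k := 8) (by norm_num)
    have e6 : (L : ℝ) * κ * (1 + y ^ 2) * Real.exp (-(N * b / 8)) ≤ 2 := by linarith
    have := mul_le_mul_of_nonneg_left e6 (by positivity : 0 ≤ 72 * Γ ^ 2)
    linarith
  have h5 : 180 * Γ ^ 2 * (10 ^ 8 / (1 + y ^ 2)) + 144 * Γ ^ 2 / (1 + y ^ 2) ≤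
      10 ^ 11 * (Γ ^ 2 / (1 + y ^ 2)) := by
    have : 0 ≤ Γ ^ 2 / (1 + y ^ 2) := by positivity
    have e : 180 * Γ ^ 2 * (10 ^ 8 / (1 + y ^ 2)) + 144 * Γ ^ 2 / (1 + y ^ 2) =
        (180 * 10 ^ 8 + 144) * (Γ ^ 2 / (1 + y ^ 2)) := by ring
    rw [e]; nlinarith
  have h6 := mul_le_mul_of_nonneg_left ((add_le_add h3 h4).trans h5) hC0
  linarith

end Schedule

/-! ### One noisy step -/

section Noise

variable {ψ σ : ℝ} {d : ℕ} {lam m w : Fin d → ℝ} {T : Matrix (Fin d) (Fin d) ℝ}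
  {P Q : Measure (Obs d)}

theorem HasSecondMoment.memLp_dotProduct {S : Matrix (Fin d) (Fin d) ℝ}
    (h : HasSecondMoment P S) (k : Fin d → ℝ) : MemLp (fun z : Obs d => k ⬝ᵥ z.1) 2 P :=
  memLp_finsetSum _ fun i _ => (h.memLp_x i).const_mul (k i)

theorem HasSecondMoment.memLp_residual {S : Matrix (Fin d) (Fin d) ℝ}
    (h : HasSecondMoment P S) (k : Fin d → ℝ) : MemLp (fun z : Obs d => z.2 - k ⬝ᵥ z.1) 2 P :=
  h.memLp_y.sub (h.memLp_dotProduct k)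

theorem HasSecondMoment.integral_dotProduct_mul
    (h : HasSecondMoment P (Matrix.diagonal lam)) (k u : Fin d → ℝ) :
    ∫ z, (k ⬝ᵥ z.1) * (u ⬝ᵥ z.1) ∂P = ∑ i, lam i * (k i * u i) := by
  have hi : ∀ i j, Integrable (fun z : Obs d => (k i * u j) * (z.1 i * z.1 j)) P := fun i j =>
    ((h.memLp_x i).integrable_mul (h.memLp_x j)).const_mul _
  have e : ∀ z : Obs d, (k ⬝ᵥ z.1) * (u ⬝ᵥ z.1) =
      ∑ i, ∑ j, (k i * u j) * (z.1 i * z.1 j) := fun z => by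
    simp only [dotProduct]
    rw [Finset.sum_mul_sum]
    exact Finset.sum_congr rfl fun i _ => Finset.sum_congr rfl fun j _ => by ring
  simp_rw [e]
  rw [integral_finsetSum _ fun i _ => integrable_finsetSum _ fun j _ => hi i j]
  refine Finset.sum_congr rfl fun i _ => ?_
  rw [integral_finsetSum _ fun j _ => hi i j, Finset.sum_eq_single i]
  · rw [integral_const_mul, h.second_moment, Matrix.diagonal_apply_eq]; ring
  · intro j _ hj
    rw [integral_const_mul, h.second_moment, Matrix.diagonal_apply_ne _ hj.symm, mul_zero]
  · simp

/-- The normal equations for the minimizer of the risk. -/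
theorem IsProblem.integral_residual_mul (h : IsProblem ψ σ lam m T P Q w) (k : Fin d → ℝ) :
    ∫ z, (z.2 - w ⬝ᵥ z.1) * (k ⬝ᵥ z.1) ∂P = 0 := by
  have hε := h.source.memLp_residual w
  have hA := h.source.memLp_dotProduct k
  have i1 : Integrable (fun z : Obs d => (z.2 - w ⬝ᵥ z.1) ^ 2) P := hε.integrable_sq
  have i2 : Integrable (fun z : Obs d => (z.2 - w ⬝ᵥ z.1) * (k ⬝ᵥ z.1)) P := hε.integrable_mul hA
  have i3 : Integrable (fun z : Obs d => (k ⬝ᵥ z.1) ^ 2) P := hA.integrable_sq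
  set e := ∫ z, (z.2 - w ⬝ᵥ z.1) * (k ⬝ᵥ z.1) ∂P with he
  set q := ∫ z, (k ⬝ᵥ z.1) ^ 2 ∂P with hq
  have hq0 : 0 ≤ q := integral_nonneg fun z => sq_nonneg _
  have hexp : ∀ t : ℝ, 0 ≤ -(2 * t) * e + t ^ 2 * q := fun t => by
    have h1 := h.source_min (w + t • k)
    rw [popRisk, popRisk] at h1
    have e1 : ∀ z : Obs d, (z.2 - (w + t • k) ⬝ᵥ z.1) ^ 2 = (z.2 - w ⬝ᵥ z.1) ^ 2 +
        (-(2 * t) * ((z.2 - w ⬝ᵥ z.1) * (k ⬝ᵥ z.1)) + t ^ 2 * (k ⬝ᵥ z.1) ^ 2) := fun z => by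
      rw [add_dotProduct, smul_dotProduct, smul_eq_mul]; ring
    have i4 : Integrable (fun z : Obs d => -(2 * t) * ((z.2 - w ⬝ᵥ z.1) * (k ⬝ᵥ z.1)) +
        t ^ 2 * (k ⬝ᵥ z.1) ^ 2) P := (i2.const_mul _).add (i3.const_mul _)
    simp_rw [e1] at h1
    rw [integral_add i1 i4, integral_add (i2.const_mul _) (i3.const_mul _), integral_const_mul,
      integral_const_mul] at h1
    linarith
  -- Dividing by `q + 1` instead of the optimal `q` covers `q = 0` and still yields a negative
  -- multiple of `e ^ 2`.
  have h2 := hexp (e / (q + 1))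
  have h3 : -(2 * (e / (q + 1))) * e + (e / (q + 1)) ^ 2 * q =
      -(e ^ 2 * ((q + 2) / (q + 1) ^ 2)) := by
    field_simp; ring
  rw [h3] at h2
  have h4 : 0 < (q + 2) / (q + 1) ^ 2 := by positivity
  have h5 : e ^ 2 ≤ 0 := by
    by_contra hc
    have := mul_pos (not_le.1 hc) h4
    linarith
  exact pow_eq_zero_iff two_ne_zero |>.1 (le_antisymm h5 (sq_nonneg e))

/-- The deviation of the stochastic gradient from its mean, at the centred point `u`. -/
def gradNoise (lam w : Fin d → ℝ) (z : Obs d) (u : Fin d → ℝ) (i : Fin d) : ℝ :=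
  lam i * u i - (u ⬝ᵥ z.1) * z.1 i + (z.2 - w ⬝ᵥ z.1) * z.1 i

theorem memLp_two_of_lintegral_le {α : Type*} [MeasurableSpace α] {μ : Measure α} {f : α → ℝ}
    (hf : AEStronglyMeasurable f μ) {C : ℝ} (h : ∫⁻ z, ENNReal.ofReal (f z ^ 2) ∂μ ≤ ENNReal.ofReal C)
    : MemLp f 2 μ := by
  rw [memLp_two_iff_integrable_sq hf]
  refine ⟨hf.pow 2, ?_⟩
  rw [hasFiniteIntegral_iff_ofReal (Filter.Eventually.of_forall fun z => sq_nonneg _)]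
  exact h.trans_lt ENNReal.ofReal_lt_top

theorem integral_sq_le_of_lintegral_le {α : Type*} [MeasurableSpace α] {μ : Measure α} {f : α → ℝ}
    (hf : MemLp f 2 μ) {C : ℝ} (hC : 0 ≤ C)
    (h : ∫⁻ z, ENNReal.ofReal (f z ^ 2) ∂μ ≤ ENNReal.ofReal C) : ∫ z, f z ^ 2 ∂μ ≤ C := by
  rw [← ofReal_integral_eq_lintegral_ofReal hf.integrable_sq
    (Filter.Eventually.of_forall fun z => sq_nonneg _)] at h
  exact (ENNReal.ofReal_le_ofReal_iff hC).1 h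

/-- The gradient noise is centred, by the normal equations and the second moments, so it has no
cross term with `c`. Its variance is split by `(A + B)² ≤ 2A² + 2B²` into a covariate part, bounded
by the fourth-moment condition for `u uᵀ`, and a residual part, bounded by the noise condition;
these are not assumed uncorrelated. -/
theorem IsProblem.lintegral_noise_le (h : IsProblem ψ σ lam m T P Q w) (hψ : 0 ≤ ψ)
    (hlam : ∀ i, 0 ≤ lam i) (u k : Fin d → ℝ) (c : ℝ) :
    ∫⁻ z, ENNReal.ofReal ((c + ∑ i, k i * gradNoise lam w z u i) ^ 2) ∂P ≤
      ENNReal.ofReal (c ^ 2 + (2 * ψ * (∑ i, lam i * u i ^ 2) + 2 * σ ^ 2) *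
        ∑ i, lam i * k i ^ 2) := by
  have := h.source.prob
  have hU := h.source.memLp_dotProduct u
  have hA := h.source.memLp_dotProduct k
  have hε := h.source.memLp_residual w
  have hu0 := sqNorm_diagonal_nonneg hlam u
  have hk0 := sqNorm_diagonal_nonneg hlam k
  have h4 : ∫⁻ z, ENNReal.ofReal (((k ⬝ᵥ z.1) * (u ⬝ᵥ z.1)) ^ 2) ∂P ≤
      ENNReal.ofReal (ψ * (∑ i, lam i * u i ^ 2) * ∑ i, lam i * k i ^ 2) := by
    have h1 := h.fourth_moment (Matrix.vecMulVec u u)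
      (by simpa using Matrix.posSemidef_vecMulVec_self_star u) k
    have e1 : ∀ x : Fin d → ℝ, sqNorm (Matrix.vecMulVec u u) x = (u ⬝ᵥ x) ^ 2 := fun x => by
      rw [sqNorm, Matrix.vecMulVec_mulVec]
      simp [dotProduct_comm, pow_two]
    have e2 : (Matrix.diagonal lam * Matrix.vecMulVec u u).trace = ∑ i, lam i * u i ^ 2 := by
      refine Finset.sum_congr rfl fun i _ => ?_
      rw [Matrix.diag_apply, Matrix.diagonal_mul, Matrix.vecMulVec_apply, pow_two]
    rw [e2, sqNorm_diagonal] at h1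
    simpa only [e1, mul_pow] using h1
  have hn : ∫⁻ z, ENNReal.ofReal (((z.2 - w ⬝ᵥ z.1) * (k ⬝ᵥ z.1)) ^ 2) ∂P ≤
      ENNReal.ofReal (σ ^ 2 * ∑ i, lam i * k i ^ 2) := by
    have h1 := h.noise k
    rw [sqNorm_diagonal] at h1
    simpa only [mul_pow] using h1
  have m4 : MemLp (fun z : Obs d => (k ⬝ᵥ z.1) * (u ⬝ᵥ z.1)) 2 P :=
    memLp_two_of_lintegral_le (hA.aestronglyMeasurable.mul hU.aestronglyMeasurable) h4
  have mn : MemLp (fun z : Obs d => (z.2 - w ⬝ᵥ z.1) * (k ⬝ᵥ z.1)) 2 P :=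
    memLp_two_of_lintegral_le (hε.aestronglyMeasurable.mul hA.aestronglyMeasurable) hn
  have I4 := integral_sq_le_of_lintegral_le m4 (by positivity) h4
  have In := integral_sq_le_of_lintegral_le mn (by positivity) hn
  set K := ∑ i, lam i * (k i * u i) with hK
  have J4 : ∫ z, (k ⬝ᵥ z.1) * (u ⬝ᵥ z.1) ∂P = K := h.source.integral_dotProduct_mul k u
  have Jn := h.integral_residual_mul k
  have i4 : Integrable (fun z : Obs d => (k ⬝ᵥ z.1) * (u ⬝ᵥ z.1)) P := hA.integrable_mul hU
  have in' : Integrable (fun z : Obs d => (z.2 - w ⬝ᵥ z.1) * (k ⬝ᵥ z.1)) P := hε.integrable_mul hA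
  have hsum : ∀ z : Obs d, ∑ i, k i * gradNoise lam w z u i =
      K - (k ⬝ᵥ z.1) * (u ⬝ᵥ z.1) + (z.2 - w ⬝ᵥ z.1) * (k ⬝ᵥ z.1) := fun z => by
    have e1 : (k ⬝ᵥ z.1) * (u ⬝ᵥ z.1) = ∑ i, k i * ((u ⬝ᵥ z.1) * z.1 i) := by
      rw [show k ⬝ᵥ z.1 = ∑ i, k i * z.1 i from rfl, Finset.sum_mul]
      exact Finset.sum_congr rfl fun i _ => by ring
    have e2 : (z.2 - w ⬝ᵥ z.1) * (k ⬝ᵥ z.1) = ∑ i, k i * ((z.2 - w ⬝ᵥ z.1) * z.1 i) := by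
      rw [show k ⬝ᵥ z.1 = ∑ i, k i * z.1 i from rfl, Finset.mul_sum]
      exact Finset.sum_congr rfl fun i _ => by ring
    rw [e1, e2, hK, ← Finset.sum_sub_distrib, ← Finset.sum_add_distrib]
    exact Finset.sum_congr rfl fun i _ => by rw [gradNoise]; ring
  have hpt : ∀ z : Obs d, (c + ∑ i, k i * gradNoise lam w z u i) ^ 2 ≤
      (c ^ 2 + 2 * c * K + 2 * K ^ 2) + ((-(2 * c) - 4 * K) * ((k ⬝ᵥ z.1) * (u ⬝ᵥ z.1)) +
      (2 * c * ((z.2 - w ⬝ᵥ z.1) * (k ⬝ᵥ z.1)) + (2 * ((k ⬝ᵥ z.1) * (u ⬝ᵥ z.1)) ^ 2 +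
        2 * ((z.2 - w ⬝ᵥ z.1) * (k ⬝ᵥ z.1)) ^ 2))) := fun z => by
    rw [hsum z]
    nlinarith [sq_nonneg (K - (k ⬝ᵥ z.1) * (u ⬝ᵥ z.1) - (z.2 - w ⬝ᵥ z.1) * (k ⬝ᵥ z.1))]
  have j1 : Integrable (fun z : Obs d => 2 * ((k ⬝ᵥ z.1) * (u ⬝ᵥ z.1)) ^ 2 +
        2 * ((z.2 - w ⬝ᵥ z.1) * (k ⬝ᵥ z.1)) ^ 2) P :=
    (m4.integrable_sq.const_mul _).add (mn.integrable_sq.const_mul _)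
  have j2 : Integrable (fun z : Obs d => 2 * c * ((z.2 - w ⬝ᵥ z.1) * (k ⬝ᵥ z.1)) +
      (2 * ((k ⬝ᵥ z.1) * (u ⬝ᵥ z.1)) ^ 2 + 2 * ((z.2 - w ⬝ᵥ z.1) * (k ⬝ᵥ z.1)) ^ 2)) P :=
    (in'.const_mul _).add j1
  have j3 : Integrable (fun z : Obs d => (-(2 * c) - 4 * K) * ((k ⬝ᵥ z.1) * (u ⬝ᵥ z.1)) +
      (2 * c * ((z.2 - w ⬝ᵥ z.1) * (k ⬝ᵥ z.1)) +
      (2 * ((k ⬝ᵥ z.1) * (u ⬝ᵥ z.1)) ^ 2 + 2 * ((z.2 - w ⬝ᵥ z.1) * (k ⬝ᵥ z.1)) ^ 2))) P :=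
    (i4.const_mul _).add j2
  have j0 : Integrable (fun z : Obs d => (c ^ 2 + 2 * c * K + 2 * K ^ 2) +
      ((-(2 * c) - 4 * K) * ((k ⬝ᵥ z.1) * (u ⬝ᵥ z.1)) +
      (2 * c * ((z.2 - w ⬝ᵥ z.1) * (k ⬝ᵥ z.1)) +
      (2 * ((k ⬝ᵥ z.1) * (u ⬝ᵥ z.1)) ^ 2 + 2 * ((z.2 - w ⬝ᵥ z.1) * (k ⬝ᵥ z.1)) ^ 2)))) P :=
    (integrable_const _).add j3
  refine (lintegral_mono fun z => ENNReal.ofReal_le_ofReal (hpt z)).trans ?_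
  rw [← ofReal_integral_eq_lintegral_ofReal j0
    (Filter.Eventually.of_forall fun z => (sq_nonneg _).trans (hpt z))]
  refine ENNReal.ofReal_le_ofReal ?_
  rw [integral_add (integrable_const _) j3, integral_add (i4.const_mul _) j2,
    integral_add (in'.const_mul _) j1, integral_add (m4.integrable_sq.const_mul _)
    (mn.integrable_sq.const_mul _), integral_const_mul, integral_const_mul, integral_const_mul,
    integral_const_mul, J4, Jn, integral_const]
  simp only [probReal_univ, one_smul]
  nlinarith [sq_nonneg K]

end Noise

/-! ### The second moments of the iterates -/

/-- The momentum parameters of ASGD as functions of the averaging rate `b`, and the long step size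
as a function of the effective step size `Γ`. -/
noncomputable def alphaOf (b : ℝ) : ℝ := (1 - b) / (1 - b / 2)

/-- The factor `2 - b` cancels the rescaling of the momentum in `modeOf`; with it the two components
of a kick add up to `Γ`, up to the division at the stage. -/
noncomputable def gammaOf (b δ Γ : ℝ) : ℝ := δ + (2 - b) * (Γ - δ)

/-- `k` iterations of ASGD, with the step sizes of iteration `t` divided by `4 ^ st t`. -/
noncomputable def asgdRun {d : ℕ} (b δ Γ : ℝ) (st : ℕ → ℕ) (k : ℕ) (data : Fin k → Obs d) :
    (Fin d → ℝ) × (Fin d → ℝ) :=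
  Fin.foldl k (fun p t => asgdStep (alphaOf b) (b / 2) (δ / 4 ^ st t) (gammaOf b δ Γ / 4 ^ st t)
    (data t) p) (0, 0)

theorem asgdRun_succ {d : ℕ} (b δ Γ : ℝ) (st : ℕ → ℕ) (k : ℕ) (data : Fin (k + 1) → Obs d) :
    asgdRun b δ Γ st (k + 1) data = asgdStep (alphaOf b) (b / 2) (δ / 4 ^ st k)
      (gammaOf b δ Γ / 4 ^ st k) (data (Fin.last k))
      (asgdRun b δ Γ st k fun i => data i.castSucc) := by
  rw [asgdRun, Fin.foldl_succ_last]
  rfl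

theorem measurable_asgdRun {d : ℕ} (b δ Γ : ℝ) (st : ℕ → ℕ) (k : ℕ) :
    Measurable fun data : Fin k → Obs d => asgdRun b δ Γ st k data := by
  induction k with
  | zero =>
    have : (fun data : Fin 0 → Obs d => asgdRun b δ Γ st 0 data) = fun _ => (0, 0) := by
      ext data <;> simp [asgdRun]
    rw [this]; exact measurable_const
  | succ k ih =>
    simp_rw [asgdRun_succ]
    have h1 : Measurable fun data : Fin (k + 1) → Obs d =>
        asgdRun b δ Γ st k fun i => data i.castSucc :=
      ih.comp (measurable_pi_lambda _ fun i => measurable_pi_apply _)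
    have h2 : Measurable fun q : Obs d × ((Fin d → ℝ) × (Fin d → ℝ)) =>
        asgdStep (alphaOf b) (b / 2) (δ / 4 ^ st k) (gammaOf b δ Γ / 4 ^ st k) q.1 q.2 := by
      unfold asgdStep dotProduct
      fun_prop
    exact h2.comp ((measurable_pi_apply (Fin.last k)).prodMk h1)

/-- The centred iterate and the rescaled momentum of a state `(w, v)` in the `i`-th coordinate. -/
noncomputable def modeOf {d : ℕ} (b : ℝ) (w : Fin d → ℝ) (p : (Fin d → ℝ) × (Fin d → ℝ))
    (i : Fin d) : ℝ × ℝ :=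
  (alphaOf b * p.1 i + (1 - alphaOf b) * p.2 i - w i, (1 - b) / (2 - b) * (p.2 i - p.1 i))

/-- Because the covariance is diagonal, the mean gradient acts in each coordinate separately; all
coupling of the modes sits in `gradNoise`. -/
theorem modeOf_asgdStep {d : ℕ} {b δ Γ : ℝ} (hb : b < 1) (lam w : Fin d → ℝ) (ℓ : ℕ) (z : Obs d)
    (p : (Fin d → ℝ) × (Fin d → ℝ)) (i : Fin d) :
    modeOf b w (asgdStep (alphaOf b) (b / 2) (δ / 4 ^ ℓ) (gammaOf b δ Γ / 4 ^ ℓ) z p) i =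
      modeStep b (δ * lam i / 4 ^ ℓ) (Γ * lam i / 4 ^ ℓ) (modeOf b w p i) +
        gradNoise lam w z (fun j => (modeOf b w p j).1) i • kick b δ Γ ℓ := by
  have h1 : 1 - b / 2 ≠ 0 := by linarith
  have h2 : 2 - b ≠ 0 := by linarith
  have hu : (fun j => (modeOf b w p j).1) ⬝ᵥ z.1 =
      z.1 ⬝ᵥ (alphaOf b • p.1 + (1 - alphaOf b) • p.2) - w ⬝ᵥ z.1 := by
    rw [dotProduct_comm z.1, ← sub_dotProduct]
    rfl
  rw [gradNoise, hu]
  set a := z.1 ⬝ᵥ (alphaOf b • p.1 + (1 - alphaOf b) • p.2) with ha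
  set e := w ⬝ᵥ z.1 with he
  ext
  · simp only [modeOf, asgdStep, modeStep, kick, Prod.fst_add, Prod.smul_fst, Pi.add_apply,
      Pi.sub_apply, Pi.smul_apply, smul_eq_mul, ← ha]
    simp only [alphaOf, gammaOf]
    field_simp
    ring
  · simp only [modeOf, asgdStep, modeStep, kick, Prod.snd_add, Prod.smul_snd, Pi.add_apply,
      Pi.sub_apply, Pi.smul_apply, smul_eq_mul, ← ha]
    simp only [alphaOf, gammaOf]
    field_simp
    ring

/-- The mean dynamics of a mode, started in the state `p` at time `s`. -/
noncomputable def flow (b D G : ℝ) (st : ℕ → ℕ) (s : ℕ) (p : ℝ × ℝ) : ℕ → ℝ × ℝ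
  | 0 => p
  | t + 1 => if s ≤ t then modeStep b (D / 4 ^ st t) (G / 4 ^ st t) (flow b D G st s p t) else p

theorem flow_self (b D G : ℝ) (st : ℕ → ℕ) (s : ℕ) (p : ℝ × ℝ) : flow b D G st s p s = p := by
  cases s with
  | zero => rfl
  | succ s => simp [flow]

theorem isTraj_flow (b D G : ℝ) (st : ℕ → ℕ) (s : ℕ) (p : ℝ × ℝ) :
    IsTraj b D G st s (flow b D G st s p) := fun t ht => by
  rw [flow, if_pos ht]

theorem isResponse_flow (b δ Γ x : ℝ) (st : ℕ → ℕ) (s : ℕ) :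
    IsResponse b δ Γ x st s (flow b (δ * x) (Γ * x) st (s + 1) (kick b δ Γ (st s))) :=
  ⟨isTraj_flow _ _ _ _ _ _, flow_self _ _ _ _ _ _⟩

/-- The pairing of a linear functional with the state of a mode. -/
def pair (f p : ℝ × ℝ) : ℝ := f.1 * p.1 + f.2 * p.2

/-- The adjoint of a step of the mean dynamics. -/
def adjStep (b D G : ℝ) (f : ℝ × ℝ) : ℝ × ℝ :=
  ((1 - D) * f.1 - (G - D) * (b * f.1 + (1 - b) * f.2), b * f.1 + (1 - b) * f.2)

theorem pair_modeStep (b D G : ℝ) (f p : ℝ × ℝ) :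
    pair f (modeStep b D G p) = pair (adjStep b D G f) p := by
  simp only [pair, modeStep, adjStep]; ring

theorem measurable_sum_pair_modeOf {d : ℕ} (b δ Γ : ℝ) (st : ℕ → ℕ) (w : Fin d → ℝ) (k : ℕ)
    (f : Fin d → ℝ × ℝ) :
    Measurable fun data : Fin k → Obs d =>
      ∑ i, pair (f i) (modeOf b w (asgdRun b δ Γ st k data) i) := by
  have h : Measurable fun p : (Fin d → ℝ) × (Fin d → ℝ) => ∑ i, pair (f i) (modeOf b w p i) := by
    unfold pair modeOf; fun_prop
  exact h.comp (measurable_asgdRun b δ Γ st k)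

/-- The mean square of a linear functional of the `t`-th iterate: the square of its mean, plus the
contributions of the noise terms at times `s < t`, with noise level determined by `f s`. -/
noncomputable def momentBound {d : ℕ} (ψ σ b δ Γ : ℝ) (lam w : Fin d → ℝ) (st : ℕ → ℕ)
    (f : ℕ → ℝ) (t : ℕ) (g : Fin d → ℝ × ℝ) : ℝ :=
  (∑ i, pair (g i) (flow b (δ * lam i) (Γ * lam i) st 0 (-w i, 0) t)) ^ 2 +
    ∑ s ∈ Finset.range t, (2 * ψ * f s + 2 * σ ^ 2) * ∑ i, lam i *
      pair (g i) (flow b (δ * lam i) (Γ * lam i) st (s + 1) (kick b δ Γ (st s)) t) ^ 2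

theorem momentBound_nonneg {d : ℕ} {ψ : ℝ} (hψ : 0 ≤ ψ) (σ b δ Γ : ℝ) {lam : Fin d → ℝ}
    (hlam : ∀ i, 0 ≤ lam i) (w : Fin d → ℝ) (st : ℕ → ℕ) {f : ℕ → ℝ} (hf : ∀ t, 0 ≤ f t) (t : ℕ)
    (g : Fin d → ℝ × ℝ) : 0 ≤ momentBound ψ σ b δ Γ lam w st f t g := by
  refine add_nonneg (sq_nonneg _) (Finset.sum_nonneg fun s _ => mul_nonneg ?_
    (Finset.sum_nonneg fun j _ => mul_nonneg (hlam j) (sq_nonneg _)))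
  have := hf s
  positivity

theorem momentBound_succ {d : ℕ} (ψ σ b δ Γ : ℝ) (lam w : Fin d → ℝ) (st : ℕ → ℕ)
    (f : ℕ → ℝ) (t : ℕ) (g : Fin d → ℝ × ℝ) :
    momentBound ψ σ b δ Γ lam w st f (t + 1) g =
      momentBound ψ σ b δ Γ lam w st f t
        (fun i => adjStep b (δ * lam i / 4 ^ st t) (Γ * lam i / 4 ^ st t) (g i)) +
      (2 * ψ * f t + 2 * σ ^ 2) * ∑ i, lam i * pair (g i) (kick b δ Γ (st t)) ^ 2 := by
  have h : ∀ (i : Fin d) (s : ℕ) (p : ℝ × ℝ), s ≤ t →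
      pair (g i) (flow b (δ * lam i) (Γ * lam i) st s p (t + 1)) =
      pair (adjStep b (δ * lam i / 4 ^ st t) (Γ * lam i / 4 ^ st t) (g i))
        (flow b (δ * lam i) (Γ * lam i) st s p t) := fun i s p hs => by
    rw [flow, if_pos hs, pair_modeStep]
  rw [momentBound, momentBound, Finset.sum_range_succ, ← add_assoc]
  congr 1
  · congr 1
    · congr 1
      exact Finset.sum_congr rfl fun i _ => h i 0 _ (Nat.zero_le t)
    · refine Finset.sum_congr rfl fun s hs => ?_
      congr 1
      exact Finset.sum_congr rfl fun i _ => by rw [h i (s + 1) _ (Finset.mem_range.1 hs)]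
  · congr 1
    exact Finset.sum_congr rfl fun i _ => by rw [flow_self]

/-- The bound for the mean squared `S`-norm of the centred iterate. -/
noncomputable def energyBound {d : ℕ} (ψ σ b δ Γ : ℝ) (lam w : Fin d → ℝ) (st : ℕ → ℕ)
    (f : ℕ → ℝ) (t : ℕ) : ℝ :=
  ∑ i, lam i * momentBound ψ σ b δ Γ lam w st f t (Pi.single i (1, 0))

/-- Induction on time for all functionals at once: the mean step passes to the functional as its
adjoint, and the new observation is independent of the past. The variance it adds involves the mean
squared `S`-norm of the current iterate, a combination of squared coordinate functionals to which
the induction hypothesis applies. The assumption on `f` closes the loop. -/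
theorem lintegral_moment_le {ψ σ : ℝ} {d : ℕ} {lam m w : Fin d → ℝ}
    {T : Matrix (Fin d) (Fin d) ℝ} {P Q : Measure (Obs d)} (h : IsProblem ψ σ lam m T P Q w)
    (hψ : 0 ≤ ψ) (hlam : ∀ i, 0 ≤ lam i) {b δ Γ : ℝ} (hb : b < 1) (st : ℕ → ℕ) {f : ℕ → ℝ}
    (hf0 : ∀ t, 0 ≤ f t) (hf : ∀ t, energyBound ψ σ b δ Γ lam w st f t ≤ f t) (t : ℕ)
    (g : Fin d → ℝ × ℝ) :
    ∫⁻ data, ENNReal.ofReal ((∑ i, pair (g i) (modeOf b w (asgdRun b δ Γ st t data) i)) ^ 2)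
        ∂(Measure.pi fun _ : Fin t => P) ≤
      ENNReal.ofReal (momentBound ψ σ b δ Γ lam w st f t g) := by
  have := h.source.prob
  induction t generalizing g with
  | zero =>
    have e : ∀ data : Fin 0 → Obs d, ∀ i, modeOf b w (asgdRun b δ Γ st 0 data) i = (-w i, 0) :=
      fun data i => by simp [asgdRun, modeOf]
    simp_rw [e]
    rw [lintegral_const, momentBound]
    simp [flow]
  | succ t ih =>
    have hm := ((measurable_sum_pair_modeOf b δ Γ st w (t + 1) g).pow_const 2).ennreal_ofReal
    rw [lintegral_pi_succ P hm]
    set g' : Fin d → ℝ × ℝ := fun i =>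
      adjStep b (δ * lam i / 4 ^ st t) (Γ * lam i / 4 ^ st t) (g i) with hg'
    set k : Fin d → ℝ := fun i => pair (g i) (kick b δ Γ (st t)) with hk
    have hk0 := sqNorm_diagonal_nonneg hlam k
    set U : (Fin t → Obs d) → Fin d → ℝ := fun data j =>
      (modeOf b w (asgdRun b δ Γ st t data) j).1 with hU
    have hUm : ∀ i, Measurable fun data => U data i := fun i => by
      have h1 : Measurable fun p : (Fin d → ℝ) × (Fin d → ℝ) => (modeOf b w p i).1 := by
        unfold modeOf; fun_prop
      exact h1.comp (measurable_asgdRun b δ Γ st t)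
    have hstep : ∀ data : Fin t → Obs d, ∀ z : Obs d,
        ∑ i, pair (g i) (modeOf b w (asgdRun b δ Γ st (t + 1) (Fin.snoc data z)) i) =
        ∑ i, pair (g' i) (modeOf b w (asgdRun b δ Γ st t data) i) +
          ∑ i, k i * gradNoise lam w z (U data) i := fun data z => by
      rw [← Finset.sum_add_distrib]
      refine Finset.sum_congr rfl fun i _ => ?_
      rw [asgdRun_succ]
      simp only [Fin.snoc_last, Fin.snoc_castSucc]
      rw [modeOf_asgdStep hb lam, hg', ← pair_modeStep]
      simp only [pair, hk, hU, Prod.fst_add, Prod.snd_add, Prod.smul_fst, Prod.smul_snd,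
        smul_eq_mul]
      ring
    have h1 : ∀ data : Fin t → Obs d, ∫⁻ z, ENNReal.ofReal ((∑ i, pair (g i)
        (modeOf b w (asgdRun b δ Γ st (t + 1) (Fin.snoc data z)) i)) ^ 2) ∂P ≤
        ENNReal.ofReal ((∑ i, pair (g' i) (modeOf b w (asgdRun b δ Γ st t data) i)) ^ 2) +
        (ENNReal.ofReal (2 * ψ * ∑ i, lam i * k i ^ 2) *
          (∑ i, ENNReal.ofReal (lam i) * ENNReal.ofReal (U data i ^ 2)) +
        ENNReal.ofReal (2 * σ ^ 2 * ∑ i, lam i * k i ^ 2)) := fun data => by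
      simp_rw [hstep data]
      refine (h.lintegral_noise_le hψ hlam (U data) k _).trans (le_of_eq ?_)
      have hu0 := sqNorm_diagonal_nonneg hlam (U data)
      have e1 : ∑ i, ENNReal.ofReal (lam i) * ENNReal.ofReal (U data i ^ 2) =
          ENNReal.ofReal (∑ i, lam i * U data i ^ 2) := by
        rw [ENNReal.ofReal_sum_of_nonneg fun i _ => mul_nonneg (hlam i) (sq_nonneg _)]
        exact Finset.sum_congr rfl fun i _ => (ENNReal.ofReal_mul (hlam i)).symm
      rw [e1, ← ENNReal.ofReal_mul (by positivity), ← ENNReal.ofReal_add (by positivity)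
        (by positivity), ← ENNReal.ofReal_add (sq_nonneg _) (by positivity)]
      congr 1
      ring
    refine (lintegral_mono h1).trans ?_
    have hm1 : Measurable fun data : Fin t → Obs d =>
        ENNReal.ofReal ((∑ i, pair (g' i) (modeOf b w (asgdRun b δ Γ st t data) i)) ^ 2) :=
      ((measurable_sum_pair_modeOf b δ Γ st w t g').pow_const 2).ennreal_ofReal
    have hm2 : ∀ i, Measurable fun data : Fin t → Obs d =>
        ENNReal.ofReal (lam i) * ENNReal.ofReal (U data i ^ 2) := fun i =>
      ((hUm i).pow_const 2).ennreal_ofReal.const_mul _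
    have hm3 : Measurable fun data : Fin t → Obs d =>
        ∑ i, ENNReal.ofReal (lam i) * ENNReal.ofReal (U data i ^ 2) :=
      Finset.measurable_sum _ fun i _ => hm2 i
    have hprob : (Measure.pi fun _ : Fin t => P) Set.univ = 1 := by
      rw [Measure.pi_univ]; simp
    rw [lintegral_add_left hm1, lintegral_add_left (hm3.const_mul _), lintegral_const_mul _ hm3,
      lintegral_finsetSum _ fun i _ => hm2 i, lintegral_const, hprob, mul_one]
    have hE : ∑ i, ∫⁻ data, ENNReal.ofReal (lam i) * ENNReal.ofReal (U data i ^ 2)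
        ∂(Measure.pi fun _ : Fin t => P) ≤ ENNReal.ofReal (f t) := by
      have e1 : ∀ i, ∫⁻ data, ENNReal.ofReal (lam i) * ENNReal.ofReal (U data i ^ 2)
          ∂(Measure.pi fun _ : Fin t => P) ≤ ENNReal.ofReal (lam i) *
          ENNReal.ofReal (momentBound ψ σ b δ Γ lam w st f t (Pi.single i (1, 0))) := fun i => by
        rw [lintegral_const_mul _ ((hUm i).pow_const 2).ennreal_ofReal]
        gcongr
        refine le_trans (le_of_eq ?_) (ih (Pi.single i (1, 0)))
        refine lintegral_congr fun data => ?_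
        congr 2
        rw [Finset.sum_eq_single i]
        · simp [pair, hU]
        · intro j _ hj; simp [pair, Pi.single_eq_of_ne hj]
        · simp
      have e2 : ∀ i, 0 ≤ momentBound ψ σ b δ Γ lam w st f t (Pi.single i (1, 0)) := fun i =>
        momentBound_nonneg hψ σ b δ Γ hlam w st hf0 t _
      refine (Finset.sum_le_sum fun i _ => e1 i).trans ?_
      simp_rw [← ENNReal.ofReal_mul (hlam _)]
      rw [← ENNReal.ofReal_sum_of_nonneg fun i _ => mul_nonneg (hlam i) (e2 i)]
      exact ENNReal.ofReal_le_ofReal (hf t)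
    refine (add_le_add (ih g') (add_le_add (mul_le_mul_right hE _) le_rfl)).trans ?_
    have hb0 : 0 ≤ momentBound ψ σ b δ Γ lam w st f t g' :=
      momentBound_nonneg hψ σ b δ Γ hlam w st hf0 t g'
    have := hf0 t
    rw [← ENNReal.ofReal_mul (by positivity), ← ENNReal.ofReal_add (by positivity)
      (by positivity), ← ENNReal.ofReal_add hb0 (by positivity), momentBound_succ]
    refine ENNReal.ofReal_le_ofReal (le_of_eq ?_)
    ring

/-! ### The noise level of the stages -/

/-- The solution of a discrete Volterra equation. -/
noncomputable def volterra (B : ℕ → ℝ) (K : ℕ → ℕ → ℝ) (p q : ℝ) (t : ℕ) : ℝ :=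
  B t + ∑ s : Fin t, (p * volterra B K p q s + q) * K t s
decreasing_by exact s.2

theorem volterra_eq (B : ℕ → ℝ) (K : ℕ → ℕ → ℝ) (p q : ℝ) (t : ℕ) :
    volterra B K p q t = B t + ∑ s ∈ Finset.range t, (p * volterra B K p q s + q) * K t s := by
  rw [volterra, Finset.sum_range]

theorem volterra_nonneg {B : ℕ → ℝ} {K : ℕ → ℕ → ℝ} {p q : ℝ} (hB : ∀ t, 0 ≤ B t)
    (hK : ∀ t s, 0 ≤ K t s) (hp : 0 ≤ p) (hq : 0 ≤ q) (t : ℕ) : 0 ≤ volterra B K p q t := by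
  induction t using Nat.strong_induction_on with
  | _ t ih =>
    rw [volterra_eq]
    refine add_nonneg (hB t) (Finset.sum_nonneg fun s hs => mul_nonneg ?_ (hK t s))
    have := ih s (Finset.mem_range.1 hs)
    positivity

/-- After exchanging the sums, a unit of noise at any time adds at most `ε` to each stage. Adding
the `L` stages gives `F ≤ L (β + ε (p F + q n))` for the total `F`, which `hsmall` solves; the
result is then inserted back into a single stage. -/
theorem sum_volterra_le {B : ℕ → ℝ} {K : ℕ → ℕ → ℝ} {p q β ε : ℝ} (hB : ∀ t, 0 ≤ B t)
    (hK : ∀ t s, 0 ≤ K t s) (hp : 0 ≤ p) (hq : 0 ≤ q) (hε : 0 ≤ ε) {n L : ℕ} {st : ℕ → ℕ}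
    (hst : ∀ t, st t < L)
    (hBs : ∀ ℓ, ∑ t ∈ (Finset.range n).filter (fun t => st t = ℓ), B t ≤ β)
    (hKs : ∀ s ℓ, ∑ t ∈ (Finset.range n).filter (fun t => st t = ℓ ∧ s < t), K t s ≤ ε)
    (hsmall : p * (L * ε) ≤ 1 / 2) (ℓ : ℕ) :
    ∑ t ∈ (Finset.range n).filter (fun t => st t = ℓ), volterra B K p q t ≤
      2 * β + 2 * ε * (q * n) := by
  set f := volterra B K p q with hf
  have hf0 : ∀ t, 0 ≤ f t := volterra_nonneg hB hK hp hq
  set F := ∑ t ∈ Finset.range n, f t with hF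
  have hF0 : 0 ≤ F := Finset.sum_nonneg fun t _ => hf0 t
  have h1 : ∀ ℓ, ∑ t ∈ (Finset.range n).filter (fun t => st t = ℓ), f t ≤
      β + ε * (p * F + q * n) := fun ℓ => by
    have e1 : ∑ t ∈ (Finset.range n).filter (fun t => st t = ℓ), f t =
        ∑ t ∈ (Finset.range n).filter (fun t => st t = ℓ), B t +
        ∑ t ∈ (Finset.range n).filter (fun t => st t = ℓ),
          ∑ s ∈ Finset.range t, (p * f s + q) * K t s := by
      rw [← Finset.sum_add_distrib]
      exact Finset.sum_congr rfl fun t _ => volterra_eq B K p q t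
    have e2 : ∑ t ∈ (Finset.range n).filter (fun t => st t = ℓ),
          ∑ s ∈ Finset.range t, (p * f s + q) * K t s =
        ∑ s ∈ Finset.range n, ∑ t ∈ (Finset.range n).filter (fun t => st t = ℓ ∧ s < t),
          (p * f s + q) * K t s := by
      refine Finset.sum_comm' fun t s => ?_
      simp only [Finset.mem_filter, Finset.mem_range]
      constructor
      · rintro ⟨⟨h1, h2⟩, h3⟩; exact ⟨⟨h1, h2, h3⟩, h3.trans h1⟩
      · rintro ⟨⟨h1, h2, h3⟩, -⟩; exact ⟨⟨h1, h2⟩, h3⟩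
    have e3 : ∑ s ∈ Finset.range n, ∑ t ∈ (Finset.range n).filter (fun t => st t = ℓ ∧ s < t),
          (p * f s + q) * K t s ≤ ε * (p * F + q * n) := by
      calc _ ≤ ∑ s ∈ Finset.range n, (p * f s + q) * ε := by
            refine Finset.sum_le_sum fun s _ => ?_
            rw [← Finset.mul_sum]
            exact mul_le_mul_of_nonneg_left (hKs s ℓ) (by have := hf0 s; positivity)
        _ = _ := by
            rw [← Finset.sum_mul, Finset.sum_add_distrib, ← Finset.mul_sum, Finset.sum_const,
              Finset.card_range, nsmul_eq_mul]
            ring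
    rw [e1, e2]
    exact add_le_add (hBs ℓ) e3
  have hβ : 0 ≤ β := (Finset.sum_nonneg fun t _ => hB t).trans (hBs 0)
  have h2 : F ≤ L * (β + ε * (p * F + q * n)) := by
    have e : F = ∑ ℓ ∈ Finset.range L, ∑ t ∈ (Finset.range n).filter (fun t => st t = ℓ), f t :=
      (Finset.sum_fiberwise_of_maps_to (fun t _ => Finset.mem_range.2 (hst t)) _).symm
    calc F = _ := e
      _ ≤ ∑ _ℓ ∈ Finset.range L, (β + ε * (p * F + q * n)) := Finset.sum_le_sum fun ℓ _ => h1 ℓ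
      _ = _ := by rw [Finset.sum_const, Finset.card_range, nsmul_eq_mul]
  have hqn : 0 ≤ q * n := by positivity
  have h3 : F ≤ 2 * (L * (β + ε * (q * n))) := by
    have := mul_le_mul_of_nonneg_right hsmall hF0
    linarith
  have h4 : ε * (p * F) ≤ β + ε * (q * n) := by
    have e1 := mul_le_mul_of_nonneg_left h3 (by positivity : 0 ≤ ε * p)
    have e2 := mul_le_mul_of_nonneg_right hsmall
      (by positivity : 0 ≤ 2 * (β + ε * (q * n)))
    linarith
  have := h1 ℓ
  linarith

theorem energyBound_eq {d : ℕ} (ψ σ b δ Γ : ℝ) (lam w : Fin d → ℝ) (st : ℕ → ℕ) (f : ℕ → ℝ)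
    (t : ℕ) : energyBound ψ σ b δ Γ lam w st f t =
      ∑ i, lam i * (flow b (δ * lam i) (Γ * lam i) st 0 (-w i, 0) t).1 ^ 2 +
      ∑ s ∈ Finset.range t, (2 * ψ * f s + 2 * σ ^ 2) * ∑ i, lam i ^ 2 *
        (flow b (δ * lam i) (Γ * lam i) st (s + 1) (kick b δ Γ (st s)) t).1 ^ 2 := by
  have h1 : ∀ (i : Fin d) (p : Fin d → ℝ × ℝ),
      ∑ j, pair ((Pi.single i (1, 0) : Fin d → ℝ × ℝ) j) (p j) = (p i).1 := fun i p => by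
    rw [Finset.sum_eq_single i]
    · simp [pair]
    · intro j _ hj; simp [pair, Pi.single_eq_of_ne hj]
    · simp
  have h2 : ∀ (i : Fin d) (p : Fin d → ℝ × ℝ),
      ∑ j, lam j * pair ((Pi.single i (1, 0) : Fin d → ℝ × ℝ) j) (p j) ^ 2 =
        lam i * (p i).1 ^ 2 := fun i p => by
    rw [Finset.sum_eq_single i]
    · simp [pair]
    · intro j _ hj; simp [pair, Pi.single_eq_of_ne hj]
    · simp
  simp only [energyBound, momentBound, h1, h2, mul_add]
  rw [Finset.sum_add_distrib]
  congr 1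
  simp only [Finset.mul_sum]
  rw [Finset.sum_comm]
  exact Finset.sum_congr rfl fun s _ => Finset.sum_congr rfl fun i _ => by ring

/-- The level is the solution of the Volterra equation itself, so the energy bound holds with
equality. `hker` says that the kernel, summed over modes and stages, is small enough for
`sum_volterra_le`; it also turns `n ≤ 2 L N` into a contribution of order `N` rather than `n`. -/
theorem exists_noise_level {b κ δ Γ B : ℝ} {N L n : ℕ} (h : Schedule b κ δ Γ B N L n) {d : ℕ}
    {lam w : Fin d → ℝ} (hlam : ∀ i, 0 < lam i) (hlamB : ∀ i, lam i ≤ B) {ψ : ℝ} (hψ : 1 ≤ ψ)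
    (σ : ℝ) {Cw : ℝ} (hw : ∑ i, lam i * w i ^ 2 ≤ Cw)
    (hker : 4 * ψ * (L * (50000 * ∑ i, min (Γ * lam i) (1 / κ + δ * lam i))) ≤ 1) :
    ∃ f : ℕ → ℝ, (∀ t, 0 ≤ f t) ∧
      (∀ t, energyBound ψ σ b δ Γ lam w (stageOf N L) f t ≤ f t) ∧
      ∀ ℓ, ∑ s ∈ (Finset.range n).filter (fun s => stageOf N L s = ℓ),
        (2 * ψ * f s + 2 * σ ^ 2) ≤ (800 * ψ * (Cw + 1) + 8 * ψ) * (1 + σ ^ 2) * N := by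
  set st := stageOf N L with hst
  set Bf : ℕ → ℝ := fun t =>
    ∑ i, lam i * (flow b (δ * lam i) (Γ * lam i) st 0 (-w i, 0) t).1 ^ 2 with hBf
  set K : ℕ → ℕ → ℝ := fun t s => ∑ i, lam i ^ 2 *
    (flow b (δ * lam i) (Γ * lam i) st (s + 1) (kick b δ Γ (st s)) t).1 ^ 2 with hK
  have hB0 : ∀ t, 0 ≤ Bf t := fun t =>
    Finset.sum_nonneg fun i _ => mul_nonneg (hlam i).le (sq_nonneg _)
  have hK0 : ∀ t s, 0 ≤ K t s := fun t s =>
    Finset.sum_nonneg fun i _ => mul_nonneg (sq_nonneg _) (sq_nonneg _)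
  set f := volterra Bf K (2 * ψ) (2 * σ ^ 2) with hf
  have hp : 0 ≤ 2 * ψ := by linarith
  have hq : 0 ≤ 2 * σ ^ 2 := by positivity
  set ε := 50000 * ∑ i, min (Γ * lam i) (1 / κ + δ * lam i) with hε
  have hκ : 0 < κ := by linarith [h.kappa]
  have hε0 : 0 ≤ ε := mul_nonneg (by norm_num) (Finset.sum_nonneg fun i _ =>
    le_min (mul_pos h.Gamma_pos (hlam i)).le
      (add_nonneg (by positivity) (mul_pos h.delta_pos (hlam i)).le))
  have hN0 : (0 : ℝ) < N := Nat.cast_pos.2 h.N_pos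
  have hL := h.L_ge
  have hcard := card_stageOf_le h.N_pos (by omega) h.n_le
  have hstL : ∀ t, st t < L := fun t => by rw [hst, stageOf]; omega
  have hCw : 0 ≤ Cw :=
    (Finset.sum_nonneg fun i _ => mul_nonneg (hlam i).le (sq_nonneg _)).trans hw
  have hBs : ∀ ℓ, ∑ t ∈ (Finset.range n).filter (fun t => st t = ℓ), Bf t ≤
      200 * N * Cw := fun ℓ => by
    rw [hBf, Finset.sum_comm]
    calc _ ≤ ∑ i, lam i * (200 * N * w i ^ 2) := by
          refine Finset.sum_le_sum fun i _ => ?_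
          rw [← Finset.mul_sum]
          refine mul_le_mul_of_nonneg_left ?_ (hlam i).le
          have := h.bias_stage_sum_le (hlam i) (hlamB i) (isTraj_flow b (δ * lam i) (Γ * lam i) st 0
            (-w i, 0)) rfl ((Finset.range n).filter (fun t => st t = ℓ)) (ℓ := ℓ)
            (fun t ht => (Finset.mem_filter.1 ht).2) (hcard ℓ)
          rwa [neg_sq] at this
      _ = 200 * N * ∑ i, lam i * w i ^ 2 := by
          rw [Finset.mul_sum]
          exact Finset.sum_congr rfl fun i _ => by ring
      _ ≤ _ := mul_le_mul_of_nonneg_left hw (by positivity)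
  have hKs : ∀ s ℓ, ∑ t ∈ (Finset.range n).filter (fun t => st t = ℓ ∧ s < t), K t s ≤ ε :=
    fun s ℓ => by
    rw [hK, Finset.sum_comm, hε, Finset.mul_sum]
    refine Finset.sum_le_sum fun i _ => ?_
    rw [← Finset.mul_sum]
    refine h.kernel_le (hlam i) (hlamB i) (isResponse_flow b δ Γ (lam i) st s) _ (ℓ := ℓ)
      (fun t ht => ?_) ?_
    · have := (Finset.mem_filter.1 ht).2
      exact ⟨this.2, this.1⟩
    · refine (Finset.card_le_card fun t ht => ?_).trans (hcard ℓ)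
      rw [Finset.mem_filter] at ht ⊢
      exact ⟨ht.1, ht.2.1⟩
  refine ⟨f, volterra_nonneg hB0 hK0 hp hq, fun t => ?_, fun ℓ => ?_⟩
  · rw [energyBound_eq]
    exact (volterra_eq Bf K (2 * ψ) (2 * σ ^ 2) t).ge
  · have h1 := sum_volterra_le hB0 hK0 hp hq hε0 hstL hBs hKs (by linarith) ℓ
    rw [Finset.sum_add_distrib, ← Finset.mul_sum, Finset.sum_const, nsmul_eq_mul]
    have h2 : (((Finset.range n).filter fun s => st s = ℓ).card : ℝ) ≤ 2 * N := by
      exact_mod_cast hcard ℓ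
    have h3 := mul_le_mul_of_nonneg_right h2 hq
    have h4 : ε * n ≤ N / 2 := by
      have e1 : (n : ℝ) ≤ 2 * L * N := by
        have : n ≤ 2 * L * N := h.n_le.trans (Nat.mul_le_mul_right N (by omega))
        exact_mod_cast this
      have e2 := mul_le_mul_of_nonneg_left e1 hε0
      have e3 : L * ε ≤ 1 / 4 := by
        have := mul_le_mul_of_nonneg_right hψ (by positivity : 0 ≤ L * ε)
        linarith
      have e4 := mul_le_mul_of_nonneg_right e3 hN0.le
      linarith
    have h5 := mul_le_mul_of_nonneg_left h4 hq
    have h6 : 2 * ψ * ∑ t ∈ (Finset.range n).filter (fun t => st t = ℓ), f t ≤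
        2 * ψ * (2 * (200 * N * Cw) + 2 * σ ^ 2 * N) :=
      mul_le_mul_of_nonneg_left (by linarith) hp
    have h7 : 0 ≤ ψ * Cw * σ ^ 2 * N := by positivity
    have h8 : 0 ≤ (ψ - 1) * σ ^ 2 * N :=
      mul_nonneg (mul_nonneg (by linarith) (sq_nonneg _)) hN0.le
    have h9 : 0 ≤ ψ * N := by positivity
    have h10 : 0 ≤ ψ * σ ^ 2 * N := by positivity
    linarith

/-! ### Bias and variance of the output -/

/-- The response of the output `w_n` of ASGD in terms of the state of a mode. -/
noncomputable def output (b : ℝ) (p : ℝ × ℝ) : ℝ := p.1 - b / (1 - b) * p.2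

theorem output_sq_le {b : ℝ} (hb : 0 < b) (hb1 : b ≤ 1 / 2) (p : ℝ × ℝ) :
    output b p ^ 2 ≤ 2 * (p.1 ^ 2 + p.2 ^ 2) := by
  have h1 : b / (1 - b) ≤ 1 := by rw [div_le_one (by linarith)]; linarith
  have h2 : 0 ≤ b / (1 - b) := div_nonneg hb.le (by linarith)
  have h3 : (b / (1 - b) * p.2) ^ 2 ≤ p.2 ^ 2 := by
    rw [mul_pow]
    exact mul_le_of_le_one_left (sq_nonneg _) (pow_le_one₀ h2 h1)
  rw [output]
  nlinarith [sq_nonneg (p.1 + b / (1 - b) * p.2)]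

/-- The bias-variance bound for the risk of ASGD. -/
theorem expRisk_asgd_le {b κ δ Γ B : ℝ} {N L n : ℕ} (h : Schedule b κ δ Γ B N L n)
    (hL : L = Nat.log 2 n) (hN : N = n / Nat.log 2 n) {ψ σ : ℝ} {d : ℕ} {lam m w : Fin d → ℝ}
    {T : Matrix (Fin d) (Fin d) ℝ} {P Q : Measure (Obs d)} (hP : IsProblem ψ σ lam m T P Q w)
    (hT : T.PosSemidef) (hlam : ∀ i, 0 < lam i) (hlamB : ∀ i, lam i ≤ B) (hψ : 1 ≤ ψ)
    {Cw : ℝ} (hw : ∑ i, lam i * w i ^ 2 ≤ Cw)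
    (hker : 4 * ψ * (L * (50000 * ∑ i, min (Γ * lam i) (1 / κ + δ * lam i))) ≤ 1) :
    expRisk (n := n) T P (asgd (alphaOf b) (b / 2) δ (gammaOf b δ Γ)) w ≤
      ENNReal.ofReal (sqNorm T (fun i => output b
        (flow b (δ * lam i) (Γ * lam i) (stageOf N L) 0 (-w i, 0) n)) +
      2 * 10 ^ 11 * ((800 * ψ * (Cw + 1) + 8 * ψ) * (1 + σ ^ 2) * N) *
        ∑ i, lam i * T i i * (Γ ^ 2 / (1 + (N * Γ * lam i) ^ 2))) := by
  have := hP.source.prob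
  have hb1 : b < 1 := by linarith [h.b_le]
  obtain ⟨f, hf0, hf, hfs⟩ := exists_noise_level h hlam hlamB hψ σ hw hker
  obtain ⟨k, v, hv, hvd⟩ := exists_sq_decomposition hT
  have hrun : ∀ data : Fin n → Obs d, asgd (alphaOf b) (b / 2) δ (gammaOf b δ Γ) data =
      (asgdRun b δ Γ (stageOf N L) n data).1 := fun data => by
    subst hL hN; rfl
  set g : Fin k → Fin d → ℝ × ℝ := fun l i => (v l i, -(b / (1 - b)) * v l i) with hg
  have hpair : ∀ l i p, pair (g l i) p = v l i * output b p := fun l i p => by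
    simp only [pair, output, hg]; ring
  have hout : ∀ (p : (Fin d → ℝ) × (Fin d → ℝ)) (i : Fin d),
      output b (modeOf b w p i) = p.1 i - w i := fun p i => by
    have h1 : 1 - b / 2 ≠ 0 := by linarith
    have h2 : 2 - b ≠ 0 := by linarith
    have h3 : 1 - b ≠ 0 := by linarith
    simp only [output, modeOf, alphaOf]
    field_simp
    ring
  have hrisk : ∀ data : Fin n → Obs d,
      ENNReal.ofReal (sqNorm T (asgd (alphaOf b) (b / 2) δ (gammaOf b δ Γ) data - w)) =
      ∑ l, ENNReal.ofReal
        ((∑ i, pair (g l i) (modeOf b w (asgdRun b δ Γ (stageOf N L) n data) i)) ^ 2) :=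
    fun data => by
    rw [hv, ENNReal.ofReal_sum_of_nonneg fun l _ => sq_nonneg _]
    refine Finset.sum_congr rfl fun l _ => ?_
    congr 2
    refine Finset.sum_congr rfl fun i _ => ?_
    rw [hpair, hout, hrun, Pi.sub_apply]
  rw [expRisk]
  simp_rw [hrisk]
  rw [lintegral_finsetSum _ fun l _ =>
    ((measurable_sum_pair_modeOf b δ Γ (stageOf N L) w n (g l)).pow_const 2).ennreal_ofReal]
  refine (Finset.sum_le_sum fun l _ => lintegral_moment_le hP (by linarith)
    (fun i => (hlam i).le) hb1 (stageOf N L) hf0 hf n (g l)).trans ?_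
  have hc0 : ∀ s, 0 ≤ 2 * ψ * f s + 2 * σ ^ 2 := fun s => by
    have := hf0 s; positivity
  rw [← ENNReal.ofReal_sum_of_nonneg fun l _ => momentBound_nonneg (by linarith) σ b δ Γ
    (fun i => (hlam i).le) w (stageOf N L) hf0 n (g l)]
  refine ENNReal.ofReal_le_ofReal ?_
  simp only [momentBound, hpair]
  rw [Finset.sum_add_distrib, hv]
  refine add_le_add le_rfl ?_
  set r : Fin d → ℕ → ℕ → ℝ × ℝ := fun i s =>
    flow b (δ * lam i) (Γ * lam i) (stageOf N L) (s + 1) (kick b δ Γ (stageOf N L s)) with hr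
  -- The noise covariance is dominated by a multiple of the diagonal `S`, so the variance sees only
  -- the diagonal of `T`, whereas the bias keeps the full `T`.
  have e1 : ∑ l, ∑ s ∈ Finset.range n, (2 * ψ * f s + 2 * σ ^ 2) * ∑ i, lam i *
      (v l i * output b (r i s n)) ^ 2 = ∑ i, lam i * T i i *
      ∑ s ∈ Finset.range n, (2 * ψ * f s + 2 * σ ^ 2) * output b (r i s n) ^ 2 := by
    simp only [hvd, Finset.mul_sum, Finset.sum_mul]
    rw [Finset.sum_comm]
    simp_rw [Finset.sum_comm (s := (Finset.univ : Finset (Fin k)))]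
    rw [Finset.sum_comm]
    exact Finset.sum_congr rfl fun i _ => Finset.sum_congr rfl fun s _ =>
      Finset.sum_congr rfl fun l _ => by ring
  refine (le_of_eq e1).trans ?_
  rw [Finset.mul_sum]
  refine Finset.sum_le_sum fun i _ => ?_
  have hTi : 0 ≤ T i i := by rw [hvd]; exact Finset.sum_nonneg fun l _ => sq_nonneg _
  have e2 : ∑ s ∈ Finset.range n, (2 * ψ * f s + 2 * σ ^ 2) * output b (r i s n) ^ 2 ≤
      2 * ∑ s ∈ Finset.range n, (2 * ψ * f s + 2 * σ ^ 2) *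
        ((r i s n).1 ^ 2 + (r i s n).2 ^ 2) := by
    rw [Finset.mul_sum]
    refine Finset.sum_le_sum fun s _ => ?_
    have := mul_le_mul_of_nonneg_left (output_sq_le h.b_pos (by linarith [h.b_le]) (r i s n))
      (hc0 s)
    linarith
  have e3 := h.final_variance_le (hlam i) (hlamB i) (p := r i)
    (fun s _ => isResponse_flow b δ Γ (lam i) (stageOf N L) s) hc0 (fun ℓ _ => hfs ℓ)
  calc _ ≤ lam i * T i i * (2 * (10 ^ 11 * ((800 * ψ * (Cw + 1) + 8 * ψ) * (1 + σ ^ 2) * N) *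
        (Γ ^ 2 / (1 + (N * Γ * lam i) ^ 2)))) :=
        mul_le_mul_of_nonneg_left (e2.trans (mul_le_mul_of_nonneg_left e3 zero_le_two))
          (mul_nonneg (hlam i).le hTi)
    _ = _ := by ring

/-! ### Dyadic sums -/

/-- The increments of `t / (1 + t)` along a geometric progression are comparable with `min t t⁻¹`,
and their sum is at most 1. -/
theorem min_inv_le_telescope {ρ t : ℝ} (hρ : 1 < ρ) (ht : 0 < t) :
    min t t⁻¹ ≤ 2 * (ρ + 1) / (ρ - 1) * (ρ * t / (1 + ρ * t) - t / (1 + t)) := by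
  have h1 : ρ * t / (1 + ρ * t) - t / (1 + t) = (ρ - 1) * t / ((1 + ρ * t) * (1 + t)) := by
    have : 1 + ρ * t ≠ 0 := by positivity
    have : 1 + t ≠ 0 := by positivity
    field_simp
    ring
  have h2 : 0 < ρ - 1 := by linarith
  have h3 : 2 * (ρ + 1) / (ρ - 1) * ((ρ - 1) * t / ((1 + ρ * t) * (1 + t))) =
      2 * (ρ + 1) * t / ((1 + ρ * t) * (1 + t)) := by
    have := h2.ne'
    field_simp
  rw [h1, h3, le_div_iff₀ (by positivity)]
  rcases le_total t 1 with h | h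
  · have h4 : (1 + ρ * t) * (1 + t) ≤ (1 + ρ) * 2 :=
      mul_le_mul (by nlinarith) (by linarith) (by positivity) (by positivity)
    calc min t t⁻¹ * ((1 + ρ * t) * (1 + t)) ≤ t * ((1 + ρ) * 2) :=
          mul_le_mul (min_le_left _ _) h4 (by positivity) ht.le
      _ = _ := by ring
  · have h4 : (1 + ρ * t) * (1 + t) ≤ ((1 + ρ) * t) * (2 * t) :=
      mul_le_mul (by nlinarith) (by linarith) (by positivity) (by positivity)
    calc min t t⁻¹ * ((1 + ρ * t) * (1 + t)) ≤ t⁻¹ * (((1 + ρ) * t) * (2 * t)) :=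
          mul_le_mul (min_le_right _ _) h4 (by positivity) (by positivity)
      _ = _ := by field_simp; ring

/-- A two-sided geometric profile around the scale `K`. -/
noncomputable def hump (p K : ℝ) (j : ℕ) : ℝ := min ((2 ^ j / K) ^ p) ((2 ^ j / K) ^ (-p))

theorem hump_pos (p : ℝ) {K : ℝ} (hK : 0 < K) (j : ℕ) : 0 < hump p K j := by
  have : (0 : ℝ) < 2 ^ j / K := by positivity
  exact lt_min (Real.rpow_pos_of_pos this _) (Real.rpow_pos_of_pos this _)

/-- At dyadic points `(2^j / K)^p` is geometric with ratio `2^p`, so the sum telescopes to a bound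
independent of `K` and `J`. -/
theorem sum_hump_le {p K : ℝ} (hp : 0 < p) (hK : 0 < K) (J : ℕ) :
    ∑ j ∈ Finset.range J, hump p K j ≤ 2 * ((2 : ℝ) ^ p + 1) / ((2 : ℝ) ^ p - 1) := by
  set ρ : ℝ := (2 : ℝ) ^ p with hρ
  have hρ1 : 1 < ρ := Real.one_lt_rpow (by norm_num) hp
  set g : ℕ → ℝ := fun j => (2 ^ j / K) ^ p with hg
  have hg0 : ∀ j, 0 < g j := fun j => Real.rpow_pos_of_pos (by positivity) _
  have hgs : ∀ j, g (j + 1) = ρ * g j := fun j => by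
    simp only [hg, hρ]
    rw [← Real.mul_rpow (by norm_num) (by positivity)]
    congr 1
    ring
  have h1 : ∀ j, hump p K j ≤ 2 * (ρ + 1) / (ρ - 1) *
      (g (j + 1) / (1 + g (j + 1)) - g j / (1 + g j)) := fun j => by
    have := min_inv_le_telescope hρ1 (hg0 j)
    rw [hgs]
    rwa [hump, Real.rpow_neg (by positivity)]
  refine (Finset.sum_le_sum fun j _ => h1 j).trans ?_
  rw [← Finset.mul_sum, Finset.sum_range_sub (fun j => g j / (1 + g j))]
  have h2 : g J / (1 + g J) ≤ 1 := by
    rw [div_le_one (by linarith [hg0 J])]; linarith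
  have h3 : 0 ≤ g 0 / (1 + g 0) := by have := hg0 0; positivity
  refine mul_le_of_le_one_right ?_ (by linarith)
  have : 0 < ρ - 1 := by linarith
  positivity

theorem pow_log_le {d : ℕ} (i : Fin d) :
    (2 : ℝ) ^ Nat.log 2 ((i : ℕ) + 1) ≤ (i : ℕ) + 1 ∧
      ((i : ℕ) + 1 : ℝ) ≤ 2 * 2 ^ Nat.log 2 ((i : ℕ) + 1) := by
  constructor
  · exact_mod_cast Nat.pow_log_le_self 2 (Nat.succ_ne_zero (i : ℕ))
  · have := (Nat.lt_pow_succ_log_self (b := 2) (by norm_num) ((i : ℕ) + 1)).le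
    rw [pow_succ, mul_comm] at this
    exact_mod_cast this

theorem log_succ_mem_range {d : ℕ} (i : Fin d) :
    Nat.log 2 ((i : ℕ) + 1) ∈ Finset.range (d + 1) := by
  have h1 := Nat.log_le_self 2 ((i : ℕ) + 1)
  have h2 := i.2
  rw [Finset.mem_range]
  omega

theorem card_log_eq_le (d j : ℕ) :
    (Finset.univ.filter fun i : Fin d => Nat.log 2 ((i : ℕ) + 1) = j).card ≤ 2 ^ j := by
  have h1 : ((Finset.univ.filter fun i : Fin d => Nat.log 2 ((i : ℕ) + 1) = j).map
      Fin.valEmbedding) ⊆ Finset.Ico (2 ^ j - 1) (2 ^ j - 1 + 2 ^ j) := by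
    intro i hi
    rw [Finset.mem_map] at hi
    obtain ⟨l, hl, rfl⟩ := hi
    have hl := (Finset.mem_filter.1 hl).2
    have e1 := Nat.pow_log_le_self 2 (Nat.succ_ne_zero (l : ℕ))
    have e2 := Nat.lt_pow_succ_log_self (b := 2) (by norm_num) ((l : ℕ) + 1)
    rw [Nat.succ_eq_add_one] at e1
    rw [hl] at e1 e2
    rw [pow_succ] at e2
    rw [Finset.mem_Ico]
    simp only [Fin.valEmbedding_apply]
    omega
  have h2 := Finset.card_le_card h1
  rwa [Finset.card_map, Nat.card_Ico, Nat.add_sub_cancel_left] at h2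

theorem sum_le_dyadic {d : ℕ} {g : Fin d → ℝ} {G : ℕ → ℝ} (hG : ∀ j, 0 ≤ G j)
    (h : ∀ i, g i ≤ G (Nat.log 2 ((i : ℕ) + 1))) :
    ∑ i, g i ≤ ∑ j ∈ Finset.range (d + 1), 2 ^ j * G j := by
  rw [← Finset.sum_fiberwise_of_maps_to (t := Finset.range (d + 1))
    (g := fun i : Fin d => Nat.log 2 ((i : ℕ) + 1)) fun i _ => log_succ_mem_range i]
  refine Finset.sum_le_sum fun j _ => ?_
  calc _ ≤ (Finset.univ.filter fun i : Fin d => Nat.log 2 ((i : ℕ) + 1) = j).card • G j :=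
        Finset.sum_le_card_nsmul _ _ _ fun i hi => by
          have := h i
          rwa [(Finset.mem_filter.1 hi).2] at this
    _ = _ := nsmul_eq_mul _ _
    _ ≤ 2 ^ j * G j := by
        gcongr
        · exact hG j
        · exact_mod_cast card_log_eq_le d j

/-! ### Sums over the modes -/

theorem sum_rpow_le {p : ℝ} (hp : 1 < p) :
    ∃ C : ℝ, 0 < C ∧ ∀ d : ℕ, ∑ i : Fin d, ((i : ℕ) + 1 : ℝ) ^ (-p) ≤ C := by
  have h1 : Summable fun n : ℕ => ((n : ℝ) + 1) ^ (-p) := by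
    have := (summable_nat_add_iff 1).2 (Real.summable_nat_rpow.2 (by linarith : -p < -1))
    simpa using this
  have h0 : ∀ n : ℕ, 0 ≤ ((n : ℝ) + 1) ^ (-p) := fun n => by positivity
  have h2 : 0 ≤ ∑' n : ℕ, ((n : ℝ) + 1) ^ (-p) := tsum_nonneg h0
  refine ⟨∑' n : ℕ, ((n : ℝ) + 1) ^ (-p) + 1, by linarith, fun d => ?_⟩
  rw [Fin.sum_univ_eq_sum_range (fun i => ((i : ℝ) + 1) ^ (-p))]
  have := h1.sum_le_tsum (Finset.range d) fun n _ => h0 n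
  linarith

theorem rpow_dyadic_le {d : ℕ} (i : Fin d) (u : ℝ) :
    ((i : ℕ) + 1 : ℝ) ^ (-u) ≤ 2 ^ |u| * (2 ^ Nat.log 2 ((i : ℕ) + 1)) ^ (-u) := by
  obtain ⟨h1, h2⟩ := pow_log_le i
  set x : ℝ := (i : ℕ) + 1 with hx
  set y : ℝ := 2 ^ Nat.log 2 ((i : ℕ) + 1) with hy
  have hy0 : 0 < y := by positivity
  rcases le_total 0 u with hu | hu
  · have e1 : x ^ (-u) ≤ y ^ (-u) := Real.rpow_le_rpow_of_nonpos hy0 h1 (by linarith)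
    have e2 : (1 : ℝ) ≤ 2 ^ |u| := Real.one_le_rpow (by norm_num) (abs_nonneg _)
    have e3 : 0 ≤ y ^ (-u) := by positivity
    nlinarith
  · rw [abs_of_nonpos hu, ← Real.mul_rpow (by norm_num) hy0.le]
    exact Real.rpow_le_rpow (by positivity) h2 (by linarith)

/-- Passing to the variable `2^j / K` isolates the power of `K` and leaves a sum of a fixed profile.
-/
theorem sum_rpow_min_le_dyadic {d : ℕ} {u a K : ℝ} (ha : 0 < a) (hK : 0 < K) :
    ∑ i : Fin d, ((i : ℕ) + 1 : ℝ) ^ (-u) * min 1 ((K / ((i : ℕ) + 1)) ^ (2 * a)) ≤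
      2 ^ |u| * K ^ (1 - u) * ∑ j ∈ Finset.range (d + 1),
        (2 ^ j / K) ^ (1 - u) * min 1 ((2 ^ j / K) ^ (-(2 * a))) := by
  refine (sum_le_dyadic (G := fun j => 2 ^ |u| * (2 ^ j) ^ (-u) *
    min 1 ((K / 2 ^ j) ^ (2 * a))) (fun j => by positivity) fun i => ?_).trans (le_of_eq ?_)
  · refine mul_le_mul (rpow_dyadic_le i u) ?_ (by positivity) (by positivity)
    refine min_le_min le_rfl (Real.rpow_le_rpow (by positivity) ?_ (by positivity))
    exact div_le_div_of_nonneg_left hK.le (by positivity) (pow_log_le i).1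
  · rw [Finset.mul_sum]
    refine Finset.sum_congr rfl fun j _ => ?_
    have h2 : (0 : ℝ) < 2 ^ j := by positivity
    have e1 : (K / 2 ^ j) ^ (2 * a) = (2 ^ j / K) ^ (-(2 * a)) := by
      rw [Real.rpow_neg (by positivity), ← Real.inv_rpow (by positivity), inv_div]
    have e2 : K ^ (1 - u) * (2 ^ j / K) ^ (1 - u) = 2 ^ j * (2 ^ j) ^ (-u) := by
      rw [← Real.mul_rpow hK.le (by positivity), mul_div_cancel₀ _ hK.ne', sub_eq_add_neg,
        Real.rpow_add h2, Real.rpow_one]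
    rw [e1]
    calc 2 ^ j * (2 ^ |u| * (2 ^ j) ^ (-u) * min 1 ((2 ^ j / K) ^ (-(2 * a)))) =
          2 ^ |u| * (2 ^ j * (2 ^ j) ^ (-u)) * min 1 ((2 ^ j / K) ^ (-(2 * a))) := by ring
      _ = _ := by rw [← e2]; ring

/-- The profile grows with exponent `1 - u` below the scale and decays with exponent `u + 2a - 1`
above it; the smaller exponent serves on both sides. -/
theorem mul_min_le_hump {u a z : ℝ} (hu : u < 1) (hua : 1 < u + 2 * a) (hz : 0 < z) :
    z ^ (1 - u) * min 1 (z ^ (-(2 * a))) ≤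
      min (z ^ min (1 - u) (u + 2 * a - 1)) (z ^ (-min (1 - u) (u + 2 * a - 1))) := by
  set p := min (1 - u) (u + 2 * a - 1) with hp
  have hp0 : 0 < p := lt_min (by linarith) (by linarith)
  have hp1 : p ≤ 1 - u := min_le_left _ _
  have hp2 : p ≤ u + 2 * a - 1 := min_le_right _ _
  have hzp : 0 ≤ z ^ (1 - u) := by positivity
  rcases le_total z 1 with h | h
  · have e1 : z ^ (1 - u) ≤ z ^ p := Real.rpow_le_rpow_of_exponent_ge hz h hp1
    have e2 : z ^ p ≤ z ^ (-p) := Real.rpow_le_rpow_of_exponent_ge hz h (by linarith)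
    have e3 : z ^ (1 - u) * min 1 (z ^ (-(2 * a))) ≤ z ^ (1 - u) :=
      mul_le_of_le_one_right hzp (min_le_left _ _)
    exact le_min (e3.trans e1) (e3.trans (e1.trans e2))
  · have e1 : z ^ (1 - u) * z ^ (-(2 * a)) ≤ z ^ (-p) := by
      rw [← Real.rpow_add hz]
      exact Real.rpow_le_rpow_of_exponent_le h (by linarith)
    have e2 : z ^ (-p) ≤ z ^ p := Real.rpow_le_rpow_of_exponent_le h (by linarith)
    have e3 : z ^ (1 - u) * min 1 (z ^ (-(2 * a))) ≤ z ^ (1 - u) * z ^ (-(2 * a)) :=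
      mul_le_mul_of_nonneg_left (min_le_right _ _) hzp
    exact le_min (e3.trans (e1.trans e2)) (e3.trans e1)

theorem sum_rpow_min_le {u a : ℝ} (ha : 0 < a) (hu : u < 1) (hua : 1 < u + 2 * a) :
    ∃ C : ℝ, 0 < C ∧ ∀ (d : ℕ) (K : ℝ), 0 < K →
      ∑ i : Fin d, ((i : ℕ) + 1 : ℝ) ^ (-u) * min 1 ((K / ((i : ℕ) + 1)) ^ (2 * a)) ≤
        C * K ^ (1 - u) := by
  set p := min (1 - u) (u + 2 * a - 1) with hp
  have hp0 : 0 < p := lt_min (by linarith) (by linarith)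
  have hρ : 0 < (2 : ℝ) ^ p - 1 := by
    have := Real.one_lt_rpow (by norm_num : (1 : ℝ) < 2) hp0; linarith
  refine ⟨2 ^ |u| * (2 * ((2 : ℝ) ^ p + 1) / ((2 : ℝ) ^ p - 1)), by positivity, fun d K hK => ?_⟩
  refine (sum_rpow_min_le_dyadic ha hK).trans ?_
  have h1 : ∑ j ∈ Finset.range (d + 1), (2 ^ j / K) ^ (1 - u) *
      min 1 ((2 ^ j / K) ^ (-(2 * a))) ≤ 2 * ((2 : ℝ) ^ p + 1) / ((2 : ℝ) ^ p - 1) :=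
    (Finset.sum_le_sum fun j _ => mul_min_le_hump hu hua (by positivity)).trans
      (sum_hump_le hp0 hK (d + 1))
  calc _ ≤ 2 ^ |u| * K ^ (1 - u) * (2 * ((2 : ℝ) ^ p + 1) / ((2 : ℝ) ^ p - 1)) :=
        mul_le_mul_of_nonneg_left h1 (by positivity)
    _ = _ := by ring

/-- At the critical exponent every dyadic block below the scale contributes a constant, which
produces the logarithm; the blocks beyond `n ≥ K` form a geometric tail. -/
theorem sum_inv_min_le {a : ℝ} (ha : 1 / 2 ≤ a) :
    ∃ C : ℝ, 0 < C ∧ ∀ (d : ℕ) (K : ℝ) (n : ℕ), 0 < K → K ≤ n →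
      ∑ i : Fin d, ((i : ℕ) + 1 : ℝ) ^ (-(1 : ℝ)) * min 1 ((K / ((i : ℕ) + 1)) ^ (2 * a)) ≤
        C * (Nat.log 2 n + 1) := by
  refine ⟨14, by norm_num, fun d K n hK hKn => ?_⟩
  refine (sum_rpow_min_le_dyadic (by linarith) hK).trans ?_
  have h1 : ∀ j : ℕ, (2 ^ j / K) ^ (1 - (1 : ℝ)) * min 1 ((2 ^ j / K) ^ (-(2 * a))) ≤
      (if j < Nat.log 2 n + 1 then 1 else 0) + hump 1 K j := fun j => by
    have hz : (0 : ℝ) < 2 ^ j / K := by positivity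
    rw [sub_self, Real.rpow_zero, one_mul]
    have h0 := (hump_pos 1 hK j).le
    split_ifs with hj
    · have := min_le_left 1 ((2 ^ j / K) ^ (-(2 * a)))
      linarith
    · have h2 : 1 ≤ 2 ^ j / K := by
        rw [le_div_iff₀ hK, one_mul]
        have := (Nat.lt_pow_succ_log_self (b := 2) (by norm_num) n).le
        have h3 : n ≤ 2 ^ j := this.trans (Nat.pow_le_pow_right (by norm_num) (by omega))
        exact hKn.trans (by exact_mod_cast h3)
      rw [zero_add, hump]
      refine (min_le_right _ _).trans (le_min ?_ ?_) <;>
        exact Real.rpow_le_rpow_of_exponent_le h2 (by linarith)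
  have h2 := Finset.sum_le_sum fun j (_ : j ∈ Finset.range (d + 1)) => h1 j
  rw [Finset.sum_add_distrib] at h2
  have h3 := sum_hump_le one_pos hK (d + 1)
  have h4 : ∑ j ∈ Finset.range (d + 1), (if j < Nat.log 2 n + 1 then (1 : ℝ) else 0) ≤
      Nat.log 2 n + 1 := by
    rw [← Finset.sum_filter, Finset.sum_const, nsmul_eq_mul, mul_one]
    have : ((Finset.range (d + 1)).filter fun j => j < Nat.log 2 n + 1).card ≤
        Nat.log 2 n + 1 := by
      refine (Finset.card_le_card fun j hj => ?_).trans (Finset.card_range _).le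
      exact Finset.mem_range.2 (Finset.mem_filter.1 hj).2
    exact_mod_cast this
  rw [sub_self, Real.rpow_zero, abs_one, Real.rpow_one, mul_one]
  rw [Real.rpow_one] at h3
  norm_num at h3
  have h5 : (0 : ℝ) ≤ Nat.log 2 n := Nat.cast_nonneg _
  have h6 : ∀ j : ℕ, (2 ^ j / K) ^ (1 - (1 : ℝ)) * min 1 ((2 ^ j / K) ^ (-(2 * a))) =
    min 1 ((2 ^ j / K) ^ (-(2 * a))) := fun j => by rw [sub_self, Real.rpow_zero, one_mul]
  simp only [h6] at h2
  simp only [Real.rpow_zero, one_mul]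
  linarith

/-! ### The bias in the target norm -/

/-- Weighted Cauchy–Schwarz in each of the squares that make up `T`. -/
theorem sqNorm_sum_le {d : ℕ} {T : Matrix (Fin d) (Fin d) ℝ} (hT : T.PosSemidef) {ι : Type*}
    (s : Finset ι) (x : ι → Fin d → ℝ) {β : ι → ℝ} (hβ : ∀ j, 0 < β j) :
    sqNorm T (∑ j ∈ s, x j) ≤ (∑ j ∈ s, β j) * ∑ j ∈ s, sqNorm T (x j) / β j := by
  obtain ⟨k, v, h1, -⟩ := exists_sq_decomposition hT
  simp only [h1, Finset.sum_div]
  rw [Finset.sum_comm, Finset.mul_sum]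
  refine Finset.sum_le_sum fun l _ => ?_
  rw [dotProduct_sum]
  refine Finset.sum_sq_le_sum_mul_sum_of_sq_le_mul s (fun j _ => (hβ j).le)
    (fun j _ => div_nonneg (sq_nonneg _) (hβ j).le) fun j _ => ?_
  rw [mul_div_cancel₀ _ (hβ j).ne']

/-- Block `j` starts at the zero-based index `2^j - 1`, so it lies in the tail of that index, where
the whitened target covariance has norm `O(2^(-jq))`. The tail bounds start at index 1; block 0, a
single coordinate, is treated through the diagonal entry. -/
theorem exists_sqNorm_block_le {c₁ : ℝ} (hc₁ : 0 < c₁) (a s r ν c₂ : ℝ)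
    (hq : 0 < (r + s) * a - ν) :
    ∃ C : ℝ, 0 < C ∧ ∀ (d D : ℕ) (lam m : Fin d → ℝ) (T : Matrix (Fin d) (Fin d) ℝ),
      PowerLaw a s r ν c₁ c₂ D lam m T → ∀ (j : ℕ) (x : Fin d → ℝ),
        (∀ i : Fin d, Nat.log 2 ((i : ℕ) + 1) ≠ j → x i = 0) →
        sqNorm T x ≤ C * (2 ^ j) ^ (-((r + s) * a - ν)) * ∑ i, m i * x i ^ 2 := by
  set q := (r + s) * a - ν with hqd
  set K₁ := max (c₁ ^ (s - 1)) (c₂ ^ (s - 1)) with hK₁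
  have hK₁0 : 0 < K₁ := lt_max_of_lt_left (Real.rpow_pos_of_pos hc₁ _)
  refine ⟨|c₂| * K₁ / c₁ + |c₂| * 2 ^ q + 1, by positivity,
    fun d D lam m T h j x hx => ?_⟩
  have hc₂ : 0 < c₂ := hc₁.trans_le h.const_le
  have hm : ∀ i, 0 < m i := h.m_pos hc₁
  have hsum : 0 ≤ ∑ i, m i * x i ^ 2 :=
    Finset.sum_nonneg fun i _ => mul_nonneg (hm i).le (sq_nonneg _)
  rw [abs_of_pos hc₂]
  rcases Nat.eq_zero_or_pos j with rfl | hj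
  · set i₀ : Fin d := ⟨0, h.dim_pos⟩ with hi₀
    have hxs : x = Pi.single i₀ (x i₀) := by
      funext i
      by_cases hi : i = i₀
      · rw [hi, Pi.single_eq_same]
      · rw [Pi.single_eq_of_ne hi]
        refine hx i fun hl => hi (Fin.ext ?_)
        have := Nat.lt_pow_succ_log_self (b := 2) (by norm_num) ((i : ℕ) + 1)
        rw [hl] at this
        have : (i : ℕ) = 0 := by omega
        simpa [hi₀] using this
    have h1 : T i₀ i₀ ≤ c₂ := by simpa [hi₀] using h.diag_upper i₀
    have h2 : lam i₀ ^ (s - 1) ≤ K₁ := by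
      have := h.lam_rpow_le hc₁ (s - 1) i₀
      rw [← hK₁] at this
      simpa [hi₀] using this
    have hl := h.lam_pos hc₁ i₀
    have h3 : c₁ ≤ K₁ * m i₀ := by
      have e1 := h.m_lower i₀
      have e2 : lam i₀ ^ (1 - s) * lam i₀ ^ (s - 1) = 1 := by
        rw [← Real.rpow_add hl]; simp
      calc c₁ = c₁ * lam i₀ ^ (1 - s) * lam i₀ ^ (s - 1) := by rw [mul_assoc, e2, mul_one]
        _ ≤ m i₀ * K₁ := mul_le_mul e1 h2 (Real.rpow_pos_of_pos hl _).le (hm i₀).le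
        _ = _ := mul_comm _ _
    have h4 : m i₀ * x i₀ ^ 2 ≤ ∑ i, m i * x i ^ 2 :=
      Finset.single_le_sum (f := fun i => m i * x i ^ 2)
        (fun i _ => mul_nonneg (hm i).le (sq_nonneg _)) (Finset.mem_univ i₀)
    rw [pow_zero, Real.one_rpow, mul_one]
    calc sqNorm T x = T i₀ i₀ * x i₀ ^ 2 := by
          conv_lhs => rw [hxs]
          rw [sqNorm_single]
      _ ≤ c₂ * (K₁ * m i₀ / c₁ * x i₀ ^ 2) := by
          refine mul_le_mul h1 ?_ (sq_nonneg _) hc₂.le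
          refine le_mul_of_one_le_left (sq_nonneg _) ?_
          rwa [le_div_iff₀ hc₁, one_mul]
      _ = c₂ * K₁ / c₁ * (m i₀ * x i₀ ^ 2) := by ring
      _ ≤ c₂ * K₁ / c₁ * ∑ i, m i * x i ^ 2 := mul_le_mul_of_nonneg_left h4 (by positivity)
      _ ≤ _ := by
          refine mul_le_mul_of_nonneg_right ?_ hsum
          have : 0 < c₂ * 2 ^ q := by positivity
          linarith
  · set k := 2 ^ j - 1 with hk
    have hj2 : 2 ≤ 2 ^ j := by
      calc 2 = 2 ^ 1 := rfl
        _ ≤ 2 ^ j := Nat.pow_le_pow_right (by norm_num) hj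
    have hzero : ∀ i : Fin d, (i : ℕ) < k → x i = 0 := fun i hi => hx i fun hl => by
      have := Nat.pow_log_le_self 2 (Nat.succ_ne_zero (i : ℕ))
      rw [Nat.succ_eq_add_one, hl] at this
      omega
    rcases le_or_gt d k with hkd | hkd
    · have : x = 0 := funext fun i => hzero i (i.2.trans_le hkd)
      have e : sqNorm T x = 0 := by rw [this]; simp [sqNorm]
      rw [e]
      positivity
    · have hk1 : 1 ≤ k := by omega
      have hkr : (2 : ℝ) ^ j / 2 ≤ k := by
        have : 2 ^ j ≤ 2 * k := by omega
        have : (2 : ℝ) ^ j ≤ 2 * k := by exact_mod_cast this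
        linarith
      have h1 : (k : ℝ) ^ (-((r + s) * a) + ν) ≤ 2 ^ q * (2 ^ j) ^ (-q) := by
        have e : -((r + s) * a) + ν = -q := by rw [hqd]; ring
        rw [e]
        calc (k : ℝ) ^ (-q) ≤ (2 ^ j / 2) ^ (-q) :=
              Real.rpow_le_rpow_of_nonpos (by positivity) hkr (by linarith)
          _ = _ := by
              rw [Real.div_rpow (by positivity) (by norm_num), Real.rpow_neg (by norm_num : (0:ℝ) ≤ 2) q]
              field_simp
      have h2 := h.tail_upper k hk1 hkd
      set v : Fin d → ℝ := fun i => √(m i) * x i with hv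
      have e1 : (fun i => (√(m i))⁻¹ * v i) = x := by
        funext i
        have : √(m i) ≠ 0 := (Real.sqrt_pos.2 (hm i)).ne'
        rw [hv]
        field_simp
      have e2 : sqNorm T x = v ⬝ᵥ (whiten m (tail k T) *ᵥ v) := by
        rw [sqNorm_whiten, e1, sqNorm_tail T hzero]
      have e3 : v ⬝ᵥ v = ∑ i, m i * x i ^ 2 :=
        Finset.sum_congr rfl fun i _ => by
          simp only [hv]; rw [← sq, mul_pow, Real.sq_sqrt (hm i).le]
      rw [e2]
      have h3 := dotProduct_mulVec_le_specNorm (whiten m (tail k T)) v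
      rw [e3] at h3
      refine h3.trans (mul_le_mul_of_nonneg_right ?_ hsum)
      have hp : (0 : ℝ) < (2 ^ j) ^ (-q) := by positivity
      calc _ ≤ c₂ * (2 ^ q * (2 ^ j) ^ (-q)) := h2.trans (mul_le_mul_of_nonneg_left h1 hc₂.le)
        _ = c₂ * 2 ^ q * (2 ^ j) ^ (-q) := by ring
        _ ≤ _ := by
            refine mul_le_mul_of_nonneg_right ?_ hp.le
            have : 0 < c₂ * K₁ / c₁ := by positivity
            linarith

theorem hump_le_one (p : ℝ) {K : ℝ} (hK : 0 < K) (j : ℕ) : hump p K j ≤ 1 := by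
  have hz : (0 : ℝ) < 2 ^ j / K := by positivity
  rw [hump, Real.rpow_neg hz.le]
  rcases le_total ((2 ^ j / K : ℝ) ^ p) 1 with h | h
  · exact (min_le_left _ _).trans h
  · exact (min_le_right _ _).trans (inv_le_one_of_one_le₀ h)

/-- Damping by `z^(2q)` outweighs the growth of `z^(-q)` towards low indices, so the profile decays
on both sides of the scale. It is written as a square because one factor serves as the
Cauchy–Schwarz weight of the block. -/
theorem rpow_mul_min_le_hump_sq {q K : ℝ} (hq : 0 < q) (hK : 0 < K) (j : ℕ) :
    (2 ^ j) ^ (-q) * min 1 ((2 ^ j / K) ^ (2 * q)) ≤ K ^ (-q) * hump (q / 2) K j ^ 2 := by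
  set z : ℝ := 2 ^ j / K with hz
  have hz0 : 0 < z := by positivity
  have e1 : ((2 : ℝ) ^ j) ^ (-q) = K ^ (-q) * z ^ (-q) := by
    rw [← Real.mul_rpow hK.le hz0.le, hz, mul_div_cancel₀ _ hK.ne']
  have e2 : ∀ p : ℝ, (z ^ p) ^ 2 = z ^ (p + p) := fun p => by
    rw [sq, Real.rpow_add hz0]
  rw [e1, mul_assoc]
  refine mul_le_mul_of_nonneg_left ?_ (by positivity)
  rw [hump, ← hz]
  rcases le_total z 1 with h | h
  · rw [min_eq_left (Real.rpow_le_rpow_of_exponent_ge hz0 h (by linarith)), e2]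
    calc z ^ (-q) * min 1 (z ^ (2 * q)) ≤ z ^ (-q) * z ^ (2 * q) :=
          mul_le_mul_of_nonneg_left (min_le_right _ _) (by positivity)
      _ = _ := by rw [← Real.rpow_add hz0]; congr 1; ring
  · rw [min_eq_right (Real.rpow_le_rpow_of_exponent_le h (by linarith)), e2]
    calc z ^ (-q) * min 1 (z ^ (2 * q)) ≤ z ^ (-q) * 1 :=
          mul_le_mul_of_nonneg_left (min_le_left _ _) (by positivity)
      _ = _ := by rw [mul_one]; congr 1; ring

/-- A profile that is damped above the scale `K⁻¹` is small in the target norm. -/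
theorem exists_sqNorm_le_of_damped {c₁ : ℝ} (hc₁ : 0 < c₁) (a s r ν c₂ : ℝ)
    (hq : 0 < (r + s) * a - ν) :
    ∃ C : ℝ, 0 < C ∧ ∀ (d D : ℕ) (lam m : Fin d → ℝ) (T : Matrix (Fin d) (Fin d) ℝ),
      PowerLaw a s r ν c₁ c₂ D lam m T → ∀ (w x : Fin d → ℝ) (A K : ℝ), 0 < K → 0 ≤ A →
        ∑ i, m i * w i ^ 2 ≤ 1 →
        (∀ i : Fin d, x i ^ 2 ≤
          A * w i ^ 2 * min 1 ((((i : ℕ) + 1 : ℝ) / K) ^ (2 * ((r + s) * a - ν)))) →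
        sqNorm T x ≤ A * C * K ^ (-((r + s) * a - ν)) := by
  obtain ⟨C₀, hC₀, hblock⟩ := exists_sqNorm_block_le hc₁ a s r ν c₂ hq
  set q := (r + s) * a - ν with hqd
  set H := 2 * ((2 : ℝ) ^ (q / 2) + 1) / ((2 : ℝ) ^ (q / 2) - 1) with hH
  have hρ : 0 < (2 : ℝ) ^ (q / 2) - 1 := by
    have := Real.one_lt_rpow (by norm_num : (1 : ℝ) < 2) (by linarith : 0 < q / 2); linarith
  have hH0 : 0 < H := by positivity
  refine ⟨H * (C₀ * 2 ^ (2 * q)), by positivity,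
    fun d D lam m T h w x A K hK hA hw hx => ?_⟩
  have hm : ∀ i, 0 < m i := h.m_pos hc₁
  set y : ℕ → Fin d → ℝ := fun j i => if Nat.log 2 ((i : ℕ) + 1) = j then x i else 0 with hy
  set W : ℕ → ℝ := fun j =>
    ∑ i : Fin d, if Nat.log 2 ((i : ℕ) + 1) = j then m i * w i ^ 2 else 0 with hW
  have hW0 : ∀ j, 0 ≤ W j := fun j => Finset.sum_nonneg fun i _ => by
    split_ifs
    · exact mul_nonneg (hm i).le (sq_nonneg _)
    · exact le_rfl
  have hWs : ∑ j ∈ Finset.range (d + 1), W j ≤ 1 := by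
    rw [hW, Finset.sum_comm]
    refine (le_of_eq (Finset.sum_congr rfl fun i _ => ?_)).trans hw
    rw [Finset.sum_ite_eq, if_pos (log_succ_mem_range i)]
  have hxy : x = ∑ j ∈ Finset.range (d + 1), y j := by
    funext i
    rw [Finset.sum_apply, hy]
    simp only
    rw [Finset.sum_ite_eq, if_pos (log_succ_mem_range i)]
  have hβ : ∀ j, 0 < hump (q / 2) K j := hump_pos _ hK
  have hterm : ∀ j, sqNorm T (y j) / hump (q / 2) K j ≤
      A * (C₀ * 2 ^ (2 * q)) * K ^ (-q) * W j := fun j => by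
    rw [div_le_iff₀ (hβ j)]
    have h1 := hblock d D lam m T h j (y j) fun i hi => if_neg hi
    have h2 : ∑ i, m i * y j i ^ 2 ≤
        A * (2 ^ (2 * q) * min 1 ((2 ^ j / K) ^ (2 * q))) * W j := by
      rw [hW, Finset.mul_sum]
      refine Finset.sum_le_sum fun i _ => ?_
      simp only [hy]
      split_ifs with hi
      · have e1 : min 1 ((((i : ℕ) + 1 : ℝ) / K) ^ (2 * q)) ≤
            2 ^ (2 * q) * min 1 ((2 ^ j / K) ^ (2 * q)) := by
          rw [mul_min_of_nonneg _ _ (by positivity), mul_one, ← Real.mul_rpow (by norm_num) (by positivity)]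
          refine min_le_min (Real.one_le_rpow (by norm_num) (by linarith)) ?_
          refine Real.rpow_le_rpow (by positivity) ?_ (by linarith)
          rw [← mul_div_assoc]
          refine div_le_div_of_nonneg_right ?_ hK.le
          have := (pow_log_le i).2
          rwa [hi] at this
        calc m i * x i ^ 2 ≤ m i * (A * w i ^ 2 * (2 ^ (2 * q) * min 1 ((2 ^ j / K) ^ (2 * q)))) :=
              mul_le_mul_of_nonneg_left ((hx i).trans
                (mul_le_mul_of_nonneg_left e1 (by positivity))) (hm i).le
          _ = _ := by ring
      · simp
    have h3 := rpow_mul_min_le_hump_sq (K := K) (by positivity : 0 < q) hK j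
    have h4 : hump (q / 2) K j ^ 2 ≤ hump (q / 2) K j := by
      have := hump_le_one (q / 2) hK j
      have := hβ j
      nlinarith
    calc sqNorm T (y j) ≤ C₀ * (2 ^ j) ^ (-q) *
          (A * (2 ^ (2 * q) * min 1 ((2 ^ j / K) ^ (2 * q))) * W j) :=
          h1.trans (mul_le_mul_of_nonneg_left h2 (by positivity))
      _ = A * (C₀ * 2 ^ (2 * q)) * W j * ((2 ^ j) ^ (-q) * min 1 ((2 ^ j / K) ^ (2 * q))) := by
          ring
      _ ≤ A * (C₀ * 2 ^ (2 * q)) * W j * (K ^ (-q) * hump (q / 2) K j) := by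
          refine mul_le_mul_of_nonneg_left (h3.trans ?_) ?_
          · exact mul_le_mul_of_nonneg_left h4 (by positivity)
          · have := hW0 j; positivity
      _ = _ := by ring
  rw [hxy]
  refine (sqNorm_sum_le h.posSemidef _ y hβ).trans ?_
  have h5 : ∑ j ∈ Finset.range (d + 1), sqNorm T (y j) / hump (q / 2) K j ≤
      A * (C₀ * 2 ^ (2 * q)) * K ^ (-q) := by
    refine (Finset.sum_le_sum fun j _ => hterm j).trans ?_
    rw [← Finset.mul_sum]
    exact mul_le_of_le_one_right (by positivity) hWs
  have h6 : ∑ j ∈ Finset.range (d + 1), hump (q / 2) K j ≤ H :=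
    sum_hump_le (by linarith) hK _
  have h7 : 0 ≤ ∑ j ∈ Finset.range (d + 1), hump (q / 2) K j :=
    Finset.sum_nonneg fun j _ => (hβ j).le
  calc _ ≤ (∑ j ∈ Finset.range (d + 1), hump (q / 2) K j) *
        (A * (C₀ * 2 ^ (2 * q)) * K ^ (-q)) := mul_le_mul_of_nonneg_left h5 h7
    _ ≤ H * (A * (C₀ * 2 ^ (2 * q)) * K ^ (-q)) :=
        mul_le_mul_of_nonneg_right h6 (by positivity)
    _ = _ := by ring

/-! ### Bias, variance and kernel under the power laws -/

section PowerLaw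

variable {a s r ν c₁ c₂ : ℝ} {d D : ℕ} {lam m : Fin d → ℝ} {T : Matrix (Fin d) (Fin d) ℝ}

theorem rpow_scale {a K G : ℝ} (hK : 0 < K) (hKa : K ^ a = G) (i : ℕ) :
    G * ((i : ℝ) + 1) ^ (-a) = (K / ((i : ℝ) + 1)) ^ a := by
  have hi : (0 : ℝ) < (i : ℝ) + 1 := by positivity
  rw [Real.div_rpow hK.le hi.le, hKa, Real.rpow_neg hi.le, div_eq_mul_inv]

/-- The modes below the scale `K` are resolved, and the ones above it do not contribute. -/
theorem PowerLaw.variance_term_le (h : PowerLaw a s r ν c₁ c₂ D lam m T) (hc₁ : 0 < c₁)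
    {N Γ K : ℝ} (hN : 0 < N) (hΓ : 0 < Γ) (hK : 0 < K) (hKa : K ^ a = N * Γ) (i : Fin d) :
    N * (lam i * T i i * (Γ ^ 2 / (1 + (N * Γ * lam i) ^ 2))) ≤
      c₂ / c₁ * (1 + c₂ ^ 2) * (1 / N) *
        (((i : ℕ) + 1 : ℝ) ^ (-(r * a)) * min 1 ((K / ((i : ℕ) + 1)) ^ (2 * a))) := by
  have hc₂ : 0 < c₂ := hc₁.trans_le h.const_le
  have hl := h.lam_pos hc₁ i
  have hi : (0 : ℝ) < (i : ℕ) + 1 := by positivity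
  set y := N * Γ * lam i with hy
  have hy0 : 0 < y := by positivity
  have hT0 : 0 ≤ T i i := le_trans (by positivity) (h.diag_lower i)
  have e1 : N * (lam i * T i i * (Γ ^ 2 / (1 + y ^ 2))) =
      T i i / lam i * (1 / N) * (y ^ 2 / (1 + y ^ 2)) := by
    have : 1 + y ^ 2 ≠ 0 := by positivity
    have h1 : T i i / lam i * (1 / N) * (y ^ 2 / (1 + y ^ 2)) =
      T i i / lam i * (1 / N) * y ^ 2 / (1 + y ^ 2) := by ring
    rw [h1, hy]
    have : 1 + (N * Γ * lam i) ^ 2 ≠ 0 := by positivity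
    field_simp
  have h1 : T i i / lam i ≤ c₂ / c₁ * ((i : ℕ) + 1 : ℝ) ^ (-(r * a)) := by
    rw [div_le_iff₀ hl]
    refine (h.diag_upper i).trans ?_
    have e : ((i : ℕ) + 1 : ℝ) ^ (-((1 + r) * a)) =
        ((i : ℕ) + 1 : ℝ) ^ (-(r * a)) * ((i : ℕ) + 1 : ℝ) ^ (-a) := by
      rw [← Real.rpow_add hi]; congr 1; ring
    rw [e]
    calc c₂ * (((i : ℕ) + 1 : ℝ) ^ (-(r * a)) * ((i : ℕ) + 1 : ℝ) ^ (-a)) =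
          c₂ / c₁ * ((i : ℕ) + 1 : ℝ) ^ (-(r * a)) * (c₁ * ((i : ℕ) + 1 : ℝ) ^ (-a)) := by
          field_simp
      _ ≤ _ := mul_le_mul_of_nonneg_left (h.lam_lower i) (by positivity)
  have h2 : y ≤ c₂ * (K / ((i : ℕ) + 1)) ^ a := by
    rw [← rpow_scale hK hKa, hy]
    calc _ ≤ N * Γ * (c₂ * ((i : ℕ) + 1 : ℝ) ^ (-a)) :=
          mul_le_mul_of_nonneg_left (h.lam_upper i) (by positivity)
      _ = _ := by ring
  have h3 : y ^ 2 / (1 + y ^ 2) ≤ (1 + c₂ ^ 2) * min 1 ((K / ((i : ℕ) + 1)) ^ (2 * a)) := by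
    have e2 : (K / ((i : ℕ) + 1 : ℝ)) ^ (2 * a) = ((K / ((i : ℕ) + 1)) ^ a) ^ 2 := by
      rw [mul_comm, Real.rpow_mul (by positivity)]; norm_num
    rw [mul_min_of_nonneg _ _ (by positivity), e2]
    refine le_min ?_ ?_
    · rw [div_le_iff₀ (by positivity)]
      nlinarith [sq_nonneg c₂, sq_nonneg y, mul_nonneg (sq_nonneg c₂) (sq_nonneg y)]
    · have h4 : y ^ 2 ≤ (c₂ * (K / ((i : ℕ) + 1)) ^ a) ^ 2 := pow_le_pow_left₀ hy0.le h2 2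
      calc y ^ 2 / (1 + y ^ 2) ≤ y ^ 2 := div_le_self (sq_nonneg _) (by nlinarith)
        _ ≤ _ := h4
        _ = c₂ ^ 2 * ((K / ((i : ℕ) + 1)) ^ a) ^ 2 := mul_pow _ _ _
        _ ≤ _ := mul_le_mul_of_nonneg_right (by linarith) (sq_nonneg _)
  rw [e1]
  calc _ ≤ (c₂ / c₁ * ((i : ℕ) + 1 : ℝ) ^ (-(r * a))) * (1 / N) *
        ((1 + c₂ ^ 2) * min 1 ((K / ((i : ℕ) + 1)) ^ (2 * a))) := by
        refine mul_le_mul ?_ h3 (by positivity) (by positivity)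
        exact mul_le_mul_of_nonneg_right h1 (by positivity)
    _ = _ := by ring

/-- The exponential beats any power of `y = N Γ lam i`, which is at least of order `(K / (i +
1))^a`; the power `2q / a` gives exactly the damping that `exists_sqNorm_le_of_damped` asks for. -/
theorem PowerLaw.exp_le (h : PowerLaw a s r ν c₁ c₂ D lam m T) (hc₁ : 0 < c₁) (ha : 0 < a)
    {q N Γ K : ℝ} (hq : 0 < q) (hN : 0 < N) (hΓ : 0 < Γ) (hK : 0 < K) (hKa : K ^ a = N * Γ)
    (i : Fin d) :
    Real.exp (-(N * Γ * lam i / 8)) ≤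
      (1 + (8 * (2 * q / a) / c₁) ^ (2 * q / a)) *
        min 1 ((((i : ℕ) + 1 : ℝ) / K) ^ (2 * q)) := by
  set p := 2 * q / a with hp
  have hp0 : 0 < p := by positivity
  have hi : (0 : ℝ) < (i : ℕ) + 1 := by positivity
  have hl := h.lam_pos hc₁ i
  set y := N * Γ * lam i with hy
  have hy0 : 0 < y := by positivity
  have h1 : c₁ * (K / ((i : ℕ) + 1)) ^ a ≤ y := by
    rw [← rpow_scale hK hKa, hy]
    calc _ = N * Γ * (c₁ * ((i : ℕ) + 1 : ℝ) ^ (-a)) := by ring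
      _ ≤ _ := mul_le_mul_of_nonneg_left (h.lam_lower i) (by positivity)
  have h2 : (y / 8 / p) ^ p ≤ Real.exp (y / 8) := by
    have e1 : y / 8 / p ≤ Real.exp (y / 8 / p) := by
      have := Real.add_one_le_exp (y / 8 / p); linarith
    calc _ ≤ Real.exp (y / 8 / p) ^ p := Real.rpow_le_rpow (by positivity) e1 hp0.le
      _ = _ := by rw [← Real.exp_mul, div_mul_cancel₀ _ hp0.ne']
  have hC : 0 < (8 * p / c₁) ^ p := by positivity
  have h3 : Real.exp (-(y / 8)) ≤ (8 * p / c₁) ^ p * (((i : ℕ) + 1 : ℝ) / K) ^ (2 * q) := by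
    have e2 : (8 * p / c₁) ^ p * (((i : ℕ) + 1 : ℝ) / K) ^ (2 * q) =
        ((c₁ * (K / ((i : ℕ) + 1)) ^ a / 8 / p) ^ p)⁻¹ := by
      have e3 : (((i : ℕ) + 1 : ℝ) / K) ^ (2 * q) = ((((i : ℕ) + 1 : ℝ) / K) ^ a) ^ p := by
        rw [← Real.rpow_mul (by positivity)]
        congr 1
        rw [hp]; field_simp
      rw [e3, ← Real.mul_rpow (by positivity) (by positivity), ← Real.inv_rpow (by positivity)]
      congr 1
      have : (((i : ℕ) + 1 : ℝ) / K) = (K / ((i : ℕ) + 1))⁻¹ := by rw [inv_div]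
      rw [this, Real.inv_rpow (by positivity)]
      have : (K / ((i : ℕ) + 1 : ℝ)) ^ a ≠ 0 := (Real.rpow_pos_of_pos (by positivity) _).ne'
      field_simp
    rw [e2, Real.exp_neg]
    refine inv_anti₀ (by positivity) (le_trans ?_ h2)
    exact Real.rpow_le_rpow (by positivity) (by gcongr) hp0.le
  rw [mul_min_of_nonneg _ _ (by positivity)]
  refine le_min ?_ (h3.trans ?_)
  · have : Real.exp (-(y / 8)) ≤ 1 := Real.exp_le_one_iff.2 (by linarith)
    linarith
  · exact mul_le_mul_of_nonneg_right (by linarith) (by positivity)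

/-- Since `lam = lam^s * lam^(1-s)` and `lam^s` is bounded for `s > 0`, the ellipsoid is bounded in
the source norm. -/
theorem PowerLaw.sum_lam_mul_sq_le (h : PowerLaw a s r ν c₁ c₂ D lam m T) (hc₁ : 0 < c₁)
    (ha : 0 < a) (hs : 0 < s) {w : Fin d → ℝ} (hw : ∑ i, m i * w i ^ 2 ≤ 1) :
    ∑ i, lam i * w i ^ 2 ≤ c₂ ^ s / c₁ := by
  have hc₂ : 0 < c₂ := hc₁.trans_le h.const_le
  have h1 : ∀ i, lam i ≤ c₂ ^ s / c₁ * m i := fun i => by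
    have hl := h.lam_pos hc₁ i
    have e1 : lam i ≤ c₂ := by
      refine (h.lam_upper i).trans (mul_le_of_le_one_right hc₂.le ?_)
      exact Real.rpow_le_one_of_one_le_of_nonpos (by simp) (by linarith)
    have e2 : lam i ^ s * lam i ^ (1 - s) = lam i := by
      rw [← Real.rpow_add hl]; simp
    calc lam i = lam i ^ s * lam i ^ (1 - s) := e2.symm
      _ ≤ c₂ ^ s * (m i / c₁) := by
          refine mul_le_mul (Real.rpow_le_rpow hl.le e1 hs.le) ?_ (by positivity) (by positivity)
          rw [le_div_iff₀ hc₁, mul_comm]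
          exact h.m_lower i
      _ = _ := by ring
  calc ∑ i, lam i * w i ^ 2 ≤ ∑ i, c₂ ^ s / c₁ * (m i * w i ^ 2) :=
        Finset.sum_le_sum fun i _ => by
          rw [← mul_assoc]
          exact mul_le_mul_of_nonneg_right (h1 i) (sq_nonneg _)
    _ ≤ c₂ ^ s / c₁ := by
        rw [← Finset.mul_sum]
        exact mul_le_of_le_one_right (by positivity) hw

end PowerLaw

/-- Interpolation: `min A B ≤ A^t B^(1-t)` with `A = Γ lam i` and `B = 1/κ`. The condition `a t > 1`
makes the sum of `lam i ^ t` bounded uniformly in the dimension. -/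
theorem exists_sum_kernel_le {c₁ : ℝ} (hc₁ : 0 < c₁) (s r ν c₂ : ℝ) {a t : ℝ} (ha : 1 < a)
    (hat : 1 < a * t) (ht : t < 1) :
    ∃ C : ℝ, 0 < C ∧ ∀ (d D : ℕ) (lam m : Fin d → ℝ) (T : Matrix (Fin d) (Fin d) ℝ),
      PowerLaw a s r ν c₁ c₂ D lam m T → ∀ Γ κ δ : ℝ, 0 < Γ → 0 < κ → 0 < δ →
        ∑ i, min (Γ * lam i) (1 / κ + δ * lam i) ≤ C * (Γ ^ t * κ ^ (t - 1) + δ) := by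
  have ht0 : 0 < t := by
    by_contra! h
    nlinarith
  obtain ⟨C₁, hC₁, h₁⟩ := sum_rpow_le hat
  obtain ⟨C₂, hC₂, h₂⟩ := sum_rpow_le ha
  refine ⟨max (c₁ ^ t) (c₂ ^ t) * C₁ + |c₂| * C₂, ?_, fun d D lam m T h Γ κ δ hΓ hκ hδ => ?_⟩
  · have : 0 < max (c₁ ^ t) (c₂ ^ t) := lt_max_of_lt_left (Real.rpow_pos_of_pos hc₁ _)
    positivity
  have hM : 0 < max (c₁ ^ t) (c₂ ^ t) := lt_max_of_lt_left (Real.rpow_pos_of_pos hc₁ _)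
  set A := max (c₁ ^ t) (c₂ ^ t) with hA
  have hc₂ : 0 < c₂ := hc₁.trans_le h.const_le
  rw [abs_of_pos hc₂]
  have hterm : ∀ i, min (Γ * lam i) (1 / κ + δ * lam i) ≤
      Γ ^ t * κ ^ (t - 1) * (A * ((i : ℕ) + 1 : ℝ) ^ (-(a * t))) +
        δ * (c₂ * ((i : ℕ) + 1 : ℝ) ^ (-a)) := fun i => by
    have hl := h.lam_pos hc₁ i
    have e1 : min (Γ * lam i) (1 / κ + δ * lam i) ≤ min (Γ * lam i) (1 / κ) + δ * lam i := by
      rw [min_add]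
      exact min_le_min (by nlinarith [mul_pos hδ hl]) le_rfl
    have e2 : min (Γ * lam i) (1 / κ) ≤ Γ ^ t * κ ^ (t - 1) * lam i ^ t := by
      have hmin : 0 < min (Γ * lam i) (1 / κ) := lt_min (by positivity) (by positivity)
      have e3 : κ ^ (t - 1) = (1 / κ) ^ (1 - t) := by
        rw [one_div, Real.inv_rpow hκ.le, ← Real.rpow_neg hκ.le]; congr 1; ring
      calc min (Γ * lam i) (1 / κ) =
            min (Γ * lam i) (1 / κ) ^ t * min (Γ * lam i) (1 / κ) ^ (1 - t) := by
            rw [← Real.rpow_add hmin]; simp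
        _ ≤ (Γ * lam i) ^ t * (1 / κ) ^ (1 - t) :=
            mul_le_mul (Real.rpow_le_rpow hmin.le (min_le_left _ _) ht0.le)
              (Real.rpow_le_rpow hmin.le (min_le_right _ _) (by linarith))
              (by positivity) (by positivity)
        _ = _ := by rw [Real.mul_rpow hΓ.le hl.le, e3]; ring
    have e4 := h.lam_rpow_le hc₁ t i
    have e5 := h.lam_upper i
    calc _ ≤ Γ ^ t * κ ^ (t - 1) * lam i ^ t + δ * lam i := e1.trans (by linarith)
      _ ≤ _ := add_le_add (mul_le_mul_of_nonneg_left e4 (by positivity))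
          (mul_le_mul_of_nonneg_left e5 hδ.le)
  refine (Finset.sum_le_sum fun i _ => hterm i).trans ?_
  rw [Finset.sum_add_distrib, ← Finset.mul_sum, ← Finset.mul_sum, ← Finset.mul_sum,
    ← Finset.mul_sum]
  have f1 : 0 < Γ ^ t * κ ^ (t - 1) := by positivity
  calc _ ≤ Γ ^ t * κ ^ (t - 1) * (A * C₁) + δ * (c₂ * C₂) := by
        refine add_le_add ?_ ?_
        · exact mul_le_mul_of_nonneg_left (mul_le_mul_of_nonneg_left (h₁ d) hM.le) f1.le
        · exact mul_le_mul_of_nonneg_left (mul_le_mul_of_nonneg_left (h₂ d) hc₂.le) hδ.le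
    _ ≤ _ := by
        have g1 : 0 < Γ ^ t * κ ^ (t - 1) * (c₂ * C₂) := by positivity
        have g2 : 0 < δ * (A * C₁) := by positivity
        nlinarith

/-- The number of resolved modes, weighted by their share of the variance. -/
noncomputable def effectiveDim (a r K : ℝ) (n : ℕ) : ℝ :=
  if 1 / a < r then 1 else if r = 1 / a then (Nat.log 2 n + 1 : ℝ) else K ^ (1 - r * a)

/-- The cases are those of convergence, logarithmic divergence and power divergence of `∑ i^(-ra)`
cut off at `K`. The lower bound on `r` makes the part beyond the cut-off, with exponent `ra + 2a`,
summable. -/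
theorem exists_variance_le {c₁ : ℝ} (hc₁ : 0 < c₁) (s ν c₂ : ℝ) {a r : ℝ} (ha : 1 < a)
    (hr : 1 / a - 2 < r) :
    ∃ C : ℝ, 0 < C ∧ ∀ (d D : ℕ) (lam m : Fin d → ℝ) (T : Matrix (Fin d) (Fin d) ℝ),
      PowerLaw a s r ν c₁ c₂ D lam m T → ∀ (N Γ K : ℝ) (n : ℕ), 0 < N → 0 < Γ → 0 < K →
        K ^ a = N * Γ → K ≤ n →
        N * ∑ i, lam i * T i i * (Γ ^ 2 / (1 + (N * Γ * lam i) ^ 2)) ≤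
          C * (effectiveDim a r K n / N) := by
  have ha0 : 0 < a := by linarith
  obtain ⟨C, hC, hsum⟩ : ∃ C : ℝ, 0 < C ∧ ∀ (d : ℕ) (K : ℝ) (n : ℕ), 0 < K → K ≤ n →
      ∑ i : Fin d, ((i : ℕ) + 1 : ℝ) ^ (-(r * a)) * min 1 ((K / ((i : ℕ) + 1)) ^ (2 * a)) ≤
        C * effectiveDim a r K n := by
    unfold effectiveDim
    split_ifs with h1 h2
    · obtain ⟨C, hC, h⟩ := sum_rpow_le ((div_lt_iff₀ ha0).1 h1)
      refine ⟨C, hC, fun d K n hK _ => ?_⟩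
      rw [mul_one]
      refine (Finset.sum_le_sum fun i _ => ?_).trans (h d)
      exact mul_le_of_le_one_right (by positivity) (min_le_left _ _)
    · obtain ⟨C, hC, h⟩ := sum_inv_min_le (a := a) (by linarith)
      have e : r * a = 1 := by rw [h2]; field_simp
      refine ⟨C, hC, fun d K n hK hKn => ?_⟩
      rw [e]
      exact h d K n hK hKn
    · have h3 : r * a < 1 :=
        (lt_div_iff₀ ha0).1 (lt_of_le_of_ne (not_lt.1 h1) h2)
      have h4 : 1 < r * a + 2 * a := by
        have := (div_lt_iff₀ ha0).1 (by linarith : 1 / a < r + 2)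
        linarith
      obtain ⟨C, hC, h⟩ := sum_rpow_min_le ha0 h3 h4
      exact ⟨C, hC, fun d K n hK _ => h d K hK⟩
  by_cases hcc : c₁ ≤ c₂
  · have hc₂ : 0 < c₂ := hc₁.trans_le hcc
    refine ⟨c₂ / c₁ * (1 + c₂ ^ 2) * C, by positivity,
      fun d D lam m T h N Γ K n hN hΓ hK hKa hKn => ?_⟩
    rw [Finset.mul_sum]
    refine (Finset.sum_le_sum fun i _ => h.variance_term_le hc₁ hN hΓ hK hKa i).trans ?_
    rw [← Finset.mul_sum]
    calc _ ≤ c₂ / c₁ * (1 + c₂ ^ 2) * (1 / N) * (C * effectiveDim a r K n) :=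
          mul_le_mul_of_nonneg_left (hsum d K n hK hKn) (by positivity)
      _ = _ := by ring
  · exact ⟨1, one_pos, fun d D lam m T h => absurd h.const_le hcc⟩

/-- The smallness assumption at the end makes the second term of `bias_sq_le` no larger than the
damping factor of the first mode, hence of any mode. -/
theorem exists_bias_le {c₁ : ℝ} (hc₁ : 0 < c₁) (s r ν c₂ : ℝ) {a : ℝ} (ha : 1 < a)
    (hq : 0 < (r + s) * a - ν) :
    ∃ C : ℝ, 0 < C ∧ ∀ (d D : ℕ) (lam m : Fin d → ℝ) (T : Matrix (Fin d) (Fin d) ℝ),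
      PowerLaw a s r ν c₁ c₂ D lam m T → ∀ (w : Fin d → ℝ) (b κ δ Γ K : ℝ) (N L n : ℕ),
        ∑ i, m i * w i ^ 2 ≤ 1 → Schedule b κ δ Γ c₂ N L n → 0 < K → K ^ a = N * Γ →
        (N : ℝ) ^ 3 * Real.exp (-(N * b / 8)) ≤ min 1 (K ^ (-(2 * ((r + s) * a - ν)))) →
        sqNorm T (fun i => output b (flow b (δ * lam i) (Γ * lam i) (stageOf N L) 0 (-w i, 0) n)) ≤
          C * K ^ (-((r + s) * a - ν)) := by
  obtain ⟨C₀, hC₀, hdamp⟩ := exists_sqNorm_le_of_damped hc₁ a s r ν c₂ hq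
  set q := (r + s) * a - ν with hqd
  set E := (8 * (2 * q / a) / c₁) ^ (2 * q / a) with hE
  have hE0 : 0 < E := by positivity
  refine ⟨96 * (2 + E) * C₀, by positivity,
    fun d D lam m T h w b κ δ Γ K N L n hw hS hK hKa htiny => ?_⟩
  refine hdamp d D lam m T h w _ (96 * (2 + E)) K hK (by positivity) hw fun i => ?_
  have hc₂ : 0 < c₂ := hc₁.trans_le h.const_le
  have hl := h.lam_pos hc₁ i
  have hlc : lam i ≤ c₂ := by
    refine (h.lam_upper i).trans (mul_le_of_le_one_right hc₂.le ?_)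
    exact Real.rpow_le_one_of_one_le_of_nonpos (by simp) (by linarith)
  have hNn : N ≤ n := by
    have := hS.le_n
    have := hS.L_ge
    nlinarith
  have h1 := hS.bias_sq_le hl hlc (isTraj_flow b (δ * lam i) (Γ * lam i) (stageOf N L) 0 (-w i, 0))
    (flow_self b (δ * lam i) (Γ * lam i) (stageOf N L) 0 (-w i, 0)) hNn
  have h2 := output_sq_le hS.b_pos (by linarith [hS.b_le])
    (flow b (δ * lam i) (Γ * lam i) (stageOf N L) 0 (-w i, 0) n)
  have hi1 : (1 : ℝ) ≤ (i : ℕ) + 1 := by simp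
  set Mi := min 1 ((((i : ℕ) + 1 : ℝ) / K) ^ (2 * q)) with hMi
  have hNp : (0 : ℝ) < N := Nat.cast_pos.2 hS.N_pos
  have h3 := h.exp_le hc₁ (by linarith) hq hNp hS.Gamma_pos hK hKa i
  have h4 : (N : ℝ) ^ 3 * Real.exp (-(N * b / 8)) ≤ Mi := by
    refine htiny.trans (min_le_min le_rfl ?_)
    rw [Real.rpow_neg hK.le, Real.div_rpow (by positivity) hK.le, div_eq_mul_inv]
    refine le_mul_of_one_le_left (by positivity) ?_
    exact Real.one_le_rpow hi1 (by linarith)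
  rw [← hMi, ← hE] at h3
  calc _ ≤ 2 * (48 * (-w i) ^ 2 * (Real.exp (-(N * Γ * lam i / 8)) +
        N ^ 3 * Real.exp (-(N * b / 8)))) := h2.trans (by linarith)
    _ = 96 * w i ^ 2 * (Real.exp (-(N * Γ * lam i / 8)) +
        N ^ 3 * Real.exp (-(N * b / 8))) := by ring
    _ ≤ 96 * w i ^ 2 * ((1 + E) * Mi + Mi) :=
        mul_le_mul_of_nonneg_left (add_le_add h3 h4) (by positivity)
    _ = _ := by ring

theorem exists_asgd_risk_le {c₁ : ℝ} (hc₁ : 0 < c₁) (ν c₂ : ℝ) {a s r ψ : ℝ} (ha : 1 < a)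
    (hs : 0 < s) (hr : 1 / a - 2 < r) (hq : 0 < (r + s) * a - ν) (hψ : 1 ≤ ψ) :
    ∃ C : ℝ, 0 < C ∧ ∀ (d D : ℕ) (lam m : Fin d → ℝ) (T : Matrix (Fin d) (Fin d) ℝ),
      PowerLaw a s r ν c₁ c₂ D lam m T → ∀ (σ : ℝ) (P Q : Measure (Obs d)) (w : Fin d → ℝ),
        IsProblem ψ σ lam m T P Q w → ∀ (b κ δ Γ K : ℝ) (n : ℕ),
        Schedule b κ δ Γ c₂ (n / Nat.log 2 n) (Nat.log 2 n) n → 0 < K →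
        K ^ a = (n / Nat.log 2 n : ℕ) * Γ → K ≤ n →
        ((n / Nat.log 2 n : ℕ) : ℝ) ^ 3 * Real.exp (-((n / Nat.log 2 n : ℕ) * b / 8)) ≤
          min 1 (K ^ (-(2 * ((r + s) * a - ν)))) →
        4 * ψ * ((Nat.log 2 n : ℕ) *
          (50000 * ∑ i, min (Γ * lam i) (1 / κ + δ * lam i))) ≤ 1 →
        expRisk (n := n) T P (asgd (alphaOf b) (b / 2) δ (gammaOf b δ Γ)) w ≤
          ENNReal.ofReal (C * (1 + σ ^ 2) * (K ^ (-((r + s) * a - ν)) +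
            effectiveDim a r K n / (n / Nat.log 2 n : ℕ))) := by
  obtain ⟨C₁, hC₁, hbias⟩ := exists_bias_le hc₁ s r ν c₂ ha hq
  obtain ⟨C₂, hC₂, hvar⟩ := exists_variance_le hc₁ s ν c₂ ha hr
  -- The absolute value is needed since `c₂ > 0` is known only once some instance satisfies the
  -- power laws, while the constant is chosen before.
  set A := 2 * 10 ^ 11 * (800 * ψ * (|c₂| ^ s / c₁ + 1) + 8 * ψ) with hA
  have hA0 : 0 < A := by positivity
  refine ⟨C₁ + A * C₂, by positivity, fun d D lam m T h σ P Q w hP b κ δ Γ K n hS hK hKa hKn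
    htiny hker => ?_⟩
  set N := n / Nat.log 2 n with hN
  set L := Nat.log 2 n with hL
  have hc₂ : 0 < c₂ := hc₁.trans_le h.const_le
  have hlc : ∀ i, lam i ≤ c₂ := fun i => by
    refine (h.lam_upper i).trans (mul_le_of_le_one_right hc₂.le ?_)
    exact Real.rpow_le_one_of_one_le_of_nonpos (by simp) (by linarith)
  have hw : ∑ i, m i * w i ^ 2 ≤ 1 := by
    have := hP.mem_ellipsoid
    rwa [ellipsoid, Set.mem_ofPred_eq, sqNorm_diagonal] at this
  have hNp : (0 : ℝ) < N := Nat.cast_pos.2 hS.N_pos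
  refine (expRisk_asgd_le hS hL hN hP h.posSemidef (h.lam_pos hc₁) hlc hψ
    (h.sum_lam_mul_sq_le hc₁ (by linarith) hs hw) hker).trans (ENNReal.ofReal_le_ofReal ?_)
  have h1 := hbias d D lam m T h w b κ δ Γ K N L n hw hS hK hKa htiny
  have h2 := hvar d D lam m T h N Γ K n hNp hS.Gamma_pos hK hKa hKn
  have hE : 0 ≤ effectiveDim a r K n := by
    unfold effectiveDim
    split_ifs <;> positivity
  have hKq : 0 < K ^ (-((r + s) * a - ν)) := by positivity
  have hσ : 0 ≤ σ ^ 2 := sq_nonneg σ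
  rw [abs_of_pos hc₂] at hA
  calc _ ≤ C₁ * K ^ (-((r + s) * a - ν)) + A * (1 + σ ^ 2) *
        (N * ∑ i, lam i * T i i * (Γ ^ 2 / (1 + (N * Γ * lam i) ^ 2))) := by
        refine add_le_add h1 (le_of_eq ?_)
        rw [hA]; ring
    _ ≤ C₁ * K ^ (-((r + s) * a - ν)) + A * (1 + σ ^ 2) * (C₂ * (effectiveDim a r K n / N)) := by
        refine add_le_add le_rfl (mul_le_mul_of_nonneg_left h2 (by positivity))
    _ ≤ _ := by
        have g1 : 0 ≤ effectiveDim a r K n / N := by positivity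
        have g2 : 0 ≤ C₁ * K ^ (-((r + s) * a - ν)) * σ ^ 2 := by positivity
        have g3 : 0 ≤ C₁ * (1 + σ ^ 2) * (effectiveDim a r K n / N) := by positivity
        have g4 : 0 ≤ A * C₂ * (1 + σ ^ 2) * K ^ (-((r + s) * a - ν)) := by positivity
        nlinarith

/-! ### The length of the stages -/

theorem natLog_le_two_mul_log (n : ℕ) : (Nat.log 2 n : ℝ) ≤ 2 * Real.log n := by
  rcases Nat.eq_zero_or_pos n with rfl | hn
  · simp
  have h1 : (Nat.log 2 n : ℝ) * Real.log 2 ≤ Real.log n := by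
    rw [← Real.log_pow]
    refine Real.log_le_log (by positivity) ?_
    exact_mod_cast Nat.pow_log_le_self 2 hn.ne'
  have h2 := Real.log_two_gt_d9
  have h3 : (0 : ℝ) ≤ Nat.log 2 n := Nat.cast_nonneg _
  nlinarith

/-- Rounding down the stage length loses at most a factor 2, and `Nat.log 2 n ≤ 2 log n` another.
All logarithms in the rate for `r < 1/a` come from here. -/
theorem le_log_mul_stageLength {n : ℕ} (hn : 2 ≤ n) :
    (n : ℝ) ≤ 4 * Real.log n * (n / Nat.log 2 n : ℕ) := by
  have hL : 0 < Nat.log 2 n := Nat.log_pos (by norm_num) hn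
  have hN : 1 ≤ n / Nat.log 2 n := (Nat.one_le_div_iff hL).2 (Nat.log_le_self 2 n)
  have h1 : n ≤ 2 * Nat.log 2 n * (n / Nat.log 2 n) := by
    have := Nat.lt_mul_div_succ n hL
    nlinarith
  have h2 : (n : ℝ) ≤ 2 * Nat.log 2 n * (n / Nat.log 2 n : ℕ) := by exact_mod_cast h1
  refine h2.trans (mul_le_mul_of_nonneg_right ?_ (Nat.cast_nonneg _))
  linarith [natLog_le_two_mul_log n]

theorem eventually_log_le_rpow {p : ℝ} (hp : 0 < p) {C : ℝ} (hC : 0 < C) :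
    ∀ᶠ n : ℕ in Filter.atTop, C * Real.log n ≤ (n : ℝ) ^ p := by
  have h1 := (isLittleO_log_rpow_atTop hp).comp_tendsto tendsto_natCast_atTop_atTop
  have h2 := h1.bound (inv_pos.2 hC)
  filter_upwards [h2, Filter.eventually_ge_atTop 1] with n hn hn1
  have hpos : (0 : ℝ) ≤ (n : ℝ) ^ p := by positivity
  simp only [Function.comp_apply, Real.norm_eq_abs, abs_of_nonneg hpos] at hn
  have h3 := (le_abs_self _).trans hn
  rw [inv_mul_eq_div, le_div_iff₀ hC] at h3
  linarith

theorem eventually_sqrt_le_stageLength :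
    ∀ᶠ n : ℕ in Filter.atTop, (n : ℝ) ^ (1 / 2 : ℝ) ≤ (n / Nat.log 2 n : ℕ) := by
  filter_upwards [eventually_log_le_rpow (by norm_num : (0 : ℝ) < 1 / 2) (by norm_num : (0 : ℝ) < 4),
    Filter.eventually_ge_atTop 2] with n hn hn2
  have h1 := le_log_mul_stageLength hn2
  have hn0 : (0 : ℝ) < n := by positivity
  have h2 : (n : ℝ) = (n : ℝ) ^ (1 / 2 : ℝ) * (n : ℝ) ^ (1 / 2 : ℝ) := by
    rw [← Real.rpow_add hn0]; norm_num
  have h3 : 0 < (n : ℝ) ^ (1 / 2 : ℝ) := by positivity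
  refine le_of_mul_le_mul_left ?_ h3
  rw [← h2]
  exact h1.trans (mul_le_mul_of_nonneg_right hn (Nat.cast_nonneg _))

theorem tendsto_stageLength :
    Filter.Tendsto (fun n : ℕ => ((n / Nat.log 2 n : ℕ) : ℝ)) Filter.atTop Filter.atTop :=
  Filter.tendsto_atTop_mono' _ eventually_sqrt_le_stageLength
    ((tendsto_rpow_atTop (by norm_num)).comp tendsto_natCast_atTop_atTop)

theorem eventually_natLog_mul_rpow_le {p : ℝ} (hp : 0 < p) {C : ℝ} (hC : 0 < C) :
    ∀ᶠ n : ℕ in Filter.atTop,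
      C * ((Nat.log 2 n : ℕ) * ((n / Nat.log 2 n : ℕ) : ℝ) ^ (-p)) ≤ 1 := by
  filter_upwards [eventually_log_le_rpow (by linarith : 0 < p / 2) (by linarith : 0 < 2 * C),
    eventually_sqrt_le_stageLength, Filter.eventually_ge_atTop 2] with n h1 h2 hn
  have hn0 : (0 : ℝ) < n := by positivity
  have h3 : ((n / Nat.log 2 n : ℕ) : ℝ) ^ (-p) ≤ ((n : ℝ) ^ (p / 2))⁻¹ := by
    calc _ ≤ ((n : ℝ) ^ (1 / 2 : ℝ)) ^ (-p) :=
          Real.rpow_le_rpow_of_nonpos (by positivity) h2 (by linarith)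
      _ = _ := by
          rw [← Real.rpow_mul hn0.le, ← Real.rpow_neg hn0.le]; congr 1; ring
  have h4 : 0 < (n : ℝ) ^ (p / 2) := by positivity
  calc _ ≤ C * (2 * Real.log n * ((n : ℝ) ^ (p / 2))⁻¹) := by
        refine mul_le_mul_of_nonneg_left ?_ hC.le
        exact mul_le_mul (natLog_le_two_mul_log n) h3 (by positivity)
          (by have := Real.log_natCast_nonneg n; positivity)
    _ = 2 * C * Real.log n / (n : ℝ) ^ (p / 2) := by ring
    _ ≤ 1 := by rwa [div_le_one h4]

/-! ### The choice of the parameters -/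

theorem eventually_rpow_mul_exp_le (p : ℝ) {h : ℝ} (hh : h < 1) :
    ∀ᶠ x : ℝ in Filter.atTop, x ^ p * Real.exp (-(x * x ^ (-h) / 8)) ≤ 1 := by
  have h0 : 0 < 1 - h := by linarith
  have h1 := (tendsto_rpow_mul_exp_neg_mul_atTop_nhds_zero (p / (1 - h)) (1 / 8)
    (by norm_num)).comp (tendsto_rpow_atTop h0)
  filter_upwards [h1.eventually_le_const one_pos, Filter.eventually_gt_atTop 0] with x hx hx0
  simp only [Function.comp_apply] at hx
  rw [← Real.rpow_mul hx0.le, mul_div_cancel₀ _ h0.ne'] at hx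
  have e : x * x ^ (-h) = x ^ (1 - h) := by
    rw [sub_eq_add_neg, Real.rpow_add hx0, Real.rpow_one]
  have e2 : -(x ^ (1 - h) / 8) = -(1 / 8) * x ^ (1 - h) := by ring
  rwa [e, e2]

theorem eventually_schedule {k h θ : ℝ} (hk : 0 < k) (hh : 0 < h) (hh1 : h < 1) (hkh : k < h)
    (hkθ : k - h + θ < 0) (hθ : -1 < θ) (hθ1 : θ < 1) {B : ℝ} (hB : 0 < B) :
    ∀ᶠ n : ℕ in Filter.atTop, Schedule (((n / Nat.log 2 n : ℕ) : ℝ) ^ (-h))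
      (((n / Nat.log 2 n : ℕ) : ℝ) ^ k) (((n / Nat.log 2 n : ℕ) : ℝ) ^ (k - h + θ))
      (((n / Nat.log 2 n : ℕ) : ℝ) ^ θ) B (n / Nat.log 2 n) (Nat.log 2 n) n := by
  have hsmall : ∀ p : ℝ, 0 < p → ∀ c : ℝ, 0 < c → ∀ᶠ x : ℝ in Filter.atTop, x ^ (-p) ≤ c :=
    fun p hp c hc => (tendsto_rpow_neg_atTop hp).eventually_le_const hc
  have hN : ∀ᶠ x : ℝ in Filter.atTop, 1 ≤ x ∧ B ≤ x ∧ x ^ (-h) ≤ 1 / 16 ∧ 64 ≤ x ^ k ∧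
      x ^ (-(h - k)) ≤ 1 / 2 ∧ x ^ (-(h - k - θ)) ≤ 1 / (4 * B) ∧
      x ^ (20 : ℝ) * Real.exp (-(x * x ^ (-h) / 8)) ≤ 1 :=
    (Filter.eventually_ge_atTop 1).and <| (Filter.eventually_ge_atTop B).and <|
      (hsmall h hh _ (by norm_num)).and <|
      ((tendsto_rpow_atTop hk).eventually_ge_atTop 64).and <|
      (hsmall (h - k) (by linarith) _ (by norm_num)).and <|
      (hsmall (h - k - θ) (by linarith) _ (by positivity)).and <|
      eventually_rpow_mul_exp_le 20 hh1
  have hL : Filter.Tendsto (fun n : ℕ => Nat.log 2 n) Filter.atTop Filter.atTop :=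
    Filter.tendsto_atTop.2 fun c => by
      filter_upwards [Filter.eventually_ge_atTop (2 ^ c)] with n hn
      exact Nat.le_log_of_pow_le (by norm_num) hn
  filter_upwards [tendsto_stageLength.eventually hN, hL.eventually_ge_atTop (⌈4 * B⌉₊ + 4),
    eventually_log_le_rpow (by norm_num : (0 : ℝ) < 1 / 2) (by norm_num : (0 : ℝ) < 4),
    eventually_sqrt_le_stageLength, Filter.eventually_ge_atTop 2] with n hx hLn hlog hsq hn2
  set L := Nat.log 2 n with hLd
  set N := n / L with hNd
  obtain ⟨x1, x2, x3, x4, x5, x6, x7⟩ := hx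
  have hx0 : (0 : ℝ) < N := by linarith
  have hLN : L ≤ N := by
    have h1 := natLog_le_two_mul_log n
    have h2 := Real.log_natCast_nonneg n
    have : (L : ℝ) ≤ N := by linarith
    exact_mod_cast this
  have hL4 : 4 * B + 4 ≤ (L : ℝ) := by
    have h1 := Nat.le_ceil (4 * B)
    have h2 : ((⌈4 * B⌉₊ + 4 : ℕ) : ℝ) ≤ L := by exact_mod_cast hLn
    push_cast at h2
    linarith
  have hLnN : L * N ≤ n := Nat.mul_div_le n L
  have hδ : (N : ℝ) ^ (k - h + θ) = (N : ℝ) ^ k * (N : ℝ) ^ (-h) * (N : ℝ) ^ θ := by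
    rw [← Real.rpow_add hx0, ← Real.rpow_add hx0]; congr 1
  have hkb : (N : ℝ) ^ k * (N : ℝ) ^ (-h) = (N : ℝ) ^ (-(h - k)) := by
    rw [← Real.rpow_add hx0]; congr 1; ring
  refine ⟨by positivity, x3, x4, ?_, hδ, ?_, ?_, x2, by omega, hLnN, ?_, hLN, ?_, ?_, ?_, ?_, ?_⟩
  · rw [mul_comm, hkb]; linarith
  · rw [hδ, hkb]
    have : 0 < (N : ℝ) ^ θ := by positivity
    nlinarith
  · have e : k - h + θ = -(h - k - θ) := by ring
    rw [e]
    calc _ ≤ 1 / (4 * B) * B := mul_le_mul_of_nonneg_right x6 hB.le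
      _ = _ := by field_simp
  · have := Nat.lt_mul_div_succ n (by omega : 0 < L)
    rw [← hNd] at this
    nlinarith
  · calc (N : ℝ) ^ θ ≤ (N : ℝ) ^ (1 : ℝ) := Real.rpow_le_rpow_of_exponent_le x1 hθ1.le
      _ = N := Real.rpow_one _
  · calc (1 : ℝ) ≤ (N : ℝ) ^ (θ + 1) := Real.one_le_rpow x1 (by linarith)
      _ = _ := by rw [Real.rpow_add hx0, Real.rpow_one]
  · calc (1 : ℝ) ≤ (N : ℝ) ^ (-h + 1) := Real.one_le_rpow x1 (by linarith)
      _ = _ := by rw [Real.rpow_add hx0, Real.rpow_one]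
  -- From `L N ≤ n < 2^(L+1)` follows `L² N² ≤ 16 * 4^(L-1)`, so `L² ≥ 16 B` suffices; this is why
  -- `L ≥ 4 B + 4` was required.
  · have h1 : (n : ℝ) ≤ 4 * 2 ^ (L - 1) := by
      have h2 := (Nat.lt_pow_succ_log_self (b := 2) (by norm_num) n).le
      have h3 : L + 1 = (L - 1) + 2 := by omega
      rw [Nat.succ_eq_add_one, ← hLd, h3, pow_add] at h2
      have : (n : ℝ) ≤ 2 ^ (L - 1) * 2 ^ 2 := by exact_mod_cast h2
      linarith
    have h2 : (L : ℝ) * N ≤ n := by exact_mod_cast hLnN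
    have h3 : (4 : ℝ) ^ (L - 1) = (2 ^ (L - 1)) ^ 2 := by
      rw [← pow_mul, mul_comm, pow_mul]; norm_num
    have h4 : 16 * B ≤ (L : ℝ) ^ 2 := by nlinarith
    have h5 : ((L : ℝ) * N) ^ 2 ≤ (4 * 2 ^ (L - 1)) ^ 2 :=
      pow_le_pow_left₀ (by positivity) (h2.trans h1) 2
    rw [h3]
    nlinarith [mul_le_mul_of_nonneg_right h4 (sq_nonneg (N : ℝ))]
  · have : (N : ℝ) ^ 20 = (N : ℝ) ^ (20 : ℝ) := by
      rw [← Real.rpow_natCast]; norm_num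
    rwa [this]

/-- As `t` tends to `1/a` the last inequality becomes `θ < k (a - 1)`, so `k` must exceed `m = max θ
0 / (a - 1)`. Then `h > k + θ` asks for slightly more than `m a`, and `m a < 1` is what the
hypothesis on `θ` provides. The gap to 1 is shared out by `ε`. -/
theorem exists_exponents {a θ : ℝ} (ha : 1 < a) (hθ : θ < (a - 1) / a) :
    ∃ k h t : ℝ, 0 < k ∧ h < 1 ∧ k < h ∧ k - h + θ < 0 ∧ 1 < a * t ∧ t < 1 ∧
      θ * t + k * (t - 1) < 0 := by
  have ha0 : 0 < a := by linarith
  have ha1 : 0 < a - 1 := by linarith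
  set m := max θ 0 / (a - 1) with hm
  have hm0 : 0 ≤ m := div_nonneg (le_max_right _ _) ha1.le
  have hθm : θ ≤ m * (a - 1) := by
    rw [hm, div_mul_cancel₀ _ ha1.ne']; exact le_max_left _ _
  have hma : m * a < 1 := by
    have h1 : max θ 0 < (a - 1) / a := max_lt hθ (by positivity)
    rw [lt_div_iff₀ ha0] at h1
    have h2 : m * a = max θ 0 * a / (a - 1) := by rw [hm]; ring
    rw [h2, div_lt_one ha1]
    exact h1
  set ε := (1 - m * a) / 4 with hε
  have hε0 : 0 < ε := by rw [hε]; linarith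
  have hε1 : ε ≤ 1 / 4 := by
    have : 0 ≤ m * a := by positivity
    rw [hε]; linarith
  set t := (1 + (a - 1) * ε / 2) / a with ht
  have hat : a * t = 1 + (a - 1) * ε / 2 := by rw [ht]; field_simp
  have ht0 : 0 < t := by rw [ht]; positivity
  refine ⟨m + ε, m * a + 2 * ε, t, by linarith, by rw [hε]; linarith, ?_, ?_, ?_, ?_, ?_⟩
  · have : m ≤ m * a := le_mul_of_one_le_right hm0 ha.le
    linarith
  · linarith
  · rw [hat]
    have : 0 < (a - 1) * ε := by positivity
    linarith
  · rw [ht, div_lt_one ha0]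
    nlinarith
  · have h1 : θ * t ≤ m * (a - 1) * t := mul_le_mul_of_nonneg_right hθm ht0.le
    have h2 : a * (m * (a - 1) * t + (m + ε) * (t - 1)) < 0 := by
      have e : a * (m * (a - 1) * t + (m + ε) * (t - 1)) =
          (a - 1) * ε * (m * a / 2 + ε / 2 - 1) := by
        linear_combination (m * a + ε) * hat
      rw [e]
      have h3 : 0 < (a - 1) * ε := by positivity
      exact mul_neg_of_pos_of_neg h3 (by linarith)
    have h3 := neg_of_mul_neg_right h2 ha0.le
    linarith

/-! ### The rate -/

/-- For `r < 1/a` bias and variance have the same exponent at this scale, because `q + 1 - ra = e`.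
For `r ≥ 1/a` one has `q ≥ e`, so the bias is at most `1/N` and the variance dominates. -/
theorem exists_rate_le {a s r ν : ℝ} (ha : 0 < a) (he : 0 < s * a - ν + 1)
    (hq : 0 < (r + s) * a - ν) :
    ∃ C : ℝ, 0 < C ∧ ∀ (n : ℕ) (N : ℝ), 3 ≤ n → 1 ≤ N → (n : ℝ) ≤ 4 * Real.log n * N →
      (N ^ (1 / (s * a - ν + 1))) ^ (-((r + s) * a - ν)) +
        effectiveDim a r (N ^ (1 / (s * a - ν + 1))) n / N ≤ C * asgdRate a s r ν n := by
  set e := s * a - ν + 1 with hed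
  set q := (r + s) * a - ν with hqd
  have hpow : ∀ N : ℝ, 1 ≤ N → (N ^ (1 / e)) ^ (-q) = N ^ (-(q / e)) := fun N hN => by
    rw [← Real.rpow_mul (by linarith)]; congr 1; ring
  have hlog : ∀ n : ℕ, 3 ≤ n → 1 ≤ Real.log n := fun n hn => by
    rw [Real.le_log_iff_exp_le (by positivity)]
    have := Real.exp_one_lt_d9
    have h3 : (3 : ℝ) ≤ n := by exact_mod_cast hn
    linarith
  have hinv : ∀ (n : ℕ) (N : ℝ), 3 ≤ n → 1 ≤ N → (n : ℝ) ≤ 4 * Real.log n * N →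
      1 / N ≤ 4 * (Real.log n / n) := fun n N hn hN h => by
    have hn0 : (0 : ℝ) < n := by positivity
    rw [div_le_iff₀ (by linarith), ← mul_div_assoc, div_mul_eq_mul_div, le_div_iff₀ hn0]
    linarith
  have hqe : 1 / a ≤ r → ∀ N : ℝ, 1 ≤ N → N ^ (-(q / e)) ≤ 1 / N := fun hr N hN => by
    have h1 : 1 ≤ q / e := by
      rw [le_div_iff₀ he]
      have := (div_le_iff₀ ha).1 hr
      rw [hqd, hed]; nlinarith
    calc N ^ (-(q / e)) ≤ N ^ (-1 : ℝ) := Real.rpow_le_rpow_of_exponent_le hN (by linarith)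
      _ = 1 / N := by rw [Real.rpow_neg_one, one_div]
  rcases lt_trichotomy r (1 / a) with hr | hr | hr
  · refine ⟨2 * 4 ^ (q / e), by positivity, fun n N hn hN h => ?_⟩
    have hN0 : 0 < N := by linarith
    have hn0 : (0 : ℝ) < n := by positivity
    have hl := hlog n hn
    rw [effectiveDim, asgdRate, if_neg (by linarith), if_neg (by linarith), if_neg (by linarith),
      if_neg (by linarith), hpow N hN, ← hed, ← hqd]
    have h1 : (N ^ (1 / e)) ^ (1 - r * a) / N = N ^ (-(q / e)) := by
      rw [← Real.rpow_mul hN0.le, ← Real.rpow_sub_one hN0.ne']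
      congr 1
      rw [hqd, hed]
      rw [hed] at he
      field_simp
      ring
    set p := q / e with hp
    have hp0 : 0 < p := div_pos hq he
    have h2 : N ^ (-p) ≤ 4 ^ p * ((1 / n : ℝ) ^ p * Real.log n ^ p) := by
      have h3 : (n : ℝ) / (4 * Real.log n) ≤ N := by
        rw [div_le_iff₀ (by linarith)]; linarith
      calc N ^ (-p) ≤ ((n : ℝ) / (4 * Real.log n)) ^ (-p) :=
            Real.rpow_le_rpow_of_nonpos (by positivity) h3 (by linarith)
        _ = (4 * (1 / n * Real.log n)) ^ p := by
            rw [Real.rpow_neg (by positivity), ← Real.inv_rpow (by positivity)]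
            congr 1
            field_simp
        _ = _ := by
            rw [Real.mul_rpow (by norm_num) (by positivity),
              Real.mul_rpow (by positivity) (by linarith)]
    -- The argument gives the exponent `p`; since `log n ≥ 1`, the maximum in the rate is only
    -- weaker.
    have h3 : Real.log n ^ p ≤ Real.log n ^ max ((3 * (1 + r) * a - 3) / a) p :=
      Real.rpow_le_rpow_of_exponent_le hl (le_max_right _ _)
    have h4 : 4 ^ p * ((1 / n : ℝ) ^ p * Real.log n ^ p) ≤ 4 ^ p * ((1 / n : ℝ) ^ p *
        Real.log n ^ max ((3 * (1 + r) * a - 3) / a) p) :=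
      mul_le_mul_of_nonneg_left (mul_le_mul_of_nonneg_left h3 (by positivity)) (by positivity)
    rw [h1]
    linarith
  · refine ⟨16, by norm_num, fun n N hn hN h => ?_⟩
    have hn0 : (0 : ℝ) < n := by positivity
    have hl := hlog n hn
    rw [effectiveDim, asgdRate, if_neg (by linarith), if_pos hr, if_neg (by linarith),
      if_pos hr, hpow N hN]
    have h1 := hqe hr.ge N hN
    have h2 := hinv n N hn hN h
    have h3 := natLog_le_two_mul_log n
    have h4 : 0 < Real.log n / n := by positivity
    have h5 : ((Nat.log 2 n : ℝ) + 1) / N ≤ (3 * Real.log n) * (4 * (Real.log n / n)) := by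
      rw [div_eq_mul_one_div]
      exact mul_le_mul (by linarith) h2 (by positivity) (by linarith)
    have h6 : Real.log n ^ 3 / n = Real.log n ^ 2 * (Real.log n / n) := by ring
    rw [h6]
    nlinarith [mul_le_mul_of_nonneg_right hl h4.le, mul_le_mul_of_nonneg_right
      (one_le_pow₀ hl : 1 ≤ Real.log n ^ 2) h4.le, mul_nonneg (mul_nonneg (by linarith : 0 ≤ Real.log n) (by linarith : 0 ≤ Real.log n - 1)) h4.le]
  · refine ⟨8, by norm_num, fun n N hn hN h => ?_⟩
    rw [effectiveDim, asgdRate, if_pos hr, if_pos hr, hpow N hN]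
    have h1 := hqe hr.le N hN
    have h2 := hinv n N hn hN h
    linarith

/-! ### The upper bound -/

theorem alphaOf_mem {b : ℝ} (hb : 0 < b) (hb1 : b < 1) : 0 < alphaOf b ∧ alphaOf b < 1 := by
  unfold alphaOf
  refine ⟨div_pos (by linarith) (by linarith), ?_⟩
  rw [div_lt_one (by linarith)]
  linarith

theorem asgd_upper_bound {a s r ν c₁ c₂ : ℝ} (hc₁ : 0 < c₁) (hν₀ : 0 ≤ ν) :
    ∀ ψ : ℝ, 1 ≤ ψ → 1 < a → (a - 1) ^ 2 / (a * (2 * a - 1)) + ν / a < s →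
      max (1 / a - 2) (-s + ν / a) < r →
      ∃ (C : ℝ) (N : ℕ) (α β δ γ : ℕ → ℝ), 0 < C ∧
        (∀ n, N ≤ n → 0 < α n ∧ α n < 1 ∧ 0 < β n ∧ β n < 1 ∧ 0 < δ n ∧ δ n ≤ γ n) ∧
        ∀ (d D : ℕ) (lam m : Fin d → ℝ) (T : Matrix (Fin d) (Fin d) ℝ),
          PowerLaw a s r ν c₁ c₂ D lam m T →
          ∀ (σ : ℝ) (P Q : Measure (Obs d)) (w : Fin d → ℝ), 0 ≤ σ →
            IsProblem ψ σ lam m T P Q w →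
            ∀ n : ℕ, N ≤ n →
              expRisk (n := n) T P (asgd (α n) (β n) (δ n) (γ n)) w ≤
                ENNReal.ofReal (C * (1 + σ ^ 2) * asgdRate a s r ν n) := by
  intro ψ hψ ha hs hr
  by_cases hcc : c₁ ≤ c₂
  swap
  · refine ⟨1, 0, fun _ => 1 / 2, fun _ => 1 / 2, fun _ => 1 / 2, fun _ => 1 / 2, one_pos,
      fun n _ => by norm_num, fun d D lam m T h => absurd h.const_le hcc⟩
  have hc₂ : 0 < c₂ := hc₁.trans_le hcc
  have ha0 : 0 < a := by linarith
  have ha2 : 0 < 2 * a - 1 := by linarith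
  obtain ⟨hr1, hr2⟩ := max_lt_iff.1 hr
  have hq : 0 < (r + s) * a - ν := by
    have : ν / a < r + s := by linarith
    have := (div_lt_iff₀ ha0).1 this
    linarith
  have hsa : (a - 1) ^ 2 / (2 * a - 1) < s * a - ν := by
    have h1 : ((a - 1) ^ 2 / (a * (2 * a - 1)) + ν / a) * a < s * a :=
      mul_lt_mul_of_pos_right hs ha0
    have h2 : ((a - 1) ^ 2 / (a * (2 * a - 1)) + ν / a) * a = (a - 1) ^ 2 / (2 * a - 1) + ν := by
      field_simp
    linarith
  have hs0 : 0 < s := lt_of_le_of_lt (by positivity) hs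
  set e := s * a - ν + 1 with hed
  have he1 : 1 < e := by
    have : 0 ≤ (a - 1) ^ 2 / (2 * a - 1) := by positivity
    linarith
  have he0 : 0 < e := by linarith
  -- This form of the hypothesis on `s` is equivalent to `θ < (a - 1) / a` for the exponent `θ` of
  -- the long step.
  have hea : a ^ 2 < e * (2 * a - 1) := by
    have h1 : (a - 1) ^ 2 < (e - 1) * (2 * a - 1) :=
      (div_lt_iff₀ ha2).1 (by linarith)
    linarith
  -- Forced by `K = N^(1/e)` and `K^a = N Γ` with `Γ = N^θ`.
  set θ := a / e - 1 with hθd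
  have hθ : θ < (a - 1) / a := by
    have : a / e < (2 * a - 1) / a := by
      rw [div_lt_div_iff₀ he0 ha0]; linarith
    have h2 : (2 * a - 1) / a = (a - 1) / a + 1 := by field_simp; ring
    linarith
  have hθ0 : -1 < θ := by
    have : 0 < a / e := by positivity
    linarith
  have hθ1 : θ < 1 := hθ.trans (by rw [div_lt_one ha0]; linarith)
  obtain ⟨k, h, t, hk, hh1, hkh, hkθ, hat, ht, hexp⟩ := exists_exponents ha hθ
  obtain ⟨C₁, hC₁, hrisk⟩ := exists_asgd_risk_le hc₁ ν c₂ ha hs0 hr1 hq hψ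
  obtain ⟨C₂, hC₂, hrate⟩ := exists_rate_le (r := r) ha0 he0 hq
  obtain ⟨C₃, hC₃, hker⟩ := exists_sum_kernel_le hc₁ s r ν c₂ ha hat ht
  -- Both parts of the kernel sum, `Γ^t κ^(t-1)` and `δ`, are at most `N^(-p)`, which outweighs the
  -- number of stages.
  set p := min (-(θ * t + k * (t - 1))) (-(k - h + θ)) with hp
  have hp0 : 0 < p := lt_min (by linarith) (by linarith)
  set q := (r + s) * a - ν with hqd
  set ℓ : ℕ → ℝ := fun n => ((n / Nat.log 2 n : ℕ) : ℝ) with hℓ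
  have hev := (eventually_schedule hk (hk.trans hkh) hh1 hkh hkθ hθ0 hθ1 hc₂).and <|
    (eventually_natLog_mul_rpow_le hp0 (by positivity : 0 < 400000 * ψ * C₃)).and <|
    (tendsto_stageLength.eventually ((Filter.eventually_ge_atTop 1).and <|
      (eventually_rpow_mul_exp_le 3 hh1).and
        (eventually_rpow_mul_exp_le (3 + 2 * q / e) hh1))).and <|
    Filter.eventually_ge_atTop 3
  obtain ⟨N₀, hN₀⟩ := Filter.eventually_atTop.1 hev
  refine ⟨C₁ * C₂, N₀, fun n => alphaOf (ℓ n ^ (-h)), fun n => ℓ n ^ (-h) / 2,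
    fun n => ℓ n ^ (k - h + θ),
    fun n => gammaOf (ℓ n ^ (-h)) (ℓ n ^ (k - h + θ)) (ℓ n ^ θ), by positivity,
    fun n hn => ?_, fun d D lam m T hPL σ P Q w hσ hP n hn => ?_⟩
  · have hS := (hN₀ n hn).1
    have hb := hS.b_pos
    have hb1 := hS.b_le
    have hδ := hS.delta_pos
    have hδ2 := hS.two_delta
    obtain ⟨h1, h2⟩ := alphaOf_mem hb (by linarith)
    refine ⟨h1, h2, by positivity, ?_, hδ, ?_⟩
    · simp only [hℓ]; linarith
    · simp only [hℓ, gammaOf]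
      nlinarith
  · obtain ⟨hS, hlog, ⟨hN1, htiny, htiny'⟩, hn3⟩ := hN₀ n hn
    have hN0 : 0 < ℓ n := by linarith
    have hKn : ℓ n ^ (1 / e) ≤ n := by
      calc ℓ n ^ (1 / e) ≤ ℓ n ^ (1 : ℝ) := by
            refine Real.rpow_le_rpow_of_exponent_le hN1 ?_
            rw [div_le_one he0]; exact he1.le
        _ = ℓ n := Real.rpow_one _
        _ ≤ n := Nat.cast_le.2 (Nat.div_le_self _ _)
    have hKa : (ℓ n ^ (1 / e)) ^ a = ℓ n * ℓ n ^ θ := by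
      rw [← Real.rpow_mul hN0.le, ← Real.rpow_one_add' hN0.le (by linarith)]
      congr 1
      rw [hθd]; ring
    refine (hrisk d D lam m T hPL σ P Q w hP _ _ _ _ (ℓ n ^ (1 / e)) n hS (by positivity) hKa hKn
      ?_ ?_).trans (ENNReal.ofReal_le_ofReal ?_)
    · have e3 : ℓ n ^ 3 = ℓ n ^ (3 : ℝ) := by rw [← Real.rpow_natCast]; norm_num
      refine le_min ?_ ?_
      · rw [show ((n / Nat.log 2 n : ℕ) : ℝ) = ℓ n from rfl, e3]
        exact htiny
      · rw [show ((n / Nat.log 2 n : ℕ) : ℝ) = ℓ n from rfl, e3, ← Real.rpow_mul hN0.le]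
        have e4 : 1 / e * -(2 * q) = -(2 * q / e) := by ring
        rw [e4]
        refine le_of_mul_le_mul_right ?_ (by positivity : 0 < ℓ n ^ (2 * q / e))
        rw [← Real.rpow_add hN0 (-(2 * q / e)), neg_add_cancel, Real.rpow_zero]
        calc _ = ℓ n ^ (3 + 2 * q / e) * Real.exp (-(ℓ n * ℓ n ^ (-h) / 8)) := by
              rw [Real.rpow_add hN0]; ring
          _ ≤ 1 := htiny'
    · have h1 := hker d D lam m T hPL (ℓ n ^ θ) (ℓ n ^ k) (ℓ n ^ (k - h + θ)) (by positivity)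
        (by positivity) (by positivity)
      have h2 : (ℓ n ^ θ) ^ t * (ℓ n ^ k) ^ (t - 1) ≤ ℓ n ^ (-p) := by
        rw [← Real.rpow_mul hN0.le, ← Real.rpow_mul hN0.le, ← Real.rpow_add hN0]
        refine Real.rpow_le_rpow_of_exponent_le hN1 ?_
        have := min_le_left (-(θ * t + k * (t - 1))) (-(k - h + θ))
        linarith
      have h3 : ℓ n ^ (k - h + θ) ≤ ℓ n ^ (-p) := by
        refine Real.rpow_le_rpow_of_exponent_le hN1 ?_
        have := min_le_right (-(θ * t + k * (t - 1))) (-(k - h + θ))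
        linarith
      have hL0 : (0 : ℝ) ≤ Nat.log 2 n := Nat.cast_nonneg _
      have h4 : C₃ * ((ℓ n ^ θ) ^ t * (ℓ n ^ k) ^ (t - 1) + ℓ n ^ (k - h + θ)) ≤
          C₃ * (2 * ℓ n ^ (-p)) := mul_le_mul_of_nonneg_left (by linarith) hC₃.le
      calc _ ≤ 4 * ψ * ((Nat.log 2 n : ℕ) * (50000 * (C₃ * (2 * ℓ n ^ (-p))))) :=
            mul_le_mul_of_nonneg_left (mul_le_mul_of_nonneg_left
              (mul_le_mul_of_nonneg_left (h1.trans h4) (by norm_num)) hL0) (by positivity)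
        _ = 400000 * ψ * C₃ * ((Nat.log 2 n : ℕ) * ℓ n ^ (-p)) := by ring
        _ ≤ 1 := hlog
    · have h1 := hrate n (ℓ n) hn3 hN1 (le_log_mul_stageLength (by omega))
      calc _ ≤ C₁ * (1 + σ ^ 2) * (C₂ * asgdRate a s r ν n) :=
            mul_le_mul_of_nonneg_left h1 (by positivity)
        _ = _ := by ring

end CovShift

theorem mainTheorem6 (a s r ν c₁ c₂ : ℝ) (hc₁ : 0 < c₁) (hν₀ : 0 ≤ ν) (hν₁ : ν ≤ 1) :
    -- ASGD upper bound
    (∀ ψ : ℝ, 1 ≤ ψ → 1 < a → (a - 1) ^ 2 / (a * (2 * a - 1)) + ν / a < s →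
      max (1 / a - 2) (-s + ν / a) < r →
      ∃ (C : ℝ) (N : ℕ) (α β δ γ : ℕ → ℝ), 0 < C ∧
        (∀ n, N ≤ n → 0 < α n ∧ α n < 1 ∧ 0 < β n ∧ β n < 1 ∧ 0 < δ n ∧ δ n ≤ γ n) ∧
        ∀ (d D : ℕ) (lam m : Fin d → ℝ) (T : Matrix (Fin d) (Fin d) ℝ),
          CovShift.PowerLaw a s r ν c₁ c₂ D lam m T →
          ∀ (σ : ℝ) (P Q : Measure (CovShift.Obs d)) (w : Fin d → ℝ), 0 ≤ σ →
            CovShift.IsProblem ψ σ lam m T P Q w →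
            ∀ n : ℕ, N ≤ n →
              CovShift.expRisk (n := n) T P (CovShift.asgd (α n) (β n) (δ n) (γ n)) w ≤
                ENNReal.ofReal (C * (1 + σ ^ 2) * CovShift.asgdRate a s r ν n)) ∧
    -- the Gaussian models, over which the lower bounds are taken, belong to the problem class
    (∀ (d D : ℕ) (lam m : Fin d → ℝ) (T : Matrix (Fin d) (Fin d) ℝ) (σ : ℝ) (w : Fin d → ℝ),
      CovShift.PowerLaw a s r ν c₁ c₂ D lam m T → 0 ≤ σ → w ∈ CovShift.ellipsoid m →
        ∃ Q : Measure (CovShift.Obs d),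
          CovShift.IsProblem 3 σ lam m T (CovShift.gaussianModel σ lam w) Q w) ∧
    -- minimax lower bound for `r > 1/a`
    (0 < a → 1 / a < r →
      ∃ c : ℝ, 0 < c ∧
        ∀ (d D : ℕ) (lam m : Fin d → ℝ) (T : Matrix (Fin d) (Fin d) ℝ),
          CovShift.PowerLaw a s r ν c₁ c₂ D lam m T →
          ∀ (n : ℕ) (σ : ℝ), 0 < σ → σ ^ 2 ≤ n →
            ENNReal.ofReal (c * (σ ^ 2 / n)) ≤ CovShift.minimaxRisk n σ lam m T) ∧
    -- minimax lower bound for `r = 1/a`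
    (0 < a → r = 1 / a → ∀ p : ℝ, 0 < p →
      ∃ c : ℝ, 0 < c ∧
        ∀ (d D : ℕ) (lam m : Fin d → ℝ) (T : Matrix (Fin d) (Fin d) ℝ),
          CovShift.PowerLaw a s r ν c₁ c₂ D lam m T →
          ∀ (n : ℕ) (σ : ℝ), 0 < σ → σ ^ 2 ≤ n → n / σ ^ 2 ≤ (d : ℝ) ^ p →
            ENNReal.ofReal (c * (σ ^ 2 / n * Real.log (n / σ ^ 2))) ≤
              CovShift.minimaxRisk n σ lam m T) ∧
    -- minimax lower bound for `r < 1/a`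
    (0 < a → r < 1 / a → s * a - ν + 1 ≠ 0 →
      ∀ κ₁ κ₂ κ₃ : ℝ, 0 < κ₁ → 0 < κ₂ → 0 < κ₃ →
      ∃ c : ℝ, 0 < c ∧
        ∀ (d D : ℕ) (lam m : Fin d → ℝ) (T : Matrix (Fin d) (Fin d) ℝ),
          CovShift.PowerLaw a s r ν c₁ c₂ D lam m T →
          ∀ (n : ℕ) (σ : ℝ) (k Δ : ℕ), 1 ≤ n → 0 < σ → 1 ≤ k → k ≤ D →
            κ₁ * (σ ^ 2 / n) ^ (-(1 / (s * a - ν + 1))) ≤ k →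
            k ≤ κ₂ * (σ ^ 2 / n) ^ (-(1 / (s * a - ν + 1))) →
            Δ = ⌊n / (Real.pi ^ 2 * σ ^ 2) * CovShift.specNorm
              (CovShift.whiten m (CovShift.tail k (Matrix.diagonal lam)))⌋₊ →
            1 ≤ Δ →
            κ₃ * CovShift.specNorm (CovShift.whiten m (CovShift.tail k T)) ≤
              1 / Δ * CovShift.topSingularSum Δ (CovShift.whiten m (CovShift.tail k T)) →
            ENNReal.ofReal (c * (σ ^ 2 / n) ^ (((r + s) * a - ν) / (s * a - ν + 1))) ≤
              CovShift.minimaxRisk n σ lam m T) :=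
  ⟨CovShift.asgd_upper_bound hc₁ hν₀, fun _ _ _ _ _ σ _ h _ hw => CovShift.isProblem_gaussianModel hc₁ h σ hw,
    fun _ _ => CovShift.minimaxRisk_ge_parametric hc₁,
    fun ha hr _ hp => CovShift.minimaxRisk_ge_log hc₁ ha hr hp,
    fun _ _ _ _ _ _ h1 h2 h3 => CovShift.minimaxRisk_ge_rpow hc₁ h1 h2 h3⟩
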